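/- \textbf{Conventions.} $\mathsf{Top}$ is the category of compactly generated spaces. Let $d\ge 1$. Let $\mathcal C$ be a closed symmetric monoidal category with all small limits and colimits, together with a strong symmetric monoidal left adjoint functor $\mathsf{Top}\to\mathcal C$; write $T\otimes X$ for the tensor product of the image of a space $T$ with $X\in\mathcal C$. (Every symmetric monoidal model category tensored over $\mathsf{Top}$ is an example.) All operads are symmetric and unital. An algebra over a coloured operad $\mathcal P$ in $\mathsf{Top}$ on a family $(X_k)$ of objects of $\mathcal C$ is given by maps $\mathcal P(k_1,\dots,k_n;k)\otimes X_{k_1}\otimes\cdots\otimes X_{k_n}\to X_k$ compatible with units, composition and symmetries. \textbf{Swiss cheese.} Let $\mathrm{SC}_d$ be the swiss cheese operad with colours $\mathrm f$ and $\mathrm h$: its operations are families of little full discs (colour $\mathrm f$) and little half discs (colour $\mathrm h$), $x\mapsto rx+c$ with $0<r\le 1$, with disjoint images in the closed unit disc (output $\mathrm f$; all inputs are then $\mathrm f$) or in the closed unit half disc $\{x: |x|\le 1,\ x_d\ge 0\}$ (output $\mathrm h$), where half discs have $c_d=0$. For operations with output $\mathrm h$, the \emph{degree} is the number of inputs of colour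 $\mathrm f$ and the \emph{arity} is the number of inputs of colour $\mathrm h$. Operads in collections $\mathrm{Op}(\mathrm{Coll})$ are two-coloured operads in which only the operations with output $\mathrm h$ are retained (composition takes place at inputs of colour $\mathrm h$; degrees add); $\mathrm{Op}(\mathrm{Coll}^{\le 1})$ is obtained by retaining only degrees $0$ and $1$. Let $\mathsf{SC}_d^{h1}=W(\mathrm{SC}_d^{h1})$ be the Boardman--Vogt $W$-construction, formed in $\mathrm{Op}(\mathrm{Coll}^{\le 1})$, on the part of $\mathrm{SC}_d$ with output $\mathrm h$ and degree $\le 1$. Let $\mathsf E_{d-1}$ be the degree $0$ part of $\mathsf{SC}_d^{h1}$, a one-coloured operad. Let $\mathsf{SC}_d^{h\infty}\in \mathrm{Op}(\mathrm{Coll})$ be the image of $\mathsf{SC}_d^{h1}$ under the left adjoint of the forgetful functor $\mathrm{Op}(\mathrm{Coll})\to\mathrm{Op}(\mathrm{Coll}^{\le 1})$; write $\mathsf{SC}_d^{h\infty}(n,m)$ for its part of degree $n$ and arity $m$. \textbf{Semidirect product.} Let $\mathrm{End}(\mathsf{SC}_d^{h\infty})(n)$ be the space of maps of $\mathsf E_{d-1}$-bimodules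 $\mathsf{SC}_d^{h\infty}(1,\bullet)\to\mathsf{SC}_d^{h\infty}(n,\bullet)$. As $\mathsf{SC}_d^{h\infty}$ is freely generated in degrees $0$ and $1$, such maps extend, compatibly with operadic composition, to an action which replaces one $\mathrm f$-input of an operation of any degree by $n$ new ones; this makes $\mathrm{End}(\mathsf{SC}_d^{h\infty})$ a one-coloured operad acting on the $\mathrm f$-inputs of $\mathsf{SC}_d^{h\infty}$. For a one-coloured operad $\mathcal O$ in $\mathsf{Top}$ and an operad map $\rho:\mathcal O\to\mathrm{End}(\mathsf{SC}_d^{h\infty})$, let $\mathsf{SC}_d^{h\infty}\rtimes_\rho\mathcal O$ be the operad with colours $\mathrm f,\mathrm h$ whose operations with output $\mathrm h$ are those of $\mathsf{SC}_d^{h\infty}$, whose operations with output $\mathrm f$ are those of $\mathcal O$ (all inputs $\mathrm f$), and whose composition is that of $\mathsf{SC}_d^{h\infty}$, that of $\mathcal O$, and the action of $\mathcal O$ on $\mathsf{SC}_d^{h\infty}$ through $\rho$. \textbf{Hochschild object.} Let $A$ be an $\mathsf E_{d-1}$-algebra in $\mathcal C$. Let $A^{sc}$ be the quotient of $\coprod_m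 \mathsf{SC}_d^{h1}(1,m)\otimes A^{\otimes m}$ by the actions of the symmetric groups and by the relations $(x\circ_j y)\otimes a\sim x\otimes y_j(a)$, for $y$ an operation of $\mathsf E_{d-1}$ inserted at the $j$-th $\mathrm h$-input of $x$; it is an $\mathsf E_{d-1}$-$A$ module through composition of operations of $\mathsf E_{d-1}$ with $x$. Let $\mathrm{Hoch}(A)=\underline{\hom}^A_{\mathsf E_{d-1}}(A^{sc},A)$, the subobject of the internal hom $\underline{\hom}_{\mathcal C}(A^{sc},A)$ (an equalizer) consisting of the maps of $\mathsf E_{d-1}$-$A$ modules. \textbf{Proposition (universal cheese).} Let $d$, $\mathcal C$, $A$ be as above, let $\mathcal O$ be any one-coloured operad in $\mathsf{Top}$, and let $\rho:\mathcal O\to\mathrm{End}(\mathsf{SC}_d^{h\infty})$ be a map of operads. There is exactly one $\mathsf{SC}_d^{h\infty}\rtimes_\rho\mathcal O$-algebra structure on the pair $(\mathrm{Hoch}(A),A)$ (with $\mathrm{Hoch}(A)$ of colour $\mathrm f$ and $A$ of colour $\mathrm h$) which extends the given $\mathsf E_{d-1}$-structure on $A$ and for which the degree one operations $\mathsf{SC}_d^{h1}(1,m)\otimes\mathrm{Hoch}(A)\otimes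 A^{\otimes m}\to A$ are the evaluation maps. Give $\mathrm{Hoch}(A)$ the $\mathcal O$-algebra structure contained in it. Let $\mathrm{Alg}^A_{\mathsf{SC}_d^{h\infty}\rtimes_\rho\mathcal O}(\mathcal C)$ be the category of $\mathsf{SC}_d^{h\infty}\rtimes_\rho\mathcal O$-algebras of the form $(B,A)$ that induce the given $\mathsf E_{d-1}$-structure on $A$, with algebra maps that are the identity on $A$; let $\mathrm{Alg}_{\mathcal O}(\mathcal C)_{/\mathrm{Hoch}(A)}$ be the category of $\mathcal O$-algebras over $\mathrm{Hoch}(A)$. Then there is an isomorphism of categories \[ \mathrm{Alg}^A_{\mathsf{SC}_d^{h\infty}\rtimes_\rho\mathcal O}(\mathcal C)\;\cong\;\mathrm{Alg}_{\mathcal O}(\mathcal C)_{/\mathrm{Hoch}(A)}. \] It sends $(B,A)$ to the object $B$ with the $\mathcal O$-structure it contains, together with a map $B\to\mathrm{Hoch}(A)$ which, with $\mathrm{id}_A$, forms a map of $\mathsf{SC}_d^{h\infty}\rtimes_\rho\mathcal O$-algebras $(B,A)\to(\mathrm{Hoch}(A),A)$; and it is the identity on the underlying morphisms of $\mathcal C$.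 -/

import Mathlib

open CategoryTheory MonoidalCategory Limits Topology

namespace Cheese

/-- The family of all compact Hausdorff spaces. -/
abbrev CH : CompHaus.{0} → Type := fun K => K

/-- The convenient category of compactly generated spaces: a space carries the final topology
for all continuous maps from compact Hausdorff spaces. -/
abbrev CGTop : Type 1 := GeneratedByTopCat.{0} CH

noncomputable instance : CartesianMonoidalCategory CGTop :=
  CartesianMonoidalCategory.ofHasFiniteProducts
noncomputable instance : BraidedCategory CGTop :=
  BraidedCategory.ofCartesianMonoidalCategory
noncomputable instance : SymmetricCategory CGTop := inferInstance

abbrev CGTop.of (T : Type) [TopologicalSpace T] [IsGeneratedBy CH T] : CGTop :=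
  GeneratedByTopCat.of T

theorem isGeneratedBy_of_sequential (T : Type) [TopologicalSpace T] [SequentialSpace T] :
    IsGeneratedBy CH T := by
  refine ⟨?_⟩
  refine continuous_from_uCompactlyGeneratedSpace.{0} _ ?_
  intro S g
  rw [continuous_def]
  intro U hU
  rw [WithGeneratedByTopology.isOpen_iff] at hU
  exact hU (i := S) g

/-- The point `x` of a space, as a morphism from the one-point space. -/
noncomputable def constHom {T : Type} [TopologicalSpace T] [IsGeneratedBy CH T] (x : T) :
    𝟙_ CGTop ⟶ CGTop.of T :=
  ObjectProperty.homMk (TopCat.ofHom (ContinuousMap.const _ x))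


/-- The two colours. -/
inductive Col
  | full
  | half

/-- A way to label by the letters of `w'` the inputs of the composite of an operation with inputs `w`
and an operation with inputs `t`, inserted at the input `i`: a colour preserving bijection between
the remaining inputs of the first together with all inputs of the second, and the positions of `w'`.
Composition along all `Graft`s packages partial compositions together with the symmetric group
actions (the actions are composition with an identity along `Graft [k] 0 w w'`). -/
structure Graft (w : List Col) (i : Fin w.length) (t w' : List Col) where
  eqv : {j : Fin w.length // j ≠ i} ⊕ Fin t.length ≃ Fin w'.length
  col_out : ∀ j, w'.get (eqv (Sum.inl j)) = w.get j
  col_in : ∀ b, w'.get (eqv (Sum.inr b)) = t.get b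

namespace Graft
variable {w t s w' t' w'' w₃ : List Col} {i : Fin w.length}

def o (e : Graft w i t w') (j : Fin w.length) (hj : j ≠ i) : Fin w'.length :=
  e.eqv (Sum.inl ⟨j, hj⟩)

def n (e : Graft w i t w') (b : Fin t.length) : Fin w'.length :=
  e.eqv (Sum.inr b)

theorem get_o (e : Graft w i t w') (j hj) : w'.get (e.o j hj) = w.get j := e.col_out ⟨j, hj⟩
theorem get_n (e : Graft w i t w') (b) : w'.get (e.n b) = t.get b := e.col_in b

theorem o_inj (e : Graft w i t w') {j j' hj hj'} : e.o j hj = e.o j' hj' ↔ j = j' := by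
  simp [o]
theorem n_inj (e : Graft w i t w') {b b'} : e.n b = e.n b' ↔ b = b' := by
  simp [n]
theorem o_ne_n (e : Graft w i t w') {j hj b} : e.o j hj ≠ e.n b := by
  simp [o, n]
theorem cases (e : Graft w i t w') (q : Fin w'.length) :
    (∃ j hj, e.o j hj = q) ∨ ∃ b, e.n b = q := by
  rcases h : e.eqv.symm q with ⟨j, hj⟩ | b
  · exact Or.inl ⟨j, hj, by simp [o, ← h]⟩
  · exact Or.inr ⟨b, by simp [n, ← h]⟩

theorem exists_std (w : List Col) (i : Fin w.length) (t : List Col) :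
    ∃ w', Nonempty (Graft w i t w') := by
  let I := {j : Fin w.length // j ≠ i} ⊕ Fin t.length
  let c : I → Col := Sum.elim (fun j => w.get j) t.get
  let ε : I ≃ Fin (Fintype.card I) := Fintype.equivFin I
  have hl : (List.ofFn (c ∘ ε.symm)).length = Fintype.card I := List.length_ofFn
  refine ⟨List.ofFn (c ∘ ε.symm), ⟨⟨ε.trans (finCongr hl.symm), ?_, ?_⟩⟩⟩
  · intro j; simp [c]
  · intro j; simp [c]

end Graft

/-- The labels in `(x ∘ᵢ y) ∘_q z = x ∘ᵢ (y ∘ⱼ z)` agree; the input `j` of `y` is called `q` in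
`x ∘ᵢ y`. -/
structure SeqCompat {w t s w' t' w'' : List Col} {i : Fin w.length} {j : Fin t.length}
    {q : Fin w'.length} (e₁ : Graft w i t w') (e₂ : Graft w' q s w'') (e₃ : Graft t j s t')
    (e₄ : Graft w i t' w'') : Prop where
  pos : e₁.n j = q
  oo : ∀ a ha h, e₂.o (e₁.o a ha) h = e₄.o a ha
  no : ∀ b hb h, e₂.o (e₁.n b) h = e₄.n (e₃.o b hb)
  nn : ∀ c, e₂.n c = e₄.n (e₃.n c)

/-- The labels in `(x ∘ᵢ y) ∘_q z = (x ∘ⱼ z) ∘_p y` agree; the input `j` of `x` is called `q` in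
`x ∘ᵢ y` and its input `i` is called `p` in `x ∘ⱼ z`. -/
structure ParCompat {w t s w' w₃ w'' : List Col} {i j : Fin w.length}
    {q : Fin w'.length} {p : Fin w₃.length} (e₁ : Graft w i t w') (e₂ : Graft w' q s w'')
    (e₃ : Graft w j s w₃) (e₄ : Graft w₃ p t w'') : Prop where
  ne : i ≠ j
  pos₁ : e₁.o j ne.symm = q
  pos₂ : e₃.o i ne = p
  oo : ∀ a hi hj h h', e₂.o (e₁.o a hi) h = e₄.o (e₃.o a hj) h'
  no : ∀ b h, e₂.o (e₁.n b) h = e₄.n b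
  on : ∀ c h, e₂.n c = e₄.o (e₃.n c) h

def sumNeInr {A B : Type} (j : B) : {s : A ⊕ B // s ≠ Sum.inr j} ≃ A ⊕ {b : B // b ≠ j} where
  toFun s := match s with
    | ⟨Sum.inl a, _⟩ => Sum.inl a
    | ⟨Sum.inr b, h⟩ => Sum.inr ⟨b, fun hb => h (by rw [hb])⟩
  invFun s := match s with
    | Sum.inl a => ⟨Sum.inl a, by simp⟩
    | Sum.inr b => ⟨Sum.inr b.1, by simpa using b.2⟩
  left_inv := by rintro ⟨a | b, h⟩ <;> rfl
  right_inv := by rintro (a | ⟨b, h⟩) <;> rfl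

def sumNeInl {A B : Type} (j : A) : {s : A ⊕ B // s ≠ Sum.inl j} ≃ {a : A // a ≠ j} ⊕ B where
  toFun s := match s with
    | ⟨Sum.inl a, h⟩ => Sum.inl ⟨a, fun ha => h (by rw [ha])⟩
    | ⟨Sum.inr b, _⟩ => Sum.inr b
  invFun s := match s with
    | Sum.inl a => ⟨Sum.inl a.1, by simpa using a.2⟩
    | Sum.inr b => ⟨Sum.inr b, by simp⟩
  left_inv := by rintro ⟨a | b, h⟩ <;> rfl
  right_inv := by rintro (⟨a, h⟩ | b) <;> rfl

def swapNe {A : Type} (i j : A) :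
    {a : {a : A // a ≠ i} // a.1 ≠ j} ≃ {a : {a : A // a ≠ j} // a.1 ≠ i} where
  toFun a := ⟨⟨a.1.1, a.2⟩, a.1.2⟩
  invFun a := ⟨⟨a.1.1, a.2⟩, a.1.2⟩
  left_inv _ := rfl
  right_inv _ := rfl

namespace Graft
variable {w t s w' t' w'' w₃ : List Col} {i : Fin w.length}

def seqEquiv (e₁ : Graft w i t w') {j : Fin t.length} {q : Fin w'.length} (hq : e₁.n j = q)
    (e₃ : Graft t j s t') :
    {p : Fin w'.length // p ≠ q} ⊕ Fin s.length ≃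
      {a : Fin w.length // a ≠ i} ⊕ Fin t'.length :=
  (Equiv.sumCongr ((e₁.eqv.symm.subtypeEquiv (q := fun s => s ≠ Sum.inr j) (by
      intro p; subst hq; simp [n, Equiv.symm_apply_eq])).trans (sumNeInr j))
    (Equiv.refl _)).trans ((Equiv.sumAssoc _ _ _).trans
      (Equiv.sumCongr (Equiv.refl _) e₃.eqv))

theorem seqEquiv_oo (e₁ : Graft w i t w') {j : Fin t.length} {q : Fin w'.length} (hq : e₁.n j = q)
    (e₃ : Graft t j s t') (a ha h) :
    seqEquiv e₁ hq e₃ (Sum.inl ⟨e₁.o a ha, h⟩) = Sum.inl ⟨a, ha⟩ := by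
  simp [seqEquiv, o, sumNeInr]

theorem seqEquiv_no (e₁ : Graft w i t w') {j : Fin t.length} {q : Fin w'.length} (hq : e₁.n j = q)
    (e₃ : Graft t j s t') (b hb h) :
    seqEquiv e₁ hq e₃ (Sum.inl ⟨e₁.n b, h⟩) = Sum.inr (e₃.o b hb) := by
  simp [seqEquiv, o, n, sumNeInr]

theorem seqEquiv_nn (e₁ : Graft w i t w') {j : Fin t.length} {q : Fin w'.length} (hq : e₁.n j = q)
    (e₃ : Graft t j s t') (c) :
    seqEquiv e₁ hq e₃ (Sum.inr c) = Sum.inr (e₃.n c) := by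
  simp [seqEquiv, n]

theorem exists_seq₂ (e₁ : Graft w i t w') {j : Fin t.length} {q : Fin w'.length}
    (hq : e₁.n j = q) (e₃ : Graft t j s t') (e₄ : Graft w i t' w'') :
    ∃ e₂ : Graft w' q s w'', SeqCompat e₁ e₂ e₃ e₄ := by
  refine ⟨⟨(seqEquiv e₁ hq e₃).trans e₄.eqv, ?_, ?_⟩, hq, ?_, ?_, ?_⟩
  · rintro ⟨p, hp⟩
    rcases e₁.cases p with ⟨a, ha, rfl⟩ | ⟨b, rfl⟩
    · simp only [Equiv.trans_apply, seqEquiv_oo]; rw [e₄.col_out, get_o]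
    · have hb : b ≠ j := by rintro rfl; exact hp hq
      simp only [Equiv.trans_apply, seqEquiv_no e₁ hq e₃ b hb]; rw [e₄.col_in, get_n, get_o]
  · intro c
    simp only [Equiv.trans_apply, seqEquiv_nn]; rw [e₄.col_in, get_n]
  · intro a ha h
    simp only [o, Equiv.trans_apply]; erw [seqEquiv_oo]
  · intro b hb h
    simp only [o, Equiv.trans_apply]; erw [seqEquiv_no e₁ hq e₃ b hb]; rfl
  · intro c
    simp only [n, Equiv.trans_apply]; erw [seqEquiv_nn]; rfl

theorem exists_seq₄ (e₁ : Graft w i t w') {j : Fin t.length} {q : Fin w'.length}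
    (hq : e₁.n j = q) (e₂ : Graft w' q s w'') (e₃ : Graft t j s t') :
    ∃ e₄ : Graft w i t' w'', SeqCompat e₁ e₂ e₃ e₄ := by
  refine ⟨⟨(seqEquiv e₁ hq e₃).symm.trans e₂.eqv, ?_, ?_⟩, hq, ?_, ?_, ?_⟩
  · rintro ⟨a, ha⟩
    have h : e₁.o a ha ≠ q := by subst hq; exact o_ne_n _
    rw [Equiv.trans_apply, ← seqEquiv_oo e₁ hq e₃ a ha h, Equiv.symm_apply_apply, e₂.col_out, get_o]
  · intro p
    rcases e₃.cases p with ⟨b, hb, rfl⟩ | ⟨c, rfl⟩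
    · have h : e₁.n b ≠ q := by subst hq; simpa [n_inj] using hb
      rw [Equiv.trans_apply, ← seqEquiv_no e₁ hq e₃ b hb h, Equiv.symm_apply_apply, e₂.col_out,
        get_n, get_o]
    · rw [Equiv.trans_apply, ← seqEquiv_nn e₁ hq e₃ c, Equiv.symm_apply_apply, e₂.col_in, get_n]
  · intro a ha h
    simp only [o, Equiv.trans_apply]
    rw [← seqEquiv_oo e₁ hq e₃ a ha h, Equiv.symm_apply_apply]; rfl
  · intro b hb h
    simp only [n, Equiv.trans_apply]
    rw [← seqEquiv_no e₁ hq e₃ b hb h, Equiv.symm_apply_apply]; rfl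
  · intro c
    simp only [n, Equiv.trans_apply]
    erw [← seqEquiv_nn e₁ hq e₃ c]; rw [Equiv.symm_apply_apply]

def outEquiv (e : Graft w i t w') {j : Fin w.length} (hj : j ≠ i) {q : Fin w'.length}
    (hq : e.o j hj = q) :
    {p : Fin w'.length // p ≠ q} ≃ {a : {a : Fin w.length // a ≠ i} // a.1 ≠ j} ⊕ Fin t.length :=
  (e.eqv.symm.subtypeEquiv (q := fun s => s ≠ Sum.inl ⟨j, hj⟩) (by
      intro p; subst hq; simp [o, Equiv.symm_apply_eq])).trans
    ((sumNeInl _).trans (Equiv.sumCongr (Equiv.subtypeEquivRight (by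
      intro a; simp [Subtype.ext_iff])) (Equiv.refl _)))

theorem outEquiv_o (e : Graft w i t w') {j : Fin w.length} (hj : j ≠ i) {q : Fin w'.length}
    (hq : e.o j hj = q) (a ha h) (haj : a ≠ j) :
    outEquiv e hj hq ⟨e.o a ha, h⟩ = Sum.inl ⟨⟨a, ha⟩, haj⟩ := by
  simp [outEquiv, o, sumNeInl]
  rfl

theorem outEquiv_n (e : Graft w i t w') {j : Fin w.length} (hj : j ≠ i) {q : Fin w'.length}
    (hq : e.o j hj = q) (b h) :
    outEquiv e hj hq ⟨e.n b, h⟩ = Sum.inr b := by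
  simp [outEquiv, n, sumNeInl]

def parEquiv (e₁ : Graft w i t w') {j : Fin w.length} (hij : i ≠ j) {q : Fin w'.length}
    (hq : e₁.o j hij.symm = q) (e₃ : Graft w j s w₃) {p : Fin w₃.length} (hp : e₃.o i hij = p) :
    {a : Fin w'.length // a ≠ q} ⊕ Fin s.length ≃ {a : Fin w₃.length // a ≠ p} ⊕ Fin t.length :=
  (Equiv.sumCongr (outEquiv e₁ hij.symm hq) (Equiv.refl _)).trans
    ((Equiv.sumAssoc _ _ _).trans
      ((Equiv.sumCongr (swapNe i j) (Equiv.sumComm _ _)).trans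
        ((Equiv.sumAssoc _ _ _).symm.trans
          (Equiv.sumCongr (outEquiv e₃ hij hp).symm (Equiv.refl _)))))

theorem parEquiv_oo (e₁ : Graft w i t w') {j : Fin w.length} (hij : i ≠ j) {q : Fin w'.length}
    (hq : e₁.o j hij.symm = q) (e₃ : Graft w j s w₃) {p : Fin w₃.length} (hp : e₃.o i hij = p)
    (a hi hj h h') :
    parEquiv e₁ hij hq e₃ hp (Sum.inl ⟨e₁.o a hi, h⟩) = Sum.inl ⟨e₃.o a hj, h'⟩ := by
  simp [parEquiv, outEquiv_o e₁ hij.symm hq a hi h hj, swapNe, Equiv.symm_apply_eq,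
    outEquiv_o e₃ hij hp a hj h' hi]

theorem parEquiv_no (e₁ : Graft w i t w') {j : Fin w.length} (hij : i ≠ j) {q : Fin w'.length}
    (hq : e₁.o j hij.symm = q) (e₃ : Graft w j s w₃) {p : Fin w₃.length} (hp : e₃.o i hij = p)
    (b h) :
    parEquiv e₁ hij hq e₃ hp (Sum.inl ⟨e₁.n b, h⟩) = Sum.inr b := by
  simp [parEquiv, outEquiv_n e₁ hij.symm hq b h]

theorem parEquiv_on (e₁ : Graft w i t w') {j : Fin w.length} (hij : i ≠ j) {q : Fin w'.length}
    (hq : e₁.o j hij.symm = q) (e₃ : Graft w j s w₃) {p : Fin w₃.length} (hp : e₃.o i hij = p)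
    (c h) :
    parEquiv e₁ hij hq e₃ hp (Sum.inr c) = Sum.inl ⟨e₃.n c, h⟩ := by
  simp [parEquiv, Equiv.symm_apply_eq, outEquiv_n e₃ hij hp c h]

theorem exists_par₄ (e₁ : Graft w i t w') {j : Fin w.length} (hij : i ≠ j) {q : Fin w'.length}
    (hq : e₁.o j hij.symm = q) (e₂ : Graft w' q s w'') (e₃ : Graft w j s w₃)
    {p : Fin w₃.length} (hp : e₃.o i hij = p) :
    ∃ e₄ : Graft w₃ p t w'', ParCompat e₁ e₂ e₃ e₄ := by
  have hne : ∀ b, e₁.n b ≠ q := by intro b; subst hq; exact (o_ne_n _).symm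
  have hne' : ∀ b, e₃.n b ≠ p := by intro b; subst hp; exact (o_ne_n _).symm
  refine ⟨⟨(parEquiv e₁ hij hq e₃ hp).symm.trans e₂.eqv, ?_, ?_⟩, hij, hq, hp, ?_, ?_, ?_⟩
  · rintro ⟨a, ha⟩
    rcases e₃.cases a with ⟨a, haj, rfl⟩ | ⟨c, rfl⟩
    · have hai : a ≠ i := by rintro rfl; exact ha hp
      have h : e₁.o a hai ≠ q := by subst hq; simpa [o_inj] using haj
      rw [Equiv.trans_apply, ← parEquiv_oo e₁ hij hq e₃ hp a hai haj h ha,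
        Equiv.symm_apply_apply, e₂.col_out, get_o, get_o]
    · rw [Equiv.trans_apply, ← parEquiv_on e₁ hij hq e₃ hp c ha,
        Equiv.symm_apply_apply, e₂.col_in, get_n]
  · intro b
    rw [Equiv.trans_apply, ← parEquiv_no e₁ hij hq e₃ hp b (hne b),
        Equiv.symm_apply_apply, e₂.col_out, get_n]
  · intro a hi hj h h'
    simp only [o, Equiv.trans_apply]
    erw [← parEquiv_oo e₁ hij hq e₃ hp a hi hj h h']
    rw [Equiv.symm_apply_apply]; rfl
  · intro b h
    simp only [n, Equiv.trans_apply]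
    rw [← parEquiv_no e₁ hij hq e₃ hp b (hne b), Equiv.symm_apply_apply]; rfl
  · intro c h
    simp only [o, Equiv.trans_apply]
    erw [← parEquiv_on e₁ hij hq e₃ hp c h]
    rw [Equiv.symm_apply_apply]; rfl

end Graft

/-- Continuity of `m` on the product of compactly generated spaces, tested on compact Hausdorff
spaces. -/
def KCont₂ {X Y Z : Type} (tX : TopologicalSpace X) (tY : TopologicalSpace Y)
    (tZ : TopologicalSpace Z) (m : X → Y → Z) : Prop :=
  ∀ (K : CompHaus.{0}) (a : K → X) (b : K → Y), Continuous[_, tX] a → Continuous[_, tY] b →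
    Continuous[_, tZ] (fun z => m (a z) (b z))

/-- Data of a topological operad with colours `full` and `half`, in which there are only operations
with inputs `w` and output `k` such that `S w k`. -/
structure OperadData (S : List Col → Col → Prop) where
  Obj : ∀ w k, S w k → Type
  top : ∀ w k h, TopologicalSpace (Obj w k h)
  gen : ∀ w k h, IsGeneratedBy CH (Obj w k h)
  one : ∀ k (h : S [k] k), Obj [k] k h
  comp : ∀ {w t w' : List Col} {k c : Col} (hw : S w k) (ht : S t c) (hw' : S w' k)
    (i : Fin w.length), w.get i = c → Graft w i t w' → Obj w k hw → Obj t c ht → Obj w' k hw'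

attribute [instance] OperadData.top OperadData.gen

/-- Topological operads. -/
structure Operad (S : List Col → Col → Prop) extends OperadData S where
  comp_continuous : ∀ {w t w' : List Col} {k c : Col} (hw : S w k) (ht : S t c) (hw' : S w' k)
    (i : Fin w.length) (hi : w.get i = c) (e : Graft w i t w'),
    KCont₂ (top w k hw) (top t c ht) (top w' k hw') (comp hw ht hw' i hi e)
  one_comp : ∀ {w : List Col} {k : Col} (h₁ : S [k] k) (hw : S w k) (e : Graft [k] 0 w w)
    (x : Obj w k hw), (∀ b, e.n b = b) → comp h₁ hw hw 0 rfl e (one k h₁) x = x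
  comp_one : ∀ {w : List Col} {k c : Col} (hw : S w k) (h₁ : S [c] c) (i : Fin w.length)
    (hi : w.get i = c) (e : Graft w i [c] w) (x : Obj w k hw),
    (∀ a ha, e.o a ha = a) → e.n 0 = i → comp hw h₁ hw i hi e x (one c h₁) = x
  comp_seq : ∀ {w t s w' t' w'' : List Col} {k c d : Col} (hw : S w k) (ht : S t c) (hs : S s d)
    (hw' : S w' k) (ht' : S t' c) (hw'' : S w'' k) {i : Fin w.length} {j : Fin t.length}
    {q : Fin w'.length} (hi : w.get i = c) (hj : t.get j = d) (hq : w'.get q = d)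
    (e₁ : Graft w i t w') (e₂ : Graft w' q s w'') (e₃ : Graft t j s t') (e₄ : Graft w i t' w'')
    (x : Obj w k hw) (y : Obj t c ht) (z : Obj s d hs), SeqCompat e₁ e₂ e₃ e₄ →
    comp hw' hs hw'' q hq e₂ (comp hw ht hw' i hi e₁ x y) z =
      comp hw ht' hw'' i hi e₄ x (comp ht hs ht' j hj e₃ y z)
  comp_par : ∀ {w t s w' w₃ w'' : List Col} {k c d : Col} (hw : S w k) (ht : S t c) (hs : S s d)
    (hw' : S w' k) (hw₃ : S w₃ k) (hw'' : S w'' k) {i j : Fin w.length}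
    {q : Fin w'.length} {p : Fin w₃.length} (hi : w.get i = c) (hj : w.get j = d)
    (hq : w'.get q = d) (hp : w₃.get p = c)
    (e₁ : Graft w i t w') (e₂ : Graft w' q s w'') (e₃ : Graft w j s w₃) (e₄ : Graft w₃ p t w'')
    (x : Obj w k hw) (y : Obj t c ht) (z : Obj s d hs), ParCompat e₁ e₂ e₃ e₄ →
    comp hw' hs hw'' q hq e₂ (comp hw ht hw' i hi e₁ x y) z =
      comp hw₃ ht hw'' p hp e₄ (comp hw hs hw₃ j hj e₃ x z) y

def OperadData.restrict {S : List Col → Col → Prop} (P : OperadData S)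
    (S' : List Col → Col → Prop) (h : ∀ w k, S' w k → S w k) : OperadData S' where
  Obj w k hw := P.Obj w k (h w k hw)
  top w k hw := P.top w k (h w k hw)
  gen w k hw := P.gen w k (h w k hw)
  one k hk := P.one k (h _ _ hk)
  comp hw ht hw' := P.comp (h _ _ hw) (h _ _ ht) (h _ _ hw')

def Operad.restrict {S : List Col → Col → Prop} (P : Operad S)
    (S' : List Col → Col → Prop) (h : ∀ w k, S' w k → S w k) : Operad S' where
  toOperadData := P.toOperadData.restrict S' h
  comp_continuous hw ht hw' := P.comp_continuous (h _ _ hw) (h _ _ ht) (h _ _ hw')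
  one_comp h₁ hw := P.one_comp (h _ _ h₁) (h _ _ hw)
  comp_one hw h₁ := P.comp_one (h _ _ hw) (h _ _ h₁)
  comp_seq hw ht hs hw' ht' hw'' :=
    P.comp_seq (h _ _ hw) (h _ _ ht) (h _ _ hs) (h _ _ hw') (h _ _ ht') (h _ _ hw'')
  comp_par hw ht hs hw' ht' hw'' :=
    P.comp_par (h _ _ hw) (h _ _ ht) (h _ _ hs) (h _ _ hw') (h _ _ ht') (h _ _ hw'')

/-- Maps of operads. -/
structure OperadHom {S : List Col → Col → Prop} (P Q : OperadData S) where
  map : ∀ w k h, P.Obj w k h → Q.Obj w k h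
  continuous_map : ∀ w k h, Continuous (map w k h)
  map_one : ∀ k h, map [k] k h (P.one k h) = Q.one k h
  map_comp : ∀ {w t w' : List Col} {k c : Col} (hw : S w k) (ht : S t c) (hw' : S w' k)
    (i : Fin w.length) (hi : w.get i = c) (e : Graft w i t w') (x : P.Obj w k hw)
    (y : P.Obj t c ht),
    map w' k hw' (P.comp hw ht hw' i hi e x y) =
      Q.comp hw ht hw' i hi e (map w k hw x) (map t c ht y)

/-- All operations: two-coloured operads. -/
def sigAll (_ : List Col) (_ : Col) : Prop := True
/-- Operations with output `half`. The number of `full` inputs is the degree: these are the operads in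
collections of spaces, the `half` inputs being the inputs and the `full` inputs the labels. -/
def sigColl (_ : List Col) (k : Col) : Prop := k = .half
/-- Output `half` and degree at most one: operads in degree 0-1 collections. -/
def sigColl₁ (w : List Col) (k : Col) : Prop :=
  k = .half ∧ ∀ i j : Fin w.length, w.get i = .full → w.get j = .full → i = j
/-- One-coloured operads, the colour being called `half`. -/
def sigHalf (w : List Col) (k : Col) : Prop := k = .half ∧ ∀ c ∈ w, c = .half
/-- One-coloured operads, the colour being called `full`. -/
def sigFull (w : List Col) (k : Col) : Prop := k = .full ∧ ∀ c ∈ w, c = .full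

section LittleDiscs

variable (d : ℕ) [NeZero d]

def lastCoord : Fin d := ⟨d - 1, Nat.sub_lt (NeZero.pos d) one_pos⟩

/-- The unit disc, and the upper half of it. -/
def disc : Col → Set (EuclideanSpace ℝ (Fin d))
  | .full => {x | ‖x‖ ≤ 1}
  | .half => {x | ‖x‖ ≤ 1 ∧ 0 ≤ x (lastCoord d)}

variable {d} in
/-- The pair `(r, a)` acts as the map `x ↦ r x + a`. -/
def affine (p : ℝ × EuclideanSpace ℝ (Fin d)) (x : EuclideanSpace ℝ (Fin d)) :
    EuclideanSpace ℝ (Fin d) := p.1 • x + p.2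

/-- Disjoint full and half discs inside the disc or half disc of colour `k`, half discs being based on
the wall `x_d = 0`. -/
structure IsCheese (w : List Col) (k : Col)
    (p : Fin w.length → ℝ × EuclideanSpace ℝ (Fin d)) : Prop where
  radius : ∀ j, 0 < (p j).1 ∧ (p j).1 ≤ 1
  base : ∀ j, w.get j = .half → k = .half ∧ (p j).2 (lastCoord d) = 0
  mapsTo : ∀ j, Set.MapsTo (affine (p j)) (disc d (w.get j)) (disc d k)
  disjoint : ∀ j j', j ≠ j' →
    Disjoint (affine (p j) '' disc d (w.get j)) (affine (p j') '' disc d (w.get j'))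

def Config (w : List Col) (k : Col) : Type :=
  {p : Fin w.length → ℝ × EuclideanSpace ℝ (Fin d) // IsCheese d w k p}

instance (w : List Col) (k : Col) : TopologicalSpace (Config d w k) :=
  inferInstanceAs (TopologicalSpace {p // IsCheese d w k p})

instance (w : List Col) (k : Col) : IsGeneratedBy CH (Config d w k) := by
  have : SequentialSpace (Config d w k) :=
    inferInstanceAs (SequentialSpace {p : Fin w.length → ℝ × EuclideanSpace ℝ (Fin d) //
      IsCheese d w k p})
  exact isGeneratedBy_of_sequential _

variable {d}

def compFun {w t w' : List Col} {i : Fin w.length} (e : Graft w i t w')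
    (p : Fin w.length → ℝ × EuclideanSpace ℝ (Fin d))
    (q : Fin t.length → ℝ × EuclideanSpace ℝ (Fin d)) (l : Fin w'.length) :
    ℝ × EuclideanSpace ℝ (Fin d) :=
  Sum.elim (fun j => p j.1) (fun b => ((p i).1 * (q b).1, (p i).1 • (q b).2 + (p i).2))
    (e.eqv.symm l)

theorem compFun_o {w t w' : List Col} {i : Fin w.length} (e : Graft w i t w')
    (p : Fin w.length → ℝ × EuclideanSpace ℝ (Fin d))
    (q : Fin t.length → ℝ × EuclideanSpace ℝ (Fin d)) (j hj) :
    compFun e p q (e.o j hj) = p j := by simp [compFun, Graft.o]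

theorem compFun_n {w t w' : List Col} {i : Fin w.length} (e : Graft w i t w')
    (p : Fin w.length → ℝ × EuclideanSpace ℝ (Fin d))
    (q : Fin t.length → ℝ × EuclideanSpace ℝ (Fin d)) (b) :
    compFun e p q (e.n b) = ((p i).1 * (q b).1, (p i).1 • (q b).2 + (p i).2) := by
  simp [compFun, Graft.n]

theorem affine_mul (p q : ℝ × EuclideanSpace ℝ (Fin d)) :
    affine (p.1 * q.1, p.1 • q.2 + p.2) = affine p ∘ affine q := by
  funext x; simp [affine, mul_smul, add_assoc]

theorem affine_injective (p : ℝ × EuclideanSpace ℝ (Fin d)) (hp : 0 < p.1) :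
    Function.Injective (affine p) := by
  intro x y h
  simpa [affine, hp.ne'] using h

theorem isCheese_comp {w t w' : List Col} {k c : Col} {i : Fin w.length} (hi : w.get i = c)
    (e : Graft w i t w') {p : Fin w.length → ℝ × EuclideanSpace ℝ (Fin d)}
    {q : Fin t.length → ℝ × EuclideanSpace ℝ (Fin d)} (hp : IsCheese d w k p)
    (hq : IsCheese d t c q) : IsCheese d w' k (compFun e p q) := by
  have hsub : ∀ b, affine (compFun e p q (e.n b)) '' disc d (w'.get (e.n b)) ⊆
      affine (p i) '' disc d (w.get i) := by
    intro b
    rw [compFun_n, affine_mul, Set.image_comp, e.get_n]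
    refine Set.image_mono ?_
    rw [hi]
    exact (hq.mapsTo b).image_subset
  refine ⟨?_, ?_, ?_, ?_⟩
  · intro l
    rcases e.cases l with ⟨j, hj, rfl⟩ | ⟨b, rfl⟩
    · rw [compFun_o]; exact hp.radius j
    · rw [compFun_n]
      exact ⟨mul_pos (hp.radius i).1 (hq.radius b).1,
        mul_le_one₀ (hp.radius i).2 (hq.radius b).1.le (hq.radius b).2⟩
  · intro l hl
    rcases e.cases l with ⟨j, hj, rfl⟩ | ⟨b, rfl⟩
    · rw [compFun_o]; rw [e.get_o] at hl; exact hp.base j hl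
    · rw [e.get_n] at hl
      obtain ⟨hc, hb⟩ := hq.base b hl
      obtain ⟨hk, hi'⟩ := hp.base i (hi.trans hc)
      rw [compFun_n]
      refine ⟨hk, ?_⟩
      simp [hb, hi']
  · intro l
    rcases e.cases l with ⟨j, hj, rfl⟩ | ⟨b, rfl⟩
    · rw [compFun_o, e.get_o]; exact hp.mapsTo j
    · rw [compFun_n, affine_mul, e.get_n]
      exact (hi ▸ hp.mapsTo i : Set.MapsTo (affine (p i)) (disc d c) (disc d k)).comp (hq.mapsTo b)
  · intro l l' hl
    rcases e.cases l with ⟨j, hj, rfl⟩ | ⟨b, rfl⟩ <;>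
      rcases e.cases l' with ⟨j', hj', rfl⟩ | ⟨b', rfl⟩
    · rw [compFun_o, compFun_o, e.get_o, e.get_o]
      exact hp.disjoint j j' (fun h => hl (by subst h; rfl))
    · rw [compFun_o, e.get_o]
      exact (hp.disjoint j i hj).mono_right (hsub b')
    · rw [compFun_o, e.get_o]
      exact (hp.disjoint i j' hj'.symm).mono_left (hsub b)
    · rw [compFun_n, compFun_n, affine_mul, affine_mul, Set.image_comp, Set.image_comp, e.get_n,
        e.get_n]
      exact (Set.disjoint_image_iff (affine_injective _ (hp.radius i).1)).2
        (hq.disjoint b b' (fun h => hl (by subst h; rfl)))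

theorem isCheese_one (k : Col) : IsCheese d [k] k (fun _ => (1, 0)) := by
  have hid : affine ((1 : ℝ), (0 : EuclideanSpace ℝ (Fin d))) = id := by
    funext x; simp [affine]
  refine ⟨fun _ => ⟨one_pos, le_rfl⟩, ?_, ?_, ?_⟩
  · intro j hj; fin_cases j; exact ⟨hj, rfl⟩
  · intro j; fin_cases j; rw [hid]; exact Set.mapsTo_id _
  · intro j j' h; exact absurd (Subsingleton.elim (α := Fin 1) j j') h

variable (d) in
/-- The swiss cheese operad, composition being insertion of discs. -/
def swissCheese : Operad sigAll where
  Obj w k _ := Config d w k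
  top _ _ _ := inferInstance
  gen _ _ _ := inferInstance
  one k _ := ⟨fun _ => (1, 0), isCheese_one k⟩
  comp _ _ _ _ hi e x y := ⟨compFun e x.1 y.1, isCheese_comp hi e x.2 y.2⟩
  comp_continuous hw ht hw' i hi e := by
    intro K a b ha hb
    refine Continuous.subtype_mk (continuous_pi fun l => ?_) _
    have ha' : ∀ j, Continuous fun z => (a z).1 j := fun j =>
      (continuous_apply j).comp (continuous_subtype_val.comp ha)
    have hb' : ∀ j, Continuous fun z => (b z).1 j := fun j =>
      (continuous_apply j).comp (continuous_subtype_val.comp hb)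
    rcases e.cases l with ⟨j, hj, rfl⟩ | ⟨c, rfl⟩
    · simpa only [compFun_o] using ha' j
    · simp only [compFun_n]
      have h1 := ha' i
      have h2 := hb' c
      fun_prop
  one_comp h₁ hw e x hb := by
    refine Subtype.ext (funext fun l => ?_)
    have h := compFun_n e (fun _ => ((1 : ℝ), (0 : EuclideanSpace ℝ (Fin d)))) x.1 l
    rw [hb] at h
    exact h.trans (by simp)
  comp_one hw h₁ i hi e x ho hn := by
    refine Subtype.ext (funext fun l => ?_)
    rcases e.cases l with ⟨j, hj, rfl⟩ | ⟨b, rfl⟩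
    · exact (compFun_o e _ _ j hj).trans (by rw [ho])
    · refine (compFun_n e _ _ b).trans ?_
      have : b = 0 := Subsingleton.elim (α := Fin 1) _ _
      subst this
      rw [hn]; simp
  comp_seq hw ht hs hw' ht' hw'' i j q hi hj hq e₁ e₂ e₃ e₄ x y z hc := by
    refine Subtype.ext (funext fun l => ?_)
    change compFun e₂ (compFun e₁ x.1 y.1) z.1 l = compFun e₄ x.1 (compFun e₃ y.1 z.1) l
    rcases e₂.cases l with ⟨p, hp, rfl⟩ | ⟨b, rfl⟩
    · rcases e₁.cases p with ⟨a, ha, rfl⟩ | ⟨b, rfl⟩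
      · rw [compFun_o, compFun_o, hc.oo, compFun_o]
      · have hb : b ≠ j := by rintro rfl; exact hp hc.pos
        rw [compFun_o, compFun_n, hc.no b hb, compFun_n, compFun_o]
    · rw [compFun_n, hc.nn, compFun_n, compFun_n, ← hc.pos, compFun_n]
      simp [mul_assoc, mul_smul, add_assoc]
  comp_par hw ht hs hw' hw₃ hw'' i j q p hi hj hq hp e₁ e₂ e₃ e₄ x y z hc := by
    refine Subtype.ext (funext fun l => ?_)
    change compFun e₂ (compFun e₁ x.1 y.1) z.1 l = compFun e₄ (compFun e₃ x.1 z.1) y.1 l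
    rcases e₂.cases l with ⟨r, hr, rfl⟩ | ⟨b, rfl⟩
    · rcases e₁.cases r with ⟨a, ha, rfl⟩ | ⟨b, rfl⟩
      · have haj : a ≠ j := by rintro rfl; exact hr hc.pos₁
        have h' : e₃.o a haj ≠ p := by
          rw [← hc.pos₂]; simpa [Graft.o_inj] using ha
        rw [compFun_o, compFun_o, hc.oo a ha haj hr h', compFun_o, compFun_o]
      · rw [compFun_o, compFun_n, hc.no b, compFun_n, ← hc.pos₂, compFun_o]
    · have h' : e₃.n b ≠ p := by rw [← hc.pos₂]; exact Graft.o_ne_n _ |>.symm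
      rw [compFun_n, hc.on b h', compFun_o, compFun_n, ← hc.pos₁, compFun_o]

end LittleDiscs

section Finest

variable {ι : Type} {X : ι → Type}

/-- The finest family of topologies with the property `Pr`, for properties that are stable under
intersections of topologies. -/
def finest (Pr : (∀ j, TopologicalSpace (X j)) → Prop) (j : ι) : TopologicalSpace (X j) :=
  ⨅ τ : {τ : ∀ j, TopologicalSpace (X j) // Pr τ}, τ.1 j

theorem finest_le {Pr : (∀ j, TopologicalSpace (X j)) → Prop} {τ : ∀ j, TopologicalSpace (X j)}
    (h : Pr τ) (j : ι) : finest Pr j ≤ τ j := iInf_le (fun τ : {τ // Pr τ} => τ.1 j) ⟨τ, h⟩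

theorem continuous_finest {Y : Type} (t : TopologicalSpace Y)
    {Pr : (∀ j, TopologicalSpace (X j)) → Prop} {j : ι} {g : Y → X j}
    (h : ∀ τ, Pr τ → Continuous[t, τ j] g) : Continuous[t, finest Pr j] g :=
  continuous_iInf_rng.2 fun τ => h τ.1 τ.2

theorem KCont₂.finest {Pr : (∀ j, TopologicalSpace (X j)) → Prop} {a b c : ι}
    {m : X a → X b → X c} (h : ∀ τ, Pr τ → KCont₂ (τ a) (τ b) (τ c) m) :
    KCont₂ (finest Pr a) (finest Pr b) (finest Pr c) m := fun K f g hf hg =>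
  continuous_finest _ fun τ hτ => h τ hτ K f g (continuous_le_rng (finest_le hτ a) hf)
    (continuous_le_rng (finest_le hτ b) hg)

/-- The compactly generated refinement of a topology. -/
abbrev kTop {Y : Type} (t : TopologicalSpace Y) : TopologicalSpace Y :=
  @TopologicalSpace.generatedBy _ CH _ Y t

theorem continuous_kTop {Y Z : Type} [tY : TopologicalSpace Y] [IsGeneratedBy CH Y]
    {t : TopologicalSpace Z} {g : Y → Z} (h : Continuous g) : Continuous[tY, kTop t] g :=
  (IsGeneratedBy.equiv_symm_comp_continuous_iff (X := CH) g).2 h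

theorem KCont₂.kTop {A B D : Type} {tA : TopologicalSpace A} {tB : TopologicalSpace B}
    {tD : TopologicalSpace D} {m : A → B → D} (h : KCont₂ tA tB tD m) :
    KCont₂ (kTop tA) (kTop tB) (kTop tD) m := fun K f g hf hg => by
  have : IsGeneratedBy CH K := inferInstanceAs (IsGeneratedBy CH (CH K))
  exact continuous_kTop (h K f g (continuous_le_rng TopologicalSpace.generatedBy_le hf)
    (continuous_le_rng TopologicalSpace.generatedBy_le hg))

theorem isGeneratedBy_finest {Pr : (∀ j, TopologicalSpace (X j)) → Prop}
    (h : Pr (fun j => kTop (Cheese.finest Pr j))) (j : ι) :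
    @IsGeneratedBy _ CH _ (X j) (Cheese.finest Pr j) :=
  IsGeneratedBy.iff_le_generatedBy.2 (finest_le h j)

end Finest

section WConstruction

variable {S : List Col → Col → Prop}

/-- Trees with vertices labelled by `P` and inner edges labelled by lengths in `[0, ∞]`, built by
grafting a tree `y` on the leaf `i` of a tree `x` with a new edge of length `ℓ`. -/
inductive WTree (P : OperadData S) : List Col → Col → Type
  | vertex {w : List Col} {k : Col} (hw : S w k) (x : P.Obj w k hw) : WTree P w k
  | graft {w t w' : List Col} {k c : Col} (hw' : S w' k) (ℓ : ENNReal) (i : Fin w.length)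
      (hi : w.get i = c) (e : Graft w i t w') (x : WTree P w k) (y : WTree P t c) : WTree P w' k

/-- Independence of the order of grafting, contraction of edges of length zero, and removal of unit
vertices between two edges, whose lengths add up. -/
inductive EdgeRel (P : OperadData S) : ∀ {w k}, WTree P w k → WTree P w k → Prop
  | zero {w t w' : List Col} {k c : Col} (hw : S w k) (ht : S t c) (hw' : S w' k)
      (i : Fin w.length) (hi : w.get i = c) (e : Graft w i t w') (x : P.Obj w k hw)
      (y : P.Obj t c ht) :
      EdgeRel P (.graft hw' 0 i hi e (.vertex hw x) (.vertex ht y))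
        (.vertex hw' (P.comp hw ht hw' i hi e x y))
  | unit {w t w' w'' : List Col} {k c : Col} (hw' : S w' k) (h₁ : S [c] c) (hw'' : S w'' k)
      {i : Fin w.length} {q : Fin w'.length} (hi : w.get i = c) (hq : w'.get q = c)
      (e₁ : Graft w i [c] w') (e₂ : Graft w' q t w'') (e : Graft w i t w'')
      (ℓ₁ ℓ₂ : ENNReal) (x : WTree P w k) (y : WTree P t c) (hn : e₁.n 0 = q)
      (ho : ∀ a ha h, e₂.o (e₁.o a ha) h = e.o a ha) (hi' : ∀ b, e₂.n b = e.n b) :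
      EdgeRel P (.graft hw'' ℓ₂ q hq e₂ (.graft hw' ℓ₁ i hi e₁ x (.vertex h₁ (P.one c h₁))) y)
        (.graft hw'' (ℓ₁ + ℓ₂) i hi e x y)
  | seq {w t s w' t' w'' : List Col} {k c d : Col} (hw' : S w' k) (ht' : S t' c) (hw'' : S w'' k)
      {i : Fin w.length} {j : Fin t.length} {q : Fin w'.length} (hi : w.get i = c)
      (hj : t.get j = d) (hq : w'.get q = d) (e₁ : Graft w i t w') (e₂ : Graft w' q s w'')
      (e₃ : Graft t j s t') (e₄ : Graft w i t' w'') (ℓ₁ ℓ₂ : ENNReal) (x : WTree P w k)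
      (y : WTree P t c) (z : WTree P s d) (hc : SeqCompat e₁ e₂ e₃ e₄) :
      EdgeRel P (.graft hw'' ℓ₂ q hq e₂ (.graft hw' ℓ₁ i hi e₁ x y) z)
        (.graft hw'' ℓ₁ i hi e₄ x (.graft ht' ℓ₂ j hj e₃ y z))
  | par {w t s w' w₃ w'' : List Col} {k c d : Col} (hw' : S w' k) (hw₃ : S w₃ k) (hw'' : S w'' k)
      {i j : Fin w.length} {q : Fin w'.length} {p : Fin w₃.length} (hi : w.get i = c)
      (hj : w.get j = d) (hq : w'.get q = d) (hp : w₃.get p = c) (e₁ : Graft w i t w')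
      (e₂ : Graft w' q s w'') (e₃ : Graft w j s w₃) (e₄ : Graft w₃ p t w'') (ℓ₁ ℓ₂ : ENNReal)
      (x : WTree P w k) (y : WTree P t c) (z : WTree P s d) (hc : ParCompat e₁ e₂ e₃ e₄) :
      EdgeRel P (.graft hw'' ℓ₂ q hq e₂ (.graft hw' ℓ₁ i hi e₁ x y) z)
        (.graft hw'' ℓ₁ p hp e₄ (.graft hw₃ ℓ₂ j hj e₃ x z) y)
  | left {w t w' : List Col} {k c : Col} (hw' : S w' k) (ℓ : ENNReal) (i : Fin w.length)
      (hi : w.get i = c) (e : Graft w i t w') {x x' : WTree P w k} (y : WTree P t c)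
      (h : EdgeRel P x x') : EdgeRel P (.graft hw' ℓ i hi e x y) (.graft hw' ℓ i hi e x' y)
  | right {w t w' : List Col} {k c : Col} (hw' : S w' k) (ℓ : ENNReal) (i : Fin w.length)
      (hi : w.get i = c) (e : Graft w i t w') (x : WTree P w k) {y y' : WTree P t c}
      (h : EdgeRel P y y') : EdgeRel P (.graft hw' ℓ i hi e x y) (.graft hw' ℓ i hi e x y')

/-- The relations of the Boardman-Vogt construction: `EdgeRel` and removal of unit vertices at the root
or at a leaf, inside the components obtained by cutting edges of infinite length. -/
inductive WRel (P : OperadData S) : ∀ {w k}, WTree P w k → WTree P w k → Prop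
  | edge {w : List Col} {k : Col} {x y : WTree P w k} (h : EdgeRel P x y) : WRel P x y
  | root {w : List Col} {k : Col} (h₁ : S [k] k) (hw : S w k) (ℓ : ENNReal) (e : Graft [k] 0 w w)
      (x : WTree P w k) (he : ∀ b, e.n b = b) :
      WRel P (.graft hw ℓ 0 rfl e (.vertex h₁ (P.one k h₁)) x) x
  | leaf {w : List Col} {k c : Col} (hw : S w k) (h₁ : S [c] c) (ℓ : ENNReal) (i : Fin w.length)
      (hi : w.get i = c) (e : Graft w i [c] w) (x : WTree P w k) (ho : ∀ a ha, e.o a ha = a)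
      (hn : e.n 0 = i) : WRel P (.graft hw ℓ i hi e x (.vertex h₁ (P.one c h₁))) x
  | left {w t w' : List Col} {k c : Col} (hw' : S w' k) (i : Fin w.length)
      (hi : w.get i = c) (e : Graft w i t w') {x x' : WTree P w k} (y : WTree P t c)
      (h : WRel P x x') : WRel P (.graft hw' ⊤ i hi e x y) (.graft hw' ⊤ i hi e x' y)
  | right {w t w' : List Col} {k c : Col} (hw' : S w' k) (i : Fin w.length)
      (hi : w.get i = c) (e : Graft w i t w') (x : WTree P w k) {y y' : WTree P t c}
      (h : WRel P y y') : WRel P (.graft hw' ⊤ i hi e x y) (.graft hw' ⊤ i hi e x y')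

/-- The space of trees has the final topology for the spaces of labels and lengths. -/
structure IsTreeTop (P : OperadData S)
    (τ : ∀ j : List Col × Col, TopologicalSpace (WTree P j.1 j.2)) : Prop where
  vertex : ∀ w k (hw : S w k), Continuous[P.top w k hw, τ (w, k)] (WTree.vertex hw)
  graft : ∀ {w t w' : List Col} {k c : Col} (hw' : S w' k) (i : Fin w.length)
    (hi : w.get i = c) (e : Graft w i t w') (K : CompHaus.{0}) (ℓ : K → ENNReal)
    (x : K → WTree P w k) (y : K → WTree P t c), Continuous ℓ → Continuous[_, τ (w, k)] x →
    Continuous[_, τ (t, c)] y →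
    Continuous[_, τ (w', k)] (fun z => WTree.graft hw' (ℓ z) i hi e (x z) (y z))

abbrev treeTop (P : OperadData S) (w : List Col) (k : Col) : TopologicalSpace (WTree P w k) :=
  finest (X := fun j : List Col × Col => WTree P j.1 j.2) (IsTreeTop P) (w, k)

/-- The quotient of the space of trees. -/
def WObj (P : OperadData S) (j : List Col × Col) : Type :=
  Quot (fun x y : WTree P j.1 j.2 => WRel P x y)

def WObj.comp {P : OperadData S} {w t w' : List Col} {k c : Col} (hw' : S w' k)
    (i : Fin w.length) (hi : w.get i = c) (e : Graft w i t w') :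
    WObj P (w, k) → WObj P (t, c) → WObj P (w', k) :=
  Quot.map₂ (WTree.graft hw' ⊤ i hi e) (fun x _ _ h => .right hw' i hi e x h)
    (fun _ _ y h => .left hw' i hi e y h)

/-- The quotient topology. -/
structure IsWTop (P : OperadData S) (τ : ∀ j, TopologicalSpace (WObj P j)) : Prop where
  proj : ∀ (w : List Col) (k : Col) (K : CompHaus.{0}) (x : K → WTree P w k),
    Continuous[_, treeTop P w k] x →
    Continuous[_, τ (w, k)] (fun z => (Quot.mk _ (x z) : WObj P (w, k)))
  comp : ∀ {w t w' : List Col} {k c : Col} (hw' : S w' k) (i : Fin w.length)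
    (hi : w.get i = c) (e : Graft w i t w'),
    KCont₂ (τ (w, k)) (τ (t, c)) (τ (w', k)) (WObj.comp hw' i hi e)

theorem isWTop_finest (P : OperadData S) : IsWTop P (finest (IsWTop P)) :=
  ⟨fun w k K x hx => continuous_finest _ fun τ (hτ : IsWTop P τ) => hτ.proj w k K x hx,
    fun hw' i hi e => KCont₂.finest fun _ hτ => hτ.comp hw' i hi e⟩

theorem IsWTop.kTop {P : OperadData S} {τ : ∀ j, TopologicalSpace (WObj P j)} (h : IsWTop P τ) :
    IsWTop P (fun j => kTop (τ j)) :=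
  ⟨fun w k K x hx => by
    have : IsGeneratedBy CH K := inferInstanceAs (IsGeneratedBy CH (CH K))
    exact continuous_kTop (h.proj w k K x hx), fun hw' i hi e => (h.comp hw' i hi e).kTop⟩

/-- The Boardman-Vogt construction: composition is grafting with a new edge of length `∞`. -/
def Operad.W (P : Operad S) : Operad S where
  Obj w k _ := WObj P.toOperadData (w, k)
  top w k _ := finest (IsWTop P.toOperadData) (w, k)
  gen w k _ := isGeneratedBy_finest (isWTop_finest _).kTop (w, k)
  one k h := Quot.mk _ (.vertex h (P.one k h))
  comp _ _ hw' i hi e := WObj.comp hw' i hi e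
  comp_continuous _ _ hw' i hi e := (isWTop_finest _).comp hw' i hi e
  one_comp h₁ hw e := by
    rintro ⟨x⟩ hb
    exact Quot.sound (.root h₁ hw ⊤ e x hb)
  comp_one hw h₁ i hi e := by
    rintro ⟨x⟩ ho hn
    exact Quot.sound (.leaf hw h₁ ⊤ i hi e x ho hn)
  comp_seq hw ht hs hw' ht' hw'' i j q hi hj hq e₁ e₂ e₃ e₄ := by
    rintro ⟨x⟩ ⟨y⟩ ⟨z⟩ hc
    exact Quot.sound (.edge (.seq hw' ht' hw'' hi hj hq e₁ e₂ e₃ e₄ ⊤ ⊤ x y z hc))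
  comp_par hw ht hs hw' hw₃ hw'' i j q p hi hj hq hp e₁ e₂ e₃ e₄ := by
    rintro ⟨x⟩ ⟨y⟩ ⟨z⟩ hc
    exact Quot.sound (.edge (.par hw' hw₃ hw'' hi hj hq hp e₁ e₂ e₃ e₄ ⊤ ⊤ x y z hc))

end WConstruction

section FreeExtension

/-- Formal composites at `half` inputs of operations of degree at most one. -/
inductive ETerm (P : OperadData sigColl₁) : List Col → Type
  | gen {w : List Col} (hw : sigColl₁ w .half) (x : P.Obj w .half hw) : ETerm P w
  | graft {w t w' : List Col} (i : Fin w.length) (hi : w.get i = .half) (e : Graft w i t w')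
      (x : ETerm P w) (y : ETerm P t) : ETerm P w'

theorem sigColl₁_unit : sigColl₁ [Col.half] .half :=
  ⟨rfl, fun i j _ _ => Subsingleton.elim (α := Fin 1) i j⟩

def ETerm.one (P : OperadData sigColl₁) : ETerm P [.half] :=
  .gen sigColl₁_unit (P.one .half sigColl₁_unit)

/-- The operad relations, and the compositions already present in `P`. -/
inductive ERel (P : OperadData sigColl₁) : ∀ {w}, ETerm P w → ETerm P w → Prop
  | gen_comp {w t w' : List Col} (hw : sigColl₁ w .half) (ht : sigColl₁ t .half)
      (hw' : sigColl₁ w' .half) (i : Fin w.length) (hi : w.get i = .half) (e : Graft w i t w')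
      (x : P.Obj w .half hw) (y : P.Obj t .half ht) :
      ERel P (.graft i hi e (.gen hw x) (.gen ht y)) (.gen hw' (P.comp hw ht hw' i hi e x y))
  | one_comp {w : List Col} (e : Graft [.half] 0 w w) (x : ETerm P w) (he : ∀ b, e.n b = b) :
      ERel P (.graft 0 rfl e (ETerm.one P) x) x
  | comp_one {w : List Col} (i : Fin w.length) (hi : w.get i = .half) (e : Graft w i [.half] w)
      (x : ETerm P w) (ho : ∀ a ha, e.o a ha = a) (hn : e.n 0 = i) :
      ERel P (.graft i hi e x (ETerm.one P)) x
  | seq {w t s w' t' w'' : List Col} {i : Fin w.length} {j : Fin t.length} {q : Fin w'.length}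
      (hi : w.get i = .half) (hj : t.get j = .half) (hq : w'.get q = .half)
      (e₁ : Graft w i t w') (e₂ : Graft w' q s w'')
      (e₃ : Graft t j s t') (e₄ : Graft w i t' w'') (x : ETerm P w)
      (y : ETerm P t) (z : ETerm P s) (hc : SeqCompat e₁ e₂ e₃ e₄) :
      ERel P (.graft q hq e₂ (.graft i hi e₁ x y) z) (.graft i hi e₄ x (.graft j hj e₃ y z))
  | par {w t s w' w₃ w'' : List Col} {i j : Fin w.length} {q : Fin w'.length} {p : Fin w₃.length}
      (hi : w.get i = .half) (hj : w.get j = .half) (hq : w'.get q = .half)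
      (hp : w₃.get p = .half) (e₁ : Graft w i t w')
      (e₂ : Graft w' q s w'') (e₃ : Graft w j s w₃) (e₄ : Graft w₃ p t w'')
      (x : ETerm P w) (y : ETerm P t) (z : ETerm P s) (hc : ParCompat e₁ e₂ e₃ e₄) :
      ERel P (.graft q hq e₂ (.graft i hi e₁ x y) z) (.graft p hp e₄ (.graft j hj e₃ x z) y)
  | left {w t w' : List Col} (i : Fin w.length) (hi : w.get i = .half) (e : Graft w i t w')
      {x x' : ETerm P w} (y : ETerm P t) (h : ERel P x x') :
      ERel P (.graft i hi e x y) (.graft i hi e x' y)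
  | right {w t w' : List Col} (i : Fin w.length) (hi : w.get i = .half) (e : Graft w i t w')
      (x : ETerm P w) {y y' : ETerm P t} (h : ERel P y y') :
      ERel P (.graft i hi e x y) (.graft i hi e x y')

def EObj (P : OperadData sigColl₁) (w : List Col) : Type :=
  Quot (fun x y : ETerm P w => ERel P x y)

def EObj.gen {P : OperadData sigColl₁} {w : List Col} (hw : sigColl₁ w .half)
    (x : P.Obj w .half hw) : EObj P w := Quot.mk _ (.gen hw x)

def EObj.comp {P : OperadData sigColl₁} {w t w' : List Col} (i : Fin w.length)
    (hi : w.get i = .half) (e : Graft w i t w') : EObj P w → EObj P t → EObj P w' :=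
  Quot.map₂ (ETerm.graft i hi e) (fun x _ _ h => .right i hi e x h)
    (fun _ _ y h => .left i hi e y h)

/-- The universal topology for which the generators are continuous and composition is continuous. -/
structure IsETop (P : OperadData sigColl₁) (τ : ∀ w, TopologicalSpace (EObj P w)) : Prop where
  gen : ∀ w (hw : sigColl₁ w .half), Continuous[P.top w .half hw, τ w] (EObj.gen hw)
  comp : ∀ {w t w' : List Col} (i : Fin w.length) (hi : w.get i = .half) (e : Graft w i t w'),
    KCont₂ (τ w) (τ t) (τ w') (EObj.comp i hi e)

theorem isETop_finest (P : OperadData sigColl₁) : IsETop P (finest (IsETop P)) :=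
  ⟨fun w hw => continuous_finest _ fun _ hτ => hτ.gen w hw,
    fun i hi e => KCont₂.finest fun _ hτ => hτ.comp i hi e⟩

instance (P : OperadData sigColl₁) (w : List Col) : TopologicalSpace (EObj P w) :=
  finest (IsETop P) w

theorem IsETop.kTop {P : OperadData sigColl₁} {τ : ∀ w, TopologicalSpace (EObj P w)}
    (h : IsETop P τ) : IsETop P (fun j => kTop (τ j)) :=
  ⟨fun w hw => continuous_kTop (h.gen w hw), fun i hi e => (h.comp i hi e).kTop⟩

instance (P : OperadData sigColl₁) (w : List Col) : IsGeneratedBy CH (EObj P w) :=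
  isGeneratedBy_finest (isETop_finest P).kTop w

/-- The free extension: the left adjoint of the restriction of operads in collections to operads in
degree 0-1 collections. -/
def freeExt (P : OperadData sigColl₁) : Operad sigColl where
  Obj w _ _ := EObj P w
  top _ _ _ := inferInstance
  gen _ _ _ := inferInstance
  one k hk := by
    cases k with
    | full => exact absurd hk (by rintro ⟨⟩)
    | half => exact EObj.gen sigColl₁_unit (P.one .half sigColl₁_unit)
  comp _ ht _ i hi e := EObj.comp i (hi.trans ht) e
  comp_continuous _ _ _ _ _ e := (isETop_finest P).comp _ _ e
  one_comp {w k} h₁ hw e := by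
    cases k with
    | full => exact absurd hw (by rintro ⟨⟩)
    | half =>
      rintro ⟨x⟩ hb
      exact Quot.sound (.one_comp e x hb)
  comp_one {w k c} hw h₁ i hi e := by
    cases c with
    | full => exact absurd h₁ (by rintro ⟨⟩)
    | half =>
      rintro ⟨x⟩ ho hn
      exact Quot.sound (.comp_one i hi e x ho hn)
  comp_seq _ ht hs _ _ _ _ _ _ hi hj hq e₁ e₂ e₃ e₄ := by
    rintro ⟨x⟩ ⟨y⟩ ⟨z⟩ hc
    exact Quot.sound (.seq (hi.trans ht) (hj.trans hs) (hq.trans hs) e₁ e₂ e₃ e₄ x y z hc)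
  comp_par _ ht hs _ _ _ _ _ _ _ hi hj hq hp e₁ e₂ e₃ e₄ := by
    rintro ⟨x⟩ ⟨y⟩ ⟨z⟩ hc
    exact Quot.sound (.par (hi.trans ht) (hj.trans hs) (hq.trans hs) (hp.trans ht)
      e₁ e₂ e₃ e₄ x y z hc)

end FreeExtension

namespace Graft
variable {w t s w' t' w'' w₃ : List Col} {i : Fin w.length}

theorem ext' {e e' : Graft w i t w'} (ho : ∀ a ha, e.o a ha = e'.o a ha)
    (hn : ∀ b, e.n b = e'.n b) : e = e' := by
  cases e with | mk e h h' => cases e' with | mk f g g' =>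
  congr 1
  ext s
  rcases s with ⟨a, ha⟩ | b
  · exact congrArg Fin.val (ho a ha)
  · exact congrArg Fin.val (hn b)

/-- Relabelling of the inputs along a colour preserving bijection, as grafting onto a corolla. -/
def relabel (k : Col) (σ : Fin w.length ≃ Fin w'.length) (h : ∀ j, w'.get (σ j) = w.get j) :
    Graft [k] 0 w w' where
  eqv :=
    haveI : IsEmpty {j : Fin [k].length // j ≠ 0} :=
      ⟨fun j => j.2 (Subsingleton.elim (α := Fin 1) _ _)⟩
    (Equiv.emptySum _ (Fin w.length)).trans σ
  col_out j := absurd (Subsingleton.elim (α := Fin 1) _ _) j.2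
  col_in b := h b

theorem relabel_n (k : Col) (σ : Fin w.length ≃ Fin w'.length) (h : ∀ j, w'.get (σ j) = w.get j)
    (b) : (relabel k σ h).n b = σ b := rfl

/-- The relabelling that turns the grafting `e` into the grafting `e'`. -/
def chg (k : Col) (e : Graft w i t w') (e' : Graft w i t w'') : Graft [k] 0 w' w'' :=
  relabel k (e.eqv.symm.trans e'.eqv) (fun q => by
    rcases e.cases q with ⟨a, ha, rfl⟩ | ⟨b, rfl⟩
    · rw [e.get_o, ← e'.get_o a ha]; simp [o]
    · rw [e.get_n, ← e'.get_n b]; simp [n])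

theorem chg_o (k : Col) (e : Graft w i t w') (e' : Graft w i t w'') (a ha) :
    (chg k e e').n (e.o a ha) = e'.o a ha := by simp [chg, relabel_n, o]

theorem chg_n (k : Col) (e : Graft w i t w') (e' : Graft w i t w'') (b) :
    (chg k e e').n (e.n b) = e'.n b := by rw [chg, relabel_n]; simp [n]

def idL (k : Col) (u : List Col) : Graft [k] 0 u u := relabel k (Equiv.refl _) (fun _ => rfl)

theorem idL_n (k : Col) (u : List Col) (b) : (idL k u).n b = b := rfl

def idR (u : List Col) (i : Fin u.length) (c : Col) (hc : u.get i = c) : Graft u i [c] u where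
  eqv :=
    { toFun := Sum.elim (fun a => a.1) (fun _ => i)
      invFun := fun a => if h : a = i then Sum.inr 0 else Sum.inl ⟨a, h⟩
      left_inv := by
        rintro (⟨a, ha⟩ | b)
        · simp [ha]
        · have hb : b = 0 := Subsingleton.elim (α := Fin 1) _ _
          subst hb
          simp
      right_inv := by
        intro a
        by_cases h : a = i <;> simp [h] }
  col_out _ := rfl
  col_in b := by
    have : b = 0 := Subsingleton.elim (α := Fin 1) _ _
    subst this
    exact hc

theorem idR_o (u : List Col) (i : Fin u.length) (c : Col) (hc : u.get i = c) (a ha) :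
    (idR u i c hc).o a ha = a := rfl

theorem idR_n (u : List Col) (i : Fin u.length) (c : Col) (hc : u.get i = c) (b) :
    (idR u i c hc).n b = i := rfl

theorem unique_o {k : Col} (a : Fin [k].length) (ha : a ≠ 0) : False :=
  ha (Subsingleton.elim (α := Fin 1) _ _)

noncomputable def stdW (u : List Col) (i : Fin u.length) (w : List Col) : List Col :=
  (exists_std u i w).choose

noncomputable def std (u : List Col) (i : Fin u.length) (w : List Col) :
    Graft u i w (stdW u i w) := (exists_std u i w).choose_spec.some

end Graft

theorem ParCompat.symm {w t s w' w₃ w'' : List Col} {i j : Fin w.length}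
    {q : Fin w'.length} {p : Fin w₃.length} {e₁ : Graft w i t w'} {e₂ : Graft w' q s w''}
    {e₃ : Graft w j s w₃} {e₄ : Graft w₃ p t w''} (h : ParCompat e₁ e₂ e₃ e₄) :
    ParCompat e₃ e₄ e₁ e₂ where
  ne := h.ne.symm
  pos₁ := h.pos₂
  pos₂ := h.pos₁
  oo a hj hi h₁ h₂ := (h.oo a hi hj h₂ h₁).symm
  no c h' := (h.on c h').symm
  on b h' := (h.no b h').symm


section Chase
variable {w t s w' t' w'' w₃ : List Col} {i : Fin w.length}

theorem SeqCompat.oo' {j : Fin t.length}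
    {q : Fin w'.length} {e₁ : Graft w i t w'} {e₂ : Graft w' q s w''} {e₃ : Graft t j s t'}
    {e₄ : Graft w i t' w''} (h : SeqCompat e₁ e₂ e₃ e₄) (a ha) :
    e₄.o a ha = e₂.o (e₁.o a ha) (by rw [← h.pos]; exact Graft.o_ne_n _) := (h.oo _ _ _).symm

theorem SeqCompat.no' {j : Fin t.length}
    {q : Fin w'.length} {e₁ : Graft w i t w'} {e₂ : Graft w' q s w''} {e₃ : Graft t j s t'}
    {e₄ : Graft w i t' w''} (h : SeqCompat e₁ e₂ e₃ e₄) (a ha) :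
    e₄.n (e₃.o a ha) = e₂.o (e₁.n a) (by rw [← h.pos, Ne, Graft.n_inj]; exact ha) :=
  (h.no _ _ _).symm

theorem SeqCompat.nn' {j : Fin t.length}
    {q : Fin w'.length} {e₁ : Graft w i t w'} {e₂ : Graft w' q s w''} {e₃ : Graft t j s t'}
    {e₄ : Graft w i t' w''} (h : SeqCompat e₁ e₂ e₃ e₄) (c) :
    e₄.n (e₃.n c) = e₂.n c := (h.nn _).symm

theorem ParCompat.oo' {j : Fin w.length}
    {q : Fin w'.length} {p : Fin w₃.length} {e₁ : Graft w i t w'} {e₂ : Graft w' q s w''}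
    {e₃ : Graft w j s w₃} {e₄ : Graft w₃ p t w''} (h : ParCompat e₁ e₂ e₃ e₄)
    (a : Fin w.length) (ha : a ≠ i) (ha' : a ≠ j) (h') :
    e₄.o (e₃.o a ha') h' = e₂.o (e₁.o a ha) (by rw [← h.pos₁, Ne, Graft.o_inj]; exact ha') :=
  (h.oo _ _ _ _ _).symm

theorem ParCompat.no' {j : Fin w.length}
    {q : Fin w'.length} {p : Fin w₃.length} {e₁ : Graft w i t w'} {e₂ : Graft w' q s w''}
    {e₃ : Graft w j s w₃} {e₄ : Graft w₃ p t w''} (h : ParCompat e₁ e₂ e₃ e₄) (b) :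
    e₄.n b = e₂.o (e₁.n b) (by rw [← h.pos₁]; exact (Graft.o_ne_n _).symm) :=
  (h.no _ _).symm

theorem ParCompat.on' {j : Fin w.length}
    {q : Fin w'.length} {p : Fin w₃.length} {e₁ : Graft w i t w'} {e₂ : Graft w' q s w''}
    {e₃ : Graft w j s w₃} {e₄ : Graft w₃ p t w''} (h : ParCompat e₁ e₂ e₃ e₄) (c) (h') :
    e₄.o (e₃.n c) h' = e₂.n c := (h.on _ _).symm

end Chase

section Chase2

theorem chase_zz {w t s w' t' w'' r s' u' t'' : List Col} {i : Fin w.length} {j : Fin t.length}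
    {q : Fin w'.length} {c : Fin s.length} {q' : Fin w''.length} {q₃ : Fin t'.length}
    {e₁ : Graft w i t w'} {e₂ : Graft w' q s w''} {e₃ : Graft t j s t'}
    {e₄ : Graft w i t' w''} {e : Graft w'' q' r u'} {g : Graft s c r s'} {f₄ : Graft w' q s' u'}
    {k : Graft t' q₃ r t''} {n₄ : Graft t j s' t''} {h₄ : Graft w i t'' u'}
    (A : SeqCompat e₁ e₂ e₃ e₄) (B : SeqCompat e₂ e g f₄) (C : SeqCompat e₃ k g n₄)
    (D : SeqCompat e₄ e k h₄) : SeqCompat e₁ f₄ n₄ h₄ := by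
  refine ⟨A.pos, ?_, ?_, ?_⟩
  · intro a ha h
    simp only [A.oo', B.oo', D.oo']
  · intro a ha h
    simp only [C.oo', D.no', B.oo', A.no']
  · intro p
    rcases g.cases p with ⟨a, ha, rfl⟩ | ⟨b, rfl⟩
    · simp only [B.no', C.no', D.no', A.nn']
    · simp only [B.nn', C.nn', D.nn']

theorem chase_zy {w t s w' t' w'' r u' w₁ t₁ t₂ : List Col} {i : Fin w.length}
    {j b : Fin t.length} {q q₁ : Fin w'.length} {q' : Fin w''.length} {q₃ : Fin t'.length}
    {q₅ : Fin w₁.length} {q₆ : Fin t₁.length}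
    {e₁ : Graft w i t w'} {e₂ : Graft w' q s w''} {e₃ : Graft t j s t'}
    {e₄ : Graft w i t' w''} {e : Graft w'' q' r u'} {g : Graft w' q₁ r w₁}
    {f₄ : Graft w₁ q₅ s u'} {m : Graft t b r t₁} {n₄ : Graft w i t₁ w₁} {k : Graft t' q₃ r t₂}
    {h₄ : Graft w i t₂ u'} {o₄ : Graft t₁ q₆ s t₂}
    (A : SeqCompat e₁ e₂ e₃ e₄) (B : ParCompat e₂ e g f₄) (C : SeqCompat e₁ g m n₄)
    (D : SeqCompat e₄ e k h₄) (E : ParCompat e₃ k m o₄) : SeqCompat n₄ f₄ o₄ h₄ := by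
  have hbj : b ≠ j := E.ne.symm
  refine ⟨?_, ?_, ?_, ?_⟩
  · simp only [← E.pos₂, C.no', ← B.pos₂, A.pos]
  · intro a ha h
    have h1 : e₁.o a ha ≠ q₁ := by rw [← C.pos]; exact Graft.o_ne_n _
    have h2 : e₁.o a ha ≠ q := by rw [← A.pos]; exact Graft.o_ne_n _
    simp only [C.oo', B.oo' _ h2 h1, D.oo', A.oo']
  · intro p hp h
    rcases m.cases p with ⟨a, ha, rfl⟩ | ⟨b, rfl⟩
    · have haj : a ≠ j := by rintro rfl; exact hp E.pos₂
      have h1 : e₁.n a ≠ q₁ := by rw [← C.pos, Ne, Graft.n_inj]; exact ha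
      have h2 : e₁.n a ≠ q := by rw [← A.pos, Ne, Graft.n_inj]; exact haj
      simp only [C.no', B.oo' _ h2 h1, E.oo' _ haj ha, D.no', A.no']
    · simp only [C.nn', B.on', E.on', D.nn']
  · intro c
    simp only [E.no', D.no', B.no', A.nn']

theorem chase_zx {w t s w' t' w'' r u' w₁ w₂ : List Col} {i b : Fin w.length}
    {j : Fin t.length} {q q₁ : Fin w'.length} {q' : Fin w''.length}
    {q₅ : Fin w₁.length} {q₆ : Fin w₂.length}
    {e₁ : Graft w i t w'} {e₂ : Graft w' q s w''} {e₃ : Graft t j s t'}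
    {e₄ : Graft w i t' w''} {e : Graft w'' q' r u'} {g : Graft w' q₁ r w₁}
    {f₄ : Graft w₁ q₅ s u'} {m : Graft w b r w₂} {n₄ : Graft w₂ q₆ t w₁}
    {h₄ : Graft w₂ q₆ t' u'} 
    (A : SeqCompat e₁ e₂ e₃ e₄) (B : ParCompat e₂ e g f₄) (C : ParCompat e₁ g m n₄)
    (D : ParCompat e₄ e m h₄) : SeqCompat n₄ f₄ e₃ h₄ := by
  refine ⟨?_, ?_, ?_, ?_⟩
  · simp only [C.no', ← B.pos₂, A.pos]
  · intro p hp h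
    rcases m.cases p with ⟨a, ha, rfl⟩ | ⟨b, rfl⟩
    · have hai : a ≠ i := by rintro rfl; exact hp C.pos₂
      have h1 : e₁.o a hai ≠ q₁ := by rw [← C.pos₁, Ne, Graft.o_inj]; exact ha
      have h2 : e₁.o a hai ≠ q := by rw [← A.pos]; exact Graft.o_ne_n _
      simp only [C.oo' _ hai ha, B.oo' _ h2 h1, D.oo' _ hai ha, A.oo']
    · simp only [C.on', B.on', D.on']
  · intro b hb h
    have h1 : e₁.n b ≠ q₁ := by rw [← C.pos₁]; exact (Graft.o_ne_n _).symm
    have h2 : e₁.n b ≠ q := by rw [← A.pos, Ne, Graft.n_inj]; exact hb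
    simp only [C.no', B.oo' _ h2 h1, D.no', A.no']
  · intro c
    simp only [B.no', D.no', A.nn']

theorem chase_px {w t s w' w₃ w'' r u' w₁ w₂ w₅ : List Col} {i j b : Fin w.length}
    {q q₁ : Fin w'.length} {p p₁ : Fin w₃.length} {q' : Fin w''.length} 
    {q₅ : Fin w₁.length} {q₆ q₈ : Fin w₂.length} {q₇ : Fin w₅.length} 
    {e₁ : Graft w i t w'} {e₂ : Graft w' q s w''} {e₃ : Graft w j s w₃}
    {e₄ : Graft w₃ p t w''} {e : Graft w'' q' r u'} {g : Graft w' q₁ r w₁}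
    {f₄ : Graft w₁ q₅ s u'} {m : Graft w b r w₂} {n₄ : Graft w₂ q₆ t w₁}
    {g' : Graft w₃ p₁ r w₅} {f₅ : Graft w₅ q₇ t u'} {n₅ : Graft w₂ q₈ s w₅}
    (A : ParCompat e₁ e₂ e₃ e₄) (B : ParCompat e₂ e g f₄) (C : ParCompat e₁ g m n₄)
    (D : ParCompat e₄ e g' f₅) (E : ParCompat e₃ g' m n₅) : ParCompat n₄ f₄ n₅ f₅ := by
  have hj1 : e₁.o j A.ne.symm ≠ q₁ := by
    rw [← C.pos₁, Ne, Graft.o_inj]; exact E.ne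
  have hi1 : e₃.o i A.ne ≠ p₁ := by
    rw [← E.pos₁, Ne, Graft.o_inj]; exact C.ne
  refine ⟨?_, ?_, ?_, ?_, ?_, ?_⟩
  · rw [← C.pos₂, ← E.pos₂, Ne, Graft.o_inj]; exact A.ne
  · simp only [← E.pos₂, C.oo' _ A.ne.symm E.ne, A.pos₁, ← B.pos₂]
  · simp only [← C.pos₂, E.oo' _ A.ne C.ne, A.pos₂, ← D.pos₂]
  · intro x hx hx' h h'
    rcases m.cases x with ⟨a, ha, rfl⟩ | ⟨c, rfl⟩
    · have hai : a ≠ i := by rintro rfl; exact hx C.pos₂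
      have haj : a ≠ j := by rintro rfl; exact hx' E.pos₂
      have h1 : e₁.o a hai ≠ q₁ := by rw [← C.pos₁, Ne, Graft.o_inj]; exact ha
      have h2 : e₁.o a hai ≠ q := by rw [← A.pos₁, Ne, Graft.o_inj]; exact haj
      have h3 : e₃.o a haj ≠ p₁ := by rw [← E.pos₁, Ne, Graft.o_inj]; exact ha
      have h4 : e₃.o a haj ≠ p := by rw [← A.pos₂, Ne, Graft.o_inj]; exact hai
      simp only [C.oo' _ hai ha, B.oo' _ h2 h1, E.oo' _ haj ha, D.oo' _ h4 h3, A.oo' _ hai haj]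
    · simp only [C.on', B.on', D.on', E.on']
  · intro b h
    have h1 : e₁.n b ≠ q₁ := by rw [← C.pos₁]; exact (Graft.o_ne_n _).symm
    have h2 : e₁.n b ≠ q := by rw [← A.pos₁]; exact (Graft.o_ne_n _).symm
    simp only [C.no', B.oo' _ h2 h1, D.no', A.no']
  · intro c h
    have h1 : e₃.n c ≠ p₁ := by rw [← E.pos₁]; exact (Graft.o_ne_n _).symm
    have h2 : e₃.n c ≠ p := by rw [← A.pos₂]; exact (Graft.o_ne_n _).symm
    simp only [B.no', E.no', D.oo' _ h2 h1, A.on']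

theorem chase_py {w t s w' w₃ w'' r u' w₁ t₁ : List Col} {i j : Fin w.length} {b : Fin t.length}
    {q q₁ : Fin w'.length} {p : Fin w₃.length} {q' : Fin w''.length} {q₅ : Fin w₁.length}
    {e₁ : Graft w i t w'} {e₂ : Graft w' q s w''} {e₃ : Graft w j s w₃}
    {e₄ : Graft w₃ p t w''} {e : Graft w'' q' r u'} {g : Graft w' q₁ r w₁}
    {f₄ : Graft w₁ q₅ s u'} {m : Graft t b r t₁} {n₄ : Graft w i t₁ w₁}
    {h₄ : Graft w₃ p t₁ u'}
    (A : ParCompat e₁ e₂ e₃ e₄) (B : ParCompat e₂ e g f₄) (C : SeqCompat e₁ g m n₄)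
    (D : SeqCompat e₄ e m h₄) : ParCompat n₄ f₄ e₃ h₄ := by
  refine ⟨A.ne, ?_, A.pos₂, ?_, ?_, ?_⟩
  · simp only [C.oo', A.pos₁, B.pos₂]
  · intro a hi hj h h'
    have h1 : e₁.o a hi ≠ q₁ := by rw [← C.pos]; exact Graft.o_ne_n _
    have h2 : e₁.o a hi ≠ q := by rw [← A.pos₁, Ne, Graft.o_inj]; exact hj
    simp only [C.oo', B.oo' _ h2 h1, D.oo', A.oo' _ hi hj]
  · intro x h
    rcases m.cases x with ⟨a, ha, rfl⟩ | ⟨c, rfl⟩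
    · have h1 : e₁.n a ≠ q₁ := by rw [← C.pos, Ne, Graft.n_inj]; exact ha
      have h2 : e₁.n a ≠ q := by rw [← A.pos₁]; exact (Graft.o_ne_n _).symm
      simp only [C.no', B.oo' _ h2 h1, D.no', A.no']
    · simp only [C.nn', B.on', D.nn']
  · intro c h
    simp only [B.no', D.oo', A.on']

theorem chase_comp {v u v₁ u' v₂ w w' t u₁ v₃ : List Col} {j : Fin v.length} {i : Fin u.length}
    {q : Fin v₁.length} {b : Fin w.length} {q₁ : Fin v₃.length} {p₁ : Fin u₁.length}
    {e₁ : Graft v j u v₁} {e₂ : Graft v₁ q w' v₂}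
    {e₃ : Graft u i w' u'} {e₄ : Graft v j u' v₂} {e : Graft w b t w'} {G : Graft v₁ q w v₃}
    {G' : Graft u i w u₁} {m₄ : Graft v j u₁ v₃} {g₂ : Graft v₃ q₁ t v₂}
    {g₃ : Graft u₁ p₁ t u'} (A : SeqCompat e₁ e₂ e₃ e₄) (B : SeqCompat e₁ G G' m₄)
    (C : SeqCompat G g₂ e e₂) (D : SeqCompat G' g₃ e e₃) : SeqCompat m₄ g₂ g₃ e₄ := by
  refine ⟨?_, ?_, ?_, ?_⟩
  · simp only [← D.pos, B.nn', C.pos]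
  · intro a ha h
    simp only [B.oo', A.oo', C.oo']
  · intro x hx h
    rcases G'.cases x with ⟨a, ha, rfl⟩ | ⟨c, rfl⟩
    · simp only [B.no', ← D.oo', A.no', C.oo']
    · have hc : c ≠ b := by rintro rfl; exact hx D.pos
      simp only [B.nn', ← D.no' _ hc, A.nn', ← C.no' _ hc]
  · intro c
    simp only [← D.nn', ← C.nn', A.nn']

theorem chase_comp' {u v u₁ u₂ u₃ w w' t y₁ y₂ : List Col} {i j : Fin u.length}
    {q : Fin u₁.length} {p : Fin u₃.length} {b : Fin w.length} {q₁ : Fin y₁.length}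
    {q₂ q₃ : Fin y₂.length}
    {e₁ : Graft u i w' u₁} {e₂ : Graft u₁ q v u₂} {e₃ : Graft u j v u₃}
    {e₄ : Graft u₃ p w' u₂} {e : Graft w b t w'} {G : Graft u₃ p w y₁} {G' : Graft u i w y₂}
    {n₂ : Graft y₂ q₂ v y₁} {g₂ : Graft y₁ q₁ t u₂} {g₃ : Graft y₂ q₃ t u₁}
    (A : ParCompat e₁ e₂ e₃ e₄) (B : ParCompat G' n₂ e₃ G) (C : SeqCompat G g₂ e e₄)
    (D : SeqCompat G' g₃ e e₁) : ParCompat n₂ g₂ g₃ e₂ := by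
  have key : ∀ a, G.n a = n₂.o (G'.n a) (by rw [← B.pos₁]; exact (Graft.o_ne_n _).symm) := B.no'
  refine ⟨?_, ?_, ?_, ?_, ?_, ?_⟩
  · rw [← B.pos₁, ← D.pos]; exact Graft.o_ne_n _
  · rw [← C.pos, key]; simp only [D.pos]
  · simp only [← B.pos₁, ← D.oo', A.pos₁]
  · intro x hx hx' h h'
    rcases G'.cases x with ⟨a, ha, rfl⟩ | ⟨c, rfl⟩
    · have haj : a ≠ j := by rintro rfl; exact hx B.pos₁
      have h1 : e₃.o a haj ≠ p := by rw [← B.pos₂, Ne, Graft.o_inj]; exact ha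
      simp only [← B.oo' _ ha haj h1, ← C.oo', ← D.oo', A.oo' _ ha haj]
    · have hc : c ≠ b := by rintro rfl; exact hx' D.pos
      simp only [← D.no' _ hc, ← A.no', C.no' _ hc, key]
  · intro c h
    have h1 : e₃.n c ≠ p := by rw [← B.pos₂]; exact (Graft.o_ne_n _).symm
    simp only [← A.on' _ h1, C.oo', B.on']
  · intro c h
    simp only [← C.nn', ← D.nn', A.no']

end Chase2

section ActTerm

variable {P : OperadData sigColl₁}

/-- Degree one: there is exactly one `full` input, and it is the input `i`. -/
def FullAt (u : List Col) (i : Fin u.length) : Prop := ∀ j, u.get j = .full ↔ j = i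

/-- Degree zero. -/
def AllHalf (u : List Col) : Prop := ∀ j : Fin u.length, u.get j = .half

/-- Bimodule maps from degree one to degree `w` (a word of `full`s) of the free extension `EObj P`, over
the degree zero part. The value of a map on `x` has the inputs of `x` with the `full` input replaced
by the inputs `w`, labelled according to a `Graft`. Relabelling of inputs is the case of `left` where
`y` is the identity. -/
structure BimodMap (P : OperadData sigColl₁) (w : List Col) where
  app : ∀ {u u' : List Col} (i : Fin u.length), FullAt u i → Graft u i w u' → EObj P u → EObj P u'
  continuous_app : ∀ {u u' : List Col} (i : Fin u.length) (hu : FullAt u i) (e : Graft u i w u'),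
    Continuous (app i hu e)
  left : ∀ {v u v₁ u' v₂ : List Col} {j : Fin v.length} {i : Fin u.length} {q : Fin v₁.length}
    (hj : v.get j = .half) (hu : FullAt u i) (hq : FullAt v₁ q) (e₁ : Graft v j u v₁)
    (e₂ : Graft v₁ q w v₂) (e₃ : Graft u i w u') (e₄ : Graft v j u' v₂) (y : EObj P v)
    (x : EObj P u), AllHalf v → SeqCompat e₁ e₂ e₃ e₄ →
    app q hq e₂ (EObj.comp j hj e₁ y x) = EObj.comp j hj e₄ y (app i hu e₃ x)
  right : ∀ {u v u₁ u₃ u₂ : List Col} {i j : Fin u.length} {q : Fin u₁.length}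
    {p : Fin u₃.length} (hj : u.get j = .half) (hu : FullAt u i) (hq : u₁.get q = .half)
    (hp : FullAt u₃ p) (e₁ : Graft u i w u₁) (e₂ : Graft u₁ q v u₂) (e₃ : Graft u j v u₃)
    (e₄ : Graft u₃ p w u₂) (x : EObj P u) (y : EObj P v), AllHalf v → ParCompat e₁ e₂ e₃ e₄ →
    app p hp e₄ (EObj.comp j hj e₃ x y) = EObj.comp q hq e₂ (app i hu e₁ x) y

theorem EObj.comp_seq {w t s w' t' w'' : List Col} {i : Fin w.length} {j : Fin t.length}
    {q : Fin w'.length}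
    {hi : w.get i = .half} {hj : t.get j = .half} {hq : w'.get q = .half}
    {e₁ : Graft w i t w'} {e₂ : Graft w' q s w''}
    {e₃ : Graft t j s t'} {e₄ : Graft w i t' w''} {x : EObj P w}
    {y : EObj P t} {z : EObj P s} (hc : SeqCompat e₁ e₂ e₃ e₄) :
    EObj.comp q hq e₂ (EObj.comp i hi e₁ x y) z = EObj.comp i hi e₄ x (EObj.comp j hj e₃ y z) := by
  induction x using Quot.ind; induction y using Quot.ind; induction z using Quot.ind
  exact Quot.sound (.seq hi hj hq e₁ e₂ e₃ e₄ _ _ _ hc)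

theorem EObj.comp_par {w t s w' w₃ w'' : List Col} {i j : Fin w.length} {q : Fin w'.length}
    {p : Fin w₃.length}
    {hi : w.get i = .half} {hj : w.get j = .half} {hq : w'.get q = .half}
    {hp : w₃.get p = .half} {e₁ : Graft w i t w'}
    {e₂ : Graft w' q s w''} {e₃ : Graft w j s w₃} {e₄ : Graft w₃ p t w''} {x : EObj P w}
    {y : EObj P t} {z : EObj P s} (hc : ParCompat e₁ e₂ e₃ e₄) :
    EObj.comp q hq e₂ (EObj.comp i hi e₁ x y) z = EObj.comp p hp e₄ (EObj.comp j hj e₃ x z) y := by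
  induction x using Quot.ind; induction y using Quot.ind; induction z using Quot.ind
  exact Quot.sound (.par hi hj hq hp e₁ e₂ e₃ e₄ _ _ _ hc)

def EObj.one (P : OperadData sigColl₁) : EObj P [.half] := Quot.mk _ (ETerm.one P)

theorem EObj.one_comp {w : List Col} (e : Graft [.half] 0 w w) (x : EObj P w)
    (he : ∀ b, e.n b = b) : EObj.comp 0 rfl e (EObj.one P) x = x := by
  induction x using Quot.ind
  exact Quot.sound (.one_comp e _ he)

theorem EObj.comp_one {w : List Col} (i : Fin w.length) (hi : w.get i = .half)
    (e : Graft w i [.half] w) (x : EObj P w) (ho : ∀ a ha, e.o a ha = a) (hn : e.n 0 = i) :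
    EObj.comp i hi e x (EObj.one P) = x := by
  induction x using Quot.ind
  exact Quot.sound (.comp_one i hi e _ ho hn)

def EObj.mk {w : List Col} (x : ETerm P w) : EObj P w := Quot.mk _ x

variable {w : List Col}

noncomputable def graftN {v t u u' : List Col} {j : Fin v.length} (hj : v.get j = .half)
    (e₁ : Graft v j t u) {b : Fin t.length} {q : Fin u.length} (hb : e₁.n b = q)
    (e : Graft u q w u') (x : EObj P v) (y : ∀ {t'}, Graft t b w t' → EObj P t') : EObj P u' :=
  EObj.comp j hj (Graft.exists_seq₄ e₁ hb e (Graft.std t b w)).choose x (y (Graft.std t b w))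

noncomputable def graftO {v t u u' : List Col} {j : Fin v.length} (hj : v.get j = .half)
    (e₁ : Graft v j t u) {a : Fin v.length} (ha : a ≠ j) {q : Fin u.length} (hq : e₁.o a ha = q)
    (e : Graft u q w u') (x : ∀ {v'}, Graft v a w v' → EObj P v') (y : EObj P t) : EObj P u' :=
  EObj.comp ((Graft.std v a w).o j ha.symm) ((Graft.get_o _ _ _).trans hj)
    (Graft.exists_par₄ e₁ ha.symm hq e (Graft.std v a w) rfl).choose (x (Graft.std v a w)) y

theorem fullAt_of_sig {u : List Col} (hw : sigColl₁ u .half) {i : Fin u.length}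
    (hi : u.get i = .full) : FullAt u i :=
  fun j => ⟨fun h => hw.2 j i h hi, fun h => h ▸ hi⟩

/-- The unique extension of a bimodule map to formal composites of any degree: it is applied to the
generator of degree one that contains the `full` input `i`. -/
noncomputable def ETerm.act (φ : BimodMap P w) : ∀ {u u' : List Col} (_ : ETerm P u)
    (i : Fin u.length), u.get i = .full → Graft u i w u' → EObj P u'
  | _, _, .gen hw x, i, hi, e => φ.app i (fullAt_of_sig hw hi) e (EObj.gen hw x)
  | _, _, .graft j hj e₁ x y, q, hq, e =>
    match h : e₁.eqv.symm q with
    | .inl a => graftO hj e₁ a.2 (q := q) (by simp [Graft.o, ← h]) e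
        (fun e' => ETerm.act φ x a.1 (by rw [← e₁.col_out a, ← h]; simpa using hq) e') (EObj.mk y)
    | .inr b => graftN hj e₁ (b := b) (q := q) (by simp [Graft.n, ← h]) e (EObj.mk x)
        (fun e' => ETerm.act φ y b (by rw [← e₁.col_in b, ← h]; simpa using hq) e')

theorem ETerm.act_graft_n' (φ : BimodMap P w) {v t u u' : List Col} {j : Fin v.length}
    (hj : v.get j = .half) (e₁ : Graft v j t u) (x : ETerm P v) (y : ETerm P t)
    (b : Fin t.length) (hb : t.get b = .full) {q : Fin u.length} (hq : e₁.n b = q) (hq')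
    (e : Graft u q w u') :
    (ETerm.graft j hj e₁ x y).act φ q hq' e =
      graftN hj e₁ hq e (EObj.mk x) (fun e' => y.act φ b hb e') := by
  subst hq
  rw [ETerm.act]
  split
  · next a h => simp [Graft.n] at h
  · next b' h =>
    have : b' = b := by simpa [Graft.n] using h.symm
    subst this; rfl

theorem ETerm.act_graft_o' (φ : BimodMap P w) {v t u u' : List Col} {j : Fin v.length}
    (hj : v.get j = .half) (e₁ : Graft v j t u) (x : ETerm P v) (y : ETerm P t)
    (a : Fin v.length) (ha : a ≠ j) (hb : v.get a = .full) {q : Fin u.length}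
    (hq : e₁.o a ha = q) (hq') (e : Graft u q w u') :
    (ETerm.graft j hj e₁ x y).act φ q hq' e =
      graftO hj e₁ ha hq e (fun e' => x.act φ a hb e') (EObj.mk y) := by
  subst hq
  rw [ETerm.act]
  split
  · next a' h =>
    have : a' = ⟨a, ha⟩ := by simpa [Graft.o] using h.symm
    subst this; rfl
  · next b' h => simp [Graft.o] at h


theorem EObj.chg_comp {u u' u'' : List Col} {i : Fin u.length} (e : Graft u i w u')
    (e' : Graft u i w u'') {v t : List Col} {j : Fin v.length} (hj : v.get j = .half)
    (f : Graft v j t u') (f' : Graft v j t u'') (x : EObj P v) (y : EObj P t)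
    (ho : ∀ a ha, (Graft.chg .half e e').n (f.o a ha) = f'.o a ha)
    (hn : ∀ b, (Graft.chg .half e e').n (f.n b) = f'.n b) :
    EObj.comp 0 rfl (Graft.chg .half e e') (EObj.one P) (EObj.comp j hj f x y) =
      EObj.comp j hj f' x y := by
  rw [← EObj.comp_seq (e₁ := Graft.idL .half v) (e₂ := f') (hq := hj), EObj.one_comp _ _ (fun _ => rfl)]
  refine ⟨rfl, fun a ha => (Graft.unique_o a ha).elim, fun b hb h => ?_, fun c => ?_⟩
  · exact (ho b hb).symm
  · exact (hn c).symm

theorem BimodMap.chg (φ : BimodMap P w) {u u' u'' : List Col} {i : Fin u.length}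
    (hu : FullAt u i) (e : Graft u i w u') (e' : Graft u i w u'') (x : EObj P u) :
    EObj.comp 0 rfl (Graft.chg .half e e') (EObj.one P) (φ.app i hu e x) = φ.app i hu e' x := by
  rw [← φ.left (v := [.half]) (j := 0) rfl hu hu (Graft.idL .half u) e' e
    (Graft.chg .half e e') (EObj.one P) x, EObj.one_comp _ _ (fun _ => rfl)]
  · intro j
    have : j = 0 := Subsingleton.elim (α := Fin 1) _ _
    subst this; rfl
  · refine ⟨rfl, fun a ha => (Graft.unique_o a ha).elim, fun b hb h => ?_, fun c => ?_⟩
    · exact (Graft.chg_o _ e e' b hb).symm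
    · exact (Graft.chg_n _ e e' c).symm

theorem ETerm.act_chg (φ : BimodMap P w) {u u' u'' : List Col} (x : ETerm P u)
    {i : Fin u.length} (hi : u.get i = .full) (e : Graft u i w u') (e' : Graft u i w u'') :
    EObj.comp 0 rfl (Graft.chg .half e e') (EObj.one P) (x.act φ i hi e) = x.act φ i hi e' := by
  cases x with
  | gen hw x => exact φ.chg _ e e' _
  | @graft v t _ j hj e₁ x y =>
    rcases e₁.cases i with ⟨a, ha, rfl⟩ | ⟨b, rfl⟩
    · have hf : v.get a = .full := by rw [← e₁.get_o a ha]; exact hi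
      rw [ETerm.act_graft_o' φ hj e₁ x y a ha hf rfl hi e,
        ETerm.act_graft_o' φ hj e₁ x y a ha hf rfl hi e']; unfold graftO; beta_reduce
      have h1 := (Graft.exists_par₄ e₁ ha.symm rfl e (Graft.std v a w) rfl).choose_spec
      have h2 := (Graft.exists_par₄ e₁ ha.symm rfl e' (Graft.std v a w) rfl).choose_spec
      refine EObj.chg_comp e e' _ _ _ _ _ ?_ ?_
      · intro p hp
        rcases (Graft.std v a w).cases p with ⟨c, hc, rfl⟩ | ⟨c, rfl⟩
        · have hcj : c ≠ j := by rintro rfl; exact hp rfl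
          rw [h1.oo' c hcj hc, h2.oo' c hcj hc, Graft.chg_o]
        · rw [h1.on', h2.on', Graft.chg_n]
      · intro b
        rw [h1.no', h2.no', Graft.chg_o]
    · have hf : t.get b = .full := by rw [← e₁.get_n b]; exact hi
      rw [ETerm.act_graft_n' φ hj e₁ x y b hf rfl hi e,
        ETerm.act_graft_n' φ hj e₁ x y b hf rfl hi e']; unfold graftN; beta_reduce
      have h1 := (Graft.exists_seq₄ e₁ rfl e (Graft.std t b w)).choose_spec
      have h2 := (Graft.exists_seq₄ e₁ rfl e' (Graft.std t b w)).choose_spec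
      refine EObj.chg_comp e e' _ _ _ _ _ ?_ ?_
      · intro a ha
        rw [h1.oo', h2.oo', Graft.chg_o]
      · intro p
        rcases (Graft.std t b w).cases p with ⟨c, hc, rfl⟩ | ⟨c, rfl⟩
        · rw [h1.no', h2.no', Graft.chg_o]
        · rw [h1.nn', h2.nn', Graft.chg_n]

theorem ETerm.act_n (φ : BimodMap P w) {v t t' u u' : List Col} {j : Fin v.length}
    (hj : v.get j = .half) {e₁ : Graft v j t u} (x : ETerm P v) (y : ETerm P t)
    {b : Fin t.length} (hb : t.get b = .full) {q : Fin u.length} (hq : u.get q = .full)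
    {e : Graft u q w u'} {e₃ : Graft t b w t'} {e₄ : Graft v j t' u'}
    (hc : SeqCompat e₁ e e₃ e₄) :
    (ETerm.graft j hj e₁ x y).act φ q hq e =
      EObj.comp j hj e₄ (EObj.mk x) (y.act φ b hb e₃) := by
  rw [ETerm.act_graft_n' φ hj e₁ x y b hb hc.pos hq e]; unfold graftN; beta_reduce
  have h1 := (Graft.exists_seq₄ e₁ hc.pos e (Graft.std t b w)).choose_spec
  rw [← ETerm.act_chg φ y hb (Graft.std t b w) e₃,
    ← EObj.comp_seq (e₁ := Graft.idR v j .half hj) (hq := hj), EObj.comp_one]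
  · exact fun _ _ => rfl
  · rfl
  · refine ⟨rfl, fun a ha h => ?_, fun b hb => (Graft.unique_o b hb).elim, fun p => ?_⟩
    · simp only [Graft.idR_o, hc.oo', h1.oo']
    · rcases (Graft.std t b w).cases p with ⟨c, hc', rfl⟩ | ⟨c, rfl⟩
      · rw [Graft.chg_o, h1.no', hc.no']
      · rw [Graft.chg_n, h1.nn', hc.nn']

theorem ETerm.act_o (φ : BimodMap P w) {v v' t u u' : List Col} {j a : Fin v.length}
    (hj : v.get j = .half) {e₁ : Graft v j t u} (x : ETerm P v) (y : ETerm P t)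
    (ha : v.get a = .full) {q : Fin u.length} (hq : u.get q = .full) {p : Fin v'.length}
    (hp : v'.get p = .half)
    {e : Graft u q w u'} {e₃ : Graft v a w v'} {e₄ : Graft v' p t u'}
    (hc : ParCompat e₁ e e₃ e₄) :
    (ETerm.graft j hj e₁ x y).act φ q hq e =
      EObj.comp p hp e₄ (x.act φ a ha e₃) (EObj.mk y) := by
  rw [ETerm.act_graft_o' φ hj e₁ x y a hc.ne.symm ha hc.pos₁ hq e]; unfold graftO; beta_reduce
  have h1 := (Graft.exists_par₄ e₁ hc.ne hc.pos₁ e (Graft.std v a w) rfl).choose_spec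
  rw [← ETerm.act_chg φ x ha e₃ (Graft.std v a w),
    EObj.comp_seq (e₄ := Graft.idL .half u') (j := p) (hj := hp) (e₃ := e₄),
    EObj.one_comp _ _ (fun _ => rfl)]
  refine ⟨?_, fun a ha h => (Graft.unique_o a ha).elim, fun x hx h => ?_, fun b => ?_⟩
  · have key := Graft.chg_o .half e₃ (Graft.std v a w) j hc.ne
    rwa [hc.pos₂] at key
  · rw [Graft.idL_n]
    rcases e₃.cases x with ⟨c, hc', rfl⟩ | ⟨c, rfl⟩
    · have hcj : c ≠ j := by rintro rfl; exact hx hc.pos₂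
      simp only [Graft.chg_o, h1.oo' c hcj hc', hc.oo' c hcj hc']
    · simp only [Graft.chg_n, h1.on', hc.on']
  · rw [Graft.idL_n, hc.no', h1.no']


theorem EObj.mk_graft {v t u : List Col} {j : Fin v.length} (hj : v.get j = .half)
    (e : Graft v j t u) (x : ETerm P v) (y : ETerm P t) :
    EObj.mk (.graft j hj e x y) = EObj.comp j hj e (EObj.mk x) (EObj.mk y) := rfl

theorem half_of_other {u : List Col} (hu : sigColl₁ u .half) {i j : Fin u.length}
    (hi : u.get i = .full) (hij : j ≠ i) : u.get j = .half := by
  cases h : u.get j with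
  | half => rfl
  | full => exact absurd (hu.2 j i h hi) hij

theorem ETerm.act_rel (φ : BimodMap P w) {u : List Col} {x y : ETerm P u} (h : ERel P x y) :
    ∀ {u' : List Col} (i : Fin u.length) (hi : u.get i = .full) (e : Graft u i w u'),
      x.act φ i hi e = y.act φ i hi e := by
  induction h with
  | @gen_comp v t v' hv ht hv' j hj e₁ x y =>
    intro u' q hq e
    have hg : EObj.gen hv' (P.comp hv ht hv' j hj e₁ x y) =
        EObj.comp j hj e₁ (EObj.gen hv x) (EObj.gen ht y) :=
      (Quot.sound (.gen_comp hv ht hv' j hj e₁ x y)).symm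
    rcases e₁.cases q with ⟨a, ha, rfl⟩ | ⟨b, rfl⟩
    · have hf : v.get a = .full := by rw [← e₁.get_o a ha]; exact hq
      have hp : (Graft.stdW v a w).get ((Graft.std v a w).o j ha.symm) = .half := by
        rw [Graft.get_o]; exact hj
      obtain ⟨e₄, h4⟩ := Graft.exists_par₄ e₁ ha.symm rfl e (Graft.std v a w) rfl
      rw [ETerm.act_o φ hj _ _ hf hq hp h4, ETerm.act, ETerm.act, hg]
      refine (φ.right hj _ hp _ _ e₄ e₁ e _ _ ?_ h4.symm).symm
      intro b
      rw [← e₁.get_n b]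
      exact half_of_other hv' hq (Graft.o_ne_n _).symm
    · have hf : t.get b = .full := by rw [← e₁.get_n b]; exact hq
      obtain ⟨e₄, h4⟩ := Graft.exists_seq₄ e₁ rfl e (Graft.std t b w)
      rw [ETerm.act_n φ hj _ _ hf hq h4, ETerm.act, ETerm.act, hg]
      refine (φ.left hj _ _ e₁ e (Graft.std t b w) e₄ _ _ ?_ h4).symm
      intro a
      by_cases ha : a = j
      · rw [ha]; exact hj
      · rw [← e₁.get_o a ha]
        exact half_of_other hv' hq (Graft.o_ne_n _)
  | @one_comp v e₁ x he =>
    intro u' q hq e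
    rw [ETerm.one, ETerm.act_n φ (b := q) (e₃ := e) (e₄ := Graft.idL .half u') rfl _ x hq hq]
    · exact EObj.one_comp _ _ (fun _ => rfl)
    · refine ⟨he q, fun a ha => (Graft.unique_o a ha).elim, fun b hb h => ?_, fun c => rfl⟩
      simp only [he]; rfl
  | @comp_one v j hj e₁ x ho hn =>
    intro u' q hq e
    have hqj : q ≠ j := by rintro rfl; rw [hq] at hj; cases hj
    have hp : u'.get (e.o j hqj.symm) = .half := by rw [Graft.get_o]; exact hj
    rw [ETerm.one, ETerm.act_o φ (a := q) (e₃ := e) (e₄ := Graft.idR u' (e.o j hqj.symm) .half hp)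
      hj x _ hq hq hp]
    · exact EObj.comp_one _ _ _ _ (fun _ _ => rfl) rfl
    · refine ⟨hqj.symm, ho q hqj, rfl, fun a h1 h2 h3 h4 => ?_, fun b h => ?_, fun c h => rfl⟩
      · simp only [ho, Graft.idR_o]
      · have hb : b = 0 := Subsingleton.elim (α := Fin 1) _ _
        subst hb
        simp only [hn, Graft.idR_n]
  | @seq v t s v' t' v'' i j q hi hj hq e₁ e₂ e₃ e₄ x y z A =>
    intro u' r hr e
    rcases e₂.cases r with ⟨p, hp, rfl⟩ | ⟨c, rfl⟩
    · have hpf : v'.get p = .full := by rw [← e₂.get_o p hp]; exact hr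
      have hz : (Graft.stdW v' p w).get ((Graft.std v' p w).o q hp.symm) = .half := by
        rw [Graft.get_o]; exact hq
      obtain ⟨f₄, B⟩ := Graft.exists_par₄ e₂ hp.symm rfl e (Graft.std v' p w) rfl
      rw [ETerm.act_o φ hq _ _ hpf hr hz B]
      rcases e₁.cases p with ⟨a, ha, rfl⟩ | ⟨b, rfl⟩
      · have haf : v.get a = .full := by rw [← e₁.get_o a ha]; exact hpf
        have hy : (Graft.stdW v a w).get ((Graft.std v a w).o i ha.symm) = .half := by
          rw [Graft.get_o]; exact hi
        obtain ⟨n₄, C⟩ := Graft.exists_par₄ e₁ ha.symm rfl (Graft.std v' _ w) (Graft.std v a w) rfl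
        have hr' : e₄.o a ha = e₂.o (e₁.o a ha) hp := A.oo' a ha
        obtain ⟨h₄, D⟩ := Graft.exists_par₄ e₄ ha.symm hr' e (Graft.std v a w) rfl
        rw [ETerm.act_o φ hi _ _ haf hpf hy C, ETerm.act_o φ hi _ _ haf hr hy D, EObj.mk_graft,
          EObj.comp_seq (chase_zx A B C D)]
      · have hbf : t.get b = .full := by rw [← e₁.get_n b]; exact hpf
        have hbj : b ≠ j := by rintro rfl; exact hp A.pos
        obtain ⟨n₄, C⟩ := Graft.exists_seq₄ e₁ rfl (Graft.std v' (e₁.n b) w) (Graft.std t b w)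
        have hr' : e₄.n (e₃.o b hbj) = e₂.o (e₁.n b) hp := A.no' b hbj
        have hk : t'.get (e₃.o b hbj) = .full := by rw [Graft.get_o]; exact hbf
        have hz' : (Graft.stdW t b w).get ((Graft.std t b w).o j hbj.symm) = .half := by
          rw [Graft.get_o]; exact hj
        obtain ⟨h₄, D⟩ := Graft.exists_seq₄ e₄ hr' e (Graft.std t' (e₃.o b hbj) w)
        obtain ⟨o₄, E⟩ := Graft.exists_par₄ e₃ hbj.symm rfl (Graft.std t' (e₃.o b hbj) w)
          (Graft.std t b w) rfl
        rw [ETerm.act_n φ hi _ _ hbf hpf C, ETerm.act_n φ hi _ _ hk hr D,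
          ETerm.act_o φ hj _ _ hbf hk hz' E, EObj.comp_seq (chase_zy A B C D E)]
    · have hcf : s.get c = .full := by rw [← e₂.get_n c]; exact hr
      obtain ⟨f₄, B⟩ := Graft.exists_seq₄ e₂ rfl e (Graft.std s c w)
      have hr' : e₄.n (e₃.n c) = e₂.n c := A.nn' c
      have hk : t'.get (e₃.n c) = .full := by rw [Graft.get_n]; exact hcf
      obtain ⟨h₄, D⟩ := Graft.exists_seq₄ e₄ hr' e (Graft.std t' (e₃.n c) w)
      obtain ⟨n₄, C⟩ := Graft.exists_seq₄ e₃ rfl (Graft.std t' (e₃.n c) w) (Graft.std s c w)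
      rw [ETerm.act_n φ hq _ _ hcf hr B, ETerm.act_n φ hi _ _ hk hr D, ETerm.act_n φ hj _ _ hcf hk C,
        EObj.mk_graft, EObj.comp_seq (chase_zz A B C D)]
  | @par v t s v' v₃ v'' i j q p hi hj hq hp e₁ e₂ e₃ e₄ x y z A =>
    intro u' r hr e
    rcases e₂.cases r with ⟨l, hl, rfl⟩ | ⟨c, rfl⟩
    · have hlf : v'.get l = .full := by rw [← e₂.get_o l hl]; exact hr
      have hz : (Graft.stdW v' l w).get ((Graft.std v' l w).o q hl.symm) = .half := by
        rw [Graft.get_o]; exact hq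
      obtain ⟨f₄, B⟩ := Graft.exists_par₄ e₂ hl.symm rfl e (Graft.std v' l w) rfl
      rw [ETerm.act_o φ hq _ _ hlf hr hz B]
      rcases e₁.cases l with ⟨a, hai, rfl⟩ | ⟨b, rfl⟩
      · have haf : v.get a = .full := by rw [← e₁.get_o a hai]; exact hlf
        have haj : a ≠ j := by rintro rfl; exact hl A.pos₁
        have hap : e₃.o a haj ≠ p := by rw [← A.pos₂, Ne, Graft.o_inj]; exact hai
        have hgf : v₃.get (e₃.o a haj) = .full := by rw [Graft.get_o]; exact haf
        have hy : (Graft.stdW v a w).get ((Graft.std v a w).o i hai.symm) = .half := by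
          rw [Graft.get_o]; exact hi
        have hy' : (Graft.stdW v a w).get ((Graft.std v a w).o j haj.symm) = .half := by
          rw [Graft.get_o]; exact hj
        have hy₃ : (Graft.stdW v₃ (e₃.o a haj) w).get ((Graft.std v₃ (e₃.o a haj) w).o p hap.symm) =
            .half := by rw [Graft.get_o]; exact hp
        obtain ⟨n₄, C⟩ := Graft.exists_par₄ e₁ hai.symm rfl (Graft.std v' _ w) (Graft.std v a w) rfl
        have hr' : e₄.o (e₃.o a haj) hap = e₂.o (e₁.o a hai) hl := A.oo' a hai haj hap
        obtain ⟨f₅, D⟩ := Graft.exists_par₄ e₄ hap.symm hr' e (Graft.std v₃ (e₃.o a haj) w) rfl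
        obtain ⟨n₅, E⟩ := Graft.exists_par₄ e₃ haj.symm rfl (Graft.std v₃ (e₃.o a haj) w)
          (Graft.std v a w) rfl
        rw [ETerm.act_o φ hi _ _ haf hlf hy C, ETerm.act_o φ hp _ _ hgf hr hy₃ D,
          ETerm.act_o φ hj _ _ haf hgf hy' E, EObj.comp_par (chase_px A B C D E)]
      · have hbf : t.get b = .full := by rw [← e₁.get_n b]; exact hlf
        obtain ⟨n₄, C⟩ := Graft.exists_seq₄ e₁ rfl (Graft.std v' (e₁.n b) w) (Graft.std t b w)
        have hr' : e₄.n b = e₂.o (e₁.n b) hl := A.no' b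
        obtain ⟨h₄, D⟩ := Graft.exists_seq₄ e₄ hr' e (Graft.std t b w)
        rw [ETerm.act_n φ hi _ _ hbf hlf C, ETerm.act_n φ hp _ _ hbf hr D, EObj.mk_graft,
          EObj.comp_par (chase_py A B C D)]
    · have hcf : s.get c = .full := by rw [← e₂.get_n c]; exact hr
      have hcp : e₃.n c ≠ p := by rw [← A.pos₂]; exact (Graft.o_ne_n _).symm
      have hr' : e₄.o (e₃.n c) hcp = e₂.n c := A.on' c hcp
      have hgf : v₃.get (e₃.n c) = .full := by rw [Graft.get_n]; exact hcf
      have hz : (Graft.stdW v₃ (e₃.n c) w).get ((Graft.std v₃ (e₃.n c) w).o p hcp.symm) = .half := by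
        rw [Graft.get_o]; exact hp
      obtain ⟨f₄, B⟩ := Graft.exists_par₄ e₄ hcp.symm hr' e (Graft.std v₃ (e₃.n c) w) rfl
      obtain ⟨n₄, C⟩ := Graft.exists_seq₄ e₃ rfl (Graft.std v₃ (e₃.n c) w) (Graft.std s c w)
      obtain ⟨h₄, D⟩ := Graft.exists_seq₄ e₂ rfl e (Graft.std s c w)
      rw [ETerm.act_n φ hq _ _ hcf hr D, ETerm.act_o φ hp _ _ hgf hr hz B,
        ETerm.act_n φ hj _ _ hcf hgf C, EObj.mk_graft, EObj.comp_par (chase_py A.symm B C D)]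
  | @left v t v' j hj e₁ x x' y h ih =>
    intro u' q hq e
    have hx : EObj.mk x = EObj.mk x' := Quot.sound h
    rcases e₁.cases q with ⟨a, ha, rfl⟩ | ⟨b, rfl⟩
    · have hf : v.get a = .full := by rw [← e₁.get_o a ha]; exact hq
      have hp : (Graft.stdW v a w).get ((Graft.std v a w).o j ha.symm) = .half := by
        rw [Graft.get_o]; exact hj
      obtain ⟨e₄, h4⟩ := Graft.exists_par₄ e₁ ha.symm rfl e (Graft.std v a w) rfl
      rw [ETerm.act_o φ hj _ _ hf hq hp h4, ETerm.act_o φ hj _ _ hf hq hp h4, ih]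
    · have hf : t.get b = .full := by rw [← e₁.get_n b]; exact hq
      obtain ⟨e₄, h4⟩ := Graft.exists_seq₄ e₁ rfl e (Graft.std t b w)
      rw [ETerm.act_n φ hj _ _ hf hq h4, ETerm.act_n φ hj _ _ hf hq h4, hx]
  | @right v t v' j hj e₁ x y y' h ih =>
    intro u' q hq e
    have hx : EObj.mk y = EObj.mk y' := Quot.sound h
    rcases e₁.cases q with ⟨a, ha, rfl⟩ | ⟨b, rfl⟩
    · have hf : v.get a = .full := by rw [← e₁.get_o a ha]; exact hq
      have hp : (Graft.stdW v a w).get ((Graft.std v a w).o j ha.symm) = .half := by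
        rw [Graft.get_o]; exact hj
      obtain ⟨e₄, h4⟩ := Graft.exists_par₄ e₁ ha.symm rfl e (Graft.std v a w) rfl
      rw [ETerm.act_o φ hj _ _ hf hq hp h4, ETerm.act_o φ hj _ _ hf hq hp h4, hx]
    · have hf : t.get b = .full := by rw [← e₁.get_n b]; exact hq
      obtain ⟨e₄, h4⟩ := Graft.exists_seq₄ e₁ rfl e (Graft.std t b w)
      rw [ETerm.act_n φ hj _ _ hf hq h4, ETerm.act_n φ hj _ _ hf hq h4, ih]


/-- The extension of a bimodule map to elements of any degree: insertion of `φ` at the `full` input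
`i`. -/
noncomputable def BimodMap.act (φ : BimodMap P w) {u u' : List Col} (i : Fin u.length)
    (hi : u.get i = .full) (e : Graft u i w u') : EObj P u → EObj P u' :=
  Quot.lift (fun x => x.act φ i hi e) (fun _ _ h => ETerm.act_rel φ h i hi e)

theorem BimodMap.act_n (φ : BimodMap P w) {v t t' u u' : List Col} {j : Fin v.length}
    (hj : v.get j = .half) {e₁ : Graft v j t u} (x : EObj P v) (y : EObj P t)
    {b : Fin t.length} (hb : t.get b = .full) {q : Fin u.length} (hq : u.get q = .full)
    {e : Graft u q w u'} {e₃ : Graft t b w t'} {e₄ : Graft v j t' u'}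
    (hc : SeqCompat e₁ e e₃ e₄) :
    φ.act q hq e (EObj.comp j hj e₁ x y) = EObj.comp j hj e₄ x (φ.act b hb e₃ y) := by
  induction x using Quot.ind; induction y using Quot.ind
  exact ETerm.act_n φ hj _ _ hb hq hc

theorem BimodMap.act_o (φ : BimodMap P w) {v v' t u u' : List Col} {j a : Fin v.length}
    (hj : v.get j = .half) {e₁ : Graft v j t u} (x : EObj P v) (y : EObj P t)
    (ha : v.get a = .full) {q : Fin u.length} (hq : u.get q = .full) {p : Fin v'.length}
    (hp : v'.get p = .half)
    {e : Graft u q w u'} {e₃ : Graft v a w v'} {e₄ : Graft v' p t u'}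
    (hc : ParCompat e₁ e e₃ e₄) :
    φ.act q hq e (EObj.comp j hj e₁ x y) = EObj.comp p hp e₄ (φ.act a ha e₃ x) y := by
  induction x using Quot.ind; induction y using Quot.ind
  exact ETerm.act_o φ hj _ _ ha hq hp hc

theorem BimodMap.act_gen (φ : BimodMap P w) {u u' : List Col} (hu : sigColl₁ u .half)
    (i : Fin u.length) (hi : u.get i = .full) (e : Graft u i w u') (x : P.Obj u .half hu) :
    φ.act i hi e (EObj.gen hu x) = φ.app i (fullAt_of_sig hu hi) e (EObj.gen hu x) := rfl

noncomputable abbrev BimodMap.actTop (φ : BimodMap P w) (u : List Col) : TopologicalSpace (EObj P u) :=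
  finest (IsETop P) u ⊓ ⨅ (i) (hi) (u') (e : Graft u i w u'),
    TopologicalSpace.induced (φ.act i hi e) (finest (IsETop P) u')

theorem BimodMap.isETop_actTop (φ : BimodMap P w) : IsETop P φ.actTop where
  gen u hu := by
    refine continuous_inf_rng.2 ⟨(isETop_finest P).gen u hu, ?_⟩
    simp only [continuous_iInf_rng, continuous_induced_rng]
    intro i hi u' e
    exact (φ.continuous_app i (fullAt_of_sig hu hi) e).comp ((isETop_finest P).gen u hu)
  comp := by
    intro v t u j hj e₁ K f g hf hg
    have hf1 := (continuous_inf_rng.1 hf).1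
    have hg1 := (continuous_inf_rng.1 hg).1
    have hf2 := (continuous_inf_rng.1 hf).2
    have hg2 := (continuous_inf_rng.1 hg).2
    simp only [continuous_iInf_rng, continuous_induced_rng] at hf2 hg2
    refine continuous_inf_rng.2 ⟨(isETop_finest P).comp j hj e₁ K f g hf1 hg1, ?_⟩
    simp only [continuous_iInf_rng, continuous_induced_rng]
    intro q hq u' e
    rcases e₁.cases q with ⟨a, ha, rfl⟩ | ⟨b, rfl⟩
    · have hf : v.get a = .full := by rw [← e₁.get_o a ha]; exact hq
      have hp : (Graft.stdW v a w).get ((Graft.std v a w).o j ha.symm) = .half := by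
        rw [Graft.get_o]; exact hj
      obtain ⟨e₄, h4⟩ := Graft.exists_par₄ e₁ ha.symm rfl e (Graft.std v a w) rfl
      have := (isETop_finest P).comp _ hp e₄ K _ _ (hf2 a hf _ (Graft.std v a w)) hg1
      refine this.congr fun z => ?_
      exact (φ.act_o hj _ _ hf hq hp h4).symm
    · have hf : t.get b = .full := by rw [← e₁.get_n b]; exact hq
      obtain ⟨e₄, h4⟩ := Graft.exists_seq₄ e₁ rfl e (Graft.std t b w)
      have := (isETop_finest P).comp _ hj e₄ K _ _ hf1 (hg2 b hf _ (Graft.std t b w))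
      refine this.congr fun z => ?_
      exact (φ.act_n hj _ _ hf hq h4).symm

theorem BimodMap.continuous_act (φ : BimodMap P w) {u u' : List Col} (i : Fin u.length)
    (hi : u.get i = .full) (e : Graft u i w u') :
    Continuous (φ.act i hi e) := by
  have h := finest_le φ.isETop_actTop u
  have h2 := continuous_id_iff_le.2 h
  have h3 := (continuous_inf_rng.1 h2).2
  simp only [continuous_iInf_rng, continuous_induced_rng] at h3
  exact h3 i hi u' e

theorem EObj.continuous_comp_right {v t u : List Col} {j : Fin v.length} (hj : v.get j = .half)
    (e : Graft v j t u) (x : EObj P v) :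
    Continuous (EObj.comp j hj e x) := by
  refine (IsGeneratedBy.continuous_iff (X := CH) _).2 fun K g => ?_
  exact (isETop_finest P).comp j hj e K _ _ continuous_const g.continuous

/-- The identity bimodule map, up to the name of the `full` input. -/
def BimodMap.one (P : OperadData sigColl₁) : BimodMap P [.full] where
  app i hu e x := EObj.comp 0 rfl
    (Graft.chg .half (Graft.idR _ i .full ((hu i).2 rfl)) e) (EObj.one P) x
  continuous_app i hu e := EObj.continuous_comp_right _ _ _
  left := by
    intro v u v₁ u' v₂ j i q hj hu hq e₁ e₂ e₃ e₄ y x hv A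
    obtain ⟨f, hf⟩ := Graft.exists_seq₂ (Graft.idR v j .half hj) (j := 0) (q := j) rfl
      (Graft.chg .half (Graft.idR u i .full ((hu i).2 rfl)) e₃) e₄
    rw [← EObj.comp_seq hf (hq := hj), EObj.comp_one _ _ _ _ (fun _ _ => rfl) rfl,
      ← EObj.comp_seq (e₁ := Graft.idL .half v) (e₂ := f) (hq := hj),
      EObj.one_comp _ _ (fun _ => rfl)]
    refine ⟨rfl, fun a ha => (Graft.unique_o a ha).elim, fun a ha h => ?_, fun c => ?_⟩
    · have h1 : e₁.o a ha ≠ q := by rw [← A.pos]; exact Graft.o_ne_n _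
      have h2 := Graft.chg_o .half (Graft.idR v₁ q .full ((hq q).2 rfl)) e₂ _ h1
      rw [Graft.idR_o] at h2
      rw [h2, ← A.oo', hf.oo']; rfl
    · by_cases hc : c = i
      · subst hc
        have h1 : e₁.n c = q := A.pos
        have h2 := Graft.chg_n .half (Graft.idR v₁ q .full ((hq q).2 rfl)) e₂ 0
        have h3 := Graft.chg_n .half (Graft.idR u c .full ((hu c).2 rfl)) e₃ 0
        rw [Graft.idR_n] at h2 h3
        rw [h1, h2, ← hf.nn', h3, A.nn']
      · have h1 : e₁.n c ≠ q := by rw [← A.pos, Ne, Graft.n_inj]; exact hc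
        have h2 := Graft.chg_o .half (Graft.idR v₁ q .full ((hq q).2 rfl)) e₂ _ h1
        have h3 := Graft.chg_o .half (Graft.idR u i .full ((hu i).2 rfl)) e₃ _ hc
        rw [Graft.idR_o] at h2 h3
        rw [h2, ← hf.nn', h3, A.no']
  right := by
    intro u v u₁ u₃ u₂ i j q p hj hu hq hp e₁ e₂ e₃ e₄ x y hv A
    refine (EObj.comp_seq ?_).symm
    refine ⟨?_, fun a ha => (Graft.unique_o a ha).elim, fun a ha h => ?_, fun c => ?_⟩
    · have h3 := Graft.chg_o .half (Graft.idR u i .full ((hu i).2 rfl)) e₁ _ A.ne.symm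
      rw [Graft.idR_o] at h3
      rw [h3, A.pos₁]
    · by_cases hc : a = i
      · subst hc
        have h1 : e₃.o a ha = p := A.pos₂
        have h2 := Graft.chg_n .half (Graft.idR u₃ p .full ((hp p).2 rfl)) e₄ 0
        have h3 := Graft.chg_n .half (Graft.idR u a .full ((hu a).2 rfl)) e₁ 0
        rw [Graft.idR_n] at h2 h3
        simp only [h1, h2, h3, A.no']
      · have h1 : e₃.o a ha ≠ p := by rw [← A.pos₂, Ne, Graft.o_inj]; exact hc
        have h2 := Graft.chg_o .half (Graft.idR u₃ p .full ((hp p).2 rfl)) e₄ _ h1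
        have h3 := Graft.chg_o .half (Graft.idR u i .full ((hu i).2 rfl)) e₁ _ hc
        rw [Graft.idR_o] at h2 h3
        simp only [h2, h3, A.oo' _ hc ha]
    · have h1 : e₃.n c ≠ p := by rw [← A.pos₂]; exact (Graft.o_ne_n _).symm
      have h2 := Graft.chg_o .half (Graft.idR u₃ p .full ((hp p).2 rfl)) e₄ _ h1
      rw [Graft.idR_o] at h2
      rw [h2, A.on']

/-- Apply `φ`, then insert `ψ` at its input `b`. -/
noncomputable def BimodMap.comp {w t w' : List Col} {b : Fin w.length} (e : Graft w b t w')
    (hb : w.get b = .full) (φ : BimodMap P w) (ψ : BimodMap P t) : BimodMap P w' where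
  app {u u'} i hu e₀ x := ψ.act ((Graft.std u i w).n b) ((Graft.get_n _ _).trans hb)
    (Graft.exists_seq₂ (Graft.std u i w) rfl e e₀).choose (φ.app i hu (Graft.std u i w) x)
  continuous_app i hu e₀ := (ψ.continuous_act _ _ _).comp (φ.continuous_app i hu _)
  left := by
    intro v u v₁ u' v₂ j i q hj hu hq e₁ e₂ e₃ e₄ y x hv A
    have C := (Graft.exists_seq₂ (Graft.std v₁ q w) rfl e e₂).choose_spec
    have D := (Graft.exists_seq₂ (Graft.std u i w) rfl e e₃).choose_spec
    obtain ⟨m₄, B⟩ := Graft.exists_seq₄ e₁ A.pos (Graft.std v₁ q w) (Graft.std u i w)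
    rw [φ.left hj hu hq e₁ _ (Graft.std u i w) m₄ y x hv B]
    exact ψ.act_n hj _ _ _ _ (chase_comp A B C D)
  right := by
    intro u v u₁ u₃ u₂ i j q p hj hu hq hp e₁ e₂ e₃ e₄ x y hv A
    have C := (Graft.exists_seq₂ (Graft.std u₃ p w) rfl e e₄).choose_spec
    have D := (Graft.exists_seq₂ (Graft.std u i w) rfl e e₁).choose_spec
    obtain ⟨n₂, B⟩ := Graft.exists_par₄ e₃ A.ne.symm A.pos₂ (Graft.std u₃ p w) (Graft.std u i w) rfl
    have B' := B.symm
    have hz : (Graft.stdW u i w).get ((Graft.std u i w).o j A.ne.symm) = .half := by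
      rw [Graft.get_o]; exact hj
    rw [φ.right hj hu hz hp (Graft.std u i w) n₂ e₃ _ x y hv B']
    exact ψ.act_o hz _ _ _ _ _ (chase_comp' A B' C D)


theorem isGeneratedBy_kTop {Y : Type} (t : TopologicalSpace Y) :
    @IsGeneratedBy _ CH _ Y (kTop t) :=
  @IsGeneratedBy.instWithGeneratedByTopology _ CH _ Y t

theorem sigFull.mk {w : List Col} (h : ∀ c ∈ w, c = .full) : sigFull w .full := ⟨rfl, h⟩

/-- The mapping space topology in compactly generated spaces. -/
instance (P : OperadData sigColl₁) (w : List Col) : TopologicalSpace (BimodMap P w) :=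
  kTop (⨅ (u) (u') (i) (hu : FullAt u i) (e : Graft u i w u'),
    TopologicalSpace.induced
      (fun φ => (⟨φ.app i hu e, (φ.continuous_app i hu e).continuousGeneratedBy⟩ :
        ContinuousMapGeneratedBy CH (EObj P u) (EObj P u'))) inferInstance)

instance (P : OperadData sigColl₁) (w : List Col) : IsGeneratedBy CH (BimodMap P w) :=
  isGeneratedBy_kTop _

/-- The one-coloured endomorphism operad `End` of the free extension of `P`. -/
noncomputable def endOperad (P : OperadData sigColl₁) : OperadData sigFull where
  Obj w _ _ := BimodMap P w
  top _ _ _ := inferInstance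
  gen _ _ _ := inferInstance
  one k h := match k, h with
    | .full, _ => BimodMap.one P
  comp _ ht _ _ hi e φ ψ := φ.comp e (hi.trans ht.1) ψ

/-- Operations with output `half` are those of the free extension of `P`; operations with output
`full` have only `full` inputs and are those of `O`. -/
def RtimesObj (P : OperadData sigColl₁) (O : OperadData sigFull) (w : List Col) : Col → Type
  | .half => EObj P w
  | .full => Σ h : PLift (∀ c ∈ w, c = .full), O.Obj w .full (.mk h.down)

instance (P : OperadData sigColl₁) (O : OperadData sigFull) (w : List Col) (k : Col) :
    TopologicalSpace (RtimesObj P O w k) :=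
  match k with
  | .half => inferInstanceAs (TopologicalSpace (EObj P w))
  | .full => instTopologicalSpaceSigma

instance (P : OperadData sigColl₁) (O : OperadData sigFull) (w : List Col) (k : Col) :
    IsGeneratedBy CH (RtimesObj P O w k) :=
  match k with
  | .half => inferInstanceAs (IsGeneratedBy CH (EObj P w))
  | .full => inferInstanceAs (IsGeneratedBy CH
      (Σ h : PLift (∀ c ∈ w, c = .full), O.Obj w .full (.mk h.down)))

theorem Graft.all_full {w t w' : List Col} {i : Fin w.length} (e : Graft w i t w')
    (hw : ∀ c ∈ w, c = Col.full) (ht : ∀ c ∈ t, c = Col.full) : ∀ c ∈ w', c = Col.full := by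
  intro c hc
  obtain ⟨q, rfl⟩ := List.get_of_mem hc
  rcases e.cases q with ⟨a, ha, rfl⟩ | ⟨b, rfl⟩
  · rw [e.get_o]; exact hw _ (List.get_mem _ _)
  · rw [e.get_n]; exact ht _ (List.get_mem _ _)

/-- The two-coloured operad `EObj P ⋊ O`. Composition uses composition in the free extension of `P`,
composition in `O`, and the action of `O` on the free extension through `ρ`. -/
noncomputable def rtimes (P : OperadData sigColl₁) (O : OperadData sigFull)
    (ρ : OperadHom O (endOperad P)) : OperadData sigAll where
  Obj w k _ := RtimesObj P O w k
  top _ _ _ := inferInstance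
  gen _ _ _ := inferInstance
  one k _ := match k with
    | .half => EObj.one P
    | .full => ⟨⟨by simp⟩, O.one .full (.mk (by simp))⟩
  comp {w t w' k c} _ _ _ i hi e := match k, c, hi with
    | .half, .half, hi => fun x y => EObj.comp i hi e x y
    | .half, .full, hi => fun x y => (ρ.map t .full (.mk y.1.down) y.2).act i hi e x
    | .full, .full, hi => fun x y => ⟨⟨e.all_full x.1.down y.1.down⟩,
        O.comp (.mk x.1.down) (.mk y.1.down) _ i hi e x.2 y.2⟩
    | .full, .half, hi => fun x _ => absurd (hi.symm.trans (x.1.down _ (List.get_mem _ _))) (by simp)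

end ActTerm

section PlanarGrafts

/-- The position of the letter `c` in the word `u ++ c :: v`. -/
def mid (u : List Col) (c : Col) (v : List Col) : Fin (u ++ c :: v).length :=
  ⟨u.length, by simp⟩

theorem get_mid (u : List Col) (c : Col) (v : List Col) : (u ++ c :: v).get (mid u c v) = c := by
  simp [mid]

/-- Substitution of the word `t` for the middle letter, keeping the linear order. -/
def Graft.planar (u : List Col) (c : Col) (v t : List Col) :
    Graft (u ++ c :: v) (mid u c v) t (u ++ (t ++ v)) where
  eqv :=
    { toFun := Sum.elim
        (fun j => if h : j.1.1 < u.length then ⟨j.1.1, by simp; omega⟩ else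
          ⟨j.1.1 - 1 + t.length, by
            have := j.1.2; have h2 : j.1.1 ≠ u.length := fun h => j.2 (Fin.ext h)
            simp at this ⊢; omega⟩)
        (fun b => ⟨u.length + b.1, by simp; omega⟩)
      invFun := fun q =>
        if h : q.1 < u.length then Sum.inl ⟨⟨q.1, by simp; omega⟩, by
          intro h'; have := congrArg Fin.val h'; simp [mid] at this; omega⟩
        else if h2 : q.1 < u.length + t.length then Sum.inr ⟨q.1 - u.length, by omega⟩
        else Sum.inl ⟨⟨q.1 + 1 - t.length, by have := q.2; simp at this ⊢; omega⟩, by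
          intro h'; have := congrArg Fin.val h'; simp [mid] at this; omega⟩
      left_inv := by
        rintro (⟨j, hj⟩ | b)
        · have h2 : j.1 ≠ u.length := fun h => hj (Fin.ext h)
          by_cases h : j.1 < u.length
          · simp [h]
          · have h3 : ¬ (j.1 - 1 + t.length < u.length) := by omega
            have h4 : ¬ (j.1 - 1 + t.length < u.length + t.length) := by omega
            simp only [Sum.elim_inl, h, h3, h4, dite_false]
            congr 2
            exact Fin.ext (by simp; omega)
        · simp
      right_inv := by
        intro q
        by_cases h : q.1 < u.length
        · simp [h]
        · by_cases h2 : q.1 < u.length + t.length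
          · simp only [h, h2, dite_false, dite_true, Sum.elim_inr]
            exact Fin.ext (by simp; omega)
          · have h3 : ¬ (q.1 + 1 - t.length < u.length) := by omega
            simp only [h, h2, h3, dite_false, Sum.elim_inl]
            exact Fin.ext (by simp; omega) }
  col_out := by
    rintro ⟨j, hj⟩
    have h2 : j.1 ≠ u.length := fun h => hj (Fin.ext h)
    simp only [Equiv.coe_fn_mk, Sum.elim_inl]
    by_cases h : j.1 < u.length
    · simp [h, List.getElem_append]
    · have h3 : ¬ (j.1 - 1 + t.length < u.length) := by omega
      have h4 : ¬ (j.1 - 1 + t.length - u.length < t.length) := by omega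
      obtain ⟨m, hm⟩ : ∃ m, j.1 - u.length = m + 1 := ⟨j.1 - u.length - 1, by omega⟩
      have h5 : j.1 - 1 + t.length - u.length - t.length = m := by omega
      simp [h, h3, h4, List.getElem_append, hm, h5]
  col_in b := by
    simp [List.getElem_append]

/-- As `planar`, for a word `.full :: t` whose first letter is moved to the front. -/
def Graft.planarFull (u : List Col) (c : Col) (v t : List Col) :
    Graft (u ++ c :: v) (mid u c v) (.full :: t) (.full :: (u ++ (t ++ v))) where
  eqv :=
    { toFun := Sum.elim
        (fun j => ((Graft.planar u c v t).eqv (Sum.inl j)).succ)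
        (fun b => Fin.cases (motive := fun _ => Fin (Col.full :: (u ++ (t ++ v))).length) 0
          (fun b => ((Graft.planar u c v t).eqv (Sum.inr b)).succ) b)
      invFun := fun q => Fin.cases
        (motive := fun _ => {j // j ≠ mid u c v} ⊕ Fin (Col.full :: t).length)
        (Sum.inr 0)
        (fun q => Sum.map id Fin.succ ((Graft.planar u c v t).eqv.symm q)) q
      left_inv := by
        rintro (j | b)
        · simp
        · refine Fin.cases ?_ (fun b => ?_) b
          · rfl
          · simp
      right_inv := by
        intro q
        refine Fin.cases ?_ (fun q => ?_) q
        · rfl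
        · simp only [Fin.cases_succ]
          rcases h : (Graft.planar u c v t).eqv.symm q with j | b
          · rw [(Equiv.symm_apply_eq _).1 h]; rfl
          · rw [(Equiv.symm_apply_eq _).1 h]; rfl }
  col_out j := by
    exact (Graft.planar u c v t).col_out j
  col_in b := by
    refine Fin.cases ?_ (fun b => ?_) b
    · rfl
    · exact (Graft.planar u c v t).col_in b

/-- The exchange of two adjacent inputs. -/
def Graft.swap (k : Col) (u : List Col) (a b : Col) (v : List Col) :
    Graft [k] 0 (u ++ a :: b :: v) (u ++ b :: a :: v) :=
  Graft.relabel k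
    ((Equiv.swap (⟨u.length, by simp⟩ : Fin (u ++ a :: b :: v).length)
      ⟨u.length + 1, by simp⟩).trans (finCongr (by simp))) (by
    intro j
    rcases lt_trichotomy j.1 u.length with h | h | h
    · rw [Equiv.trans_apply, Equiv.swap_apply_of_ne_of_ne]
      · simp [h]
      · intro h'; have := congrArg Fin.val h'; simp at this; omega
      · intro h'; have := congrArg Fin.val h'; simp at this; omega
    · obtain rfl : j = ⟨u.length, by simp⟩ := Fin.ext h
      rw [Equiv.trans_apply, Equiv.swap_apply_left]
      simp
    · by_cases h2 : j.1 = u.length + 1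
      · obtain rfl : j = ⟨u.length + 1, by simp⟩ := Fin.ext h2
        rw [Equiv.trans_apply, Equiv.swap_apply_right]
        simp
      · rw [Equiv.trans_apply, Equiv.swap_apply_of_ne_of_ne]
        · have h3 : ¬ (j.1 < u.length) := by omega
          obtain ⟨m, hm⟩ : ∃ m, j.1 - u.length = m + 2 := ⟨j.1 - u.length - 2, by omega⟩
          simp [h3, List.getElem_append, hm]
        · intro h'; have := congrArg Fin.val h'; simp at this; omega
        · intro h'; have := congrArg Fin.val h'; simp at this; omega)

end PlanarGrafts

section Algebras

universe v u

variable {C : Type u} [Category.{v} C] [MonoidalCategory C]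

/-- The tensor product `X c₁ ⊗ (X c₂ ⊗ (⋯ ⊗ 𝟙))` of a word. -/
def wordTensor (X : Col → C) : List Col → C
  | [] => 𝟙_ C
  | c :: w => X c ⊗ wordTensor X w

def wordTensorMap {X Y : Col → C} : ∀ (w : List Col), (∀ c ∈ w, X c ⟶ Y c) →
    (wordTensor X w ⟶ wordTensor Y w)
  | [], _ => 𝟙 _
  | c :: w, g => g c List.mem_cons_self ⊗ₘ
      wordTensorMap w (fun c' h => g c' (List.mem_cons_of_mem c h))

theorem wordTensorMap_id (X : Col → C) (w : List Col) :
    wordTensorMap w (fun c _ => 𝟙 (X c)) = 𝟙 _ := by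
  induction w with
  | nil => rfl
  | cons c w ih => simp only [wordTensorMap, ih]; exact id_tensorHom_id _ _

theorem wordTensorMap_comp {X Y Z : Col → C} (w : List Col) (g : ∀ c ∈ w, X c ⟶ Y c)
    (h : ∀ c ∈ w, Y c ⟶ Z c) :
    wordTensorMap w (fun c hc => g c hc ≫ h c hc) = wordTensorMap w g ≫ wordTensorMap w h := by
  induction w with
  | nil => exact (Category.id_comp _).symm
  | cons c w ih => simp only [wordTensorMap, ih]; exact (tensorHom_comp_tensorHom _ _ _ _).symm

/-- The associativity isomorphism. -/
def splitHom (X : Col → C) (v : List Col) : ∀ t : List Col,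
    wordTensor X (t ++ v) ⟶ wordTensor X t ⊗ wordTensor X v
  | [] => (λ_ _).inv
  | c :: t => X c ◁ splitHom X v t ≫ (α_ (X c) (wordTensor X t) (wordTensor X v)).inv

/-- Evaluation of `g` on the tensor factors `t` in the middle. -/
def splice (X : Col → C) {c : Col} (v : List Col) {t : List Col}
    (g : wordTensor X t ⟶ X c) :
    ∀ u : List Col, wordTensor X (u ++ (t ++ v)) ⟶ wordTensor X (u ++ c :: v)
  | [] => splitHom X v t ≫ g ▷ wordTensor X v
  | a :: u => X a ◁ splice X v g u

variable [SymmetricCategory C]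

/-- As `splice`, for a map `g` depending on a further tensor factor `H` in front. -/
def spliceParam (X : Col → C) (H : C) {c : Col} (v : List Col) {t : List Col}
    (g : H ⊗ wordTensor X t ⟶ X c) :
    ∀ u : List Col, H ⊗ wordTensor X (u ++ (t ++ v)) ⟶ wordTensor X (u ++ c :: v)
  | [] => H ◁ splitHom X v t ≫ (α_ H (wordTensor X t) (wordTensor X v)).inv ≫ g ▷ wordTensor X v
  | a :: u => (α_ H (X a) (wordTensor X (u ++ (t ++ v)))).inv ≫
      (β_ H (X a)).hom ▷ wordTensor X (u ++ (t ++ v)) ≫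
      (α_ (X a) H (wordTensor X (u ++ (t ++ v)))).hom ≫ X a ◁ spliceParam X H v g u

/-- The symmetry on two adjacent factors. -/
def swapHom (X : Col → C) (a b : Col) (v : List Col) : ∀ u : List Col,
    wordTensor X (u ++ b :: a :: v) ⟶ wordTensor X (u ++ a :: b :: v)
  | [] => (α_ (X b) (X a) (wordTensor X v)).inv ≫ (β_ (X b) (X a)).hom ▷ wordTensor X v ≫
      (α_ (X a) (X b) (wordTensor X v)).hom
  | c :: u => X c ◁ swapHom X a b v u

variable (i : CGTop ⥤ C) [i.Braided]

/-- The inclusion of `X` into the tensor product of the space `T` with `X` at the point `x`. -/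
noncomputable def pt {T : Type} [TopologicalSpace T] [IsGeneratedBy CH T] (x : T) (X : C) :
    X ⟶ i.obj (CGTop.of T) ⊗ X :=
  (λ_ X).inv ≫ (Functor.LaxMonoidal.ε i ≫ i.map (constHom x)) ▷ X

/-- Algebras over the coloured topological operad `P`, on the family of objects `X`: structure maps
`P(w; k) ⊗ X w₁ ⊗ ⋯ ⊗ X wₙ ⟶ X k` compatible with units, partial compositions and exchange of
adjacent inputs. Compatibility is stated at each point of the spaces of operations. -/
structure Alg {S : List Col → Col → Prop} (P : OperadData S) (X : Col → C) where
  str : ∀ w k (h : S w k), i.obj (CGTop.of (P.Obj w k h)) ⊗ wordTensor X w ⟶ X k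
  one : ∀ k (h : S [k] k), pt i (P.one k h) (wordTensor X [k]) ≫ str [k] k h = (ρ_ (X k)).hom
  comp : ∀ {u v t : List Col} {k c : Col} (hw : S (u ++ c :: v) k) (ht : S t c)
    (hw' : S (u ++ (t ++ v)) k) (x : P.Obj _ k hw) (y : P.Obj t c ht),
    pt i (P.comp hw ht hw' (mid u c v) (get_mid u c v) (Graft.planar u c v t) x y) _ ≫
      str _ k hw' = splice X v (pt i y _ ≫ str t c ht) u ≫ pt i x _ ≫ str _ k hw
  swap : ∀ {u v : List Col} {a b k : Col} (h : S [k] k) (hw : S (u ++ a :: b :: v) k)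
    (hw' : S (u ++ b :: a :: v) k) (x : P.Obj _ k hw),
    pt i (P.comp h hw hw' 0 rfl (Graft.swap k u a b v) (P.one k h) x) _ ≫ str _ k hw' =
      swapHom X a b v u ≫ pt i x _ ≫ str _ k hw

variable {i}

/-- The operation `X c₁ ⊗ ⋯ ⊗ X cₙ ⟶ X k` given by a point of the operad. -/
noncomputable def Alg.op {S : List Col → Col → Prop} {P : OperadData S} {X : Col → C}
    (α : Alg i P X) {w : List Col} {k : Col} {h : S w k} (x : P.Obj w k h) :
    wordTensor X w ⟶ X k := pt i x _ ≫ α.str w k h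

end Algebras

section Hochschild

universe v u

theorem sigColl₁_of_half {w : List Col} {k : Col} (h : sigHalf w k) : sigColl₁ w k :=
  ⟨h.1, fun a _ ha _ => by have := h.2 _ (List.get_mem w a); rw [ha] at this; cases this⟩

/-- The part of degree zero, a one-coloured operad with colour `half`. -/
def OperadData.degZero (P : OperadData sigColl₁) : OperadData sigHalf :=
  P.restrict sigHalf fun _ _ => sigColl₁_of_half

theorem sigHalf.mk {w : List Col} (h : ∀ c ∈ w, c = .half) : sigHalf w .half := ⟨rfl, h⟩

theorem sigColl₁.zero {w : List Col} (h : ∀ c ∈ w, c = .half) : sigColl₁ w .half :=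
  sigColl₁_of_half (.mk h)

theorem sigColl₁.one {w : List Col} (h : ∀ c ∈ w, c = .half) : sigColl₁ (.full :: w) .half := by
  refine ⟨rfl, fun a b => ?_⟩
  have key : ∀ c : Fin (Col.full :: w).length, (Col.full :: w).get c = .full → c = 0 := by
    intro c
    refine Fin.cases (fun _ => rfl) (fun c hc => ?_) c
    have := h _ (List.get_mem w c)
    rw [List.get_cons_succ'] at hc
    rw [hc] at this; cases this
  exact fun ha hb => (key a ha).trans (key b hb).symm

theorem half_append {u v t : List Col} {c : Col} (h : ∀ c' ∈ u ++ c :: v, c' = .half)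
    (ht : ∀ c ∈ t, c = .half) : ∀ c ∈ u ++ (t ++ v), c = Col.half := by
  intro c' hc'
  simp only [List.mem_append] at hc'
  rcases hc' with h1 | h1 | h1
  · exact h c' (by simp [h1])
  · exact ht c' h1
  · exact h c' (by simp [h1])

variable {C : Type u} [Category.{v} C] [MonoidalCategory C] [SymmetricCategory C]
  [HasLimitsOfSize.{0, 0} C] [HasColimitsOfSize.{0, 0} C] (i : CGTop ⥤ C) [i.Braided]
  (P : OperadData sigColl₁) (A : C)

/-- The coproduct of the `P(1, m) ⊗ A ^ m`, the `full` input being put in front. -/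
noncomputable def preAsc : C :=
  ∐ fun w : {w : List Col // ∀ c ∈ w, c = .half} =>
    i.obj (CGTop.of (P.Obj (.full :: w.1) .half (.one w.2))) ⊗ wordTensor (fun _ => A) w.1

variable {P}

/-- The summand at the point `x`. -/
noncomputable def preAsc.ι {w : List Col} (h : ∀ c ∈ w, c = .half)
    (x : P.Obj (.full :: w) .half (.one h)) : wordTensor (fun _ => A) w ⟶ preAsc i P A :=
  pt i x _ ≫ Sigma.ι (fun w : {w : List Col // ∀ c ∈ w, c = .half} =>
    i.obj (CGTop.of (P.Obj (.full :: w.1) .half (.one w.2))) ⊗ wordTensor (fun _ => A) w.1) ⟨w, h⟩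

variable (P)

/-- Generators of the relations in `A^sc`: equivariance, and `(x ∘ y) ⊗ a ∼ x ⊗ y a` for `y` of degree
zero. -/
inductive AscRel
  | swap (u v : List Col) (h : ∀ c ∈ u ++ .half :: .half :: v, c = .half)
      (x : P.Obj (.full :: (u ++ .half :: .half :: v)) .half (.one h))
  | comp (u v t : List Col) (h : ∀ c ∈ u ++ .half :: v, c = .half) (ht : ∀ c ∈ t, c = .half)
      (x : P.Obj (.full :: (u ++ .half :: v)) .half (.one h)) (y : P.Obj t .half (.zero ht))

variable {P}

def AscRel.source : AscRel P → List Col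
  | .swap u v _ _ => u ++ .half :: .half :: v
  | .comp u v t _ _ _ _ => u ++ (t ++ v)

noncomputable def AscRel.lhs :
    ∀ r : AscRel P, wordTensor (fun _ => A) r.source ⟶ preAsc i P A
  | .swap u v h x => preAsc.ι i A h (P.comp sigColl₁_unit (.one h) (.one h) 0 rfl
      (Graft.swap .half (.full :: u) .half .half v) (P.one .half sigColl₁_unit) x)
  | .comp u v t h ht x y => preAsc.ι i A (half_append h ht)
      (P.comp (.one h) (.zero ht) (.one (half_append h ht)) (mid (.full :: u) .half v)
        (get_mid (.full :: u) .half v) (Graft.planar (.full :: u) .half v t) x y)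

variable {i A}

noncomputable def AscRel.rhs (α : Alg i P.degZero (fun _ => A)) :
    ∀ r : AscRel P, wordTensor (fun _ => A) r.source ⟶ preAsc i P A
  | .swap u v h x => swapHom (fun _ => A) .half .half v u ≫ preAsc.ι i A h x
  | .comp u v t h ht x y => splice (fun _ => A) (c := .half) v
      (α.op (k := .half) (h := .mk ht) y) u ≫ preAsc.ι i A h x

/-- The module `A^sc`, the quotient of `∐ P(1, m) ⊗ A ^ m` that makes the action of the degree zero
part by composition from the right agree with its action on `A`. -/
noncomputable def Asc (α : Alg i P.degZero (fun _ => A)) : C :=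
  coequalizer (Sigma.desc (AscRel.lhs i A)) (Sigma.desc (AscRel.rhs α))

noncomputable def Asc.ι (α : Alg i P.degZero (fun _ => A)) {w : List Col}
    (h : ∀ c ∈ w, c = .half) (x : P.Obj (.full :: w) .half (.one h)) :
    wordTensor (fun _ => A) w ⟶ Asc α :=
  preAsc.ι i A h x ≫ coequalizer.π (Sigma.desc (AscRel.lhs i A)) (Sigma.desc (AscRel.rhs α))

variable [MonoidalClosed C]

/-- Evaluation of a map `Asc ⟶ A` on the elements `x ⊗ a`. -/
noncomputable def Asc.eval (α : Alg i P.degZero (fun _ => A)) {w : List Col}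
    (h : ∀ c ∈ w, c = .half) (x : P.Obj (.full :: w) .half (.one h)) :
    (ihom (Asc α)).obj A ⊗ wordTensor (fun _ => A) w ⟶ A :=
  (ihom (Asc α)).obj A ◁ Asc.ι α h x ≫ (β_ _ _).hom ≫ (ihom.ev (Asc α)).app A

variable (P) in
/-- An operation `y` of degree zero with a distinguished input between `u` and `v`, and elements
`x ⊗ t` of `A^sc` to be inserted there. The action of `y` on the module `A^sc` is
`y (a', x ⊗ a, a'') = (y ∘ x) ⊗ (a', a, a'')`. -/
structure HochRel where
  u : List Col
  v : List Col
  t : List Col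
  h : ∀ c ∈ u ++ .half :: v, c = .half
  ht : ∀ c ∈ t, c = .half
  y : P.Obj (u ++ .half :: v) .half (.zero h)
  x : P.Obj (.full :: t) .half (.one ht)

/-- A map `f : A^sc ⟶ A` is sent to `(a', a, a'') ↦ f (y (a', x ⊗ a, a''))`. -/
noncomputable def HochRel.lhs (α : Alg i P.degZero (fun _ => A)) (r : HochRel P) :
    (ihom (Asc α)).obj A ⟶ (ihom (wordTensor (fun _ => A) (r.u ++ (r.t ++ r.v)))).obj A :=
  (MonoidalClosed.pre (Asc.ι α (half_append r.h r.ht)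
    (P.comp (.zero r.h) (.one r.ht) (.one (half_append r.h r.ht)) (mid r.u .half r.v)
      (get_mid r.u .half r.v) (Graft.planarFull r.u .half r.v r.t) r.y r.x))).app A

/-- A map `f : A^sc ⟶ A` is sent to `(a', a, a'') ↦ y (a', f (x ⊗ a), a'')`. -/
noncomputable def HochRel.rhs (α : Alg i P.degZero (fun _ => A)) (r : HochRel P) :
    (ihom (Asc α)).obj A ⟶ (ihom (wordTensor (fun _ => A) (r.u ++ (r.t ++ r.v)))).obj A :=
  MonoidalClosed.curry ((β_ _ _).hom ≫
    spliceParam (fun _ => A) ((ihom (Asc α)).obj A) (c := .half) r.v (Asc.eval α r.ht r.x) r.u ≫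
      α.op (k := .half) (h := .mk r.h) r.y)

/-- The object of module maps from `A^sc` to `A`, as a subobject of the internal hom. -/
noncomputable def Hoch (α : Alg i P.degZero (fun _ => A)) : C :=
  equalizer (Pi.lift (HochRel.lhs α)) (Pi.lift (HochRel.rhs α))

/-- Evaluation on the elements `x ⊗ a` of `A^sc`. -/
noncomputable def Hoch.eval (α : Alg i P.degZero (fun _ => A)) {w : List Col}
    (h : ∀ c ∈ w, c = .half) (x : P.Obj (.full :: w) .half (.one h)) :
    Hoch α ⊗ wordTensor (fun _ => A) w ⟶ A :=
  equalizer.ι (Pi.lift (HochRel.lhs α)) (Pi.lift (HochRel.rhs α)) ▷ _ ≫ Asc.eval α h x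


end Hochschild

section Main

universe v u

variable {C : Type u} [Category.{v} C] [MonoidalCategory C] [SymmetricCategory C]
  {i : CGTop ⥤ C} [i.Braided]

/-- Maps of algebras. -/
def Alg.IsHom {S : List Col → Col → Prop} {P : OperadData S} {X Y : Col → C} (α : Alg i P X)
    (β : Alg i P Y) (g : ∀ c, X c ⟶ Y c) : Prop :=
  ∀ (w : List Col) (k : Col) (h : S w k) (x : P.Obj w k h),
    α.op x ≫ g k = wordTensorMap w (fun c _ => g c) ≫ β.op x

theorem Alg.IsHom.id {S : List Col → Col → Prop} {P : OperadData S} {X : Col → C}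
    (α : Alg i P X) : α.IsHom α (fun c => 𝟙 (X c)) := by
  intro w k h x
  rw [wordTensorMap_id, Category.comp_id, Category.id_comp]

theorem Alg.IsHom.comp {S : List Col → Col → Prop} {P : OperadData S} {X Y Z : Col → C}
    {α : Alg i P X} {β : Alg i P Y} {γ : Alg i P Z} {g : ∀ c, X c ⟶ Y c} {g' : ∀ c, Y c ⟶ Z c}
    (h : α.IsHom β g) (h' : β.IsHom γ g') : α.IsHom γ (fun c => g c ≫ g' c) := by
  intro w k hw x
  rw [wordTensorMap_comp w (fun c _ => g c) (fun c _ => g' c), Category.assoc, ← h' w k hw x,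
    ← Category.assoc, h w k hw x, Category.assoc]

variable (i) in
/-- Algebras in `C` over a one-coloured operad. -/
structure AlgO (O : OperadData sigFull) where
  carrier : C
  alg : Alg i O (fun _ => carrier)

@[ext]
structure AlgO.Hom {O : OperadData sigFull} (B B' : AlgO i O) where
  hom : B.carrier ⟶ B'.carrier
  isHom : B.alg.IsHom B'.alg (fun _ => hom)

instance (O : OperadData sigFull) : Category (AlgO i O) where
  Hom B B' := AlgO.Hom B B'
  id B := ⟨𝟙 _, .id _⟩
  comp f g := ⟨f.hom ≫ g.hom, f.isHom.comp g.isHom⟩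
  id_comp f := AlgO.Hom.ext (Category.id_comp _)
  comp_id f := AlgO.Hom.ext (Category.comp_id _)
  assoc f g h := AlgO.Hom.ext (Category.assoc _ _ _)

def pair (B A : C) : Col → C
  | .full => B
  | .half => A

def pairMap {B B' : C} (A : C) (f : B ⟶ B') : ∀ c, pair B A c ⟶ pair B' A c
  | .full => f
  | .half => 𝟙 A

def toHalf (B A : C) : ∀ c, c = Col.half → (pair B A c ⟶ A)
  | .half, _ => 𝟙 A

def toFull (B A : C) : ∀ c, c = Col.full → (pair B A c ⟶ B)
  | .full, _ => 𝟙 B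

variable {P : OperadData sigColl₁} {O : OperadData sigFull} {ρ : OperadHom O (endOperad P)}

/-- The structure `θ` on `(B, A)` extends the structure `α` on `A`. -/
def Extends {A B : C} (α : Alg i P.degZero (fun _ => A)) (θ : Alg i (rtimes P O ρ) (pair B A)) :
    Prop :=
  ∀ (w : List Col) (h : ∀ c ∈ w, c = .half) (x : P.Obj w .half (.zero h)),
    θ.op (w := w) (k := .half) (h := trivial) (EObj.gen (.zero h) x) =
      wordTensorMap w (fun c hc => toHalf B A c (h c hc)) ≫ α.op (k := .half) (h := .mk h) x

/-- `g` is a map of algebras over `O`, from `B` with the restriction of `θ` to `B'`. -/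
def IsFullHom {A B B' : C} (θ : Alg i (rtimes P O ρ) (pair B A)) (η : Alg i O (fun _ => B'))
    (g : B ⟶ B') : Prop :=
  ∀ (w : List Col) (h : ∀ c ∈ w, c = .full) (x : O.Obj w .full (.mk h)),
    θ.op (w := w) (k := .full) (h := trivial) (⟨⟨h⟩, x⟩ : RtimesObj P O w .full) ≫ g =
      wordTensorMap w (fun c hc => toFull B A c (h c hc) ≫ g) ≫ η.op x

variable (ρ) in
/-- Algebras of the form `(B, A)` where the induced structure on `A` is the given one. -/
structure AlgUnder {A : C} (α : Alg i P.degZero (fun _ => A)) where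
  carrier : C
  alg : Alg i (rtimes P O ρ) (pair carrier A)
  extends_alg : Extends α alg

@[ext]
structure AlgUnder.Hom {A : C} {α : Alg i P.degZero (fun _ => A)} (B B' : AlgUnder ρ α) where
  hom : B.carrier ⟶ B'.carrier
  isHom : B.alg.IsHom B'.alg (pairMap A hom)

theorem pairMap_id (B A : C) : pairMap A (𝟙 B) = fun c => 𝟙 (pair B A c) := by
  funext c; cases c <;> rfl

theorem pairMap_comp {B B' B'' : C} (A : C) (f : B ⟶ B') (g : B' ⟶ B'') :
    pairMap A (f ≫ g) = fun c => pairMap A f c ≫ pairMap A g c := by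
  funext c; cases c
  · rfl
  · exact (Category.id_comp _).symm

instance {A : C} (α : Alg i P.degZero (fun _ => A)) : Category (AlgUnder ρ α) where
  Hom B B' := AlgUnder.Hom B B'
  id B := ⟨𝟙 _, by rw [pairMap_id]; exact .id _⟩
  comp f g := ⟨f.hom ≫ g.hom, by rw [pairMap_comp]; exact f.isHom.comp g.isHom⟩
  id_comp f := AlgUnder.Hom.ext (Category.id_comp _)
  comp_id f := AlgUnder.Hom.ext (Category.comp_id _)
  assoc f g h := AlgUnder.Hom.ext (Category.assoc _ _ _)

variable [HasLimitsOfSize.{0, 0} C] [HasColimitsOfSize.{0, 0} C] [MonoidalClosed C]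

/-- The structure on `(Hoch A, A)` is the induced one: it extends the structure on `A`, and the
operations of degree one act by evaluation. -/
structure IsInduced {A : C} (α : Alg i P.degZero (fun _ => A))
    (θ : Alg i (rtimes P O ρ) (pair (Hoch α) A)) : Prop where
  extends_alg : Extends α θ
  eval : ∀ (w : List Col) (h : ∀ c ∈ w, c = .half) (x : P.Obj (.full :: w) .half (.one h)),
    θ.op (w := .full :: w) (k := .half) (h := trivial) (EObj.gen (.one h) x) =
      Hoch α ◁ wordTensorMap w (fun c hc => toHalf (Hoch α) A c (h c hc)) ≫ Hoch.eval α h x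

end Main

/-- The Boardman-Vogt construction on the degree 0-1 part of the swiss cheese operad. Its degree zero
part is the model of the little `d - 1` discs operad, and its free extension is `SC^{h∞}`. -/
noncomputable def SC₁ (d : ℕ) [NeZero d] : OperadData sigColl₁ :=
  ((swissCheese d).restrict sigColl₁ fun _ _ _ => trivial).W.toOperadData

end Cheese

universe v u

set_option linter.unusedSectionVars false

/-! The theorem is a tensor-hom adjunction carried out over an operad. An algebra on `(B, A)` over
the semidirect product that extends `α` splits into three data (`Alg.exists_decomposition`,
`HalfAlg.Compat.exists_alg`): an action of the operations of degree at most one on `(B, A)`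
restricting to `α` (`HalfAlg`); an `O`-algebra structure on `B`; and the condition `HalfAlg.Compat`
that acting on an operation through `ρ` becomes inserting the operation of `O` at a full input.
Higher degrees carry no further data, because they are freely generated by degrees zero and one
(`HalfAlg.eval`, `HalfAlg.eval_unique`).

The first datum is a family of maps from `B ⊗ A ⊗ ⋯ ⊗ A` to `A`, indexed continuously by the
operations of degree one (`ModuleFamily`). Equivariance and compatibility with composition from the
right say that the family factors through the quotient `Asc`; compatibility with composition from
the left says that the transposed map lands in the equalizer `Hoch`. So the first datum is a map
from `B` to `Hoch α` (`Hoch.exists_lift`, `Hoch.hom_ext`, `HalfAlg.Restricts.exists_map`).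

The same universal property makes `O` act on `Hoch α`. For a bimodule map `φ` of degree `n`,
evaluating `φ x` on `n` Hochschild factors and on factors `A` is again a module family, now with
parameter object the `n`-fold tensor power of `Hoch α`; its classifying map is `BimodMap.hoch`.
Since maps to `Hoch α` are detected by evaluation, this assignment respects units and composition
(`BimodMap.hoch_one`, `BimodMap.hoch_comp`), and by `BimodMap.eval_act` it satisfies `Compat`.
Detection by evaluation also shows that, given a classifying map of `B`, `Compat` amounts to that
map being a map of `O`-algebras (`HalfAlg.IsHom.isHom_hochAlgO`, `HalfAlg.IsHom.compat`). This
yields the isomorphism of categories and the uniqueness of the structure on `(Hoch α, A)`.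

Two technical supports are needed. Every grafting must act on tensor words by a well-defined
insertion `Graft.ins` obeying the operad laws (`Graft.ins_seq`, `Graft.ins_par`); this rests on the
coherence statement `Coh.unique`. And pointwise statements must suffice: because `i` is a left
adjoint and `C` is closed, a map out of `i.obj T ⊗ X` is the same as a continuous family of maps
indexed by `T` (`continuous_homTop_iff`, `hom_ext_pt`). Nothing about discs is used beyond the
operad laws, so the argument runs for any operad `P` in degrees zero and one. -/

namespace Cheese

/-! ### Coherence: permutations of tensor factors with distinct labels are unique. -/

section Coherence

variable {C : Type u} [Category.{v} C] [MonoidalCategory C] [SymmetricCategory C]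

/-- The exchange of the first two of three tensor factors. -/
def exch (a b c : C) : a ⊗ b ⊗ c ⟶ b ⊗ a ⊗ c :=
  (α_ a b c).inv ≫ (β_ a b).hom ▷ c ≫ (α_ b a c).hom

theorem exch_natural {a b c a' b' c' : C} (f : a ⟶ a') (g : b ⟶ b') (h : c ⟶ c') :
    (f ⊗ₘ g ⊗ₘ h) ≫ exch a' b' c' = exch a b c ≫ (g ⊗ₘ f ⊗ₘ h) := by
  have h1 : ((f ⊗ₘ g) ⊗ₘ h) ≫ (β_ a' b').hom ▷ c' = (β_ a b).hom ▷ c ≫ ((g ⊗ₘ f) ⊗ₘ h) := by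
    rw [← tensorHom_id, ← tensorHom_id, MonoidalCategory.tensorHom_comp_tensorHom,
      MonoidalCategory.tensorHom_comp_tensorHom, BraidedCategory.braiding_naturality,
      Category.comp_id, Category.id_comp]
  rw [exch, associator_inv_naturality_assoc, reassoc_of% h1, exch, Category.assoc, Category.assoc,
    associator_naturality]

theorem exch_exch (a b c : C) : exch a b c ≫ exch b a c = 𝟙 _ := by
  simp [exch, ← comp_whiskerRight_assoc]

theorem exch_right (a b : C) {c c' : C} (h : c ⟶ c') :
    a ◁ b ◁ h ≫ exch a b c' = exch a b c ≫ b ◁ a ◁ h := by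
  simpa using exch_natural (𝟙 a) (𝟙 b) h

/-- The braid relation for exchanges. -/
theorem exch_braid (a b c d : C) :
    exch a b (c ⊗ d) ≫ b ◁ exch a c d ≫ exch b c (a ⊗ d) =
      a ◁ exch b c d ≫ exch a c (b ⊗ d) ≫ c ◁ exch a b d := by
  -- The last factor `d` is a spectator; stripping it off leaves one side of the Yang-Baxter
  -- equation.
  calc _ = 𝟙 _ ⊗≫ ((β_ a b).hom ▷ c ⊗≫ b ◁ (β_ a c).hom ⊗≫ (β_ b c).hom ▷ a) ▷ d ⊗≫ 𝟙 _ := by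
        simp only [exch]; monoidal
    _ = _ := by
        rw [BraidedCategory.yang_baxter']; simp only [exch]; monoidal

/-- This and the next three identities are the cases of `Pull.swap`. They are isolated for arbitrary
objects, since only the shape of the diagrams matters and not the words behind the objects. -/
theorem exch_head (a b c : C) :
    exch a b c ≫ b ◁ 𝟙 _ ≫ exch b a c = 𝟙 _ ≫ a ◁ 𝟙 _ := by
  simp [exch_exch]

theorem exch_tail_head (a b c : C) :
    exch a b c ≫ 𝟙 _ = (a ◁ 𝟙 _ ≫ exch a b c) ≫ b ◁ 𝟙 _ := by
  simp

theorem exch_tail_tail (a b : C) {c v w : C} (q : v ⟶ c ⊗ w) :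
    exch a b v ≫ b ◁ (a ◁ q ≫ exch a c w) ≫ exch b c (a ⊗ w) =
      (a ◁ (b ◁ q ≫ exch b c w) ≫ exch a c (b ⊗ w)) ≫ c ◁ exch a b w := by
  simp only [MonoidalCategory.whiskerLeft_comp, Category.assoc]
  rw [← reassoc_of% (exch_right a b q), exch_braid]

theorem exch_cons (b : C) {c u u' w w' : C} {s : u ⟶ u'} {p : u ⟶ c ⊗ w} {p' : u' ⟶ c ⊗ w'}
    {f : w ⟶ w'} (h : s ≫ p' = p ≫ c ◁ f) :
    b ◁ s ≫ b ◁ p' ≫ exch b c w' = (b ◁ p ≫ exch b c w) ≫ c ◁ b ◁ f := by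
  rw [← MonoidalCategory.whiskerLeft_comp_assoc, h, MonoidalCategory.whiskerLeft_comp,
    Category.assoc, Category.assoc, exch_right]

variable (X : Col → C)


theorem swapHom_cons (a b c : Col) (v u : List Col) :
    swapHom X a b v (c :: u) = X c ◁ swapHom X a b v u := rfl

theorem swapHom_swapHom (a b : Col) (v u : List Col) :
    swapHom X a b v u ≫ swapHom X b a v u = 𝟙 _ := by
  induction u with
  | nil => exact exch_exch _ _ _
  | cons c u ih =>
    simp only [swapHom_cons]
    erw [← MonoidalCategory.whiskerLeft_comp, ih, MonoidalCategory.whiskerLeft_id]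
    rfl

/-- `Coh X w a w' a' f`: the inputs `w` and `w'` are labelled by `a` and `a'`, and `f` is the permutation
of tensor factors that preserves the labels. -/
inductive Coh {I : Type} : ∀ (w : List Col) (_ : List I) (w' : List Col) (_ : List I),
    (wordTensor X w ⟶ wordTensor X w') → Prop
  | refl (w : List Col) (a : List I) (h : w.length = a.length) : Coh w a w a (𝟙 _)
  | swap {u v : List Col} {au av : List I} (hu : u.length = au.length) (hv : v.length = av.length)
      (c d : Col) (x y : I) : Coh (u ++ c :: d :: v) (au ++ x :: y :: av) (u ++ d :: c :: v)
        (au ++ y :: x :: av) (swapHom X d c v u)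
  | trans {w w' w'' : List Col} {a a' a'' : List I} {f : wordTensor X w ⟶ wordTensor X w'}
      {g : wordTensor X w' ⟶ wordTensor X w''} (hf : Coh w a w' a' f) (hg : Coh w' a' w'' a'' g) :
      Coh w a w'' a'' (f ≫ g)

namespace Coh
variable {X} {I : Type} {w w' w'' : List Col} {a a' a'' : List I}
  {f : wordTensor X w ⟶ wordTensor X w'}

theorem perm (h : Coh X w a w' a' f) : a.Perm a' := by
  induction h with
  | refl => exact .refl _
  | swap => exact (List.Perm.swap _ _ _).append_left _
  | trans _ _ h1 h2 => exact h1.trans h2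

theorem word_perm (h : Coh X w a w' a' f) : w.Perm w' := by
  induction h with
  | refl => exact .refl _
  | swap => exact (List.Perm.swap _ _ _).append_left _
  | trans _ _ h1 h2 => exact h1.trans h2

theorem length (h : Coh X w a w' a' f) : w.length = a.length := by
  induction h with
  | refl _ _ h => exact h
  | swap hu hv => simp [hu, hv]
  | trans _ _ h1 h2 => exact h1

theorem length' (h : Coh X w a w' a' f) : w'.length = a'.length := by
  rw [← h.perm.length_eq, ← h.word_perm.length_eq, h.length]

theorem cons (h : Coh X w a w' a' f) (c : Col) (x : I) :
    Coh X (c :: w) (x :: a) (c :: w') (x :: a') (X c ◁ f) := by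
  induction h with
  | refl w a h =>
    rw [MonoidalCategory.whiskerLeft_id]
    exact .refl _ _ (by simp [h])
  | @swap u v au av hu hv c' d' x' y' =>
    exact Coh.swap (u := c :: u) (au := x :: au) (by simp [hu]) hv c' d' x' y'
  | trans _ _ h1 h2 =>
    rw [MonoidalCategory.whiskerLeft_comp]
    exact .trans h1 h2

theorem symm (h : Coh X w a w' a' f) : ∃ g, Coh X w' a' w a g ∧ f ≫ g = 𝟙 _ ∧ g ≫ f = 𝟙 _ := by
  induction h with
  | refl w a h => exact ⟨𝟙 _, .refl _ _ h, by simp, by simp⟩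
  | swap hu hv c d x y =>
    exact ⟨_, .swap hu hv d c y x, swapHom_swapHom _ _ _ _ _, swapHom_swapHom _ _ _ _ _⟩
  | trans _ _ h1 h2 =>
    obtain ⟨g1, c1, e1, e1'⟩ := h1
    obtain ⟨g2, c2, e2, e2'⟩ := h2
    refine ⟨_, .trans c2 c1, ?_, ?_⟩
    · rw [Category.assoc, reassoc_of% e2, e1]
    · rw [Category.assoc, reassoc_of% e1', e2']

theorem relabel {J : Type} (φ : I → J) (h : Coh X w a w' a' f) :
    Coh X w (a.map φ) w' (a'.map φ) f := by
  induction h with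
  | refl w a h => exact .refl _ _ (by rw [List.length_map]; exact h)
  | swap hu hv c d x y =>
    simp only [List.map_append, List.map_cons]
    exact .swap (by simp [hu]) (by simp [hv]) _ _ _ _
  | trans _ _ h1 h2 => exact .trans h1 h2

/-- The generators of `List.Perm` are realized by tensoring with an identity, by a symmetry and by
composition. When the colour is a function of the label, a permutation of labels is all that has to
be exhibited. -/
theorem exists_of_perm (col : I → Col) (h : a.Perm a') :
    ∃ f, Coh X (a.map col) a (a'.map col) a' f := by
  induction h with
  | nil => exact ⟨_, .refl _ _ rfl⟩
  | cons x _ ih => obtain ⟨f, hf⟩ := ih; exact ⟨_, hf.cons _ _⟩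
  | swap x y l =>
    exact ⟨_, .swap (u := []) (v := l.map col) (au := []) (av := l) rfl (by rw [List.length_map]) _ _ _ _⟩
  | trans _ _ h1 h2 =>
    obtain ⟨f, hf⟩ := h1
    obtain ⟨g, hg⟩ := h2
    exact ⟨_, hf.trans hg⟩

end Coh

/-- `Pull X x w a c w₀ a₀ p`: the map `p` moves the factor with label `x` to the front. -/
inductive Pull {I : Type} (x : I) : ∀ (w : List Col) (_ : List I) (c : Col) (w₀ : List Col)
    (_ : List I), (wordTensor X w ⟶ X c ⊗ wordTensor X w₀) → Prop
  | head (c : Col) (w : List Col) (a : List I) : Pull x (c :: w) (x :: a) c w a (𝟙 _)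
  | tail {w w₀ : List Col} {a a₀ : List I} {c : Col} (d : Col) (y : I) (hxy : x ≠ y)
      {p : wordTensor X w ⟶ X c ⊗ wordTensor X w₀} (h : Pull x w a c w₀ a₀ p) :
      Pull x (d :: w) (y :: a) c (d :: w₀) (y :: a₀) (X d ◁ p ≫ exch _ _ _)

namespace Pull
variable {X} {I : Type} {w w' w₀ : List Col} {a a' a₀ : List I} {x : I} {c : Col}

theorem exists_of_mem (h : w.length = a.length) (hx : x ∈ a) :
    ∃ c w₀ a₀ p, Pull X x w a c w₀ a₀ p := by
  induction a generalizing w with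
  | nil => simp at hx
  | cons y a ih =>
    cases w with
    | nil => simp at h
    | cons d w =>
      by_cases hxy : x = y
      · subst hxy; exact ⟨_, _, _, _, .head _ _ _⟩
      · obtain ⟨c, w₀, a₀, p, hp⟩ := ih (w := w) (by simpa using h) (by simpa [hxy] using hx)
        exact ⟨_, _, _, _, .tail d y hxy hp⟩

theorem perm {p : wordTensor X w ⟶ X c ⊗ wordTensor X w₀} (h : Pull X x w a c w₀ a₀ p) :
    a.Perm (x :: a₀) := by
  induction h with
  | head => exact .refl _
  | tail d y hxy h ih => exact (ih.cons y).trans (.swap _ _ _)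

/-- Pulling out the factor `x` commutes with one exchange of neighbours, up to a permutation of what
remains. The remaining permutation is trivial if `x` is one of the exchanged labels and is the same
exchange otherwise. -/
theorem swap {u v : List Col} {au av : List I} (hu : u.length = au.length)
    (hv : v.length = av.length) (c' d : Col) (x' y : I) (hn : (au ++ x' :: y :: av).Nodup)
    {p : wordTensor X _ ⟶ X c ⊗ wordTensor X w₀}
    (h : Pull X x (u ++ c' :: d :: v) (au ++ x' :: y :: av) c w₀ a₀ p) :
    ∃ w₀' a₀' p' f', Pull X x (u ++ d :: c' :: v) (au ++ y :: x' :: av) c w₀' a₀' p' ∧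
      Coh X w₀ a₀ w₀' a₀' f' ∧ swapHom X d c' v u ≫ p' = p ≫ X c ◁ f' := by
  induction u generalizing au c w₀ a₀ with
  | nil =>
    obtain rfl : au = [] := by simpa using hu.symm
    simp only [List.nil_append, List.nodup_cons, List.mem_cons, not_or] at hn
    cases h with
    | head =>
      -- Distinctness of labels enters here: after the exchange, `x` stands behind `y`, and `Pull`
      -- may only pass over a label different from `x`.
      refine ⟨_, _, _, _, .tail d y hn.1.1 (.head _ _ _), .refl _ _ (by simp [hv]), ?_⟩
      exact exch_head _ _ _
    | tail _ _ hxy h =>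
      cases h with
      | head =>
        refine ⟨_, _, _, _, .head _ _ _, .refl _ _ (by simp [hv]), ?_⟩
        exact exch_tail_head _ _ _
      | @tail _ w₁ _ a₁ _ _ _ hxy' q h =>
        have hl : w₁.length = a₁.length := by
          clear hn hxy hxy'
          induction h with
          | head => simpa using hv
          | tail _ _ _ _ ih => simp [ih (by simpa using hv)]
        -- The pulled factor lies behind both exchanged ones and crosses them in either order: this
        -- is the braid relation.
        refine ⟨_, _, _, _, .tail _ _ hxy' (.tail _ _ hxy h),
          .swap (X := X) (u := []) (v := w₁) (au := []) (av := a₁) rfl hl c' d x' y, ?_⟩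
        exact exch_tail_tail _ _ q
  | cons b u ih =>
    cases au with
    | nil => simp at hu
    | cons z au =>
      have hn' : (au ++ x' :: y :: av).Nodup := (List.nodup_cons.1 hn).2
      cases h with
      | head =>
        refine ⟨_, _, _, _, .head _ _ _, .swap (by simpa using hu) hv _ _ _ _, ?_⟩
        erw [Category.id_comp, Category.comp_id]
        rfl
      | tail _ _ hxy h =>
        obtain ⟨w₀', a₀', p', f', h1, h2, h3⟩ := ih (by simpa using hu) hn' h
        refine ⟨_, _, _, _, .tail _ _ hxy h1, h2.cons _ _, ?_⟩
        exact exch_cons _ h3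

/-- It suffices to treat a single exchange, distinctness of labels being inherited along the
permutation. This lets a statement about permutations be reduced to a word with one factor fewer. -/
theorem coh {f : wordTensor X w ⟶ wordTensor X w'} (hf : Coh X w a w' a' f) (hn : a.Nodup)
    {p : wordTensor X w ⟶ X c ⊗ wordTensor X w₀} (h : Pull X x w a c w₀ a₀ p) :
    ∃ w₀' a₀' p' f', Pull X x w' a' c w₀' a₀' p' ∧ Coh X w₀ a₀ w₀' a₀' f' ∧
      f ≫ p' = p ≫ X c ◁ f' := by
  induction hf generalizing w₀ a₀ c with
  | refl w a hl =>
    refine ⟨_, _, _, 𝟙 _, h, .refl _ _ ?_, by simp⟩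
    clear hn
    induction h with
    | head => simpa using hl
    | tail _ _ _ _ ih => simp [ih (by simpa using hl)]
  | swap hu hv c₁ d₁ x₁ y₁ => exact swap hu hv c₁ d₁ x₁ y₁ hn h
  | trans hf hg h1 h2 =>
    obtain ⟨w₁, a₁, p₁, f₁, c1, c2, c3⟩ := h1 hn h
    obtain ⟨w₂, a₂, p₂, f₂, d1, d2, d3⟩ := h2 (hf.perm.nodup_iff.1 hn) c1
    exact ⟨_, _, _, _, d1, c2.trans d2, by
      rw [Category.assoc, d3, reassoc_of% c3, MonoidalCategory.whiskerLeft_comp]⟩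

/-- A label at the head can only be pulled out by `head`, since `tail` requires a different first
label. -/
theorem of_head {d : Col} {p : wordTensor X (d :: w) ⟶ X c ⊗ wordTensor X w₀}
    (h : Pull X x (d :: w) (x :: a) c w₀ a₀ p) :
    ∃ (hc : d = c) (hw : w = w₀), a = a₀ ∧ p = eqToHom (by rw [hc, hw]; rfl) := by
  cases h with
  | head => exact ⟨rfl, rfl, rfl, rfl⟩
  | tail _ _ hxy => exact absurd rfl hxy

end Pull

namespace Coh
variable {X} {I : Type} {w w' w'' v v' : List Col} {a a' a'' b b' : List I}
  {f g : wordTensor X w ⟶ wordTensor X w'}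

theorem eq_id (h : Coh X w a w' a' f) (hw : w = []) : ∃ e : w = w', f = eqToHom (by rw [e]) := by
  induction h with
  | refl => exact ⟨rfl, rfl⟩
  | swap => simp at hw
  | trans _ _ h1 h2 =>
    obtain ⟨e, h1⟩ := h1 hw
    obtain ⟨e', h2⟩ := h2 (e ▸ hw)
    exact ⟨e.trans e', by rw [h1, h2, eqToHom_trans]⟩

/-- The permutation of tensor factors between two labelled words is unique. -/
theorem unique (hn : a.Nodup) (hf : Coh X w a w' a' f) (hg : Coh X w a w' a' g) : f = g := by
  induction w' generalizing w a a' with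
  | nil =>
    obtain rfl : w = [] := by simpa using hf.word_perm
    obtain ⟨_, h1⟩ := hf.eq_id rfl
    obtain ⟨_, h2⟩ := hg.eq_id rfl
    rw [h1, h2]
  | cons c w' ih =>
    cases a' with
    | nil => simpa using hf.length'
    | cons x a' =>
      -- The label that comes first in the target is pulled out of the source. Both permutations
      -- then become the identity of that factor tensored with a permutation of shorter words, where
      -- induction applies.
      obtain ⟨c', w₀, a₀, p, hp⟩ := Pull.exists_of_mem (X := X) (x := x) hf.length
        (hf.perm.mem_iff.2 (by simp))
      obtain ⟨w₁, a₁, p₁, f₁, c1, c2, c3⟩ := Pull.coh hf hn hp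
      obtain ⟨w₂, a₂, p₂, f₂, d1, d2, d3⟩ := Pull.coh hg hn hp
      obtain ⟨rfl, rfl, rfl, rfl⟩ := c1.of_head
      obtain ⟨_, rfl, rfl, rfl⟩ := d1.of_head
      have h0 : a₀.Nodup := (List.nodup_cons.1 (hp.perm.nodup_iff.1 hn)).2
      have := ih h0 c2 d2
      subst this
      erw [Category.comp_id] at c3 d3
      exact c3.trans d3.symm

/-- A permutation that preserves the first label is trivial on the first factor. -/
theorem of_cons {c c' : Col} {x : I} {f : wordTensor X (c :: w) ⟶ wordTensor X (c' :: w')}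
    (hf : Coh X (c :: w) (x :: a) (c' :: w') (x :: a') f) (hn : (x :: a).Nodup) :
    ∃ (hc : c = c') (f' : wordTensor X w ⟶ wordTensor X w'), Coh X w a w' a' f' ∧
      f = eqToHom (by rw [hc]) ▷ wordTensor X w ≫ X c' ◁ f' := by
  obtain ⟨w₁, a₁, p₁, f₁, c1, c2, c3⟩ := Pull.coh hf hn (.head _ _ _)
  obtain ⟨rfl, rfl, rfl, rfl⟩ := c1.of_head
  refine ⟨rfl, _, c2, ?_⟩
  erw [Category.comp_id, Category.id_comp] at c3
  rw [c3, eqToHom_refl, id_whiskerRight]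
  exact (Category.id_comp _).symm

end Coh

end Coherence

/-! ### Moving blocks of tensor factors past each other. -/

section Blocks

variable {C : Type u} [Category.{v} C] [MonoidalCategory C] [SymmetricCategory C]

theorem exch_unit (a b : C) : (λ_ (a ⊗ b)).inv = a ◁ (λ_ b).inv ≫ exch a (𝟙_ C) b := by
  simp [exch]

theorem exch_tensor_mid (a b c d : C) :
    exch a (b ⊗ c) d =
      a ◁ (α_ b c d).hom ≫ exch a b (c ⊗ d) ≫ b ◁ exch a c d ≫ (α_ b c (a ⊗ d)).inv := by
  simp only [exch, BraidedCategory.braiding_tensor_right_hom]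
  monoidal

theorem exch_tensor_left (a b c d : C) :
    exch (a ⊗ b) c d =
      (α_ a b (c ⊗ d)).hom ≫ a ◁ exch b c d ≫ exch a c (b ⊗ d) ≫ c ◁ (α_ a b d).inv := by
  simp only [exch, BraidedCategory.braiding_tensor_left_hom]
  monoidal

theorem exch_split (a b : C) {z v w : C} (s : z ⟶ v ⊗ w) :
    exch a b z ≫ b ◁ (a ◁ s ≫ (α_ a v w).inv) ≫ (α_ b (a ⊗ v) w).inv =
      (a ◁ (b ◁ s ≫ (α_ b v w).inv) ≫ (α_ a (b ⊗ v) w).inv) ≫ exch a b v ▷ w := by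
  simp only [MonoidalCategory.whiskerLeft_comp, Category.assoc]
  rw [← reassoc_of% (exch_right a b s)]
  simp only [exch]
  monoidal

/-- Here and in the following lemmas ending in `_cons`, `s`, `p`, `q` stand for splittings of the
tail of a word. Each lemma is the induction step for one compatibility of `splitHom` with
permutations. -/
theorem split_swap_cons (b : C) {z z' v v' w : C} {s : z ⟶ v ⊗ w} {s' : z' ⟶ v' ⊗ w}
    {f : v ⟶ v'} {f' : z ⟶ z'} (h : f' ≫ s' = s ≫ f ▷ w) :
    b ◁ f' ≫ b ◁ s' ≫ (α_ b v' w).inv = (b ◁ s ≫ (α_ b v w).inv) ≫ (b ◁ f) ▷ w := by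
  rw [← MonoidalCategory.whiskerLeft_comp_assoc, h]
  simp

theorem split_nat_cons (b : C) {z z' v w w' : C} {s : z ⟶ v ⊗ w} {s' : z' ⟶ v ⊗ w'}
    {f : w ⟶ w'} {f' : z ⟶ z'} (h : f' ≫ s' = s ≫ v ◁ f) :
    b ◁ f' ≫ b ◁ s' ≫ (α_ b v w').inv = (b ◁ s ≫ (α_ b v w).inv) ≫ (b ⊗ v) ◁ f := by
  rw [← MonoidalCategory.whiskerLeft_comp_assoc, h]
  simp

theorem split_assoc_cons (b : C) {z z' y s t v m : C} {f : z ⟶ z'} {p : z' ⟶ m ⊗ v}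
    {p' : m ⟶ s ⊗ t} {q : z ⟶ s ⊗ y} {q' : y ⟶ t ⊗ v}
    (h : f ≫ p ≫ p' ▷ v = q ≫ s ◁ q' ≫ (α_ s t v).inv) :
    b ◁ f ≫ (b ◁ p ≫ (α_ b m v).inv) ≫ (b ◁ p' ≫ (α_ b s t).inv) ▷ v =
      (b ◁ q ≫ (α_ b s y).inv) ≫ (b ⊗ s) ◁ q' ≫ (α_ (b ⊗ s) t v).inv := by
  have h' := congrArg (fun k => b ◁ k) h
  simp only [MonoidalCategory.whiskerLeft_comp] at h'
  calc _ = (b ◁ f ≫ b ◁ p ≫ b ◁ (p' ▷ v)) ≫ (α_ b (s ⊗ t) v).inv ≫ (α_ b s t).inv ▷ v := by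
        simp
    _ = _ := by rw [h']; monoidal

theorem move_cons (c b : C) {z z' t v : C} {f : c ⊗ z ⟶ z'} {s : z ⟶ t ⊗ v}
    {s' : z' ⟶ t ⊗ c ⊗ v} (h : f ≫ s' = c ◁ s ≫ exch c t v) :
    (exch c b z ≫ b ◁ f) ≫ b ◁ s' ≫ (α_ b t (c ⊗ v)).inv =
      c ◁ (b ◁ s ≫ (α_ b t v).inv) ≫ exch c (b ⊗ t) v := by
  have h' := congrArg (fun k => b ◁ k) h
  simp only [MonoidalCategory.whiskerLeft_comp] at h'
  rw [Category.assoc, reassoc_of% h', exch_tensor_mid]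
  simp only [MonoidalCategory.whiskerLeft_comp, Category.assoc]
  rw [← reassoc_of% (exch_right c b s)]
  simp

theorem block_cons (c : C) {z z' z'' y s t v m : C} {f : z ⟶ z'} {g : c ⊗ z' ⟶ z''}
    {p : z' ⟶ t ⊗ m} {p' : m ⟶ s ⊗ v} {q : z ⟶ s ⊗ y} {q' : y ⟶ t ⊗ v}
    {p'' : z'' ⟶ t ⊗ c ⊗ m}
    (h : f ≫ p ≫ t ◁ p' = q ≫ s ◁ q' ≫ exch s t v)
    (hg : g ≫ p'' = c ◁ p ≫ exch c t m) :
    (c ◁ f ≫ g) ≫ p'' ≫ t ◁ (c ◁ p' ≫ (α_ c s v).inv) =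
      (c ◁ q ≫ (α_ c s y).inv) ≫ (c ⊗ s) ◁ q' ≫ exch (c ⊗ s) t v := by
  have h' := congrArg (fun k => c ◁ k) h
  simp only [MonoidalCategory.whiskerLeft_comp] at h'
  rw [Category.assoc, reassoc_of% hg, MonoidalCategory.whiskerLeft_comp,
    ← reassoc_of% (exch_right c t p'), reassoc_of% h', exch_tensor_left]
  simp

variable (X : Col → C)

/-- The tensor product of the identity of the factors `t` with a map. -/
def appMap : ∀ (t : List Col) {v v' : List Col}, (wordTensor X v ⟶ wordTensor X v') →
    (wordTensor X (t ++ v) ⟶ wordTensor X (t ++ v'))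
  | [], _, _, f => f
  | c :: t, _, _, f => X c ◁ appMap t f

theorem appMap_split (t : List Col) {v v' : List Col} (f : wordTensor X v ⟶ wordTensor X v') :
    appMap X t f ≫ splitHom X v' t = splitHom X v t ≫ wordTensor X t ◁ f := by
  induction t with
  | nil => exact leftUnitor_inv_naturality f
  | cons c t ih => exact split_nat_cons _ ih

theorem exists_split_inv (v t : List Col) : ∃ g : wordTensor X t ⊗ wordTensor X v ⟶
    wordTensor X (t ++ v), splitHom X v t ≫ g = 𝟙 _ ∧ g ≫ splitHom X v t = 𝟙 _ := by
  induction t with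
  | nil => exact ⟨(λ_ _).hom, Iso.inv_hom_id _, Iso.hom_inv_id _⟩
  | cons c t ih =>
    obtain ⟨g, h1, h2⟩ := ih
    refine ⟨(α_ _ _ _).hom ≫ X c ◁ g, ?_, ?_⟩
    · have : (X c ◁ splitHom X v t ≫ (α_ _ _ _).inv) ≫ (α_ _ _ _).hom ≫ X c ◁ g = 𝟙 _ := by
        simp [← MonoidalCategory.whiskerLeft_comp, h1]
      exact this
    · have : ((α_ _ _ _).hom ≫ X c ◁ g) ≫ X c ◁ splitHom X v t ≫ (α_ _ _ _).inv = 𝟙 _ := by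
        simp [← MonoidalCategory.whiskerLeft_comp_assoc, h2]
      exact this

variable {X} {I : Type}

theorem Coh.append_left {v v' : List Col} {b b' : List I} {f : wordTensor X v ⟶ wordTensor X v'}
    (h : Coh X v b v' b' f) : ∀ {t : List Col} {e : List I}, t.length = e.length →
    Coh X (t ++ v) (e ++ b) (t ++ v') (e ++ b') (appMap X t f)
  | [], [], _ => h
  | c :: t, x :: e, ht => (Coh.append_left h (t := t) (e := e) (by simpa using ht)).cons c x

/-- Extension by the identity on the left is `appMap`; on the right the product is not the recursive
one, so the extension is characterized through `splitHom`. -/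
theorem Coh.append_right {v : List Col} {r : List I} (hv : v.length = r.length)
    {t t' : List Col} {b b' : List I} {f : wordTensor X t ⟶ wordTensor X t'}
    (h : Coh X t b t' b' f) :
    ∃ f', Coh X (t ++ v) (b ++ r) (t' ++ v) (b' ++ r) f' ∧
      f' ≫ splitHom X v t' = splitHom X v t ≫ f ▷ wordTensor X v := by
  induction h with
  | refl w a h => exact ⟨𝟙 _, .refl _ _ (by simp [h, hv]), by simp⟩
  | @swap u v' au av hu hv' c d x y =>
    induction u generalizing au with
    | nil =>
      obtain rfl : au = [] := by simpa using hu.symm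
      exact ⟨_, .swap (X := X) (u := []) (v := v' ++ v) (au := []) (av := av ++ r) rfl
        (by simp [hv, hv']) c d x y, exch_split _ _ _⟩
    | cons e u ih =>
      cases au with
      | nil => simp at hu
      | cons z au =>
        obtain ⟨f', h1, h2⟩ := ih (au := au) (by simpa using hu)
        exact ⟨_, h1.cons e z, split_swap_cons _ h2⟩
  | trans _ _ h1 h2 =>
    obtain ⟨f, c1, e1⟩ := h1
    obtain ⟨g, c2, e2⟩ := h2
    exact ⟨_, c1.trans c2, by
      rw [Category.assoc, e2, reassoc_of% e1, comp_whiskerRight]⟩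

/-- The two bracketings of a concatenation are equal only propositionally. Treating the passage
between them as one more labelled permutation avoids casts and leaves it subject to `Coh.unique`. -/
theorem Coh.exists_assoc {s t v : List Col} {e b r : List I} (hs : s.length = e.length)
    (ht : t.length = b.length) (hv : v.length = r.length) :
    ∃ f, Coh X (s ++ (t ++ v)) (e ++ (b ++ r)) ((s ++ t) ++ v) ((e ++ b) ++ r) f ∧
      f ≫ splitHom X v (s ++ t) ≫ splitHom X t s ▷ wordTensor X v =
        splitHom X (t ++ v) s ≫ wordTensor X s ◁ splitHom X v t ≫ (α_ _ _ _).inv := by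
  induction s generalizing e with
  | nil =>
    obtain rfl : e = [] := by simpa using hs.symm
    refine ⟨𝟙 _, .refl _ _ (by simp [ht, hv]), ?_⟩
    have : ∀ {a b c : C} (f : a ⟶ b ⊗ c), 𝟙 _ ≫ f ≫ (λ_ b).inv ▷ c =
      (λ_ a).inv ≫ (𝟙_ C) ◁ f ≫ (α_ _ _ _).inv := by intros; simp
    exact this _
  | cons c s ih =>
    cases e with
    | nil => simp at hs
    | cons x e =>
      obtain ⟨f, h1, h2⟩ := ih (e := e) (by simpa using hs)
      exact ⟨_, h1.cons c x, split_assoc_cons _ h2⟩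

theorem Coh.exists_move (c : Col) (x : I) {t v : List Col} {b r : List I}
    (ht : t.length = b.length) (hv : v.length = r.length) :
    ∃ f, Coh X (c :: (t ++ v)) (x :: (b ++ r)) (t ++ c :: v) (b ++ x :: r) f ∧
      f ≫ splitHom X (c :: v) t = X c ◁ splitHom X v t ≫ exch (X c) (wordTensor X t) _ := by
  induction t generalizing b with
  | nil =>
    obtain rfl : b = [] := by simpa using ht.symm
    exact ⟨𝟙 _, .refl _ _ (by simp [hv]), (Category.id_comp _).trans (exch_unit _ _)⟩
  | cons d t ih =>
    cases b with
    | nil => simp at ht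
    | cons y b =>
      obtain ⟨f, h1, h2⟩ := ih (b := b) (by simpa using ht)
      exact ⟨_, .trans (.swap (X := X) (u := []) (v := t ++ v) (au := []) (av := b ++ r) rfl
        (by simpa [hv] using ht) c d x y) (h1.cons d y), move_cons _ _ h2⟩

/-- The block `s` crosses the block `t` one letter at a time, by `Coh.exists_move`. -/
theorem Coh.exists_block {s t v : List Col} {e b r : List I} (hs : s.length = e.length)
    (ht : t.length = b.length) (hv : v.length = r.length) :
    ∃ f, Coh X (s ++ (t ++ v)) (e ++ (b ++ r)) (t ++ (s ++ v)) (b ++ (e ++ r)) f ∧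
      f ≫ splitHom X (s ++ v) t ≫ wordTensor X t ◁ splitHom X v s =
        splitHom X (t ++ v) s ≫ wordTensor X s ◁ splitHom X v t ≫ exch _ _ _ := by
  induction s generalizing e with
  | nil =>
    obtain rfl : e = [] := by simpa using hs.symm
    refine ⟨𝟙 _, .refl _ _ (by simp [ht, hv]), ?_⟩
    have : ∀ {a b c : C} (f : a ⟶ b ⊗ c), 𝟙 _ ≫ f ≫ b ◁ (λ_ c).inv =
      (λ_ a).inv ≫ (𝟙_ C) ◁ f ≫ exch _ _ _ := by intros; simp [exch]
    exact this _
  | cons c s ih =>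
    cases e with
    | nil => simp at hs
    | cons x e =>
      obtain ⟨f, h1, h2⟩ := ih (e := e) (by simpa using hs)
      obtain ⟨g, h3, h4⟩ := Coh.exists_move (X := X) c x ht (v := s ++ v) (r := e ++ r)
        (by simpa [hv] using hs)
      exact ⟨_, (h1.cons c x).trans h3, block_cons _ h2 h4⟩

end Blocks

/-! ### Insertion of a map into labelled tensor factors. -/

section Insertion

variable {C : Type u} [Category.{v} C] [MonoidalCategory C] [SymmetricCategory C] {X : Col → C}
  {I : Type}

/-- `IsIns g w' a' b x w a f`: the map `f` applies `g` to the factors of `w'` labelled by `b`; the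
resulting factor has the label `x` in `w`, and the labels of all other factors are preserved. -/
def IsIns {t : List Col} {c : Col} (g : wordTensor X t ⟶ X c) (w' : List Col) (a' b : List I)
    (x : I) (w : List Col) (a : List I) (f : wordTensor X w' ⟶ wordTensor X w) : Prop :=
  ∃ (v : List Col) (r : List I) (p : wordTensor X w' ⟶ wordTensor X (t ++ v))
    (q : wordTensor X (c :: v) ⟶ wordTensor X w), Coh X w' a' (t ++ v) (b ++ r) p ∧
    Coh X (c :: v) (x :: r) w a q ∧ f = p ≫ splitHom X v t ≫ g ▷ wordTensor X v ≫ q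

/-- Permuting the untouched factors before or after applying `g` makes no difference, by the
interchange law. This is how two presentations of the same insertion are compared. -/
theorem ins_unique_aux {T V V₁ W W' Z Z₁ K : C} {g : T ⟶ K} {p : W' ⟶ Z} {s : Z ⟶ T ⊗ V}
    {m : Z ⟶ Z₁} {s₁ : Z₁ ⟶ T ⊗ V₁} {k : V ⟶ V₁} {q : K ⊗ V₁ ⟶ W} (h : m ≫ s₁ = s ≫ T ◁ k) :
    p ≫ s ≫ g ▷ V ≫ K ◁ k ≫ q = (p ≫ m) ≫ s₁ ≫ g ▷ V₁ ≫ q := by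
  rw [Category.assoc, reassoc_of% h, whisker_exchange_assoc]

theorem ins_seq_aux {T V S V3 T' M Z Z' Y Y' W W' W'' W3 D K : C} {g : T ⟶ K} {g' : S ⟶ D}
    {p1 : W' ⟶ Z} {p1i : Z ⟶ W'} {q1 : K ⊗ V ⟶ W} {sp1 : Z ⟶ T ⊗ V} {p3 : T' ⟶ M} {p3i : M ⟶ T'}
    {sp3 : M ⟶ S ⊗ V3} {q3 : D ⊗ V3 ⟶ T} {Q3 : D ⊗ Y ⟶ Z} {spY : Y ⟶ V3 ⊗ V} {p2 : W'' ⟶ Y'}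
    {spY' : Y' ⟶ S ⊗ Y} {asc : Y' ⟶ Z'} {spZ' : Z' ⟶ M ⊗ V} {P3 : Z' ⟶ W3} {spW3 : W3 ⟶ T' ⊗ V}
    (h1 : p1i ≫ p1 = 𝟙 _) (hQ : Q3 ≫ sp1 = (D ◁ spY ≫ (α_ D V3 V).inv) ≫ q3 ▷ V)
    (h3 : p3i ≫ p3 = 𝟙 _) (hP : P3 ≫ spW3 = spZ' ≫ p3i ▷ V)
    (hasc : asc ≫ spZ' ≫ sp3 ▷ V = spY' ≫ S ◁ spY ≫ (α_ S V3 V).inv) :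
    (p2 ≫ spY' ≫ g' ▷ Y ≫ Q3 ≫ p1i) ≫ p1 ≫ sp1 ≫ g ▷ V ≫ q1 =
      ((p2 ≫ asc) ≫ P3) ≫ spW3 ≫ ((p3 ≫ sp3 ≫ g' ▷ V3 ≫ q3) ≫ g) ▷ V ≫ q1 := by
  simp only [Category.assoc, comp_whiskerRight]
  rw [reassoc_of% h1, reassoc_of% hP, ← comp_whiskerRight_assoc p3i, h3, id_whiskerRight,
    Category.id_comp, reassoc_of% hasc, reassoc_of% hQ]
  simp [← whisker_exchange_assoc]

/-- The maps `g` and `g'` act on disjoint tensor factors; the interchange law and naturality of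
`exch` identify the two orders of application. -/
theorem ins_par_aux {S T V D K W W' W'' W3 Z Z' Y Y' U U' : C} {g : T ⟶ K} {g' : S ⟶ D}
    {p1 : W' ⟶ Z} {p1i : Z ⟶ W'} {spZ : Z ⟶ T ⊗ D ⊗ V} {q1 : K ⊗ D ⊗ V ⟶ W}
    {p3 : W3 ⟶ Z'} {p3i : Z' ⟶ W3} {spZ' : Z' ⟶ S ⊗ K ⊗ V}
    {p2 : W'' ⟶ Y} {spY : Y ⟶ S ⊗ U} {spU : U ⟶ T ⊗ V} {mv : D ⊗ U ⟶ Z}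
    {bl : Y ⟶ Y'} {spY' : Y' ⟶ T ⊗ U'} {spU' : U' ⟶ S ⊗ V} {mv' : K ⊗ U' ⟶ Z'}
    (h1 : p1i ≫ p1 = 𝟙 _) (h3 : p3i ≫ p3 = 𝟙 _)
    (hm : mv ≫ spZ = D ◁ spU ≫ exch D T V) (hm' : mv' ≫ spZ' = K ◁ spU' ≫ exch K S V)
    (hb : bl ≫ spY' ≫ T ◁ spU' = spY ≫ S ◁ spU ≫ exch S T V) :
    (p2 ≫ spY ≫ g' ▷ U ≫ mv ≫ p1i) ≫ p1 ≫ spZ ≫ g ▷ (D ⊗ V) ≫ q1 =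
      ((p2 ≫ bl) ≫ spY' ≫ g ▷ U' ≫ mv' ≫ p3i) ≫
        p3 ≫ spZ' ≫ g' ▷ (K ⊗ V) ≫ exch D K V ≫ q1 := by
  have e1 : g' ▷ (T ⊗ V) ≫ exch D T V = exch S T V ≫ T ◁ (g' ▷ V) := by
    have := exch_natural g' (𝟙 T) (𝟙 V)
    simpa using this
  have e2 : g' ▷ (K ⊗ V) ≫ exch D K V = exch S K V ≫ K ◁ (g' ▷ V) := by
    have := exch_natural g' (𝟙 K) (𝟙 V)
    simpa using this
  have e3 := exch_exch K S V
  simp only [Category.assoc]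
  rw [reassoc_of% h1, reassoc_of% h3, reassoc_of% hm, reassoc_of% hm', reassoc_of% e2,
    reassoc_of% e3, ← whisker_exchange_assoc g' spU, ← whisker_exchange_assoc g spU',
    reassoc_of% hb, reassoc_of% e1, whisker_exchange_assoc]

namespace IsIns
variable {t s w w' w'' w₃ t' : List Col} {c d : Col} {g : wordTensor X t ⟶ X c} {a a' a'' b : List I}
  {x : I} {f f₁ : wordTensor X w' ⟶ wordTensor X w}

/-- Two presentations differ by the order in which the untouched factors are listed. Comparing the
final permutations gives one that fixes the new factor, hence comes from a permutation `k` of the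
untouched factors; `Coh.unique` then forces the initial permutations to differ by `k` as well. -/
theorem unique (hn' : a'.Nodup) (hn : a.Nodup) (h : IsIns g w' a' b x w a f)
    (h₁ : IsIns g w' a' b x w a f₁) : f = f₁ := by
  obtain ⟨v, r, p, q, hp, hq, rfl⟩ := h
  obtain ⟨v₁, r₁, p₁, q₁, hp₁, hq₁, rfl⟩ := h₁
  obtain ⟨qi, hqi, _, e2⟩ := hq₁.symm
  have hx : (x :: r).Nodup := hq.perm.nodup_iff.2 hn
  obtain ⟨_, k, hk, e⟩ := (hq.trans hqi).of_cons hx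
  have e' : q = X c ◁ k ≫ q₁ := by
    have h1 : q ≫ qi = X c ◁ k := e.trans (by
      rw [eqToHom_refl, id_whiskerRight]; exact Category.id_comp _)
    have h2 : q = (q ≫ qi) ≫ q₁ := by rw [Category.assoc, e2, Category.comp_id]
    exact h2.trans (congrArg (fun k => k ≫ q₁) h1)
  have hl : t.length = b.length := by
    have h1 := hp.length'
    have h2 := hk.length
    simp only [List.length_append] at h1
    omega
  have hp' := hp.trans (hk.append_left hl)
  rw [← hp'.unique hn' hp₁, e']
  exact ins_unique_aux (appMap_split X t k)

theorem relabel {J : Type} (φ : I → J) (h : IsIns g w' a' b x w a f) :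
    IsIns g w' (a'.map φ) (b.map φ) (φ x) w (a.map φ) f := by
  obtain ⟨v, r, p, q, hp, hq, rfl⟩ := h
  exact ⟨v, r.map φ, p, q, by simpa using hp.relabel φ, by simpa using hq.relabel φ, rfl⟩

/-- By uniqueness, each of the three insertions may be computed from any presentation. Presentations
are chosen whose permutations cancel when composed. -/
theorem seq {r r₃ e b' : List I} {y : I} {g' : wordTensor X s ⟶ X d}
    {f₂ : wordTensor X w'' ⟶ wordTensor X w'} {f₃ : wordTensor X t' ⟶ wordTensor X t}
    (col : I → Col) (ht : t = b.map col) (hs : s = e.map col) (ht' : t' = b'.map col)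
    (hc : c = col x) (hd : d = col y) (hw : w = a.map col) (hw' : w' = a'.map col)
    (hw'' : w'' = a''.map col) (h : (x :: r).Perm a) (h₃ : (y :: r₃).Perm b)
    (h' : a'.Perm (b ++ r)) (hb' : b'.Perm (e ++ r₃)) (h'' : a''.Perm (e ++ (r₃ ++ r)))
    (hn : a.Nodup) (hn' : a'.Nodup) (hn'' : a''.Nodup) (hnb' : b'.Nodup)
    (i₁ : IsIns g w' a' b x w a f) (i₂ : IsIns g' w'' a'' e y w' a' f₂)
    (i₃ : IsIns g' t' b' e y t b f₃) :
    IsIns (f₃ ≫ g) w'' a'' b' x w a (f₂ ≫ f) := by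
  subst ht hs ht' hc hd hw hw' hw''
  have hnb : b.Nodup := (List.nodup_append.1 (h'.nodup_iff.1 hn')).1
  obtain ⟨q1, hq1⟩ := Coh.exists_of_perm (X := X) col h
  obtain ⟨p1, hp1⟩ : ∃ p, Coh X (a'.map col) a' (b.map col ++ r.map col) (b ++ r) p := by
    rw [← List.map_append]; exact Coh.exists_of_perm col h'
  obtain ⟨q3, hq3⟩ := Coh.exists_of_perm (X := X) col h₃
  obtain ⟨p3, hp3⟩ : ∃ p, Coh X (b'.map col) b' (e.map col ++ r₃.map col) (e ++ r₃) p := by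
    rw [← List.map_append]; exact Coh.exists_of_perm col hb'
  obtain ⟨p2, hp2⟩ : ∃ p, Coh X (a''.map col) a'' (e.map col ++ (r₃.map col ++ r.map col))
      (e ++ (r₃ ++ r)) p := by
    rw [← List.map_append, ← List.map_append]; exact Coh.exists_of_perm col h''
  obtain ⟨p1i, hp1i, -, e1⟩ := hp1.symm
  obtain ⟨p3i, hp3i, -, e3⟩ := hp3.symm
  obtain ⟨Q3, hQ3, eQ⟩ := hq3.append_right (v := r.map col) (r := r) (by simp)
  obtain ⟨P3, hP3, eP⟩ := hp3i.append_right (v := r.map col) (r := r) (by simp)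
  obtain ⟨asc, hasc, easc⟩ := Coh.exists_assoc (X := X) (s := e.map col) (t := r₃.map col)
    (v := r.map col) (e := e) (b := r₃) (r := r) (by simp) (by simp) (by simp)
  -- The final permutation of the inner insertion ends with the inverse `p1i` of the initial
  -- permutation `p1` of the outer one, so that the two cancel.
  have j1 : IsIns g (a'.map col) a' b x (a.map col) a _ := ⟨_, _, _, _, hp1, hq1, rfl⟩
  have j2 : IsIns g' (a''.map col) a'' e y (a'.map col) a' _ :=
    ⟨_, _, _, _, hp2, hQ3.trans hp1i, rfl⟩
  have j3 : IsIns g' (b'.map col) b' e y (b.map col) b _ := ⟨_, _, _, _, hp3, hq3, rfl⟩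
  rw [i₁.unique hn' hn j1, i₂.unique hn'' hn' j2, i₃.unique hnb' hnb j3]
  exact ⟨_, _, _, _, (hp2.trans hasc).trans hP3, hq1, ins_seq_aux e1 eQ e3 eP easc⟩

/-- Again by uniqueness, the four insertions may be put in forms where the blocks `e` and `b` stand
in front of the common rest `r`; what remains is the interchange law in `ins_par_aux`. -/
theorem par {r e a₃ : List I} {y : I} {g' : wordTensor X s ⟶ X d}
    {f₂ : wordTensor X w'' ⟶ wordTensor X w'} {f₃ : wordTensor X w₃ ⟶ wordTensor X w}
    {f₄ : wordTensor X w'' ⟶ wordTensor X w₃}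
    (col : I → Col) (ht : t = b.map col) (hs : s = e.map col)
    (hc : c = col x) (hd : d = col y) (hw : w = a.map col) (hw' : w' = a'.map col)
    (hw₃ : w₃ = a₃.map col)
    (hw'' : w'' = a''.map col) (h : (x :: y :: r).Perm a)
    (h' : a'.Perm (b ++ y :: r)) (h₃ : a₃.Perm (e ++ x :: r)) (h'' : a''.Perm (e ++ (b ++ r)))
    (hn : a.Nodup) (hn' : a'.Nodup) (hn₃ : a₃.Nodup) (hn'' : a''.Nodup)
    (i₁ : IsIns g w' a' b x w a f) (i₂ : IsIns g' w'' a'' e y w' a' f₂)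
    (i₃ : IsIns g' w₃ a₃ e y w a f₃) (i₄ : IsIns g w'' a'' b x w₃ a₃ f₄) :
    f₂ ≫ f = f₄ ≫ f₃ := by
  subst ht hs hc hd hw hw' hw'' hw₃
  obtain ⟨q1, hq1⟩ := Coh.exists_of_perm (X := X) col h
  obtain ⟨p1, hp1⟩ : ∃ p, Coh X (a'.map col) a' (b.map col ++ (y :: r).map col) (b ++ y :: r) p := by
    rw [← List.map_append]; exact Coh.exists_of_perm col h'
  obtain ⟨p3, hp3⟩ : ∃ p, Coh X (a₃.map col) a₃ (e.map col ++ (x :: r).map col) (e ++ x :: r) p := by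
    rw [← List.map_append]; exact Coh.exists_of_perm col h₃
  obtain ⟨p2, hp2⟩ : ∃ p, Coh X (a''.map col) a'' (e.map col ++ (b.map col ++ r.map col))
      (e ++ (b ++ r)) p := by
    rw [← List.map_append, ← List.map_append]; exact Coh.exists_of_perm col h''
  obtain ⟨p1i, hp1i, -, e1⟩ := hp1.symm
  obtain ⟨p3i, hp3i, -, e3⟩ := hp3.symm
  obtain ⟨mv, hmv, emv⟩ := Coh.exists_move (X := X) (col y) y (t := b.map col) (v := r.map col)
    (b := b) (r := r) (by simp) (by simp)
  obtain ⟨mv', hmv', emv'⟩ := Coh.exists_move (X := X) (col x) x (t := e.map col) (v := r.map col)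
    (b := e) (r := r) (by simp) (by simp)
  obtain ⟨bl, hbl, ebl⟩ := Coh.exists_block (X := X) (s := e.map col) (t := b.map col)
    (v := r.map col) (e := e) (b := b) (r := r) (by simp) (by simp) (by simp)
  -- In the normal form of an insertion the new factor comes first. For `g'` this is `y`, whereas
  -- `q1` expects `x` in front of `y`.
  have hq3 := (Coh.swap (X := X) (u := []) (v := r.map col) (au := []) (av := r) rfl (by simp)
    (col y) (col x) y x).trans hq1
  have j1 : IsIns g (a'.map col) a' b x (a.map col) a _ := ⟨_, _, _, _, hp1, hq1, rfl⟩
  have j2 : IsIns g' (a''.map col) a'' e y (a'.map col) a' _ :=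
    ⟨_, _, _, _, hp2, hmv.trans hp1i, rfl⟩
  have j3 : IsIns g' (a₃.map col) a₃ e y (a.map col) a _ := ⟨_, _, _, _, hp3, hq3, rfl⟩
  have j4 : IsIns g (a''.map col) a'' b x (a₃.map col) a₃ _ :=
    ⟨_, _, _, _, hp2.trans hbl, hmv'.trans hp3i, rfl⟩
  rw [i₁.unique hn' hn j1, i₂.unique hn'' hn' j2, i₃.unique hn₃ hn j3, i₄.unique hn'' hn₃ j4]
  exact ins_par_aux e1 e3 emv emv' ebl

end IsIns

end Insertion

/-! ### Labels of the inputs in a grafting. -/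

section Labels

variable {I : Type}

/-- The list of labels of `n` inputs. -/
def lbl {n : ℕ} (l : Fin n → I) : List I := (List.finRange n).map l

theorem lbl_nodup {n : ℕ} {l : Fin n → I} (h : Function.Injective l) : (lbl l).Nodup :=
  (List.nodup_finRange n).map h

theorem lbl_map {n : ℕ} {J : Type} (l : Fin n → I) (φ : I → J) : (lbl l).map φ = lbl (φ ∘ l) := by
  simp [lbl]

theorem lbl_length {n : ℕ} (l : Fin n → I) : (lbl l).length = n := by simp [lbl]

theorem lbl_col {w : List Col} {l : Fin w.length → I} {col : I → Col}
    (h : ∀ j, col (l j) = w.get j) : w = (lbl l).map col := by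
  rw [lbl_map, show col ∘ l = w.get from funext h, lbl]
  simp

theorem lbl_erase {n : ℕ} (l : Fin n → I) (i : Fin n) :
    (l i :: ((List.finRange n).erase i).map l).Perm (lbl l) :=
  ((List.perm_cons_erase (List.mem_finRange i)).map l).symm

namespace Graft
variable {w t w' : List Col} {i : Fin w.length}

/-- Both lists are free of duplicates, so comparing their elements is enough; the inputs of `w'` are
those of `t` together with those of `w` other than `i`. -/
theorem lbl_perm (e : Graft w i t w') {la : Fin w.length → I} {lb : Fin t.length → I}
    {lc : Fin w'.length → I} (ha : Function.Injective la) (hc : Function.Injective lc)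
    (ho : ∀ j hj, lc (e.o j hj) = la j) (hn : ∀ b, lc (e.n b) = lb b) :
    (lbl lc).Perm (lbl lb ++ ((List.finRange w.length).erase i).map la) := by
  have hb : Function.Injective lb := fun b b' h => by
    rw [← hn, ← hn] at h; exact e.n_inj.1 (hc h)
  have hmem : ∀ j, j ∈ (List.finRange w.length).erase i ↔ j ≠ i := fun j => by
    rw [(List.nodup_finRange _).mem_erase_iff]; simp
  refine (List.perm_ext_iff_of_nodup (lbl_nodup hc) ?_).2 fun z => ?_
  · refine List.nodup_append'.2 ⟨lbl_nodup hb, ((List.nodup_finRange _).erase _).map ha, ?_⟩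
    intro z hz hz'
    simp only [lbl, List.mem_map, List.mem_finRange, true_and] at hz
    simp only [List.mem_map, hmem] at hz'
    obtain ⟨b, rfl⟩ := hz
    obtain ⟨j, hj, h⟩ := hz'
    rw [← hn, ← ho j hj] at h
    exact e.o_ne_n (hc h)
  · simp only [lbl, List.mem_append, List.mem_map, List.mem_finRange, true_and, hmem]
    constructor
    · rintro ⟨q, rfl⟩
      rcases e.cases q with ⟨j, hj, rfl⟩ | ⟨b, rfl⟩
      · exact Or.inr ⟨j, hj, (ho j hj).symm⟩
      · exact Or.inl ⟨b, (hn b).symm⟩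
    · rintro (⟨b, rfl⟩ | ⟨j, hj, rfl⟩)
      · exact ⟨_, hn b⟩
      · exact ⟨_, ho j hj⟩

/-- The labels of `w` that agree with the labels `l` of `w'`, where `x` is the label of `i`. -/
def lab (e : Graft w i t w') (x : I) (l : Fin w'.length → I) (j : Fin w.length) : I :=
  if h : j = i then x else l (e.o j h)

theorem lab_self (e : Graft w i t w') (x : I) (l : Fin w'.length → I) : e.lab x l i = x := by
  simp [lab]

theorem lab_o (e : Graft w i t w') (x : I) (l : Fin w'.length → I) (j) (hj : j ≠ i) :
    e.lab x l j = l (e.o j hj) := by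
  simp [lab, hj]

theorem lab_injective (e : Graft w i t w') {x : I} {l : Fin w'.length → I}
    (hl : Function.Injective l) (hx : ∀ q, l q ≠ x) : Function.Injective (e.lab x l) := by
  intro j j' h
  by_cases hj : j = i <;> by_cases hj' : j' = i
  · rw [hj, hj']
  · subst hj; rw [lab_self, e.lab_o _ _ _ hj'] at h; exact absurd h.symm (hx _)
  · subst hj'; rw [lab_self, e.lab_o _ _ _ hj] at h; exact absurd h (hx _)
  · rw [e.lab_o _ _ _ hj, e.lab_o _ _ _ hj'] at h; exact e.o_inj.1 (hl h)

theorem lab_col (e : Graft w i t w') {x : I} {l : Fin w'.length → I} {col : I → Col}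
    (hx : col x = w.get i) (hl : ∀ q, col (l q) = w'.get q) (j) : col (e.lab x l j) = w.get j := by
  by_cases hj : j = i
  · subst hj; rw [lab_self, hx]
  · rw [e.lab_o _ _ _ hj, hl, get_o]

theorem lab_ne (e : Graft w i t w') {x y : I} {l : Fin w'.length → I} (hx : x ≠ y)
    (hl : ∀ q, l q ≠ y) (j) : e.lab x l j ≠ y := by
  by_cases hj : j = i
  · subst hj; rwa [lab_self]
  · rw [e.lab_o _ _ _ hj]; exact hl _

end Graft

end Labels

/-! ### The insertion map of a grafting and its operad laws. -/

section Ins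

variable {C : Type u} [Category.{v} C] [MonoidalCategory C] [SymmetricCategory C] {X : Col → C}
  {I : Type} {w t w' s t' w'' w₃ : List Col} {i : Fin w.length} {c d k : Col}

theorem Coh.exists_words {a a' : List I} (col : I → Col) (hw : w = a.map col)
    (hw' : w' = a'.map col) (h : a.Perm a') : ∃ f, Coh X w a w' a' f := by
  subst hw hw'; exact Coh.exists_of_perm col h

theorem Graft.exists_ins (X : Col → C) (e : Graft w i t w') (hi : w.get i = c) :
    ∃ (v : List Col) (r : List (Option (Fin w'.length)))
      (p : wordTensor X w' ⟶ wordTensor X (t ++ v)) (q : wordTensor X (c :: v) ⟶ wordTensor X w),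
      Coh X w' (lbl some) (t ++ v) (lbl (fun b => some (e.n b)) ++ r) p ∧
        Coh X (c :: v) (none :: r) w (lbl (e.lab none some)) q := by
  -- Inputs of `w'` serve as their own labels, and `none` labels the new factor, that is the input
  -- `i` of `w`.
  let col : Option (Fin w'.length) → Col := fun o => o.elim c w'.get
  have hla : Function.Injective (e.lab none some) :=
    e.lab_injective (Option.some_injective _) (by simp)
  have h1 := e.lbl_perm hla (Option.some_injective _) (fun j hj => (e.lab_o _ _ j hj).symm)
    (fun _ => rfl)
  have h2 := lbl_erase (e.lab none some) i
  rw [e.lab_self] at h2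
  have hw : w = (lbl (e.lab none some)).map col := lbl_col (e.lab_col hi.symm (fun _ => rfl))
  have hw' : w' = (lbl (some : Fin w'.length → _)).map col := lbl_col (fun _ => rfl)
  have ht : t = (lbl (fun b => some (e.n b))).map col := lbl_col (fun b => e.get_n b)
  obtain ⟨q, hq⟩ := Coh.exists_words (X := X) col
    (w := c :: (((List.finRange w.length).erase i).map (e.lab none some)).map col) rfl hw h2
  obtain ⟨p, hp⟩ := Coh.exists_words (X := X) col
    (w' := t ++ (((List.finRange w.length).erase i).map (e.lab none some)).map col) hw'
    (by rw [List.map_append, ← ht]) h1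
  exact ⟨_, _, p, q, hp, hq⟩

/-- The map `X w'₁ ⊗ ⋯ ⊗ X w'ₙ ⟶ X w₁ ⊗ ⋯ ⊗ X wₘ` that applies `g` to the factors grafted at `i`. -/
noncomputable def Graft.ins (e : Graft w i t w') (hi : w.get i = c) (g : wordTensor X t ⟶ X c) :
    wordTensor X w' ⟶ wordTensor X w :=
  (e.exists_ins X hi).choose_spec.choose_spec.choose ≫ splitHom X _ t ≫
    g ▷ wordTensor X (e.exists_ins X hi).choose ≫
      (e.exists_ins X hi).choose_spec.choose_spec.choose_spec.choose

/-- The point is that `p` and `q` do not depend on `g`: insertion is composition and whiskering with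
fixed maps, so it is continuous in `g`. -/
theorem Graft.ins_form (X : Col → C) (e : Graft w i t w') (hi : w.get i = c) :
    ∃ (v : List Col) (p : wordTensor X w' ⟶ wordTensor X (t ++ v))
      (q : wordTensor X (c :: v) ⟶ wordTensor X w), ∀ g : wordTensor X t ⟶ X c,
        e.ins hi g = p ≫ splitHom X v t ≫ g ▷ wordTensor X v ≫ q :=
  ⟨_, _, _, fun _ => rfl⟩

/-- Every compatible labelling factors through the universal one used in the construction, and
`IsIns` is stable under change of labels. Together with `IsIns.unique` this characterizes
`Graft.ins`. -/
theorem Graft.ins_isIns (e : Graft w i t w') (hi : w.get i = c) (g : wordTensor X t ⟶ X c)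
    {la : Fin w.length → I} {lb : Fin t.length → I} {lc : Fin w'.length → I}
    (ho : ∀ j hj, lc (e.o j hj) = la j) (hn : ∀ b, lc (e.n b) = lb b) :
    IsIns g w' (lbl lc) (lbl lb) (la i) w (lbl la) (e.ins hi g) := by
  have h : IsIns g w' (lbl some) (lbl (fun b => some (e.n b))) none w (lbl (e.lab none some))
      (e.ins hi g) :=
    ⟨_, _, _, _, (e.exists_ins X hi).choose_spec.choose_spec.choose_spec.choose_spec.1,
      (e.exists_ins X hi).choose_spec.choose_spec.choose_spec.choose_spec.2, rfl⟩
  have h' := h.relabel (fun o => o.elim (la i) lc)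
  simp only [lbl_map] at h'
  have e1 : (fun o => Option.elim o (la i) lc) ∘ (fun b => some (e.n b)) = lb := funext hn
  have e2 : (fun o => Option.elim o (la i) lc) ∘ (e.lab none some) = la := by
    funext j
    by_cases hj : j = i
    · subst hj; simp [lab_self]
    · simp [e.lab_o _ _ _ hj, ho]
  rw [e1, e2] at h'
  exact h'

/-- The insertion of a composite is a composite of insertions. -/
theorem Graft.ins_seq {j : Fin t.length} {q : Fin w'.length} {e₁ : Graft w i t w'}
    {e₂ : Graft w' q s w''} {e₃ : Graft t j s t'} {e₄ : Graft w i t' w''}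
    (h : SeqCompat e₁ e₂ e₃ e₄) (hi : w.get i = c) (hj : t.get j = d) (hq : w'.get q = d)
    (g : wordTensor X t ⟶ X c) (g' : wordTensor X s ⟶ X d) :
    e₂.ins hq g' ≫ e₁.ins hi g = e₄.ins hi (e₃.ins hj g' ≫ g) := by
  -- One label set serves all four words: the inputs of `w''` label themselves, `some none` labels
  -- the value of `g'`, and `none` the value of `g`.
  let l'' : Fin w''.length → Option (Option (Fin w''.length)) := fun p => some (some p)
  let l' := e₂.lab (some none) l''
  let l := e₁.lab none l'
  let col : Option (Option (Fin w''.length)) → Col :=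
    fun o => o.elim c (fun o => o.elim d w''.get)
  have hl'' : Function.Injective l'' := fun _ _ h => by simpa [l''] using h
  have hl' : Function.Injective l' := e₂.lab_injective hl'' (by simp [l''])
  have hx : ∀ p, l' p ≠ none := e₂.lab_ne (by simp) (by simp [l''])
  have hl : Function.Injective l := e₁.lab_injective hl' hx
  have o1 : ∀ a ha, l' (e₁.o a ha) = l a := fun a ha => (e₁.lab_o _ _ a ha).symm
  have o2 : ∀ a ha, l'' (e₂.o a ha) = l' a := fun a ha => (e₂.lab_o _ _ a ha).symm
  have ht' : Function.Injective (l'' ∘ e₄.n) := hl''.comp fun _ _ h => e₄.n_inj.1 h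
  have o4 : ∀ a ha, l'' (e₄.o a ha) = l a := fun a ha => by rw [h.oo', o2, o1]
  have o3 : ∀ a ha, (l'' ∘ e₄.n) (e₃.o a ha) = (l' ∘ e₁.n) a := fun a ha => by
    rw [Function.comp, h.no', o2]; rfl
  have n3 : ∀ a, (l'' ∘ e₄.n) (e₃.n a) = (l'' ∘ e₂.n) a := fun a => by
    rw [Function.comp, h.nn']; rfl
  have lx : l i = none := e₁.lab_self _ _
  have ly : l' q = some none := e₂.lab_self _ _
  have ly' : (l' ∘ e₁.n) j = some none := by rw [Function.comp, h.pos, ly]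
  have ht : Function.Injective (l' ∘ e₁.n) := hl'.comp fun _ _ h => e₁.n_inj.1 h
  have i₁ := e₁.ins_isIns hi g o1 (lb := l' ∘ e₁.n) (fun _ => rfl)
  have i₂ := e₂.ins_isIns hq g' o2 (lb := l'' ∘ e₂.n) (fun _ => rfl)
  have i₃ := e₃.ins_isIns hj g' o3 n3
  have i₄ := e₄.ins_isIns hi (e₃.ins hj g' ≫ g) o4 (lb := l'' ∘ e₄.n) (fun _ => rfl)
  have c'' : ∀ p, col (l'' p) = w''.get p := fun _ => rfl
  have c' : ∀ p, col (l' p) = w'.get p := e₂.lab_col hq.symm c''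
  have p1 := lbl_erase l i
  have p3 := lbl_erase (l' ∘ e₁.n) j
  have p' := e₁.lbl_perm hl hl' o1 (lb := l' ∘ e₁.n) (fun _ => rfl)
  have pb' := e₃.lbl_perm ht ht' o3 n3
  -- The inputs of `w''` fall into three groups: those of `s`, those of `t` other than `j`, and
  -- those of `w` other than `i`.
  have p'' := (e₄.lbl_perm hl hl'' o4 (lb := l'' ∘ e₄.n) (fun _ => rfl)).trans
    (pb'.append_right _)
  rw [lx] at p1 i₁ i₄
  rw [ly] at i₂
  rw [ly'] at p3 i₃
  rw [List.append_assoc] at p''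
  refine (IsIns.seq col (lbl_col fun a => ?_) (lbl_col fun a => ?_) (lbl_col fun a => ?_) rfl rfl
    (lbl_col (e₁.lab_col (x := none) hi.symm c')) (lbl_col c') (lbl_col c'') p1 p3 p' pb' p''
    (lbl_nodup hl) (lbl_nodup hl') (lbl_nodup hl'') (lbl_nodup ht') i₁ i₂ i₃).unique
    (lbl_nodup hl'') (lbl_nodup hl) i₄
  · rw [Function.comp, c', get_n]
  · rw [Function.comp, c'', get_n]
  · rw [Function.comp, c'', get_n]

/-- Insertions at different inputs commute. -/
theorem Graft.ins_par {j : Fin w.length} {q : Fin w'.length} {p : Fin w₃.length}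
    {e₁ : Graft w i t w'} {e₂ : Graft w' q s w''} {e₃ : Graft w j s w₃} {e₄ : Graft w₃ p t w''}
    (h : ParCompat e₁ e₂ e₃ e₄) (hi : w.get i = c) (hj : w.get j = d) (hq : w'.get q = d)
    (hp : w₃.get p = c) (g : wordTensor X t ⟶ X c) (g' : wordTensor X s ⟶ X d) :
    e₂.ins hq g' ≫ e₁.ins hi g = e₄.ins hp g ≫ e₃.ins hj g' := by
  let l'' : Fin w''.length → Option (Option (Fin w''.length)) := fun p => some (some p)
  let l' := e₂.lab (some none) l''
  let l := e₁.lab none l'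
  let l₃ := e₄.lab none l''
  let col : Option (Option (Fin w''.length)) → Col :=
    fun o => o.elim c (fun o => o.elim d w''.get)
  have hl'' : Function.Injective l'' := fun _ _ h => by simpa [l''] using h
  have hl' : Function.Injective l' := e₂.lab_injective hl'' (by simp [l''])
  have hx : ∀ p, l' p ≠ none := e₂.lab_ne (by simp) (by simp [l''])
  have hl : Function.Injective l := e₁.lab_injective hl' hx
  have hl₃ : Function.Injective l₃ := e₄.lab_injective hl'' (by simp [l''])
  have o1 : ∀ a ha, l' (e₁.o a ha) = l a := fun a ha => (e₁.lab_o _ _ a ha).symm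
  have o2 : ∀ a ha, l'' (e₂.o a ha) = l' a := fun a ha => (e₂.lab_o _ _ a ha).symm
  have o4 : ∀ a ha, l'' (e₄.o a ha) = l₃ a := fun a ha => (e₄.lab_o _ _ a ha).symm
  have lx : l i = none := e₁.lab_self _ _
  have ly : l' q = some none := e₂.lab_self _ _
  have ly' : l j = some none := by rw [← o1 j h.ne.symm, h.pos₁, ly]
  have lx' : l₃ p = none := e₄.lab_self _ _
  have o3 : ∀ a ha, l₃ (e₃.o a ha) = l a := fun a ha => by
    by_cases hai : a = i
    · subst hai; rw [h.pos₂, lx', lx]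
    · have hap : e₃.o a ha ≠ p := by rw [← h.pos₂, Ne, o_inj]; exact hai
      rw [← o4 _ hap, h.oo' a hai ha, o2, o1]
  have n3 : ∀ a, l₃ (e₃.n a) = (l'' ∘ e₂.n) a := fun a => by
    have hap : e₃.n a ≠ p := by rw [← h.pos₂]; exact (o_ne_n _).symm
    rw [← o4 _ hap, h.on']; rfl
  have n4 : ∀ a, l'' (e₄.n a) = (l' ∘ e₁.n) a := fun a => by rw [h.no', o2]; rfl
  have i₁ := e₁.ins_isIns hi g o1 (lb := l' ∘ e₁.n) (fun _ => rfl)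
  have i₂ := e₂.ins_isIns hq g' o2 (lb := l'' ∘ e₂.n) (fun _ => rfl)
  have i₃ := e₃.ins_isIns hj g' o3 n3
  have i₄ := e₄.ins_isIns hp g o4 n4
  have c'' : ∀ p, col (l'' p) = w''.get p := fun _ => rfl
  have c' : ∀ p, col (l' p) = w'.get p := e₂.lab_col hq.symm c''
  have hij : j ∈ (List.finRange w.length).erase i :=
    ((List.nodup_finRange _).mem_erase_iff).2 ⟨h.ne.symm, List.mem_finRange _⟩
  have hji : i ∈ (List.finRange w.length).erase j :=
    ((List.nodup_finRange _).mem_erase_iff).2 ⟨h.ne, List.mem_finRange _⟩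
  -- Removing `i` or `j` from the inputs of `w` leaves the other one and a common rest; the next two
  -- facts exhibit this rest, as `IsIns.par` requires.
  have r1 : (((List.finRange w.length).erase i).map l).Perm
      (some none :: (((List.finRange w.length).erase i).erase j).map l) := by
    rw [← ly']; exact (List.perm_cons_erase hij).map l
  have r3 : (((List.finRange w.length).erase j).map l).Perm
      (none :: (((List.finRange w.length).erase i).erase j).map l) := by
    rw [← lx, List.erase_comm]; exact (List.perm_cons_erase hji).map l
  have p1 := (r1.symm.cons none).trans (lx ▸ lbl_erase l i)
  have p' := (e₁.lbl_perm hl hl' o1 (lb := l' ∘ e₁.n) (fun _ => rfl)).trans (r1.append_left _)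
  have p3 := (e₃.lbl_perm hl hl₃ o3 n3).trans (r3.append_left _)
  have p'' := e₂.lbl_perm hl' hl'' o2 (lb := l'' ∘ e₂.n) (fun _ => rfl)
  have r2 := ((lbl_erase l' q).trans p').trans List.perm_middle
  rw [ly] at r2
  have p''' := p''.trans ((r2.cons_inv).append_left _)
  rw [lx] at i₁
  rw [ly] at i₂
  rw [ly'] at i₃
  rw [lx'] at i₄
  refine IsIns.par col (lbl_col fun a => ?_) (lbl_col fun a => ?_) rfl rfl
    (lbl_col (e₁.lab_col (x := none) hi.symm c')) (lbl_col c') (lbl_col (e₄.lab_col (x := none) hp.symm c''))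
    (lbl_col c'') p1 p' p3 p''' (lbl_nodup hl) (lbl_nodup hl') (lbl_nodup hl₃) (lbl_nodup hl'')
    i₁ i₂ i₃ i₄
  · rw [Function.comp, c', get_n]
  · rw [Function.comp, c'', get_n]

end Ins

/-! ### Planar graftings, relabellings and units as insertions. -/

section LabelLists

variable {I : Type}

theorem lbl_append {u v : List Col} (l : Fin (u ++ v).length → I) :
    lbl l = lbl (fun j : Fin u.length => l ⟨j, by have := j.2; simp; omega⟩) ++
      lbl (fun j : Fin v.length => l ⟨u.length + j, by simp⟩) := by
  refine List.ext_getElem (by simp [lbl]) fun n h h' => ?_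
  simp only [lbl, List.getElem_append, List.getElem_map, List.getElem_finRange, List.length_map,
    List.length_finRange]
  split
  · rfl
  · congr 1
    exact Fin.ext (by simp; omega)

theorem lbl_cons {c : Col} {v : List Col} (l : Fin (c :: v).length → I) :
    lbl l = l 0 :: lbl (fun j : Fin v.length => l j.succ) := by
  refine List.ext_getElem (by simp [lbl]) fun n h h' => ?_
  cases n with
  | zero => simp [lbl]
  | succ n => simp [lbl]

end LabelLists

section Perm

variable {C : Type u} [Category.{v} C] [MonoidalCategory C] [SymmetricCategory C] {X : Col → C}
  {I : Type} {w t w' w'' : List Col} {c d k : Col}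

/-- The normal form wants the inputs of `g` in front, so the extra factor `d` is moved past them
before `g` is applied and past the output of `g` afterwards. -/
theorem IsIns.cons {a a' b : List I} {x : I} {g : wordTensor X t ⟶ X c}
    {f : wordTensor X w' ⟶ wordTensor X w}
    (h : IsIns g w' a' b x w a f) (d : Col) (y : I) (ht : t.length = b.length) :
    IsIns g (d :: w') (y :: a') b x (d :: w) (y :: a) (X d ◁ f) := by
  obtain ⟨v, r, p, q, hp, hq, rfl⟩ := h
  have hv : v.length = r.length := by simpa using hq.length
  obtain ⟨m, hm, em⟩ := Coh.exists_move (X := X) d y (t := t) (v := v) (b := b) (r := r) ht hv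
  refine ⟨d :: v, y :: r, _, _, (hp.cons d y).trans hm,
    (Coh.swap (X := X) (u := []) (v := v) (au := []) (av := r) rfl hv c d x y).trans
      (hq.cons d y), ?_⟩
  have key : ∀ {D W' Z Z' T V K W : C} {p : W' ⟶ Z} {s : Z ⟶ T ⊗ V} {g : T ⟶ K} {q : K ⊗ V ⟶ W}
      {m : D ⊗ Z ⟶ Z'} {s' : Z' ⟶ T ⊗ D ⊗ V}, m ≫ s' = D ◁ s ≫ exch D T V →
      D ◁ (p ≫ s ≫ g ▷ V ≫ q) = (D ◁ p ≫ m) ≫ s' ≫ g ▷ (D ⊗ V) ≫ exch K D V ≫ D ◁ q := by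
    intro D W' Z Z' T V K W p s g q m s' h
    have e1 : g ▷ (D ⊗ V) ≫ exch K D V = exch T D V ≫ D ◁ (g ▷ V) := by
      have := exch_natural g (𝟙 D) (𝟙 V)
      simpa using this
    rw [Category.assoc, reassoc_of% h, reassoc_of% e1, reassoc_of% (exch_exch D T V)]
    simp only [MonoidalCategory.whiskerLeft_comp]
  exact key em

theorem IsIns.precomp {a a' a'' b : List I} {x : I} {g : wordTensor X t ⟶ X c}
    {f : wordTensor X w' ⟶ wordTensor X w} {f' : wordTensor X w'' ⟶ wordTensor X w'}
    (hf : Coh X w'' a'' w' a' f') (h : IsIns g w' a' b x w a f) :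
    IsIns g w'' a'' b x w a (f' ≫ f) := by
  obtain ⟨v, r, p, q, hp, hq, rfl⟩ := h
  exact ⟨_, _, _, _, hf.trans hp, hq, (Category.assoc _ _ _).symm⟩

theorem splice_isIns {u v : List Col} {au b av : List I} (x : I) (hu : u.length = au.length)
    (ht : t.length = b.length) (hv : v.length = av.length) (g : wordTensor X t ⟶ X c) :
    IsIns g (u ++ (t ++ v)) (au ++ (b ++ av)) b x (u ++ c :: v) (au ++ x :: av)
      (splice X v g u) := by
  induction u generalizing au with
  | nil =>
    obtain rfl : au = [] := by simpa using hu.symm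
    refine ⟨v, av, 𝟙 _, 𝟙 _, .refl _ _ (by simp [ht, hv]), .refl _ _ (by simp [hv]), ?_⟩
    exact ((Category.id_comp _).trans (congrArg (fun k => splitHom X v t ≫ k)
      (Category.comp_id _))).symm
  | cons e u ih =>
    cases au with
    | nil => simp at hu
    | cons y au => exact (ih (by simpa using hu)).cons e y ht

/-- Taking the parameter object to be the factor `X d` turns `spliceParam` into an ordinary
insertion whose first argument sits in front of the whole word. -/
theorem spliceParam_isIns {u v : List Col} {au b av : List I} (x z : I)
    (hu : u.length = au.length) (ht : t.length = b.length) (hv : v.length = av.length)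
    (g : wordTensor X (d :: t) ⟶ X c) :
    IsIns g (d :: (u ++ (t ++ v))) (z :: (au ++ (b ++ av))) (z :: b) x (u ++ c :: v)
      (au ++ x :: av) (spliceParam X (X d) v g u) := by
  induction u generalizing au with
  | nil =>
    obtain rfl : au = [] := by simpa using hu.symm
    refine ⟨v, av, 𝟙 _, 𝟙 _, .refl _ _ (by simp [ht, hv]), .refl _ _ (by simp [hv]), ?_⟩
    exact ((Category.id_comp _).trans (((congrArg (fun k => splitHom X v (d :: t) ≫ k)
      (Category.comp_id _))).trans (Category.assoc _ _ _))).symm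
  | cons e u ih =>
    cases au with
    | nil => simp at hu
    | cons y au =>
      have h1 := (ih (au := au) (by simpa using hu)).cons e y (by simp [ht])
      have h2 := IsIns.precomp (Coh.swap (X := X) (u := []) (v := u ++ (t ++ v)) (au := [])
        (av := au ++ (b ++ av)) rfl (by simpa [ht, hv] using hu) d e z y) h1
      have e1 : exch (X d) (X e) _ ≫ X e ◁ spliceParam X (X d) v g u =
          spliceParam X (X d) v g (e :: u) := by
        simp only [exch, Category.assoc]; rfl
      rw [← e1]
      exact h2

theorem Graft.ins_eq {i : Fin w.length} (e : Graft w i t w') (hi : w.get i = c)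
    (g : wordTensor X t ⟶ X c)
    {la : Fin w.length → I} {lb : Fin t.length → I} {lc : Fin w'.length → I}
    (ha : Function.Injective la) (hc : Function.Injective lc)
    (ho : ∀ j hj, lc (e.o j hj) = la j) (hn : ∀ b, lc (e.n b) = lb b)
    {f : wordTensor X w' ⟶ wordTensor X w}
    (h : IsIns g w' (lbl lc) (lbl lb) (la i) w (lbl la) f) : e.ins hi g = f :=
  (e.ins_isIns hi g ho hn).unique (lbl_nodup hc) (lbl_nodup ha) h

theorem Graft.planar_o_lt {u v : List Col} (j : Fin (u ++ c :: v).length) (hj)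
    (h : j.1 < u.length) :
    (Graft.planar u c v t).o j hj = ⟨j, by simp; omega⟩ := by
  simp [Graft.o, Graft.planar, h]

theorem Graft.planar_o_gt {u v : List Col} (j : Fin v.length) (hj) :
    (Graft.planar u c v t).o ⟨u.length + (j + 1), by simp⟩ hj =
      ⟨u.length + (t.length + j), by simp⟩ := by
  simp [Graft.o, Graft.planar]
  omega


theorem Graft.lbl_planar {u v : List Col} (x : I) (l : Fin (u ++ (t ++ v)).length → I) :
    ∃ au av : List I, u.length = au.length ∧ v.length = av.length ∧
      lbl l = au ++ (lbl (l ∘ (Graft.planar u c v t).n) ++ av) ∧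
      lbl ((Graft.planar u c v t).lab x l) = au ++ x :: av := by
  refine ⟨_, _, ?_, ?_, (lbl_append l).trans (congrArg _ (lbl_append _)),
    (lbl_append _).trans ?_⟩
  · simp [lbl_length]
  · simp [lbl_length]
  · rw [lbl_cons]
    congr 1
    · congr 1
      funext j
      rw [lab_o _ _ _ _ (by intro h; have := congrArg Fin.val h; simp [mid] at this; omega),
        planar_o_lt _ _ j.2]
    · congr 1
      · exact lab_self _ _ _
      · congr 1
        funext j
        have hj : (⟨u.length + (j + 1), by simp⟩ : Fin (u ++ c :: v).length) ≠ mid u c v := by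
          intro h; have := congrArg Fin.val h; simp [mid] at this
        exact (lab_o _ _ _ _ hj).trans (congrArg l (planar_o_gt j hj))

/-- Both sides are insertions for the same labels, so uniqueness applies. This links the planar
composition axiom of `Alg` with arbitrary graftings. -/
theorem Graft.ins_planar (u v : List Col) (g : wordTensor X t ⟶ X c) :
    (Graft.planar u c v t).ins (get_mid u c v) g = splice X v g u := by
  obtain ⟨au, av, hu, hv, h1, h2⟩ := Graft.lbl_planar (u := u) (c := c) (t := t) (v := v)
    none (some : Fin (u ++ (t ++ v)).length → Option _)
  refine Graft.ins_eq _ _ g (lab_injective _ (x := none) (Option.some_injective _) (by simp))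
    (Option.some_injective _) (fun j hj => (lab_o _ _ _ j hj).symm)
    (lb := some ∘ (Graft.planar u c v t).n) (fun _ => rfl) ?_
  rw [h1, h2, lab_self]
  exact splice_isIns _ hu (lbl_length _).symm hv g

theorem Graft.planarFull_o {u v : List Col} (j : Fin (u ++ c :: v).length) (hj) :
    (Graft.planarFull u c v t).o j hj = ((Graft.planar u c v t).o j hj).succ := rfl

theorem Graft.planarFull_n_zero {u v : List Col} : (Graft.planarFull u c v t).n 0 = 0 := rfl

theorem Graft.planarFull_n_succ {u v : List Col} (b : Fin t.length) :
    (Graft.planarFull u c v t).n b.succ = ((Graft.planar u c v t).n b).succ := rfl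

theorem Graft.ins_planarFull (u v : List Col) (g : wordTensor X (.full :: t) ⟶ X c) :
    (Graft.planarFull u c v t).ins (get_mid u c v) g = spliceParam X (X .full) v g u := by
  obtain ⟨au, av, hu, hv, h1, h2⟩ := Graft.lbl_planar (u := u) (c := c) (t := t) (v := v)
    none (fun q : Fin (u ++ (t ++ v)).length => some q.succ)
  refine Graft.ins_eq _ _ g (lab_injective _ (x := none) (Option.some_injective _) (by simp))
    (Option.some_injective _) (fun j hj => (lab_o _ _ _ j hj).symm)
    (lb := some ∘ (Graft.planarFull u c v t).n) (fun _ => rfl) ?_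
  -- `planarFull` is `planar` with all positions raised by one to make room for the full input at
  -- position zero.
  have e1 : (Graft.planarFull u c v t).lab none some =
      (Graft.planar u c v t).lab none (fun q => some q.succ) := rfl
  rw [e1, h2, lab_self, lbl_cons (some ∘ (Graft.planarFull u c v t).n)]
  have e2 := lbl_cons (some : Fin (Col.full :: (u ++ (t ++ v))).length → Option _)
  rw [e2, h1]
  exact spliceParam_isIns _ _ hu (lbl_length _).symm hv g

/-- Relabellings as permutations of tensor factors. -/
theorem Graft.exists_perm (X : Col → C) (σ : Graft [k] 0 w w') :
    ∃ f : wordTensor X w' ⟶ wordTensor X w, Coh X w' (lbl id) w (lbl σ.n) f := by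
  refine Coh.exists_words w'.get (lbl_col fun _ => rfl) (lbl_col σ.get_n) ?_
  -- A relabelling is a grafting onto a corolla with one input. No other inputs of the corolla
  -- remain, so the labels of `w'` are exactly those coming from `w`.
  have h := σ.lbl_perm (la := σ.lab none some) (σ.lab_injective (Option.some_injective _) (by simp))
    (lc := some) (lb := some ∘ σ.n) (Option.some_injective _)
    (fun j hj => (unique_o j hj).elim) (fun _ => rfl)
  have h0 : (List.finRange [k].length).erase 0 = [] := by
    change (List.finRange 1).erase 0 = []
    simp [List.finRange_succ]
  rw [h0, List.map_nil, List.append_nil, ← lbl_map] at h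
  have h' : (List.map some (lbl (id : Fin w'.length → _))).Perm (List.map some (lbl σ.n)) := by
    rw [lbl_map]; exact h
  have := h'.filterMap id
  simpa [List.filterMap_map] using this

noncomputable def Graft.perm (X : Col → C) (σ : Graft [k] 0 w w') :
    wordTensor X w' ⟶ wordTensor X w := (σ.exists_perm X).choose

theorem Graft.perm_coh (σ : Graft [k] 0 w w') {lc : Fin w'.length → I}
    {lb : Fin w.length → I} (h : ∀ b, lc (σ.n b) = lb b) :
    Coh X w' (lbl lc) w (lbl lb) (σ.perm X) := by
  have := (σ.exists_perm X).choose_spec.relabel lc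
  rw [lbl_map, lbl_map, show lc ∘ σ.n = lb from funext h] at this
  exact this

theorem Graft.perm_eq (σ : Graft [k] 0 w w') {lc : Fin w'.length → I}
    {lb : Fin w.length → I} (h : ∀ b, lc (σ.n b) = lb b) (hc : Function.Injective lc)
    {f : wordTensor X w' ⟶ wordTensor X w} (hf : Coh X w' (lbl lc) w (lbl lb) f) :
    σ.perm X = f := (σ.perm_coh h).unique (lbl_nodup hc) hf

/-- As with associativity, `w ++ []` is not `w` by definition; the comparison is kept as a labelled
permutation. -/
theorem Coh.exists_nil (h : w.length = a.length) : ∃ p, Coh X w a (w ++ []) (a ++ ([] : List I)) p ∧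
    p ≫ splitHom X [] w = (ρ_ _).inv := by
  induction w generalizing a with
  | nil =>
    obtain rfl : a = [] := by simpa using h.symm
    exact ⟨𝟙 _, .refl _ _ rfl, (Category.id_comp _).trans unitors_inv_equal⟩
  | cons c w ih =>
    cases a with
    | nil => simp at h
    | cons x a =>
      obtain ⟨p, h1, h2⟩ := ih (a := a) (by simpa using h)
      refine ⟨_, h1.cons c x, ?_⟩
      have : ∀ {Z W U : C} {p : W ⟶ Z} {s : Z ⟶ W ⊗ 𝟙_ C}, p ≫ s = (ρ_ W).inv →
          U ◁ p ≫ U ◁ s ≫ (α_ _ _ _).inv = (ρ_ (U ⊗ W)).inv := by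
        intro Z W U p s h
        rw [← MonoidalCategory.whiskerLeft_comp_assoc, h]; simp
      exact this h2

/-- The word tensor of the corolla `[k]` is `X k ⊗ 𝟙_ C`, which accounts for the unitor. -/
theorem Graft.ins_perm (σ : Graft [k] 0 w w') (g : wordTensor X w ⟶ X k) :
    σ.ins rfl g = σ.perm X ≫ g ≫ (ρ_ (X k)).inv := by
  have hla := lab_injective σ (x := none) (Option.some_injective (Fin w'.length)) (by simp)
  refine Graft.ins_eq σ rfl g hla
    (Option.some_injective _) (fun j hj => (lab_o _ _ _ j hj).symm)
    (lb := some ∘ σ.n) (fun _ => rfl) ?_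
  obtain ⟨p, hp, e⟩ := Coh.exists_nil (X := X) (w := w) (a := lbl (some ∘ σ.n)) (lbl_length _).symm
  refine ⟨[], [], _, 𝟙 _, (σ.perm_coh (fun _ => rfl)).trans hp, ?_, ?_⟩
  · rw [lbl_cons]; exact .refl _ _ rfl
  · rw [Category.assoc, reassoc_of% e]
    have : ∀ {W K : C} (g : W ⟶ K), g ≫ (ρ_ K).inv = (ρ_ W).inv ≫ g ▷ 𝟙_ C ≫ 𝟙 _ := by
      intros; simp
    exact congrArg _ (this g)

theorem Graft.ins_perm' (σ : Graft [k] 0 w w') (g : wordTensor X w ⟶ X k) :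
    σ.ins rfl g ≫ (ρ_ (X k)).hom = σ.perm X ≫ g := by
  rw [ins_perm]
  have : ∀ {W W' K : C} (p : W' ⟶ W) (g : W ⟶ K), (p ≫ g ≫ (ρ_ K).inv) ≫ (ρ_ K).hom = p ≫ g := by
    intros; simp
  exact this _ _

theorem Graft.perm_of_id (σ : Graft [k] 0 w w) (h : ∀ b, σ.n b = b) : σ.perm X = 𝟙 _ :=
  σ.perm_eq (lc := id) (lb := id) h Function.injective_id (.refl _ _ (lbl_length _).symm)

theorem Graft.perm_trans {σ : Graft [k] 0 w w'} {τ : Graft [d] 0 w' w''} {κ : Graft [c] 0 w w''}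
    (h : ∀ b, τ.n (σ.n b) = κ.n b) : κ.perm X = τ.perm X ≫ σ.perm X :=
  κ.perm_eq (lc := id) (lb := κ.n) (fun _ => rfl) Function.injective_id
    ((τ.perm_coh (lb := τ.n) (fun _ => rfl)).trans (σ.perm_coh h))

/-- Inserting the identity operation changes nothing. -/
theorem Graft.ins_unit {i : Fin w.length} (e : Graft w i [c] w) (hi : w.get i = c)
    (ho : ∀ a ha, e.o a ha = a) (hn : e.n 0 = i) :
    e.ins hi (show wordTensor X [c] ⟶ X c from (ρ_ (X c)).hom) = 𝟙 _ := by
  refine Graft.ins_eq e hi _ (la := id) (lc := id) (lb := fun _ => i) Function.injective_id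
    Function.injective_id ho ?_ ?_
  · intro b
    obtain rfl : b = 0 := Subsingleton.elim (α := Fin 1) _ _
    exact hn
  · have h1 := lbl_erase (id : Fin w.length → _) i
    obtain ⟨q, hq⟩ := Coh.exists_words (X := X) w.get
      (w := c :: (((List.finRange w.length).erase i).map id).map w.get) (w' := w)
      (by rw [List.map_cons, id, hi]) (lbl_col fun _ => rfl) h1
    obtain ⟨p, hp, e1, e2⟩ := hq.symm
    refine ⟨_, _, p, q, hp, hq, ?_⟩
    have : ∀ {K V W : C} {p : W ⟶ K ⊗ V} {q : K ⊗ V ⟶ W}, p ≫ q = 𝟙 _ →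
        𝟙 _ = p ≫ (K ◁ (λ_ V).inv ≫ (α_ _ _ _).inv) ≫ (ρ_ K).hom ▷ V ≫ q := by
      intro K V W p q h
      simp [h]
    exact this e2

end Perm

/-! ### Naturality of permutations and insertions in the family of objects. -/

section Naturality
variable {C : Type u} [Category.{v} C] [MonoidalCategory C] [SymmetricCategory C] {X Y : Col → C}
  {K : Col → Prop} {I : Type} {w w' t u v : List Col} {a a' b : List I} {k c : Col}

/-- The tensor product of maps that are defined for the colours in `K` only. -/
def mapWord (φ : ∀ c, K c → (X c ⟶ Y c)) (w : List Col) (hw : ∀ c ∈ w, K c) :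
    wordTensor X w ⟶ wordTensor Y w := wordTensorMap w (fun c h => φ c (hw c h))


theorem exch_nat_cons {a a' : C} (f : a ⟶ a') {z z₁ y y₁ : C} {g : z ⟶ z₁} {h : y ⟶ y₁}
    {s : z ⟶ y} {s₁ : z₁ ⟶ y₁} (e : g ≫ s₁ = s ≫ h) : (f ⊗ₘ g) ≫ a' ◁ s₁ = a ◁ s ≫ (f ⊗ₘ h) := by
  rw [← id_tensorHom, ← id_tensorHom, MonoidalCategory.tensorHom_comp_tensorHom,
    MonoidalCategory.tensorHom_comp_tensorHom, e, Category.comp_id, Category.id_comp]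

theorem mapWord_swapHom (φ : ∀ c, K c → (X c ⟶ Y c)) (c d : Col) (v u : List Col)
    (hw : ∀ c' ∈ u ++ d :: c :: v, K c') (hw' : ∀ c' ∈ u ++ c :: d :: v, K c') :
    mapWord φ _ hw ≫ swapHom Y c d v u = swapHom X c d v u ≫ mapWord φ _ hw' := by
  induction u with
  | nil => exact exch_natural _ _ _
  | cons e u ih => exact exch_nat_cons _ (ih _ _)

theorem mapWord_splitHom (φ : ∀ c, K c → (X c ⟶ Y c)) (v t : List Col)
    (hw : ∀ c ∈ t ++ v, K c) (ht : ∀ c ∈ t, K c) (hv : ∀ c ∈ v, K c) :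
    mapWord φ _ hw ≫ splitHom Y v t = splitHom X v t ≫ (mapWord φ t ht ⊗ₘ mapWord φ v hv) := by
  induction t with
  | nil =>
    have : ∀ {a a' : C} (f : a ⟶ a'), f ≫ (λ_ a').inv = (λ_ a).inv ≫ (𝟙 _ ⊗ₘ f) := by
      intros; simp
    exact this _
  | cons e t ih =>
    have : ∀ {a a' z z' t t' v v' : C} {f : a ⟶ a'} {g : z ⟶ z'} {s : z ⟶ t ⊗ v} {s' : z' ⟶ t' ⊗ v'}
        {h : t ⟶ t'} {k : v ⟶ v'}, g ≫ s' = s ≫ (h ⊗ₘ k) →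
        (f ⊗ₘ g) ≫ a' ◁ s' ≫ (α_ _ _ _).inv = (a ◁ s ≫ (α_ _ _ _).inv) ≫ ((f ⊗ₘ h) ⊗ₘ k) := by
      intro a a' z z' t t' v v' f g s s' h k e
      rw [← Category.assoc, exch_nat_cons f e, Category.assoc, Category.assoc,
        associator_inv_naturality]
    exact this (ih _ _)

theorem Coh.natural (φ : ∀ c, K c → (X c ⟶ Y c)) {f : wordTensor X w ⟶ wordTensor X w'}
    (h : Coh X w a w' a' f) (hw : ∀ c ∈ w, K c) (hw' : ∀ c ∈ w', K c) :
    ∃ f', Coh Y w a w' a' f' ∧ mapWord φ w hw ≫ f' = f ≫ mapWord φ w' hw' := by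
  induction h with
  | refl w a h => exact ⟨𝟙 _, .refl _ _ h, by simp⟩
  | swap hu hv c d x y => exact ⟨_, .swap hu hv c d x y, mapWord_swapHom _ _ _ _ _ _ _⟩
  | trans h1 h2 ih1 ih2 =>
    have hm := fun c h => hw c (h1.word_perm.mem_iff.2 h)
    obtain ⟨f1, c1, e1⟩ := ih1 hw hm
    obtain ⟨f2, c2, e2⟩ := ih2 hm hw'
    exact ⟨_, c1.trans c2, by rw [reassoc_of% e1, e2, Category.assoc]⟩


/-- The permutations and splittings in an insertion are natural; only the square for `g` and `g'` is
an assumption. It is used with `K` selecting the colour `half`, the colour `full`, or all colours.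
-/
theorem Graft.ins_natural (φ : ∀ c, K c → (X c ⟶ Y c)) {i : Fin w.length} (e : Graft w i t w')
    (hi : w.get i = c) {g : wordTensor X t ⟶ X c} {g' : wordTensor Y t ⟶ Y c}
    (hw : ∀ c ∈ w, K c) (hw' : ∀ c ∈ w', K c) (ht : ∀ c ∈ t, K c) (hc : K c)
    (h : mapWord φ t ht ≫ g' = g ≫ φ c hc) :
    mapWord φ w' hw' ≫ e.ins hi g' = e.ins hi g ≫ mapWord φ w hw := by
  have hla := lab_injective e (x := none) (Option.some_injective (Fin w'.length)) (by simp)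
  have hin := e.ins_isIns hi g (la := e.lab none some) (lc := some) (lb := some ∘ e.n)
    (fun j hj => (lab_o _ _ _ j hj).symm) (fun _ => rfl)
  obtain ⟨v, r, p, q, hp, hq, e1⟩ := hin
  have htv : ∀ c ∈ t ++ v, K c := fun c h => hw' c (hp.word_perm.mem_iff.2 h)
  have hv : ∀ c ∈ v, K c := fun c h => htv c (List.mem_append_right _ h)
  have hcv : ∀ c' ∈ c :: v, K c' := fun c' h => hw c' (hq.word_perm.mem_iff.1 h)
  obtain ⟨p', hp', ep⟩ := hp.natural φ hw' htv
  obtain ⟨q', hq', eq⟩ := hq.natural φ hcv hw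
  rw [Graft.ins_eq e hi g' hla (Option.some_injective _) (fun j hj => (lab_o _ _ _ j hj).symm)
    (lb := some ∘ e.n) (fun _ => rfl) ⟨v, r, p', q', hp', hq', rfl⟩, e1]
  have key : ∀ {W W' Z Z' T T' V V' k k' U U' : C} {m : W ⟶ W'} {p : W ⟶ Z} {p' : W' ⟶ Z'}
      {z : Z ⟶ Z'} {s : Z ⟶ T ⊗ V} {s' : Z' ⟶ T' ⊗ V'} {t : T ⟶ T'} {v : V ⟶ V'} {g : T ⟶ k}
      {g' : T' ⟶ k'} {f : k ⟶ k'} {q : k ⊗ V ⟶ U} {q' : k' ⊗ V' ⟶ U'} {n : U ⟶ U'},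
      m ≫ p' = p ≫ z → z ≫ s' = s ≫ (t ⊗ₘ v) → t ≫ g' = g ≫ f → (f ⊗ₘ v) ≫ q' = q ≫ n →
      m ≫ p' ≫ s' ≫ g' ▷ V' ≫ q' = (p ≫ s ≫ g ▷ V ≫ q) ≫ n := by
    intro W W' Z Z' T T' V V' k k' U U' m p p' z s s' t v g g' f q q' n h1 h2 h3 h4
    have h5 : (t ⊗ₘ v) ≫ g' ▷ V' = g ▷ V ≫ (f ⊗ₘ v) := by
      rw [← tensorHom_id, ← tensorHom_id, MonoidalCategory.tensorHom_comp_tensorHom,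
        MonoidalCategory.tensorHom_comp_tensorHom, h3, Category.comp_id, Category.id_comp]
    rw [reassoc_of% h1, reassoc_of% h2, reassoc_of% h5, h4]
    simp only [Category.assoc]
  exact key ep (mapWord_splitHom φ v t htv ht hv) h eq

/-- The form of an insertion after a relabelling. -/
theorem Graft.ins_chg {w'' : List Col} {i : Fin w.length} (e : Graft w i t w')
    (e' : Graft w i t w'') (hi : w.get i = c) (g : wordTensor X t ⟶ X c) :
    e'.ins hi g = (chg k e e').perm X ≫ e.ins hi g := by
  have hla := lab_injective e' (x := none) (Option.some_injective (Fin w''.length)) (by simp)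
  refine Graft.ins_eq e' hi g hla (Option.some_injective _)
    (fun j hj => (lab_o _ _ _ j hj).symm) (lb := some ∘ e'.n) (fun _ => rfl) ?_
  have h1 := (chg k e e').perm_coh (X := X) (lc := some) (lb := some ∘ (chg k e e').n)
    (fun _ => rfl)
  refine IsIns.precomp h1 ?_
  have := e.ins_isIns hi g (la := e'.lab none some) (lc := some ∘ (chg k e e').n)
    (lb := some ∘ e'.n) (fun j hj => ?_) (fun b => ?_)
  · rw [lab_self] at this ⊢
    exact this
  · rw [lab_o _ _ _ j hj, Function.comp, chg_o]
  · rw [Function.comp, chg_n]; rfl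

end Naturality

/-! ### Maps out of `i.obj T ⊗ X` as continuous families of maps. -/

section HomTop
variable {C : Type u} [Category.{v} C] [MonoidalCategory C] [SymmetricCategory C]
  [MonoidalClosed C] (i : CGTop ⥤ C) [i.Braided]

/-- The points of an object of `CGTop`. -/
noncomputable def constO (T : CGTop) (t : T) : 𝟙_ CGTop ⟶ T :=
  ObjectProperty.homMk (TopCat.ofHom (ContinuousMap.const _ t))

def cmap {T S : CGTop} (f : T → S) (hf : Continuous f) : T ⟶ S :=
  ObjectProperty.homMk (TopCat.ofHom ⟨f, hf⟩)

theorem CGTop.hom_ext' {T S : CGTop} {f g : T ⟶ S} (h : ∀ t : T, f.hom t = g.hom t) : f = g := by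
  ext t; exact h t

theorem constO_comp {T S : CGTop} (f : T ⟶ S) (t : T) : constO T t ≫ f = constO S (f.hom t) := rfl

noncomputable def ptO (T : CGTop) (t : T) (X : C) : X ⟶ i.obj T ⊗ X :=
  (λ_ X).inv ≫ (Functor.LaxMonoidal.ε i ≫ i.map (constO T t)) ▷ X

theorem pt_eq_ptO {T : Type} [TopologicalSpace T] [IsGeneratedBy CH T] (t : T) (X : C) :
    pt i t X = ptO i (CGTop.of T) t X := rfl

variable {i}

theorem ptO_map {T S : CGTop} (f : T ⟶ S) (t : T) (X : C) :
    ptO i T t X ≫ i.map f ▷ X = ptO i S (f.hom t) X := by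
  rw [ptO, Category.assoc, ← comp_whiskerRight, Category.assoc, ← i.map_comp, constO_comp, ptO]

theorem ptO_natural (T : CGTop) (t : T) {X Y : C} (f : X ⟶ Y) :
    f ≫ ptO i T t Y = ptO i T t X ≫ i.obj T ◁ f := by
  rw [ptO, ptO, Category.assoc, ← whisker_exchange, leftUnitor_inv_naturality_assoc]

theorem ptO_whisker (T : CGTop) (t : T) (X V : C) :
    ptO i T t (X ⊗ V) = ptO i T t X ▷ V ≫ (α_ _ _ _).hom := by
  simp [ptO]

variable [i.IsLeftAdjoint]

/-- The space of maps from `X` to `Y`. -/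
noncomputable abbrev mapSpace (i : CGTop ⥤ C) [i.IsLeftAdjoint] (X Y : C) : CGTop :=
  i.rightAdjoint.obj ((ihom X).obj Y)

/-- Closedness of `C` moves `X` to the target, and the right adjoint of `i` moves the problem into
spaces. A map out of `i.obj T ⊗ X` thus becomes a map of spaces, which is determined by its values
at points. -/
noncomputable def transp {T : CGTop} {X Y : C} : (i.obj T ⊗ X ⟶ Y) ≃ (T ⟶ mapSpace i X Y) :=
  (((β_ X (i.obj T)).homCongr (Iso.refl Y)).symm.trans
    ((ihom.adjunction X).homEquiv _ _)).trans ((Adjunction.ofIsLeftAdjoint i).homEquiv T _)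

theorem transp_map {T S : CGTop} {X Y : C} (f : T ⟶ S) (F : i.obj S ⊗ X ⟶ Y) :
    transp (i.map f ▷ X ≫ F) = f ≫ transp F := by
  simp only [transp, Equiv.trans_apply]
  rw [← Adjunction.homEquiv_naturality_left, ← Adjunction.homEquiv_naturality_left]
  congr 2
  simp [Iso.homCongr]


/-- The projection from the tensor product with the one-point space. -/
noncomputable def forgetUnit (i : CGTop ⥤ C) [i.Braided] (X : C) :
    i.obj (CGTop.of PUnit) ⊗ X ⟶ X :=
  (i.map (CartesianMonoidalCategory.toUnit _) ≫ Functor.OplaxMonoidal.η i) ▷ X ≫ (λ_ X).hom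

theorem ptO_forgetUnit (X : C) : ptO i (CGTop.of PUnit) PUnit.unit X ≫ forgetUnit i X = 𝟙 X := by
  have h : constO (CGTop.of PUnit) PUnit.unit ≫ CartesianMonoidalCategory.toUnit _ = 𝟙 _ :=
    CartesianMonoidalCategory.toUnit_unique _ _
  rw [ptO, forgetUnit, Category.assoc, ← comp_whiskerRight_assoc, Category.assoc,
    ← i.map_comp_assoc, h]
  simp

theorem forgetUnit_ptO (T : CGTop) (t : T) (X : C) :
    forgetUnit i X ≫ ptO i T t X = i.map (cmap (fun _ => t) continuous_const) ▷ X := by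
  have h : CartesianMonoidalCategory.toUnit (CGTop.of PUnit) ≫ constO T t =
    cmap (fun _ => t) continuous_const := rfl
  rw [ptO, forgetUnit, Category.assoc, Iso.hom_inv_id_assoc, ← comp_whiskerRight, ← h]
  simp

/-- A morphism is a family indexed by the one-point space; its transpose picks out a point of the
mapping space. -/
noncomputable def homPt (i : CGTop ⥤ C) [i.Braided] [i.IsLeftAdjoint] {X Y : C} (f : X ⟶ Y) :
    mapSpace i X Y :=
  (transp (forgetUnit i X ≫ f)).hom PUnit.unit

theorem transp_apply {T : CGTop} {X Y : C} (F : i.obj T ⊗ X ⟶ Y) (t : T) :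
    (transp F).hom t = homPt i (ptO i T t X ≫ F) := by
  rw [homPt, ← Category.assoc, forgetUnit_ptO, transp_map]
  rfl

theorem homPt_injective {X Y : C} : Function.Injective (homPt i : (X ⟶ Y) → _) := by
  intro f g h
  have h1 : transp (forgetUnit i X ≫ f) = transp (forgetUnit i X ≫ g) :=
    CGTop.hom_ext' fun t => h
  have h2 := congrArg (fun k => ptO i _ PUnit.unit X ≫ k) (transp.injective h1)
  simpa only [← Category.assoc, ptO_forgetUnit, Category.id_comp] using h2

/-- The topology on the set of maps. -/
@[reducible] noncomputable def homTop (i : CGTop ⥤ C) [i.Braided] [i.IsLeftAdjoint] (X Y : C) :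
    TopologicalSpace (X ⟶ Y) := TopologicalSpace.induced (homPt i) inferInstance

/-- After transposition this is extensionality of maps of spaces. It justifies stating the axioms of
algebras, of `Asc` and of `Hoch` at single points of the spaces of operations. -/
theorem hom_ext_pt {T : CGTop} {X Y : C} {F G : i.obj T ⊗ X ⟶ Y}
    (h : ∀ t, ptO i T t X ≫ F = ptO i T t X ≫ G) : F = G :=
  transp.injective (CGTop.hom_ext' fun t => by rw [transp_apply, transp_apply, h])

/-- The topology is induced from the mapping space, so a continuous family is a map from `T` to the
mapping space, and hence has a transpose. -/
theorem continuous_homTop_iff {T : CGTop} {X Y : C} (f : T → (X ⟶ Y)) :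
    Continuous[_, homTop i X Y] f ↔ ∃ F : i.obj T ⊗ X ⟶ Y, ∀ t, ptO i T t X ≫ F = f t := by
  rw [homTop, continuous_induced_rng]
  constructor
  · intro h
    refine ⟨transp.symm (cmap _ h), fun t => homPt_injective (i := i) ?_⟩
    rw [← transp_apply, Equiv.apply_symm_apply]
    rfl
  · rintro ⟨F, hF⟩
    have : homPt i ∘ f = (transp F).hom := by
      funext t
      rw [transp_apply, hF]; rfl
    rw [this]
    exact (transp F).hom.hom.continuous


theorem ptO_tensor {T S : CGTop} (p : (T ⊗ S : CGTop)) (X : C) :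
    ptO i (T ⊗ S) p X ≫ Functor.OplaxMonoidal.δ i T S ▷ X ≫ (α_ _ _ _).hom =
      ptO i S ((CartesianMonoidalCategory.snd T S).hom p) X ≫
        ptO i T ((CartesianMonoidalCategory.fst T S).hom p) (i.obj S ⊗ X) := by
  -- The tensor product of `CGTop` is the cartesian product, so a point is determined by its two
  -- projections.
  have h : constO (T ⊗ S) p = (λ_ (𝟙_ CGTop)).inv ≫
      (constO T ((CartesianMonoidalCategory.fst T S).hom p) ⊗ₘ
        constO S ((CartesianMonoidalCategory.snd T S).hom p)) := by
    apply CartesianMonoidalCategory.hom_ext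
    · rw [Category.assoc, CartesianMonoidalCategory.tensorHom_fst]; rfl
    · rw [Category.assoc, CartesianMonoidalCategory.tensorHom_snd]; rfl
  have h2 : Functor.LaxMonoidal.ε i ≫ i.map (constO (T ⊗ S) p) ≫ Functor.OplaxMonoidal.δ i T S =
      (λ_ (𝟙_ C)).inv ≫ ((Functor.LaxMonoidal.ε i ≫
        i.map (constO T ((CartesianMonoidalCategory.fst T S).hom p))) ⊗ₘ
        (Functor.LaxMonoidal.ε i ≫
          i.map (constO S ((CartesianMonoidalCategory.snd T S).hom p)))) := by
    rw [h, i.map_comp, Category.assoc, ← Functor.OplaxMonoidal.δ_natural,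
      ← MonoidalCategory.tensorHom_comp_tensorHom]
    simp only [← Category.assoc]
    congr 1
    rw [← Functor.LaxMonoidal.left_unitality_inv]
    simp [tensorHom_def']
  rw [ptO, Category.assoc, ← comp_whiskerRight_assoc, Category.assoc, h2, ptO, ptO]
  set a := Functor.LaxMonoidal.ε i ≫ i.map (constO T ((CartesianMonoidalCategory.fst T S).hom p))
  set b := Functor.LaxMonoidal.ε i ≫ i.map (constO S ((CartesianMonoidalCategory.snd T S).hom p))
  clear_value a b
  have : ∀ {A B : C} (a : 𝟙_ C ⟶ A) (b : 𝟙_ C ⟶ B),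
      (λ_ X).inv ≫ ((λ_ (𝟙_ C)).inv ≫ (a ⊗ₘ b)) ▷ X ≫ (α_ A B X).hom =
        ((λ_ X).inv ≫ b ▷ X) ≫ (λ_ _).inv ≫ a ▷ (B ⊗ X) := by
    intro A B a b
    rw [tensorHom_def']
    simp only [comp_whiskerRight, Category.assoc, whiskerRight_tensor]
    simp
  exact this a b

end HomTop

/-! ### Operations on continuous families of maps. -/

section Families
variable {C : Type u} [Category.{v} C] [MonoidalCategory C] [SymmetricCategory C]
  [MonoidalClosed C] {i : CGTop ⥤ C} [i.Braided] [i.IsLeftAdjoint]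

theorem isGeneratedBy_compHaus (K : CompHaus.{0}) : IsGeneratedBy CH K :=
  inferInstanceAs (IsGeneratedBy CH (CH K))

/-- A continuous family with two parameters, as a map. -/
theorem exists_two_parameter {T S : CGTop} {X Y : C} (m : T → S → (X ⟶ Y))
    (hm : ∀ (K : CompHaus.{0}) (a : K → T) (b : K → S), Continuous a → Continuous b →
      Continuous[_, homTop i X Y] (fun z => m (a z) (b z))) :
    ∃ F : i.obj T ⊗ (i.obj S ⊗ X) ⟶ Y, ∀ t s, ptO i S s X ≫ ptO i T t _ ≫ F = m t s := by
  let f : (T ⊗ S : CGTop) → (X ⟶ Y) := fun p =>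
    m ((CartesianMonoidalCategory.fst T S).hom p) ((CartesianMonoidalCategory.snd T S).hom p)
  have hf : Continuous[_, homTop i X Y] f := by
    let _ := homTop i X Y
    -- The product formed in `CGTop` is compactly generated, so test maps from compact Hausdorff
    -- spaces suffice, and these are pairs of maps to the factors.
    refine (IsGeneratedBy.continuous_iff (X := CH) _).2 fun K g => ?_
    exact hm K _ _ ((CartesianMonoidalCategory.fst T S).hom.hom.continuous.comp g.continuous)
      ((CartesianMonoidalCategory.snd T S).hom.hom.continuous.comp g.continuous)
  obtain ⟨F, hF⟩ := (continuous_homTop_iff f).1 hf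
  refine ⟨(α_ _ _ _).inv ≫ Functor.LaxMonoidal.μ i T S ▷ X ≫ F, fun t s => ?_⟩
  -- The point `(t, s)` is produced by the universal property of the product, evaluated at the point
  -- of `PUnit`.
  let p : (T ⊗ S : CGTop) := (CartesianMonoidalCategory.lift
    (cmap (T := CGTop.of PUnit) (fun _ => t) continuous_const) (cmap (fun _ => s) continuous_const)).hom PUnit.unit
  have h1 : (CartesianMonoidalCategory.fst T S).hom p = t := by
    have := CartesianMonoidalCategory.lift_fst
      (cmap (T := CGTop.of PUnit) (fun _ => t) continuous_const) (cmap (fun _ => s) continuous_const)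
    exact congrArg (fun k => k.hom PUnit.unit) this
  have h2 : (CartesianMonoidalCategory.snd T S).hom p = s := by
    have := CartesianMonoidalCategory.lift_snd
      (cmap (T := CGTop.of PUnit) (fun _ => t) continuous_const) (cmap (fun _ => s) continuous_const)
    exact congrArg (fun k => k.hom PUnit.unit) this
  have h3 := ptO_tensor (i := i) p X
  rw [h1, h2] at h3
  rw [← Category.assoc, ← h3]
  have h4 := hF p
  simp only [f, h1, h2] at h4
  rw [← h4]
  simp [← comp_whiskerRight_assoc]

variable {T : Type} [TopologicalSpace T] [IsGeneratedBy CH T] {X Y Z : C}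

theorem continuous_homTop {f : T → (X ⟶ Y)} :
    Continuous[_, homTop i X Y] f ↔
      ∃ F : i.obj (CGTop.of T) ⊗ X ⟶ Y, ∀ t, pt i t X ≫ F = f t :=
  continuous_homTop_iff (T := CGTop.of T) f

theorem continuous_homTop_comp {f : T → (X ⟶ Y)} {g : T → (Y ⟶ Z)}
    (hf : Continuous[_, homTop i X Y] f) (hg : Continuous[_, homTop i Y Z] g) :
    Continuous[_, homTop i X Z] (fun t => f t ≫ g t) := by
  obtain ⟨F, hF⟩ := continuous_homTop.1 hf
  obtain ⟨G, hG⟩ := continuous_homTop.1 hg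
  let T' := CGTop.of T
  -- The diagonal supplies both families with the same parameter.
  let D : T' ⟶ T' ⊗ T' := CartesianMonoidalCategory.lift (𝟙 _) (𝟙 _)
  refine continuous_homTop.2 ⟨i.map D ▷ X ≫ Functor.OplaxMonoidal.δ i T' T' ▷ X ≫
    (α_ _ _ _).hom ≫ i.obj T' ◁ F ≫ G, fun t => ?_⟩
  have h1 : (CartesianMonoidalCategory.fst T' T').hom (D.hom t) = t :=
    congrArg (fun k => k.hom t) (CartesianMonoidalCategory.lift_fst (𝟙 T') (𝟙 T'))
  have h2 : (CartesianMonoidalCategory.snd T' T').hom (D.hom t) = t :=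
    congrArg (fun k => k.hom t) (CartesianMonoidalCategory.lift_snd (𝟙 T') (𝟙 T'))
  have h3 := ptO_tensor (i := i) (D.hom t) X
  rw [h1, h2] at h3
  have h4 := ptO_map (i := i) D t X
  rw [← hF, ← hG, pt_eq_ptO, pt_eq_ptO, ← Category.assoc, h4, reassoc_of% h3,
    ← reassoc_of% (ptO_natural (i := i) T' t F)]
  simp only [Category.assoc]
  rfl

theorem continuous_homTop_precomp (h : X ⟶ Y) {f : T → (Y ⟶ Z)}
    (hf : Continuous[_, homTop i Y Z] f) : Continuous[_, homTop i X Z] (fun t => h ≫ f t) := by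
  obtain ⟨F, hF⟩ := continuous_homTop.1 hf
  refine continuous_homTop.2 ⟨_ ◁ h ≫ F, fun t => ?_⟩
  rw [← hF, pt_eq_ptO, ← reassoc_of% (ptO_natural (i := i) (CGTop.of T) t h), pt_eq_ptO]

theorem continuous_homTop_postcomp (h : Y ⟶ Z) {f : T → (X ⟶ Y)}
    (hf : Continuous[_, homTop i X Y] f) : Continuous[_, homTop i X Z] (fun t => f t ≫ h) := by
  obtain ⟨F, hF⟩ := continuous_homTop.1 hf
  exact continuous_homTop.2 ⟨F ≫ h, fun t => by rw [← hF, Category.assoc]⟩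

theorem continuous_homTop_whiskerRight (V : C) {f : T → (X ⟶ Y)}
    (hf : Continuous[_, homTop i X Y] f) :
    Continuous[_, homTop i (X ⊗ V) (Y ⊗ V)] (fun t => f t ▷ V) := by
  obtain ⟨F, hF⟩ := continuous_homTop.1 hf
  refine continuous_homTop.2 ⟨(α_ _ _ _).inv ≫ F ▷ V, fun t => ?_⟩
  rw [← hF, pt_eq_ptO, ptO_whisker, pt_eq_ptO]
  simp

end Families

/-! ### Algebras described by their pointwise operations. -/

section AlgOps
variable {C : Type u} [Category.{v} C] [MonoidalCategory C] [SymmetricCategory C]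
  [MonoidalClosed C] {i : CGTop ⥤ C} [i.Braided] [i.IsLeftAdjoint]
  {S : List Col → Col → Prop} {P : OperadData S} {X : Col → C}

theorem Graft.continuous_ins {T : Type} [TopologicalSpace T] [IsGeneratedBy CH T]
    {w t w' : List Col} {j : Fin w.length} {c : Col} (e : Graft w j t w') (hj : w.get j = c)
    {f : T → (wordTensor X t ⟶ X c)} (hf : Continuous[_, homTop i _ _] f) :
    Continuous[_, homTop i _ _] (fun z => e.ins hj (f z)) := by
  obtain ⟨v, p, q, h⟩ := e.ins_form X hj
  simp only [h]
  exact continuous_homTop_precomp _ (continuous_homTop_precomp _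
    (continuous_homTop_postcomp _ (continuous_homTop_whiskerRight _ hf)))

theorem Alg.continuous_op (α : Alg i P X) {w : List Col} {k : Col} (h : S w k) :
    Continuous[P.top w k h, homTop i _ _] (fun x : P.Obj w k h => α.op x) :=
  continuous_homTop.2 ⟨α.str w k h, fun _ => rfl⟩

theorem Alg.ext_op {α β : Alg i P X}
    (h : ∀ w k (hw : S w k) (x : P.Obj w k hw), α.op x = β.op x) : α = β := by
  have : α.str = β.str := by
    funext w k hw
    exact hom_ext_pt (T := CGTop.of (P.Obj w k hw)) (fun x => h w k hw x)
  cases α; cases β; cases this; rfl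

theorem Alg.op_one (α : Alg i P X) {k : Col} (h : S [k] k) :
    α.op (P.one k h) = (ρ_ (X k)).hom := α.one k h

/-- Continuity of the pointwise operations is exactly what assembles them into structure maps; the
axioms are pointwise already. -/
theorem Alg.exists_of_op (op : ∀ w k (h : S w k), P.Obj w k h → (wordTensor X w ⟶ X k))
    (hc : ∀ w k h, Continuous[P.top w k h, homTop i _ _] (op w k h))
    (one : ∀ k (h : S [k] k), op [k] k h (P.one k h) = (ρ_ (X k)).hom)
    (comp : ∀ {u v t : List Col} {k c : Col} (hw : S (u ++ c :: v) k) (ht : S t c)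
      (hw' : S (u ++ (t ++ v)) k) (x : P.Obj _ k hw) (y : P.Obj t c ht),
      op _ k hw' (P.comp hw ht hw' (mid u c v) (get_mid u c v) (Graft.planar u c v t) x y) =
        splice X v (op t c ht y) u ≫ op _ k hw x)
    (swap : ∀ {u v : List Col} {a b k : Col} (h : S [k] k) (hw : S (u ++ a :: b :: v) k)
      (hw' : S (u ++ b :: a :: v) k) (x : P.Obj _ k hw),
      op _ k hw' (P.comp h hw hw' 0 rfl (Graft.swap k u a b v) (P.one k h) x) =
        swapHom X a b v u ≫ op _ k hw x) :
    ∃ α : Alg i P X, ∀ w k (h : S w k) (x : P.Obj w k h), α.op x = op w k h x := by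
  choose F hF using fun w k h => continuous_homTop.1 (hc w k h)
  refine ⟨⟨F, fun k h => ?_, fun hw ht hw' x y => ?_, fun h hw hw' x => ?_⟩,
    fun w k h x => hF w k h x⟩
  · rw [hF, one]
  · rw [hF, hF, hF, comp]
  · rw [hF, hF, swap]

end AlgOps

/-! ### From exchanges of neighbours and planar compositions to all graftings. -/

section Equivariance
variable {w t w' w'' : List Col} {k c : Col} {I : Type}

theorem lbl_getElem? {n : ℕ} (l : Fin n → I) (j : Fin n) : (lbl l)[j.1]? = some (l j) := by
  simp [lbl]

/-- A relabelling as a bijection. -/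
def Graft.toEquiv (σ : Graft [k] 0 w w') : Fin w.length ≃ Fin w'.length :=
  haveI : IsEmpty {j : Fin [k].length // j ≠ 0} :=
    ⟨fun j => j.2 (Subsingleton.elim (α := Fin 1) _ _)⟩
  (Equiv.emptySum _ (Fin w.length)).symm.trans σ.eqv

theorem Graft.toEquiv_apply (σ : Graft [k] 0 w w') (b) : σ.toEquiv b = σ.n b := rfl

def Graft.trans (σ : Graft [k] 0 w w') (τ : Graft [k] 0 w' w'') : Graft [k] 0 w w'' :=
  relabel k (σ.toEquiv.trans τ.toEquiv) fun _ => (τ.get_n _).trans (σ.get_n _)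

theorem Graft.trans_n (σ : Graft [k] 0 w w') (τ : Graft [k] 0 w' w'') (b) :
    (σ.trans τ).n b = τ.n (σ.n b) := rfl

def Graft.symm (σ : Graft [k] 0 w w') : Graft [k] 0 w' w :=
  relabel k σ.toEquiv.symm fun b => by
    rw [← σ.get_n, ← Graft.toEquiv_apply, Equiv.apply_symm_apply]


theorem Graft.n_symm_n (σ : Graft [k] 0 w w') (b) : σ.n (σ.symm.n b) = b :=
  σ.toEquiv.apply_symm_apply b

theorem Graft.relabel_ext {σ τ : Graft [k] 0 w w'} (h : ∀ b, σ.n b = τ.n b) : σ = τ :=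
  Graft.ext' (fun _ ha => (unique_o _ ha).elim) h

theorem Graft.perm_word (σ : Graft [k] 0 w w') : w.Perm w' := by
  have h : w = (List.finRange w.length).map (fun b => w'.get (σ.n b)) := by
    simp only [σ.get_n]
    rw [← List.ofFn_eq_map]
    exact (List.ofFn_get w).symm
  have h2 : w' = (List.finRange w'.length).map w'.get := by
    rw [← List.ofFn_eq_map, List.ofFn_get]
  rw [h2]
  conv_lhs => rw [h]
  have h3 : ((List.finRange w.length).map σ.n).Perm (List.finRange w'.length) := by
    refine (List.perm_ext_iff_of_nodup ((List.nodup_finRange _).map fun _ _ h => σ.n_inj.1 h)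
      (List.nodup_finRange _)).2 fun q => ?_
    simp only [List.mem_map, List.mem_finRange, true_and, iff_true]
    exact ⟨σ.symm.n q, σ.n_symm_n q⟩
  have := h3.map w'.get
  rwa [List.map_map] at this

theorem Graft.swap_getElem? {u v : List Col} {au av : List I} (hu : u.length = au.length) (c d : Col)
    (x y : I) (b : Fin (u ++ d :: c :: v).length) :
    (au ++ x :: y :: av)[((Graft.swap k u d c v).n b).1]? = (au ++ y :: x :: av)[b.1]? := by
  change (au ++ x :: y :: av)[(Equiv.swap (⟨u.length, by simp⟩ : Fin (u ++ d :: c :: v).length)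
      ⟨u.length + 1, by simp⟩ b).1]? = _
  by_cases h1 : b.1 = u.length
  · obtain rfl : b = ⟨u.length, by simp⟩ := Fin.ext h1
    rw [Equiv.swap_apply_left]
    simp [hu]
  by_cases h2 : b.1 = u.length + 1
  · obtain rfl : b = ⟨u.length + 1, by simp⟩ := Fin.ext h2
    rw [Equiv.swap_apply_right]
    simp [hu]
  · rw [Equiv.swap_apply_of_ne_of_ne (fun h => h1 (by rw [h])) (fun h => h2 (by rw [h]))]
    rcases lt_or_ge b.1 au.length with h | h
    · rw [List.getElem?_append_left h, List.getElem?_append_left h]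
    · rw [List.getElem?_append_right h, List.getElem?_append_right h]
      obtain ⟨m, hm⟩ : ∃ m, b.1 - au.length = m + 2 := ⟨b.1 - au.length - 2, by omega⟩
      simp [hm]

variable {C : Type u} [Category.{v} C] [MonoidalCategory C] [SymmetricCategory C] {X : Col → C}

/-- Compatibility with exchanges of neighbours implies equivariance. -/
theorem equivariant_of_swap {S : List Col → Prop} {Q : ∀ w, S w → Type} {Y : C}
    (hS : ∀ {w w'}, S w → w.Perm w' → S w')
    (act : ∀ {w w'} (hw : S w) (hw' : S w'), Graft [k] 0 w w' → Q w hw → Q w' hw')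
    (act_id : ∀ {w} (hw : S w) (x : Q w hw), act hw hw (Graft.idL k w) x = x)
    (act_act : ∀ {w w' w''} (hw : S w) (hw' : S w') (hw'' : S w'') (σ : Graft [k] 0 w w')
      (τ : Graft [k] 0 w' w'') (x : Q w hw),
      act hw hw'' (σ.trans τ) x = act hw' hw'' τ (act hw hw' σ x))
    (op : ∀ w (hw : S w), Q w hw → (wordTensor X w ⟶ Y))
    (swap : ∀ {u v : List Col} {a b : Col} (hw : S (u ++ a :: b :: v)) (hw' : S (u ++ b :: a :: v))
      (x : Q _ hw), op _ hw' (act hw hw' (Graft.swap k u a b v) x) = swapHom X a b v u ≫ op _ hw x)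
    {w w' : List Col} (hw : S w) (hw' : S w') (σ : Graft [k] 0 w w') (x : Q w hw) :
    op w' hw' (act hw hw' σ x) = σ.perm X ≫ op w hw x := by
  -- The permutation of tensor factors is a product of exchanges. Following these on the side of
  -- operations builds a relabelling `τ`, whose identity is recorded by reading labels through it.
  have main : ∀ {I : Type} {w' w : List Col} {a' a : List I}
      {f : wordTensor X w' ⟶ wordTensor X w}, Coh X w' a' w a f → ∀ (hw : S w) (hw' : S w'),
      ∃ τ : Graft [k] 0 w w', (∀ b, a'[(τ.n b).1]? = a[b.1]?) ∧
        ∀ x, op w' hw' (act hw hw' τ x) = f ≫ op w hw x := by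
    intro I w' w a' a f h
    induction h with
    | refl w a h =>
      exact fun hw hw' => ⟨Graft.idL k w, fun b => rfl, fun x => by
        rw [act_id, Category.id_comp]⟩
    | @swap u v au av hu hv c d x y =>
      exact fun hw hw' => ⟨Graft.swap k u d c v, Graft.swap_getElem? hu c d x y,
        fun x => swap hw hw' x⟩
    | trans h1 h2 ih1 ih2 =>
      intro hw hw'
      have hm := hS hw' h1.word_perm
      obtain ⟨τ, l1, e1⟩ := ih1 hm hw'
      obtain ⟨σ, l2, e2⟩ := ih2 hw hm
      exact ⟨σ.trans τ, fun b => by rw [Graft.trans_n, l1, l2], fun x => by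
        rw [act_act hw hm hw', e1, e2, Category.assoc]⟩
  obtain ⟨τ, l, e⟩ := main (σ.perm_coh (X := X) (lc := id) (lb := σ.n) (fun _ => rfl)) hw hw'
  -- With positions as labels, the record determines `τ` completely.
  have : σ = τ := Graft.relabel_ext fun b => by
    have := l b
    rw [lbl_getElem?, lbl_getElem?] at this
    exact (Option.some.inj this).symm
  rw [this] at e ⊢
  rw [e]

/-- Every input stands between the letters before and after it. As an induction principle this
replaces a position by the middle letter of a decomposed word without casts. -/
theorem exists_mid {motive : ∀ w : List Col, Fin w.length → Prop}
    (h : ∀ u c v, motive (u ++ c :: v) (mid u c v)) (w : List Col) (i : Fin w.length) :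
    motive w i := by
  have key : ∀ (w u : List Col) (i : Fin w.length),
      motive (u ++ w) ⟨u.length + i, by simp⟩ := by
    intro w
    induction w with
    | nil => exact fun _ i => i.elim0
    | cons c w ih =>
      intro u i
      refine Fin.cases (h u c w) (fun j => ?_) i
      have := ih (u ++ [c]) j
      have e : u ++ [c] ++ w = u ++ c :: w := by simp
      have hh : ∀ (z : List Col) (e : u ++ [c] ++ w = z) (q : Fin z.length),
        q.1 = (u ++ [c]).length + j → motive z q := by
        intro z e q hq
        subst e
        exact (Fin.ext hq : q = ⟨_, by simp; omega⟩) ▸ this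
      exact hh _ e _ (by simp; omega)
  have := key w [] i
  simpa using this

/-- The laws of relabelling. -/
structure OperadData.Relabels {S : List Col → Col → Prop} (Q : OperadData S) : Prop where
  perm : ∀ {w w' k}, S w k → w.Perm w' → S w' k
  unit : ∀ {w k}, S w k → S [k] k
  act_id : ∀ {w k} (h : S [k] k) (hw : S w k) (x : Q.Obj w k hw),
    Q.comp h hw hw 0 rfl (Graft.idL k w) (Q.one k h) x = x
  act_act : ∀ {w w' w'' k} (h : S [k] k) (hw : S w k) (hw' : S w' k) (hw'' : S w'' k)
    (σ : Graft [k] 0 w w') (τ : Graft [k] 0 w' w'') (x : Q.Obj w k hw),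
    Q.comp h hw hw'' 0 rfl (σ.trans τ) (Q.one k h) x =
      Q.comp h hw' hw'' 0 rfl τ (Q.one k h) (Q.comp h hw hw' 0 rfl σ (Q.one k h) x)
  chg : ∀ {w t w' w'' k c} {i : Fin w.length} (h : S [k] k) (hw : S w k) (ht : S t c)
    (hw' : S w' k) (hw'' : S w'' k) (hi : w.get i = c) (e : Graft w i t w') (e' : Graft w i t w'')
    (x : Q.Obj w k hw) (y : Q.Obj t c ht),
    Q.comp hw ht hw'' i hi e' x y =
      Q.comp h hw' hw'' 0 rfl (Graft.chg k e e') (Q.one k h) (Q.comp hw ht hw' i hi e x y)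

theorem Operad.relabels {S : List Col → Col → Prop} (Q : Operad S)
    (perm : ∀ {w w' k}, S w k → w.Perm w' → S w' k) (unit : ∀ {w k}, S w k → S [k] k) :
    Q.toOperadData.Relabels where
  perm := perm
  unit := unit
  act_id h hw x := Q.one_comp h hw _ x fun _ => rfl
  act_act h hw hw' hw'' σ τ x := by
    rw [← Q.comp_seq h h hw h hw' hw'' rfl rfl rfl (Graft.idL _ _) (σ.trans τ) σ τ,
      Q.one_comp h h _ _ (fun _ => rfl)]
    exact ⟨rfl, fun a ha => (Graft.unique_o a ha).elim, fun a ha => (Graft.unique_o a ha).elim,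
      fun c => rfl⟩
  chg h hw ht hw' hw'' hi e e' x y := by
    rw [← Q.comp_seq h hw ht hw hw' hw'' rfl hi hi (Graft.idL _ _) e' e,
      Q.one_comp h hw _ _ (fun _ => rfl)]
    exact ⟨rfl, fun a ha => (Graft.unique_o a ha).elim, fun a ha h => (Graft.chg_o _ e e' a ha).symm,
      fun c => (Graft.chg_n _ e e' c).symm⟩

variable {i : CGTop ⥤ C} [i.Braided] {S : List Col → Col → Prop} {Q : OperadData S}

theorem Alg.op_act (α : Alg i Q X) (hQ : Q.Relabels) (h : S [k] k) (hw : S w k) (hw' : S w' k)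
    (σ : Graft [k] 0 w w') (x : Q.Obj w k hw) :
    α.op (Q.comp h hw hw' 0 rfl σ (Q.one k h) x) = σ.perm X ≫ α.op x :=
  equivariant_of_swap (S := fun w => S w k) (Q := fun w hw => Q.Obj w k hw) hQ.perm
    (fun hw hw' σ x => Q.comp h hw hw' 0 rfl σ (Q.one k h) x)
    (fun hw x => hQ.act_id h hw x) (fun hw hw' hw'' σ τ x => hQ.act_act h hw hw' hw'' σ τ x)
    (fun _ _ x => α.op x) (fun hw hw' x => α.swap h hw hw' x) hw hw' σ x

/-- Structure maps are compatible with all compositions. -/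
theorem Alg.op_comp (α : Alg i Q X) (hQ : Q.Relabels) (hw : S w k) (ht : S t c) (hw' : S w' k)
    (j : Fin w.length) (hj : w.get j = c) (e : Graft w j t w') (x : Q.Obj w k hw)
    (y : Q.Obj t c ht) :
    α.op (Q.comp hw ht hw' j hj e x y) = e.ins hj (α.op y) ≫ α.op x := by
  revert hw hj e x
  refine exists_mid (motive := fun w j => ∀ (hw : S w k) (hj : w.get j = c) (e : Graft w j t w')
    (x : Q.Obj w k hw), α.op (Q.comp hw ht hw' j hj e x y) = e.ins hj (α.op y) ≫ α.op x) ?_ w j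
  intro u c' v hw hj e x
  obtain rfl : c' = c := by simpa [mid] using hj
  have hp : S (u ++ (t ++ v)) k := hQ.perm hw' ((Graft.planar u c' v t).chg k e).perm_word.symm
  have h := hQ.unit hw
  -- Any grafting at this input is the planar one followed by a relabelling, both for operations and
  -- for insertions of maps.
  rw [hQ.chg h hw ht hp hw' hj (Graft.planar u c' v t) e, α.op_act hQ,
    (Graft.planar u c' v t).ins_chg (k := k) e hj, Graft.ins_planar, Category.assoc]
  exact congrArg _ (α.comp hw ht hp x y)

end Equivariance

/-! ### Extension of operations of degree at most one to the free extension. -/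

section FreeExtensionOps
variable {C : Type u} [Category.{v} C] [MonoidalCategory C] [SymmetricCategory C]
  [MonoidalClosed C] {i : CGTop ⥤ C} [i.Braided] [i.IsLeftAdjoint]

/-- An action of operations with output `half` and degree at most one on a pair of objects,
compatible with all compositions. -/
structure HalfAlg (i : CGTop ⥤ C) [i.Braided] [i.IsLeftAdjoint] (P : OperadData sigColl₁)
    (X : Col → C) where
  op : ∀ {w} (hw : sigColl₁ w .half), P.Obj w .half hw → (wordTensor X w ⟶ X .half)
  continuous_op : ∀ {w} (hw : sigColl₁ w .half),
    Continuous[P.top w .half hw, homTop i _ _] (op hw)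
  op_one : op sigColl₁_unit (P.one .half sigColl₁_unit) = (ρ_ (X .half)).hom
  op_comp : ∀ {w t w' : List Col} (hw : sigColl₁ w .half) (ht : sigColl₁ t .half)
    (hw' : sigColl₁ w' .half) {j : Fin w.length} (hj : w.get j = .half) (e : Graft w j t w')
    (x : P.Obj w .half hw) (y : P.Obj t .half ht),
    op hw' (P.comp hw ht hw' j hj e x y) = e.ins hj (op ht y) ≫ op hw x

variable {P : OperadData sigColl₁} {X : Col → C}

theorem HalfAlg.ext_op {m m' : HalfAlg i P X}
    (h : ∀ {w} (hw : sigColl₁ w .half) (x : P.Obj w .half hw), m.op hw x = m'.op hw x) :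
    m = m' := by
  cases m with | mk op _ _ _ =>
  cases m' with | mk op' _ _ _ =>
  have : @op = @op' := by
    funext w hw x; exact h hw x
  subst this
  rfl

namespace HalfAlg
variable (m : HalfAlg i P X)

noncomputable def onTerm : ∀ {w : List Col}, ETerm P w → (wordTensor X w ⟶ X .half)
  | _, .gen hw x => m.op hw x
  | _, .graft _ hj e x y => e.ins hj (onTerm y) ≫ onTerm x

/-- Each defining relation of the free extension is matched by a law of insertion: associativity by
`Graft.ins_seq`, commutation by `Graft.ins_par`, units by `Graft.ins_perm'` and `Graft.ins_unit`. -/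
theorem onTerm_rel {w : List Col} {x y : ETerm P w} (h : ERel P x y) :
    m.onTerm x = m.onTerm y := by
  induction h with
  | gen_comp hw ht hw' j hj e x y => exact (m.op_comp hw ht hw' hj e x y).symm
  | one_comp e x he =>
    rw [ETerm.one, onTerm, onTerm, m.op_one]
    exact (e.ins_perm' _).trans (by rw [e.perm_of_id he, Category.id_comp])
  | comp_one j hj e x ho hn =>
    rw [ETerm.one, onTerm, onTerm, m.op_one]
    exact (congrArg (fun k => k ≫ m.onTerm x) (e.ins_unit hj ho hn)).trans (Category.id_comp _)
  | seq hi hj hq e₁ e₂ e₃ e₄ x y z hc =>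
    simp only [onTerm]
    rw [← Category.assoc, Graft.ins_seq hc hi hj hq]
  | par hi hj hq hp e₁ e₂ e₃ e₄ x y z hc =>
    simp only [onTerm]
    rw [← Category.assoc, Graft.ins_par hc hi hj hq hp, Category.assoc]
  | left j hj e y h ih => simp only [onTerm, ih]
  | right j hj e x h ih => simp only [onTerm, ih]

/-- The action of the free extension. -/
noncomputable def eval {w : List Col} : EObj P w → (wordTensor X w ⟶ X .half) :=
  Quot.lift m.onTerm fun _ _ h => m.onTerm_rel h

theorem eval_gen {w : List Col} (hw : sigColl₁ w .half) (x : P.Obj w .half hw) :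
    m.eval (EObj.gen hw x) = m.op hw x := rfl

theorem eval_one : m.eval (EObj.one P) = (ρ_ (X .half)).hom := m.op_one

theorem eval_comp {w t w' : List Col} {j : Fin w.length} (hj : w.get j = .half)
    (e : Graft w j t w') (x : EObj P w) (y : EObj P t) :
    m.eval (EObj.comp j hj e x y) = e.ins hj (m.eval y) ≫ m.eval x := by
  induction x using Quot.ind; induction y using Quot.ind; rfl

theorem eval_act {w w' : List Col} (σ : Graft [.half] 0 w w') (x : EObj P w) :
    m.eval (EObj.comp 0 rfl σ (EObj.one P) x) = σ.perm X ≫ m.eval x := by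
  rw [eval_comp, eval_one]; exact σ.ins_perm' _

theorem continuous_eval (w : List Col) :
    Continuous[_, homTop i _ _] (m.eval : EObj P w → _) := by
  -- The free extension carries the finest topology making generators and composition continuous.
  -- The topology induced by evaluation has these properties, so it is coarser, which is continuity
  -- of evaluation.
  let τ : ∀ w, TopologicalSpace (EObj P w) := fun w =>
    TopologicalSpace.induced m.eval (homTop i _ _)
  have hτ : IsETop P τ := by
    refine ⟨fun w hw => continuous_induced_rng.2 (m.continuous_op hw), ?_⟩
    intro w t w' j hj e K a b ha hb
    have := isGeneratedBy_compHaus K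
    have ha' := continuous_induced_rng.1 ha
    have hb' := continuous_induced_rng.1 hb
    refine continuous_induced_rng.2 ?_
    have h := continuous_homTop_comp (e.continuous_ins hj hb') ha'
    have e1 : m.eval ∘ (fun z => EObj.comp j hj e (a z) (b z)) =
        fun z => e.ins hj (m.eval (b z)) ≫ m.eval (a z) := funext fun z => m.eval_comp hj e _ _
    rw [e1]
    exact h
  exact continuous_le_dom (finest_le hτ w) continuous_induced_dom

/-- Uniqueness of the extension. -/
theorem eval_unique (F : ∀ {w}, EObj P w → (wordTensor X w ⟶ X .half))
    (hg : ∀ {w} (hw : sigColl₁ w .half) (x : P.Obj w .half hw), F (EObj.gen hw x) = m.op hw x)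
    (hc : ∀ {w t w' : List Col} {j : Fin w.length} (hj : w.get j = .half)
      (e : Graft w j t w') (x : EObj P w) (y : EObj P t),
      F (EObj.comp j hj e x y) = e.ins hj (F y) ≫ F x) {w : List Col} (x : EObj P w) :
    F x = m.eval x := by
  induction x using Quot.ind with | mk x =>
  induction x with
  | gen hw x => exact hg hw x
  | graft j hj e x y hx hy =>
    have := hc hj e (EObj.mk x) (EObj.mk y)
    refine this.trans ?_
    rw [show F (EObj.mk x) = _ from hx, show F (EObj.mk y) = _ from hy]
    rfl

end HalfAlg
end FreeExtensionOps

/-! ### Relabelling laws for the operads in use. -/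

section Laws

theorem sigColl₁.of_perm {w w' : List Col} {k : Col} (h : sigColl₁ w k) (hp : w.Perm w') :
    sigColl₁ w' k := by
  refine ⟨h.1, ?_⟩
  -- Having at most one full letter is restated as a symmetric pairwise condition, which is visibly
  -- invariant under permutations.
  have key : ∀ w : List Col, (∀ i j : Fin w.length, w.get i = .full → w.get j = .full → i = j) ↔
      w.Pairwise (fun a b => ¬ (a = .full ∧ b = .full)) := by
    intro w
    rw [List.pairwise_iff_get]
    constructor
    · intro h i j hij hc
      exact hij.ne (h i j hc.1 hc.2)
    · intro h i j hi hj
      rcases lt_trichotomy i j with hij | hij | hij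
      · exact absurd ⟨hi, hj⟩ (h i j hij)
      · exact hij
      · exact absurd ⟨hj, hi⟩ (h j i hij)
  rw [key]
  refine (hp.pairwise_iff ?_).1 ((key w).1 h.2)
  intro a b h hc
  exact h ⟨hc.2, hc.1⟩

theorem sigColl₁.unit {w : List Col} {k : Col} (h : sigColl₁ w k) : sigColl₁ [k] k :=
  ⟨h.1, fun _ _ _ _ => Subsingleton.elim (α := Fin 1) _ _⟩

theorem Operad.relabels_coll (P : Operad sigColl₁) : P.toOperadData.Relabels :=
  P.relabels (fun h hp => h.of_perm hp) (fun h => h.unit)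

theorem sigHalf.of_perm {w w' : List Col} {k : Col} (h : sigHalf w k) (hp : w.Perm w') :
    sigHalf w' k := ⟨h.1, fun c hc => h.2 c (hp.mem_iff.2 hc)⟩

theorem Operad.relabels_degZero (P : Operad sigColl₁) : P.toOperadData.degZero.Relabels :=
  (P.restrict sigHalf fun _ _ => sigColl₁_of_half).relabels (fun h hp => h.of_perm hp)
    (fun h => ⟨h.1, by simp [h.1]⟩)

theorem Operad.relabels_full (O : Operad sigFull) : O.toOperadData.Relabels :=
  O.relabels (fun h hp => ⟨h.1, fun c hc => h.2 c (hp.mem_iff.2 hc)⟩)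
    (fun h => ⟨h.1, by simp [h.1]⟩)

end Laws

/-! ### Universal properties of `Asc` and of the Hochschild object. -/

section HochUniversal
variable {C : Type u} [Category.{v} C] [MonoidalCategory C] [SymmetricCategory C]

theorem spliceParam_natural (X : Col → C) {D H : C} (f : D ⟶ H) {c : Col} (v : List Col)
    {t : List Col} (g : H ⊗ wordTensor X t ⟶ X c) (u : List Col) :
    f ▷ wordTensor X (u ++ (t ++ v)) ≫ spliceParam X H v g u =
      spliceParam X D v (f ▷ wordTensor X t ≫ g) u := by
  induction u with
  | nil =>
    have : ∀ {Z T V K : C} (s : Z ⟶ T ⊗ V) (g : H ⊗ T ⟶ K),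
        f ▷ Z ≫ H ◁ s ≫ (α_ H T V).inv ≫ g ▷ V =
          D ◁ s ≫ (α_ D T V).inv ≫ (f ▷ T ≫ g) ▷ V := by
      intro Z T V K s g
      rw [← whisker_exchange_assoc, comp_whiskerRight, whiskerRight_tensor]
      simp
    exact this _ _
  | cons e u ih =>
    have : ∀ {E Z W : C} {s : H ⊗ Z ⟶ W} {s' : D ⊗ Z ⟶ W}, f ▷ Z ≫ s = s' →
        f ▷ (E ⊗ Z) ≫ (α_ H E Z).inv ≫ (β_ H E).hom ▷ Z ≫ (α_ E H Z).hom ≫ E ◁ s =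
          (α_ D E Z).inv ≫ (β_ D E).hom ▷ Z ≫ (α_ E D Z).hom ≫ E ◁ s' := by
      intro E Z W s s' h
      subst h
      have := exch_natural f (𝟙 E) (𝟙 Z)
      rw [id_tensorHom_id, tensorHom_id, tensorHom_id, id_tensorHom] at this
      simp only [exch, Category.assoc] at this
      rw [reassoc_of% this, MonoidalCategory.whiskerLeft_comp]
    exact this ih

variable [MonoidalClosed C]

theorem uncurry_eval {D W Z A : C} (f : D ⟶ (ihom Z).obj A) (j : W ⟶ Z) :
    f ▷ W ≫ (ihom Z).obj A ◁ j ≫ (β_ _ _).hom ≫ (ihom.ev Z).app A =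
      D ◁ j ≫ (β_ D Z).hom ≫ MonoidalClosed.uncurry f := by
  rw [MonoidalClosed.uncurry_eq, ← BraidedCategory.braiding_naturality_left_assoc,
    whisker_exchange_assoc]

theorem uncurry_comp_pre {D Z W A : C} (f : D ⟶ (ihom Z).obj A) (j : W ⟶ Z) :
    MonoidalClosed.uncurry (f ≫ (MonoidalClosed.pre j).app A) =
      (β_ W D).hom ≫ D ◁ j ≫ (β_ D Z).hom ≫ MonoidalClosed.uncurry f := by
  rw [MonoidalClosed.uncurry_natural_left, MonoidalClosed.uncurry_pre,
    MonoidalClosed.uncurry_eq, whisker_exchange_assoc,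
    ← BraidedCategory.braiding_naturality_left_assoc]
  simp

variable {i : CGTop ⥤ C} [i.Braided] [i.IsLeftAdjoint]

theorem continuous_homTop_curry {T : Type} [TopologicalSpace T] [IsGeneratedBy CH T] {D Y Z : C}
    {f : T → (D ⊗ Y ⟶ Z)} (hf : Continuous[_, homTop i _ _] f) :
    Continuous[_, homTop i Y ((ihom D).obj Z)] (fun t => MonoidalClosed.curry (f t)) := by
  obtain ⟨F, hF⟩ := continuous_homTop.1 hf
  refine continuous_homTop.2 ⟨MonoidalClosed.curry (exch _ _ _ ≫ F), fun t => ?_⟩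
  rw [← hF, ← MonoidalClosed.curry_natural_left, pt_eq_ptO, pt_eq_ptO]
  have : ∀ {I : C} (p : 𝟙_ C ⟶ I), D ◁ ((λ_ Y).inv ≫ p ▷ Y) ≫ exch D I Y =
      (λ_ (D ⊗ Y)).inv ≫ p ▷ (D ⊗ Y) := by
    intro I p
    have h := exch_natural (𝟙 D) p (𝟙 Y)
    simp only [tensorHom_id, id_tensorHom] at h
    rw [MonoidalCategory.whiskerLeft_comp, Category.assoc, h]
    simp [exch]
  have h := this (Functor.LaxMonoidal.ε i ≫ i.map (constO (CGTop.of T) t))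
  congr 1
  rw [← Category.assoc]
  exact congrArg (fun k => k ≫ F) h

variable [HasLimitsOfSize.{0, 0} C] [HasColimitsOfSize.{0, 0} C] {P : OperadData sigColl₁} {A : C}
  (α : Alg i P.degZero (fun _ => A))

theorem Asc.ι_rel (r : AscRel P) : AscRel.lhs i A r ≫ coequalizer.π (Sigma.desc (AscRel.lhs i A))
    (Sigma.desc (AscRel.rhs α)) = AscRel.rhs α r ≫ coequalizer.π (Sigma.desc (AscRel.lhs i A))
    (Sigma.desc (AscRel.rhs α)) := by
  have := congrArg (fun k => Sigma.ι (fun r : AscRel P => wordTensor (fun _ => A) r.source) r ≫ k)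
    (coequalizer.condition (Sigma.desc (AscRel.lhs i A)) (Sigma.desc (AscRel.rhs α)))
  simpa using this

theorem Asc.ι_swap (u v : List Col) (h : ∀ c ∈ u ++ .half :: .half :: v, c = .half)
    (x : P.Obj (.full :: (u ++ .half :: .half :: v)) .half (.one h)) :
    Asc.ι α h (P.comp sigColl₁_unit (.one h) (.one h) 0 rfl
      (Graft.swap .half (.full :: u) .half .half v) (P.one .half sigColl₁_unit) x) =
        swapHom (fun _ => A) .half .half v u ≫ Asc.ι α h x :=
  (Asc.ι_rel α (.swap u v h x)).trans (Category.assoc _ _ _)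

theorem Asc.ι_comp (u v t : List Col) (h : ∀ c ∈ u ++ .half :: v, c = .half)
    (ht : ∀ c ∈ t, c = .half) (x : P.Obj (.full :: (u ++ .half :: v)) .half (.one h))
    (y : P.Obj t .half (.zero ht)) :
    Asc.ι α (half_append h ht) (P.comp (.one h) (.zero ht) (.one (half_append h ht))
      (mid (.full :: u) .half v) (get_mid (.full :: u) .half v)
      (Graft.planar (.full :: u) .half v t) x y) =
    splice (fun _ => A) (c := .half) v (α.op (k := .half) (h := .mk ht) y) u ≫ Asc.ι α h x :=
  (Asc.ι_rel α (.comp u v t h ht x y)).trans (Category.assoc _ _ _)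

theorem preAsc.hom_ext {Z : C} {f g : preAsc i P A ⟶ Z}
    (h : ∀ (w : List Col) (hw : ∀ c ∈ w, c = .half) (x : P.Obj (.full :: w) .half (.one hw)),
      preAsc.ι i A hw x ≫ f = preAsc.ι i A hw x ≫ g) : f = g :=
  Sigma.hom_ext _ _ fun w =>
    hom_ext_pt (T := CGTop.of (P.Obj (.full :: w.1) .half (.one w.2))) fun x =>
      (Category.assoc _ _ _).symm.trans ((h w.1 w.2 x).trans (Category.assoc _ _ _))

theorem preAsc.exists_desc {Z : C} (k : ∀ (w : List Col) (hw : ∀ c ∈ w, c = .half),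
      P.Obj (.full :: w) .half (.one hw) → (wordTensor (fun _ => A) w ⟶ Z))
    (hc : ∀ w hw, Continuous[_, homTop i _ _] (k w hw)) :
    ∃ F : preAsc i P A ⟶ Z, ∀ w hw x, preAsc.ι i A hw x ≫ F = k w hw x := by
  choose F hF using fun w hw => continuous_homTop.1 (hc w hw)
  refine ⟨Sigma.desc (fun w => F w.1 w.2), fun w hw x => ?_⟩
  refine (Category.assoc _ _ _).trans (Eq.trans ?_ (hF w hw x))
  exact congrArg (fun k => pt i x _ ≫ k)
    (Sigma.ι_desc (fun w : {w : List Col // ∀ c ∈ w, c = .half} => F w.1 w.2) ⟨w, hw⟩)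

theorem Asc.hom_ext {Z : C} {f g : Asc α ⟶ Z}
    (h : ∀ (w : List Col) (hw : ∀ c ∈ w, c = .half) (x : P.Obj (.full :: w) .half (.one hw)),
      Asc.ι α hw x ≫ f = Asc.ι α hw x ≫ g) : f = g :=
  coequalizer.hom_ext (preAsc.hom_ext fun w hw x => (Category.assoc _ _ _).symm.trans
    ((h w hw x).trans (Category.assoc _ _ _)))

/-- Continuity glues the family on each summand into one map out of the coproduct; the other two
conditions are the relations imposed by the coequalizer, which are indexed by points. -/
theorem Asc.exists_desc {Z : C} (k : ∀ (w : List Col) (hw : ∀ c ∈ w, c = .half),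
      P.Obj (.full :: w) .half (.one hw) → (wordTensor (fun _ => A) w ⟶ Z))
    (hc : ∀ w hw, Continuous[_, homTop i _ _] (k w hw))
    (swap : ∀ (u v : List Col) (h : ∀ c ∈ u ++ .half :: .half :: v, c = .half)
      (x : P.Obj (.full :: (u ++ .half :: .half :: v)) .half (.one h)),
      k _ h (P.comp sigColl₁_unit (.one h) (.one h) 0 rfl
        (Graft.swap .half (.full :: u) .half .half v) (P.one .half sigColl₁_unit) x) =
          swapHom (fun _ => A) .half .half v u ≫ k _ h x)
    (comp : ∀ (u v t : List Col) (h : ∀ c ∈ u ++ .half :: v, c = .half)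
      (ht : ∀ c ∈ t, c = .half) (x : P.Obj (.full :: (u ++ .half :: v)) .half (.one h))
      (y : P.Obj t .half (.zero ht)),
      k _ (half_append h ht) (P.comp (.one h) (.zero ht) (.one (half_append h ht))
        (mid (.full :: u) .half v) (get_mid (.full :: u) .half v)
        (Graft.planar (.full :: u) .half v t) x y) =
      splice (fun _ => A) (c := .half) v (α.op (k := .half) (h := .mk ht) y) u ≫ k _ h x) :
    ∃ f : Asc α ⟶ Z, ∀ w hw x, Asc.ι α hw x ≫ f = k w hw x := by
  obtain ⟨F, hF⟩ := preAsc.exists_desc k hc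
  refine ⟨coequalizer.desc F (Sigma.hom_ext _ _ fun r => ?_), fun w hw x => ?_⟩
  · rw [← Category.assoc, ← Category.assoc, Sigma.ι_desc, Sigma.ι_desc]
    cases r with
    | swap u v h x =>
      exact (hF _ h _).trans ((swap u v h x).trans
        ((congrArg (fun z => swapHom (fun _ => A) .half .half v u ≫ z) (hF _ h x)).symm.trans
          (Category.assoc _ _ _).symm))
    | comp u v t h ht x y =>
      exact (hF _ (half_append h ht) _).trans ((comp u v t h ht x y).trans
        ((congrArg (fun z => splice (fun _ => A) (c := .half) v
            (α.op (k := .half) (h := .mk ht) y) u ≫ z) (hF _ h x)).symm.trans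
          (Category.assoc _ _ _).symm))
  · refine (Category.assoc _ _ _).trans (Eq.trans ?_ (hF w hw x))
    exact congrArg (fun z => preAsc.ι i A hw x ≫ z) (coequalizer.π_desc F _)

theorem Hoch.ι_rel (r : HochRel P) :
    equalizer.ι (Pi.lift (HochRel.lhs α)) (Pi.lift (HochRel.rhs α)) ≫ HochRel.lhs α r =
      equalizer.ι (Pi.lift (HochRel.lhs α)) (Pi.lift (HochRel.rhs α)) ≫ HochRel.rhs α r := by
  have := congrArg (fun k => k ≫ Pi.π (fun r : HochRel P =>
    (ihom (wordTensor (fun _ => A) (r.u ++ (r.t ++ r.v)))).obj A) r)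
    (equalizer.condition (Pi.lift (HochRel.lhs α)) (Pi.lift (HochRel.rhs α)))
  simpa using this

theorem whisker_eval {D : C} (f : D ⟶ (ihom (Asc α)).obj A) {w : List Col}
    (hw : ∀ c ∈ w, c = .half) (x : P.Obj (.full :: w) .half (.one hw)) :
    f ▷ _ ≫ Asc.eval α hw x = D ◁ Asc.ι α hw x ≫ (β_ _ _).hom ≫ MonoidalClosed.uncurry f :=
  uncurry_eval f _

/-- With `uncurry_rhs`, this expresses the equalizer condition of `Hoch` in terms of evaluations,
where it becomes the left module law of a family. -/
theorem uncurry_lhs {D : C} (f : D ⟶ (ihom (Asc α)).obj A) (r : HochRel P) :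
    MonoidalClosed.uncurry (f ≫ HochRel.lhs α r) = (β_ _ _).hom ≫ f ▷ _ ≫
      Asc.eval α (half_append r.h r.ht)
        (P.comp (.zero r.h) (.one r.ht) (.one (half_append r.h r.ht)) (mid r.u .half r.v)
          (get_mid r.u .half r.v) (Graft.planarFull r.u .half r.v r.t) r.y r.x) := by
  rw [whisker_eval]
  exact uncurry_comp_pre f _

theorem uncurry_rhs {D : C} (f : D ⟶ (ihom (Asc α)).obj A) (r : HochRel P) :
    MonoidalClosed.uncurry (f ≫ HochRel.rhs α r) = (β_ _ _).hom ≫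
      spliceParam (fun _ => A) D (c := .half) r.v (f ▷ _ ≫ Asc.eval α r.ht r.x) r.u ≫
        α.op (k := .half) (h := .mk r.h) r.y := by
  rw [HochRel.rhs, ← MonoidalClosed.curry_natural_left, MonoidalClosed.uncurry_curry,
    BraidedCategory.braiding_naturality_right_assoc]
  congr 1
  rw [← Category.assoc]
  exact congrArg (fun k => k ≫ _) (spliceParam_natural _ f r.v _ r.u)

theorem whisker_ι_eval {D : C} (f : D ⟶ Hoch α) {w : List Col}
    (hw : ∀ c ∈ w, c = .half) (x : P.Obj (.full :: w) .half (.one hw)) :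
    f ▷ _ ≫ Hoch.eval α hw x = (f ≫ equalizer.ι (Pi.lift (HochRel.lhs α))
      (Pi.lift (HochRel.rhs α))) ▷ _ ≫ Asc.eval α hw x :=
  (comp_whiskerRight_assoc f (equalizer.ι (Pi.lift (HochRel.lhs α)) (Pi.lift (HochRel.rhs α)))
    _ _).symm

/-- `Hoch` is a subobject of an internal hom out of `Asc`, and the elements `x ⊗ a` generate `Asc`;
so a map to `Hoch` is detected by evaluation on them. -/
theorem Hoch.hom_ext {D : C} {f g : D ⟶ Hoch α}
    (h : ∀ (w : List Col) (hw : ∀ c ∈ w, c = .half) (x : P.Obj (.full :: w) .half (.one hw)),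
      f ▷ _ ≫ Hoch.eval α hw x = g ▷ _ ≫ Hoch.eval α hw x) : f = g := by
  refine equalizer.hom_ext (MonoidalClosed.uncurry_injective ?_)
  -- Currying the parameter object instead of `Asc` turns `Asc` into a source, so that its own
  -- extensionality applies.
  have curry_ext : ∀ {D S Z : C} {k k' : S ⊗ D ⟶ Z}, MonoidalClosed.curry ((β_ D S).hom ≫ k) =
      MonoidalClosed.curry ((β_ D S).hom ≫ k') → k = k' := fun h =>
    (cancel_epi _).1 (MonoidalClosed.curry_injective h)
  refine curry_ext (Asc.hom_ext α fun w hw x => ?_)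
  have := (whisker_eval α (f ≫ equalizer.ι _ _) hw x).symm.trans
    ((whisker_ι_eval α f hw x).symm.trans ((h w hw x).trans ((whisker_ι_eval α g hw x).trans
      (whisker_eval α (g ≫ equalizer.ι _ _) hw x))))
  rw [← MonoidalClosed.curry_natural_left, ← MonoidalClosed.curry_natural_left]
  exact congrArg _ this

theorem Hoch.exists_lift {D : C} (g : ∀ (w : List Col) (hw : ∀ c ∈ w, c = .half),
      P.Obj (.full :: w) .half (.one hw) → (D ⊗ wordTensor (fun _ => A) w ⟶ A))
    (hc : ∀ w hw, Continuous[_, homTop i _ _] (g w hw))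
    (swap : ∀ (u v : List Col) (h : ∀ c ∈ u ++ .half :: .half :: v, c = .half)
      (x : P.Obj (.full :: (u ++ .half :: .half :: v)) .half (.one h)),
      g _ h (P.comp sigColl₁_unit (.one h) (.one h) 0 rfl
        (Graft.swap .half (.full :: u) .half .half v) (P.one .half sigColl₁_unit) x) =
          D ◁ swapHom (fun _ => A) .half .half v u ≫ g _ h x)
    (comp : ∀ (u v t : List Col) (h : ∀ c ∈ u ++ .half :: v, c = .half)
      (ht : ∀ c ∈ t, c = .half) (x : P.Obj (.full :: (u ++ .half :: v)) .half (.one h))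
      (y : P.Obj t .half (.zero ht)),
      g _ (half_append h ht) (P.comp (.one h) (.zero ht) (.one (half_append h ht))
        (mid (.full :: u) .half v) (get_mid (.full :: u) .half v)
        (Graft.planar (.full :: u) .half v t) x y) =
      D ◁ splice (fun _ => A) (c := .half) v (α.op (k := .half) (h := .mk ht) y) u ≫ g _ h x)
    (left : ∀ (u v t : List Col) (h : ∀ c ∈ u ++ .half :: v, c = .half)
      (ht : ∀ c ∈ t, c = .half) (y : P.Obj (u ++ .half :: v) .half (.zero h))
      (x : P.Obj (.full :: t) .half (.one ht)),
      g _ (half_append h ht) (P.comp (.zero h) (.one ht) (.one (half_append h ht)) (mid u .half v)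
        (get_mid u .half v) (Graft.planarFull u .half v t) y x) =
      spliceParam (fun _ => A) D (c := .half) v (g _ ht x) u ≫
        α.op (k := .half) (h := .mk h) y) :
    ∃ f : D ⟶ Hoch α, ∀ w hw x, f ▷ _ ≫ Hoch.eval α hw x = g w hw x := by
  -- With the parameter `D` moved to the target, the family becomes maps out of the summands of
  -- `Asc`; `swap` and `comp` are the relations of `Asc`.
  obtain ⟨f₁, h₁⟩ := Asc.exists_desc α (Z := (ihom D).obj A)
    (fun w hw x => MonoidalClosed.curry (g w hw x)) (fun w hw => continuous_homTop_curry (hc w hw))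
    (fun u v h x => by
      rw [swap u v h x, MonoidalClosed.curry_natural_left])
    (fun u v t h ht x y => by
      rw [comp u v t h ht x y, MonoidalClosed.curry_natural_left])
  -- The roles of `D` and `Asc` in the currying are now exchanged.
  let f₂ : D ⟶ (ihom (Asc α)).obj A :=
    MonoidalClosed.curry ((β_ _ _).hom ≫ MonoidalClosed.uncurry f₁)
  have h₂ : ∀ w hw x, f₂ ▷ _ ≫ Asc.eval α hw x = g w hw x := by
    intro w hw x
    rw [whisker_eval, MonoidalClosed.uncurry_curry, SymmetricCategory.symmetry_assoc,
      ← MonoidalClosed.uncurry_natural_left, h₁, MonoidalClosed.uncurry_curry]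
  -- The remaining hypothesis `left` says precisely that the transpose lands in the module maps.
  refine ⟨equalizer.lift f₂ (Pi.hom_ext _ _ fun r => ?_), fun w hw x => ?_⟩
  · rw [Category.assoc, Category.assoc, Pi.lift_π, Pi.lift_π]
    refine MonoidalClosed.uncurry_injective ?_
    rw [uncurry_lhs, uncurry_rhs, h₂, h₂, left r.u r.v r.t r.h r.ht r.y r.x]
  · refine (whisker_ι_eval α _ hw x).trans (Eq.trans ?_ (h₂ w hw x))
    exact congrArg (fun k => k ▷ _ ≫ Asc.eval α hw x) (equalizer.lift_ι _ _)

theorem Hoch.eval_left (u v t : List Col) (h : ∀ c ∈ u ++ .half :: v, c = .half)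
    (ht : ∀ c ∈ t, c = .half) (y : P.Obj (u ++ .half :: v) .half (.zero h))
    (x : P.Obj (.full :: t) .half (.one ht)) :
    Hoch.eval α (half_append h ht) (P.comp (.zero h) (.one ht) (.one (half_append h ht))
      (mid u .half v) (get_mid u .half v) (Graft.planarFull u .half v t) y x) =
    spliceParam (fun _ => A) (Hoch α) (c := .half) v (Hoch.eval α ht x) u ≫
      α.op (k := .half) (h := .mk h) y := by
  have h1 := congrArg MonoidalClosed.uncurry (Hoch.ι_rel α ⟨u, v, t, h, ht, y, x⟩)
  rw [uncurry_lhs, uncurry_rhs, cancel_epi] at h1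
  exact h1

/-- All evaluations come from a single pairing with `Asc`, so continuity in `x` and the relations of
`Asc` pass to them. -/
theorem Hoch.eval_eq : ∃ e : Hoch α ⊗ Asc α ⟶ A,
    ∀ {w : List Col} (hw : ∀ c ∈ w, c = .half) (x : P.Obj (.full :: w) .half (.one hw)),
      Hoch.eval α hw x = Hoch α ◁ Asc.ι α hw x ≫ e :=
  ⟨_, fun hw x => whisker_eval α _ hw x⟩

end HochUniversal

/-! ### Relabellings that fix the first input. -/

section Relabelling
variable {w w' w'' : List Col} {k c : Col}

theorem Graft.n_bijective (σ : Graft [k] 0 w w') : Function.Bijective σ.n := σ.toEquiv.bijective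

theorem exists_relabel (k : Col) (f : Fin w.length → Fin w'.length) (hf : Function.Bijective f)
    (h : ∀ j, w'.get (f j) = w.get j) : ∃ σ : Graft [k] 0 w w', ∀ b, σ.n b = f b :=
  ⟨Graft.relabel k (Equiv.ofBijective f hf) h, fun _ => rfl⟩

theorem exists_cons_relabel (c : Col) (σ : Graft [k] 0 w w') :
    ∃ τ : Graft [k] 0 (c :: w) (c :: w'), τ.n 0 = 0 ∧ ∀ b : Fin w.length, τ.n b.succ = (σ.n b).succ := by
  let f : Fin (w.length + 1) → Fin (w'.length + 1) :=
    Fin.cases (motive := fun _ => Fin (w'.length + 1)) 0 fun b => (σ.n b).succ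
  have hf : Function.Bijective f := by
    constructor
    · intro a b
      refine Fin.cases ?_ (fun a => ?_) a <;> refine Fin.cases ?_ (fun b => ?_) b
      · simp
      · intro h; exact absurd h.symm (Fin.succ_ne_zero _)
      · intro h; exact absurd h (Fin.succ_ne_zero _)
      · intro h
        exact congrArg Fin.succ (σ.n_bijective.1 (Fin.succ_injective _ h))
    · intro a
      refine Fin.cases ⟨0, rfl⟩ (fun a => ?_) a
      obtain ⟨b, hb⟩ := σ.n_bijective.2 a
      exact ⟨b.succ, congrArg Fin.succ hb⟩
  obtain ⟨τ, h⟩ := exists_relabel (w := c :: w) (w' := c :: w') k f hf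
    (Fin.cases rfl fun b => σ.get_n b)
  exact ⟨τ, h 0, fun b => h b.succ⟩

noncomputable def Graft.cons (c : Col) (σ : Graft [k] 0 w w') : Graft [k] 0 (c :: w) (c :: w') :=
  (exists_cons_relabel c σ).choose

theorem Graft.cons_zero (c : Col) (σ : Graft [k] 0 w w') : (σ.cons c).n 0 = 0 :=
  (exists_cons_relabel c σ).choose_spec.1

theorem Graft.cons_succ (c : Col) (σ : Graft [k] 0 w w') (b : Fin w.length) :
    (σ.cons c).n b.succ = (σ.n b).succ :=
  (exists_cons_relabel c σ).choose_spec.2 b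

theorem Graft.eq_cons (σ : Graft [k] 0 w w') (τ : Graft [k] 0 (c :: w) (c :: w'))
    (h0 : τ.n 0 = 0) (h : ∀ b : Fin w.length, τ.n b.succ = (σ.n b).succ) : τ = σ.cons c :=
  Graft.relabel_ext fun b => Fin.cases (h0.trans (σ.cons_zero c).symm)
    (fun b => (h b).trans (σ.cons_succ c b).symm) b

theorem Graft.cons_idL (k c : Col) (w : List Col) : (idL k w).cons c = idL k (c :: w) :=
  (eq_cons _ _ rfl fun _ => rfl).symm

theorem Graft.cons_trans (σ : Graft [k] 0 w w') (τ : Graft [k] 0 w' w'') :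
    (σ.trans τ).cons c = (σ.cons c).trans (τ.cons c) :=
  (eq_cons _ _ (by rw [trans_n, cons_zero, cons_zero]) fun b => by
    rw [trans_n, cons_succ, cons_succ, trans_n]).symm

theorem Graft.swap_n_val (k : Col) (u : List Col) (a b : Col) (v : List Col)
    (j : Fin (u ++ a :: b :: v).length) : ((swap k u a b v).n j).1 =
      if j.1 = u.length then u.length + 1 else if j.1 = u.length + 1 then u.length else j.1 := by
  change (Equiv.swap (⟨u.length, by simp⟩ : Fin (u ++ a :: b :: v).length)
    ⟨u.length + 1, by simp⟩ j).1 = _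
  simp only [Equiv.swap_apply_def, Fin.ext_iff]
  split_ifs <;> rfl

theorem Graft.cons_swap (k c : Col) (u : List Col) (a b : Col) (v : List Col) :
    (swap k u a b v).cons c = swap k (c :: u) a b v := by
  refine (eq_cons (swap k u a b v) (swap k (c :: u) a b v) (Fin.ext ?_) fun z => Fin.ext ?_).symm
  · exact (swap_n_val k (c :: u) a b v _).trans (by simp)
  · refine (swap_n_val k (c :: u) a b v _).trans
      (Eq.trans ?_ (congrArg (· + 1) (swap_n_val k u a b v z)).symm)
    simp only [Fin.val_succ, List.length_cons, Nat.add_right_cancel_iff]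
    split_ifs <;> rfl

theorem Graft.exists_eq_cons (τ : Graft [k] 0 (c :: w) (c :: w')) (h0 : τ.n 0 = 0) :
    ∃ σ : Graft [k] 0 w w', τ = σ.cons c := by
  have hne : ∀ b : Fin w.length, τ.n b.succ ≠ 0 := fun b hb =>
    Fin.succ_ne_zero b (τ.n_bijective.1 (hb.trans h0.symm))
  have hs : ∀ b : Fin w.length, ((τ.n b.succ).pred (hne b)).succ = τ.n b.succ :=
    fun b => Fin.succ_pred _ _
  have hb : Function.Bijective fun b => (τ.n b.succ).pred (hne b) := by
    constructor
    · intro a b hab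
      exact Fin.succ_injective _ (τ.n_bijective.1 ((hs a).symm.trans
        ((congrArg Fin.succ hab).trans (hs b))))
    · intro a
      obtain ⟨b, hb⟩ := τ.n_bijective.2 a.succ
      revert hb
      refine Fin.cases (fun hb => ?_) (fun b hb => ?_) b
      · exact absurd (hb.symm.trans h0) (Fin.succ_ne_zero _)
      · exact ⟨b, Fin.succ_injective _ ((hs b).trans hb)⟩
  obtain ⟨σ, hσ⟩ := exists_relabel (w := w) (w' := w') k _ hb fun j => by
    have := τ.get_n j.succ
    rw [← hs j] at this
    exact this
  exact ⟨σ, eq_cons σ τ h0 fun b => by rw [hσ, hs]⟩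

theorem Graft.exists_of_perm (k : Col) (h : w.Perm w') : Nonempty (Graft [k] 0 w w') := by
  induction h with
  | nil => exact ⟨idL k _⟩
  | cons c _ ih => exact ih.map (Graft.cons c)
  | swap a b l => exact ⟨swap k [] _ _ l⟩
  | trans _ _ ih ih' => obtain ⟨σ⟩ := ih; obtain ⟨τ⟩ := ih'; exact ⟨σ.trans τ⟩

variable {C : Type u} [Category.{v} C] [MonoidalCategory C] [SymmetricCategory C] {X : Col → C}

theorem Graft.perm_cons (c : Col) (σ : Graft [k] 0 w w') :
    (σ.cons c).perm X = X c ◁ σ.perm X := by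
  have h := (σ.perm_coh (X := X) (lc := fun q : Fin w'.length => q.succ)
    (lb := fun b => (σ.n b).succ) fun _ => rfl).cons c 0
  refine (σ.cons c).perm_eq (lc := id) (lb := (σ.cons c).n) (fun _ => rfl)
    Function.injective_id ?_
  rw [lbl_cons, lbl_cons, cons_zero]
  simp only [cons_succ]
  exact h

end Relabelling

/-- A full letter, if present, is unique and can be moved to the front. This normal form allows
operations of degree one to be studied with their full input first, as in `preAsc`. -/
theorem sigColl₁.half_or_one {w : List Col} {k : Col} (h : sigColl₁ w k) :
    (∀ c ∈ w, c = .half) ∨ ∃ w₀ : List Col, (∀ c ∈ w₀, c = .half) ∧ w.Perm (.full :: w₀) := by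
  by_cases hf : Col.full ∈ w
  · obtain ⟨s, t, rfl⟩ := List.append_of_mem hf
    refine Or.inr ⟨s ++ t, fun c hc => ?_, List.perm_middle⟩
    have h' := h.of_perm List.perm_middle
    obtain ⟨j, rfl⟩ := List.get_of_mem hc
    by_contra hj
    have hj' : (s ++ t).get j = .full := by
      revert hj; cases (s ++ t).get j <;> simp
    exact Fin.succ_ne_zero j (h'.2 j.succ 0 hj' rfl)
  · refine Or.inl fun c hc => ?_
    cases c with
    | half => rfl
    | full => exact absurd hc hf

/-- Relabellings preserve colours, and the first letter is the only full one; so it stays in place.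
-/
theorem full_cons_relabel {w w' : List Col} (hw : ∀ c ∈ w, c = .half)
    (τ : Graft [.half] 0 (.full :: w) (.full :: w')) :
    ∃ σ : Graft [.half] 0 w w', τ = σ.cons .full := by
  refine τ.exists_eq_cons ?_
  obtain ⟨b, hb⟩ := τ.n_bijective.2 0
  revert hb
  refine Fin.cases id (fun b hb => ?_) b
  have h1 := τ.get_n b.succ
  rw [hb] at h1
  have h2 := hw _ (List.get_mem w b)
  exact absurd (h1.trans h2) (by simp)

/-! ### Actions in degree at most one from normal forms of operations. -/

section Generators
variable {C : Type u} [Category.{v} C] [MonoidalCategory C] [SymmetricCategory C]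
  [MonoidalClosed C] {i : CGTop ⥤ C} [i.Braided] [i.IsLeftAdjoint] {P : Operad sigColl₁}
  {X : Col → C}

/-- The action of relabellings on the operations. -/
def Operad.permute (P : Operad sigColl₁) {w w' : List Col} (hw : sigColl₁ w .half)
    (hw' : sigColl₁ w' .half) (σ : Graft [.half] 0 w w') (x : P.Obj w .half hw) :
    P.Obj w' .half hw' :=
  P.comp sigColl₁_unit hw hw' 0 rfl σ (P.one .half sigColl₁_unit) x

theorem Operad.permute_permute (P : Operad sigColl₁) {w w' w'' : List Col} (hw : sigColl₁ w .half)
    (hw' : sigColl₁ w' .half) (hw'' : sigColl₁ w'' .half) (σ : Graft [.half] 0 w w')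
    (τ : Graft [.half] 0 w' w'') (x : P.Obj w .half hw) :
    P.permute hw' hw'' τ (P.permute hw hw' σ x) = P.permute hw hw'' (σ.trans τ) x :=
  (P.relabels_coll.act_act sigColl₁_unit hw hw' hw'' σ τ x).symm

theorem Operad.permute_idL (P : Operad sigColl₁) {w : List Col} (hw : sigColl₁ w .half)
    (x : P.Obj w .half hw) : P.permute hw hw (Graft.idL _ _) x = x :=
  P.relabels_coll.act_id sigColl₁_unit hw x

theorem Operad.continuous_permute {w w' : List Col} (hw : sigColl₁ w .half)
    (hw' : sigColl₁ w' .half) (σ : Graft [.half] 0 w w') : Continuous (P.permute hw hw' σ) :=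
  (IsGeneratedBy.continuous_iff (X := CH) _).2 fun K g =>
    P.comp_continuous sigColl₁_unit hw hw' 0 rfl σ K (fun _ => P.one .half sigColl₁_unit) g
      continuous_const g.continuous

variable {w w' t w₀ t₀ : List Col}

/-- Relabelling is composition with the unit from the left, so equivariance of composition is an
instance of associativity. In `Operad.comp_permute_right` the unit sits in the middle instead; the
two lemmas on `Graft.ins` after it are the counterparts for maps. -/
theorem Operad.comp_permute_left (hw₀ : sigColl₁ w₀ .half) (hw : sigColl₁ w .half)
    (ht : sigColl₁ t .half) (hw' : sigColl₁ w' .half) {w₃ : List Col} (hw₃ : sigColl₁ w₃ .half)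
    {j₀ : Fin w₀.length} {j : Fin w.length} (hj₀ : w₀.get j₀ = .half) (hj : w.get j = .half)
    (σ : Graft [.half] 0 w₀ w) (e : Graft w j t w') (e₃ : Graft w₀ j₀ t w₃)
    (e₄ : Graft [.half] 0 w₃ w') (hc : SeqCompat σ e e₃ e₄)
    (x : P.Obj w₀ .half hw₀) (y : P.Obj t .half ht) :
    P.comp hw ht hw' j hj e (P.permute hw₀ hw σ x) y =
      P.permute hw₃ hw' e₄ (P.comp hw₀ ht hw₃ j₀ hj₀ e₃ x y) :=
  P.comp_seq sigColl₁_unit hw₀ ht hw hw₃ hw' rfl hj₀ hj σ e e₃ e₄ _ x y hc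

theorem Operad.comp_permute_right (hw : sigColl₁ w .half) (ht₀ : sigColl₁ t₀ .half)
    (ht : sigColl₁ t .half) (hw' : sigColl₁ w' .half) {j : Fin w.length} (hj : w.get j = .half)
    (σ : Graft [.half] 0 t₀ t) (e : Graft w j t w') (e₂ : Graft w j t₀ w')
    (hc : SeqCompat (Graft.idR w j .half hj) e₂ σ e)
    (x : P.Obj w .half hw) (y : P.Obj t₀ .half ht₀) :
    P.comp hw ht hw' j hj e x (P.permute ht₀ ht σ y) = P.comp hw ht₀ hw' j hj e₂ x y := by
  rw [Operad.permute, ← P.comp_seq hw sigColl₁_unit ht₀ hw ht hw' hj rfl hj (Graft.idR w j .half hj) e₂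
    σ e x _ y hc, P.comp_one hw sigColl₁_unit j hj _ _ (fun _ _ => rfl) rfl]

theorem Graft.ins_permute_left {w₃ : List Col} {j₀ : Fin w₀.length} {j : Fin w.length} {k c : Col}
    (hj₀ : w₀.get j₀ = c) (hj : w.get j = c) (σ : Graft [k] 0 w₀ w) (e : Graft w j t w')
    (e₃ : Graft w₀ j₀ t w₃) (e₄ : Graft [k] 0 w₃ w') (hc : SeqCompat σ e e₃ e₄)
    (g : wordTensor X t ⟶ X c) (f : wordTensor X w₀ ⟶ X k) :
    e.ins hj g ≫ σ.perm X ≫ f = e₄.perm X ≫ e₃.ins hj₀ g ≫ f := by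
  have h := congrArg (fun z : _ ⟶ X k ⊗ 𝟙_ C => z ≫ (ρ_ (X k)).hom)
    (Graft.ins_seq hc rfl hj₀ hj f g)
  have assoc : ∀ {U V W Z : C} (a : U ⟶ V) (b : V ⟶ W) (c : W ⟶ Z), (a ≫ b) ≫ c = a ≫ b ≫ c :=
    fun a b c => Category.assoc a b c
  rw [← σ.ins_perm' f, ← e₄.ins_perm' (e₃.ins hj₀ g ≫ f)]
  exact (assoc _ _ _).symm.trans h

theorem Graft.ins_permute_right {j : Fin w.length} {c : Col} (hj : w.get j = c)
    (σ : Graft [c] 0 t₀ t) (e : Graft w j t w') (e₂ : Graft w j t₀ w')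
    (hc : SeqCompat (Graft.idR w j c hj) e₂ σ e) (g : wordTensor X t₀ ⟶ X c) :
    e.ins hj (σ.perm X ≫ g) = e₂.ins hj g := by
  have h := Graft.ins_seq hc hj rfl hj (ρ_ (X c)).hom g
  rw [Graft.ins_unit _ _ (fun _ _ => rfl) rfl, Category.comp_id] at h
  rw [← σ.ins_perm' g]
  exact h.symm

/-- An algebra is determined by operations of degree zero, and by operations of degree one whose first
input is the one of colour `full`. -/
theorem HalfAlg.exists_of_generators
    (op₀ : ∀ {w : List Col} (hw : ∀ c ∈ w, c = .half), P.Obj w .half (.zero hw) →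
      (wordTensor X w ⟶ X .half))
    (op₁ : ∀ {w : List Col} (hw : ∀ c ∈ w, c = .half), P.Obj (.full :: w) .half (.one hw) →
      (wordTensor X (.full :: w) ⟶ X .half))
    (cont₀ : ∀ {w : List Col} (hw : ∀ c ∈ w, c = .half), Continuous[_, homTop i _ _] (op₀ hw))
    (cont₁ : ∀ {w : List Col} (hw : ∀ c ∈ w, c = .half), Continuous[_, homTop i _ _] (op₁ hw))
    (one : op₀ (w := [.half]) (by simp) (P.one .half sigColl₁_unit) = (ρ_ (X .half)).hom)
    (comp₀ : ∀ {w t w' : List Col} (hw : ∀ c ∈ w, c = .half) (ht : ∀ c ∈ t, c = .half)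
      (hw' : ∀ c ∈ w', c = .half) {j : Fin w.length} (hj : w.get j = .half) (e : Graft w j t w')
      (x : P.Obj w .half (.zero hw)) (y : P.Obj t .half (.zero ht)),
      op₀ hw' (P.comp (.zero hw) (.zero ht) (.zero hw') j hj e x y) =
        e.ins hj (op₀ ht y) ≫ op₀ hw x)
    (swap : ∀ (u v : List Col) (h : ∀ c ∈ u ++ .half :: .half :: v, c = .half)
      (x : P.Obj (.full :: (u ++ .half :: .half :: v)) .half (.one h)),
      op₁ h (P.comp sigColl₁_unit (.one h) (.one h) 0 rfl
        (Graft.swap .half (.full :: u) .half .half v) (P.one .half sigColl₁_unit) x) =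
          swapHom X .half .half v (.full :: u) ≫ op₁ h x)
    (comp : ∀ (u v t : List Col) (h : ∀ c ∈ u ++ .half :: v, c = .half)
      (ht : ∀ c ∈ t, c = .half) (x : P.Obj (.full :: (u ++ .half :: v)) .half (.one h))
      (y : P.Obj t .half (.zero ht)),
      op₁ (half_append h ht) (P.comp (.one h) (.zero ht) (.one (half_append h ht))
        (mid (.full :: u) .half v) (get_mid (.full :: u) .half v)
        (Graft.planar (.full :: u) .half v t) x y) =
      splice X v (op₀ ht y) (.full :: u) ≫ op₁ h x)
    (left : ∀ (u v t : List Col) (h : ∀ c ∈ u ++ .half :: v, c = .half)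
      (ht : ∀ c ∈ t, c = .half) (y : P.Obj (u ++ .half :: v) .half (.zero h))
      (x : P.Obj (.full :: t) .half (.one ht)),
      op₁ (half_append h ht) (P.comp (.zero h) (.one ht) (.one (half_append h ht)) (mid u .half v)
        (get_mid u .half v) (Graft.planarFull u .half v t) y x) =
      spliceParam X (X .full) (c := .half) v (op₁ ht x) u ≫ op₀ h y) :
    ∃ m : HalfAlg i P.toOperadData X, (∀ {w : List Col} (hw : ∀ c ∈ w, c = .half) x,
      m.op (.zero hw) x = op₀ (w := w) hw x) ∧ ∀ {w : List Col} (hw : ∀ c ∈ w, c = .half) x,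
      m.op (.one hw) x = op₁ (w := w) hw x := by
  have act₀ : ∀ {w w' : List Col} (hw : ∀ c ∈ w, c = .half) (hw' : ∀ c ∈ w', c = .half)
      (σ : Graft [.half] 0 w w') (x : P.Obj w .half (.zero hw)),
      op₀ hw' (P.permute (.zero hw) (.zero hw') σ x) = σ.perm X ≫ op₀ hw x := by
    intro w w' hw hw' σ x
    have := comp₀ (w := [.half]) (by simp) hw hw' rfl σ (P.one .half sigColl₁_unit) x
    rw [one] at this
    exact this.trans (σ.ins_perm' _)
  have act₁ : ∀ {w w' : List Col} (hw : ∀ c ∈ w, c = .half) (hw' : ∀ c ∈ w', c = .half)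
      (τ : Graft [.half] 0 (.full :: w) (.full :: w')) (x : P.Obj (.full :: w) .half (.one hw)),
      op₁ hw' (P.permute (.one hw) (.one hw') τ x) = τ.perm X ≫ op₁ hw x := by
    intro w w' hw hw' τ x
    obtain ⟨σ, rfl⟩ := full_cons_relabel hw τ
    -- Only the half inputs are permuted. The factor `X .full` is hidden in the internal hom, so
    -- that the general principle applies to words in half letters alone.
    have key := equivariant_of_swap (k := .half) (X := X) (S := fun w => ∀ c ∈ w, c = Col.half)
      (Q := fun w hw => P.Obj (.full :: w) .half (.one hw))
      (Y := (ihom (X .full)).obj (X .half))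
      (fun hw hp c hc => hw c (hp.mem_iff.2 hc))
      (fun hw hw' σ x => P.permute (.one hw) (.one hw') (σ.cons .full) x)
      (fun hw x => by
        rw [Graft.cons_idL, P.permute_idL])
      (fun hw hw' hw'' σ τ x => by
        rw [Graft.cons_trans, P.permute_permute])
      (fun w hw x => MonoidalClosed.curry (op₁ hw x))
      (fun {u v a b} hw hw' x => by
        obtain rfl : a = .half := hw a (by simp)
        obtain rfl : b = .half := hw b (by simp)
        rw [Graft.cons_swap]
        exact (congrArg MonoidalClosed.curry (swap u v hw x)).trans
          (MonoidalClosed.curry_natural_left _ _)) hw hw' σ x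
    rw [Graft.perm_cons]
    exact MonoidalClosed.curry_injective (key.trans (MonoidalClosed.curry_natural_left _ _).symm)
  have hτ : ∀ (w : List Col) (hw : sigColl₁ w .half), ¬ (∀ c ∈ w, c = .half) →
      ∃ w₀ : List Col, ∃ _ : ∀ c ∈ w₀, c = .half, Nonempty (Graft [.half] 0 (.full :: w₀) w) := by
    intro w hw hn
    obtain ⟨w₀, h, hp⟩ := hw.half_or_one.resolve_left hn
    exact ⟨w₀, h, Graft.exists_of_perm _ hp.symm⟩
  choose W hW T using hτ
  -- For each word of degree one, a relabelling from a word with the full letter in front is chosen;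
  -- the operation is defined by transport along it.
  let τ : ∀ {w : List Col} (hw : sigColl₁ w .half) (h : ¬ ∀ c ∈ w, c = .half),
    Graft [.half] 0 (.full :: W _ hw h) w := fun hw h => (T _ hw h).some
  classical
  let op : ∀ {w : List Col} (hw : sigColl₁ w .half), P.Obj w .half hw → (wordTensor X w ⟶ X .half) :=
    fun {w} hw x => if h : ∀ c ∈ w, c = .half then op₀ h x else
      (τ hw h).perm X ≫ op₁ (hW _ hw h) (P.permute (w' := .full :: W _ hw h) hw
        (.one (hW _ hw h)) (τ hw h).symm x)
  have e₀ : ∀ {w : List Col} (hw : ∀ c ∈ w, c = .half) x, op (.zero hw) x = op₀ (w := w) hw x :=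
    fun hw x => dif_pos hw
  have act_symm : ∀ {w w' w'' : List Col} (hw : sigColl₁ w .half) (hw' : sigColl₁ w' .half)
      (hw'' : sigColl₁ w'' .half) (τ : Graft [.half] 0 w w') (σ : Graft [.half] 0 w' w'')
      (x : P.Obj w' .half hw'), P.permute hw hw'' (τ.trans σ) (P.permute hw' hw τ.symm x) =
        P.permute hw' hw'' σ x := by
    intro w w' w'' hw hw' hw'' τ σ x
    rw [P.permute_permute]
    congr 1
    exact Graft.relabel_ext fun b => by rw [Graft.trans_n, Graft.trans_n, Graft.n_symm_n]
  -- The transported operation does not depend on the choice: two relabellings differ by one that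
  -- fixes the full input, which `act₁` handles.
  have act' : ∀ {w₀ w : List Col} (hw₀ : ∀ c ∈ w₀, c = .half) (hw : sigColl₁ w .half)
      (σ : Graft [.half] 0 (.full :: w₀) w) (x : P.Obj (.full :: w₀) .half (.one hw₀)),
      op hw (P.permute (.one hw₀) hw σ x) = σ.perm X ≫ op₁ hw₀ x := by
    intro w₀ w hw₀ hw σ x
    have hn : ¬ ∀ c ∈ w, c = .half := fun h => absurd
      (h .full (σ.perm_word.mem_iff.1 List.mem_cons_self)) (by simp)
    refine (dif_neg hn).trans ?_
    rw [P.permute_permute, act₁ hw₀, ← Category.assoc]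
    congr 1
    refine (Graft.perm_trans fun b => ?_).symm
    rw [Graft.trans_n, Graft.n_symm_n]
  have e₁ : ∀ {w : List Col} (hw : ∀ c ∈ w, c = .half) x, op (.one hw) x = op₁ (w := w) hw x := by
    intro w hw x
    have := act' hw (.one hw) (Graft.idL _ (.full :: w)) x
    rwa [Graft.perm_of_id _ (fun _ => rfl), Category.id_comp, P.permute_idL] at this
  have cases : ∀ {w : List Col} (hw : sigColl₁ w .half) (x : P.Obj w .half hw),
      (∀ c ∈ w, c = .half) ∨ ∃ (w₀ : List Col) (hw₀ : ∀ c ∈ w₀, c = .half)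
        (σ : Graft [.half] 0 (.full :: w₀) w) (x₀ : P.Obj (.full :: w₀) .half (.one hw₀)),
        x = P.permute (.one hw₀) hw σ x₀ := by
    intro w hw x
    refine hw.half_or_one.imp id ?_
    rintro ⟨w₀, hw₀, hp⟩
    obtain ⟨σ⟩ := Graft.exists_of_perm .half hp.symm
    refine ⟨w₀, hw₀, σ, P.permute hw (.one hw₀) σ.symm x, ?_⟩
    have := act_symm (.one hw₀) hw hw σ (Graft.idL _ _) x
    have e : σ.trans (Graft.idL _ _) = σ := Graft.relabel_ext fun b => rfl
    rw [e] at this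
    rw [this]
    exact (P.permute_idL hw x).symm
  have act : ∀ {w w' : List Col} (hw : sigColl₁ w .half) (hw' : sigColl₁ w' .half)
      (σ : Graft [.half] 0 w w') (x : P.Obj w .half hw),
      op hw' (P.permute hw hw' σ x) = σ.perm X ≫ op hw x := by
    intro w w' hw hw' σ x
    rcases cases hw x with h | ⟨w₀, hw₀, τ, x₀, rfl⟩
    · have h' : ∀ c ∈ w', c = .half := fun c hc => h c (σ.perm_word.mem_iff.2 hc)
      exact (e₀ h' _).trans ((act₀ h h' σ x).trans (congrArg _ (e₀ h x).symm))
    · rw [act' hw₀, P.permute_permute, act' hw₀, ← Category.assoc]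
      congr 1
      exact Graft.perm_trans fun b => rfl
  -- By equivariance on both sides, the composition law may be checked after relabelling the outer
  -- operation.
  have reduce_left : ∀ {w₀ w t w' w₃ : List Col} (hw₀ : sigColl₁ w₀ .half) (hw : sigColl₁ w .half)
      (ht : sigColl₁ t .half) (hw' : sigColl₁ w' .half) {j₀ : Fin w₀.length}
      (hj₀ : w₀.get j₀ = .half) (σ : Graft [.half] 0 w₀ w) (hj : w.get (σ.n j₀) = .half)
      (e : Graft w (σ.n j₀) t w') (e₃ : Graft w₀ j₀ t w₃) (x : P.Obj w₀ .half hw₀)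
      (y : P.Obj t .half ht), (∀ hw₃ : sigColl₁ w₃ .half,
        op hw₃ (P.comp hw₀ ht hw₃ j₀ hj₀ e₃ x y) = e₃.ins hj₀ (op ht y) ≫ op hw₀ x) →
      op hw' (P.comp hw ht hw' (σ.n j₀) hj e (P.permute hw₀ hw σ x) y) =
        e.ins hj (op ht y) ≫ op hw (P.permute hw₀ hw σ x) := by
    intro w₀ w t w' w₃ hw₀ hw ht hw' j₀ hj₀ σ hj e e₃ x y h
    obtain ⟨e₄, he⟩ := Graft.exists_seq₄ σ rfl e e₃
    have hw₃ := hw'.of_perm e₄.perm_word.symm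
    rw [P.comp_permute_left hw₀ hw ht hw' hw₃ hj₀ hj σ e e₃ e₄ he, act, act, h hw₃,
      Graft.ins_permute_left hj₀ hj σ e e₃ e₄ he]
  -- The same reduction for the inner operation.
  have reduce_right : ∀ {t₀ w t w' : List Col} (hw : sigColl₁ w .half) (ht₀ : sigColl₁ t₀ .half)
      (ht : sigColl₁ t .half) (hw' : sigColl₁ w' .half) {j : Fin w.length}
      (hj : w.get j = .half) (σ : Graft [.half] 0 t₀ t) (e : Graft w j t w')
      (x : P.Obj w .half hw) (y : P.Obj t₀ .half ht₀), (∀ e₂ : Graft w j t₀ w',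
        op hw' (P.comp hw ht₀ hw' j hj e₂ x y) = e₂.ins hj (op ht₀ y) ≫ op hw x) →
      op hw' (P.comp hw ht hw' j hj e x (P.permute ht₀ ht σ y)) =
        e.ins hj (op ht (P.permute ht₀ ht σ y)) ≫ op hw x := by
    intro t₀ w t w' hw ht₀ ht hw' j hj σ e x y h
    obtain ⟨e₂, he⟩ := Graft.exists_seq₂ (Graft.idR w j .half hj) rfl σ e
    rw [P.comp_permute_right hw ht₀ ht hw' hj σ e e₂ he, act,
      Graft.ins_permute_right hj σ e e₂ he]
    exact h e₂
  -- At a given input one grafting is as good as another, since they differ by a relabelling; so the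
  -- planar ones suffice.
  have free : ∀ {w t w' w₃ : List Col} (hw : sigColl₁ w .half) (ht : sigColl₁ t .half)
      (hw' : sigColl₁ w' .half) {j : Fin w.length} (hj : w.get j = .half) (e : Graft w j t w')
      (e₃ : Graft w j t w₃) (x : P.Obj w .half hw) (y : P.Obj t .half ht),
      (∀ hw₃ : sigColl₁ w₃ .half,
        op hw₃ (P.comp hw ht hw₃ j hj e₃ x y) = e₃.ins hj (op ht y) ≫ op hw x) →
      op hw' (P.comp hw ht hw' j hj e x y) = e.ins hj (op ht y) ≫ op hw x := by
    intro w t w' w₃ hw ht hw' j hj e e₃ x y h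
    have := reduce_left hw hw ht hw' hj (Graft.idL _ _) hj e e₃ x y h
    rwa [P.permute_idL] at this
  refine ⟨⟨fun hw x => op hw x, fun {w} hw => ?_, (e₀ _ _).trans one,
    fun {w t w'} hw ht hw' {j} hj e x y => ?_⟩, e₀, e₁⟩
  · by_cases h : ∀ c ∈ w, c = .half
    · have : op hw = op₀ h := funext fun x => dif_pos h
      rw [this]
      exact cont₀ h
    · have : op hw = fun x => (τ hw h).perm X ≫
        op₁ (hW _ hw h) (P.permute (w' := .full :: W _ hw h) hw
        (.one (hW _ hw h)) (τ hw h).symm x) :=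
          funext fun x => dif_neg h
      rw [this]
      let _ := homTop i (wordTensor X (.full :: W _ hw h)) (X .half)
      exact continuous_homTop_precomp _ ((cont₁ (hW _ hw h)).comp (P.continuous_permute _ _ _))
  -- The degrees of `x` and `y` give three cases: both zero is `comp₀`, only `y` of degree one is
  -- `left`, only `x` of degree one is `comp`. Both of degree one is excluded by the degree of the
  -- composite.
  · rcases cases hw x with h | ⟨w₀, hw₀, σ, x, rfl⟩
    · rcases cases ht y with h' | ⟨t₀, ht₀, τ, y, rfl⟩
      · have h'' : ∀ c ∈ w', c = .half := by
          intro c hc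
          obtain ⟨q, rfl⟩ := List.get_of_mem hc
          rcases e.cases q with ⟨a, ha, rfl⟩ | ⟨b, rfl⟩
          · rw [e.get_o]; exact h _ (List.get_mem _ _)
          · rw [e.get_n]; exact h' _ (List.get_mem _ _)
        rw [e₀ h'', e₀ h', e₀ h]
        exact comp₀ h h' h'' hj e x y
      · refine reduce_right hw (.one ht₀) ht hw' hj τ e x y fun e₂ => ?_
        clear e
        revert hw hj x h e₂
        refine exists_mid (motive := fun w j => ∀ (hw : sigColl₁ w .half) (hj : w.get j = .half)
          (x : P.Obj w .half hw) (h : ∀ c ∈ w, c = .half) (e : Graft w j (.full :: t₀) w'),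
          op hw' (P.comp hw (.one ht₀) hw' j hj e x y) = e.ins hj (op (.one ht₀) y) ≫ op hw x)
          ?_ w j
        intro u c v hw hj x h e
        obtain rfl : c = .half := h c (by simp)
        refine free hw (.one ht₀) hw' hj e (Graft.planarFull u .half v t₀) x y fun hw₃ => ?_
        rw [e₁ ht₀, e₀ h, Graft.ins_planarFull]
        exact (e₁ (half_append h ht₀) _).trans (left u v t₀ h ht₀ x y)
    · obtain ⟨j, rfl⟩ := σ.n_bijective.2 j
      have hj₀ : (Col.full :: w₀).get j = .half := (σ.get_n j).symm.trans hj
      refine reduce_left (.one hw₀) hw ht hw' hj₀ σ hj e (Graft.std _ _ _) x y fun hw₃ => ?_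
      generalize Graft.std (Col.full :: w₀) j t = e'
      generalize Graft.stdW (Col.full :: w₀) j t = w₃ at hw₃ e'
      clear hj e hw hw' σ
      -- A full letter in `t` would be a second full input of the composite, next to the one of `x`.
      have ht' : ∀ c ∈ t, c = .half := by
        intro c hc
        obtain ⟨b, rfl⟩ := List.get_of_mem hc
        by_contra hb
        have hb' : t.get b = .full := by revert hb; cases t.get b <;> simp
        have hj' : (0 : Fin (Col.full :: w₀).length) ≠ j := by rintro rfl; simp at hj₀
        exact e'.o_ne_n (hw₃.2 (e'.o 0 hj') (e'.n b) ((e'.get_o _ _).trans rfl)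
          ((e'.get_n _).trans hb'))
      revert hj₀ e'
      refine Fin.cases (fun hj₀ => by simp at hj₀) (fun j => ?_) j
      revert hw₀ x
      refine exists_mid (motive := fun w₀ j => ∀ (hw₀ : ∀ c ∈ w₀, c = .half)
        (x : P.Obj (.full :: w₀) .half (.one hw₀)) (hj₀ : (Col.full :: w₀).get j.succ = .half)
        (e' : Graft (.full :: w₀) j.succ t w₃),
        op hw₃ (P.comp (.one hw₀) ht hw₃ j.succ hj₀ e' x y) =
          e'.ins hj₀ (op ht y) ≫ op (.one hw₀) x) ?_ w₀ j
      intro u c v h x hj₀ e'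
      obtain rfl : c = .half := h c (by simp)
      refine free (.one h) ht hw₃ hj₀ e' (Graft.planar (.full :: u) .half v t) x y fun hw₃ => ?_
      rw [e₁ h, e₀ ht']
      refine (e₁ (half_append h ht') _).trans ((comp u v t h ht' x y).trans ?_)
      exact congrArg (fun z => z ≫ op₁ h x) (Graft.ins_planar (.full :: u) v (op₀ ht' y)).symm

end Generators

/-! ### Naturality of parametrized insertions. -/

section SpliceParam
variable {C : Type u} [Category.{v} C] [MonoidalCategory C] [SymmetricCategory C] {X Y : Col → C}
  {K : Col → Prop}

theorem spliceParam_mapWord (φ : ∀ c, K c → (X c ⟶ Y c)) (H : C) {c : Col} (v : List Col)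
    {t : List Col} {g : H ⊗ wordTensor X t ⟶ X c} {g' : H ⊗ wordTensor Y t ⟶ Y c} (hc : K c)
    (ht : ∀ c ∈ t, K c) (hv : ∀ c ∈ v, K c) (h : H ◁ mapWord φ t ht ≫ g' = g ≫ φ c hc)
    (u : List Col) (hw : ∀ c ∈ u ++ (t ++ v), K c) (hw' : ∀ c' ∈ u ++ c :: v, K c') :
    H ◁ mapWord φ _ hw ≫ spliceParam Y H v g' u = spliceParam X H v g u ≫ mapWord φ _ hw' := by
  induction u with
  | nil =>
    have : ∀ {Z Z' T T' V V' E E' : C} {s : Z ⟶ T ⊗ V} {s' : Z' ⟶ T' ⊗ V'} {M : Z ⟶ Z'}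
        {m : T ⟶ T'} {n : V ⟶ V'} {g : H ⊗ T ⟶ E} {g' : H ⊗ T' ⟶ E'} {f : E ⟶ E'},
        M ≫ s' = s ≫ (m ⊗ₘ n) → H ◁ m ≫ g' = g ≫ f →
        H ◁ M ≫ H ◁ s' ≫ (α_ H T' V').inv ≫ g' ▷ V' =
          (H ◁ s ≫ (α_ H T V).inv ≫ g ▷ V) ≫ (f ⊗ₘ n) := by
      intro Z Z' T T' V V' E E' s s' M m n g g' f h1 h2
      rw [← MonoidalCategory.whiskerLeft_comp_assoc, h1, MonoidalCategory.whiskerLeft_comp,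
        tensorHom_def f n, Category.assoc, Category.assoc, Category.assoc,
        ← comp_whiskerRight_assoc, ← h2, tensorHom_def m n]
      simp only [MonoidalCategory.whiskerLeft_comp, Category.assoc, whisker_assoc_symm]
      simp [← whisker_exchange]
    exact this (mapWord_splitHom φ v t _ ht hv) h
  | cons e u ih =>
    have : ∀ {E E' Z Z' W W' : C} {s : H ⊗ Z ⟶ W} {s' : H ⊗ Z' ⟶ W'} {f : E ⟶ E'} {M : Z ⟶ Z'}
        {m : W ⟶ W'}, H ◁ M ≫ s' = s ≫ m →
        H ◁ (f ⊗ₘ M) ≫ (α_ H E' Z').inv ≫ (β_ H E').hom ▷ Z' ≫ (α_ E' H Z').hom ≫ E' ◁ s' =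
          ((α_ H E Z).inv ≫ (β_ H E).hom ▷ Z ≫ (α_ E H Z).hom ≫ E ◁ s) ≫ (f ⊗ₘ m) := by
      intro E E' Z Z' W W' s s' f M m h
      have h1 := exch_natural (𝟙 H) f M
      rw [id_tensorHom, id_tensorHom] at h1
      simp only [exch, Category.assoc] at h1
      rw [reassoc_of% h1, exch_nat_cons f h]
      simp only [Category.assoc]
    exact this (ih _ _)

theorem splice_mapWord (φ : ∀ c, K c → (X c ⟶ Y c)) {c : Col} (v : List Col)
    {t : List Col} {g : wordTensor X t ⟶ X c} {g' : wordTensor Y t ⟶ Y c} (hc : K c)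
    (ht : ∀ c ∈ t, K c) (h : mapWord φ t ht ≫ g' = g ≫ φ c hc)
    (u : List Col) (hw : ∀ c ∈ u ++ (t ++ v), K c) (hw' : ∀ c' ∈ u ++ c :: v, K c') :
    mapWord φ _ hw ≫ splice Y v g' u = splice X v g u ≫ mapWord φ _ hw' := by
  rw [← Graft.ins_planar, ← Graft.ins_planar]
  exact Graft.ins_natural φ _ _ hw' hw ht hc h

/-- The position labels before and after the relabelling differ by one exchange of neighbours, and
the permutation of factors is determined by its labels. -/
theorem Graft.perm_swap (k : Col) (u : List Col) (a b : Col) (v : List Col) :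
    (swap k u a b v).perm X = swapHom X a b v u := by
  refine (swap k u a b v).perm_eq (lc := id) (lb := (swap k u a b v).n) (fun _ => rfl)
    Function.injective_id ?_
  have hl : (lbl (id : Fin (u ++ b :: a :: v).length → _)).length = (u ++ b :: a :: v).length :=
    lbl_length _
  obtain ⟨au, x, y, av, hu, hv, e⟩ : ∃ au x y av, u.length = au.length ∧ v.length = av.length ∧
      lbl (id : Fin (u ++ b :: a :: v).length → _) = au ++ x :: y :: av := by
    generalize lbl (id : Fin (u ++ b :: a :: v).length → _) = l at hl
    obtain ⟨x, l', hx⟩ := List.exists_cons_of_length_eq_add_one (n := v.length + 1)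
      (l := l.drop u.length) (by simp [hl])
    have h2 : l'.length = v.length + 1 := by
      have := congrArg List.length hx
      simp [hl] at this; omega
    obtain ⟨y, av, rfl⟩ := List.exists_cons_of_length_eq_add_one h2
    refine ⟨l.take u.length, x, y, av, by simp [hl], by simpa using h2.symm, ?_⟩
    rw [← hx, List.take_append_drop]
  have e' : lbl (swap k u a b v).n = au ++ y :: x :: av := by
    refine List.ext_getElem? fun n => ?_
    have hlen : (lbl (swap k u a b v).n).length = (u ++ a :: b :: v).length := lbl_length _
    by_cases hn : n < (u ++ a :: b :: v).length
    · have h1 := swap_getElem? (k := k) (av := av) hu b a x y ⟨n, hn⟩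
      rw [← e, lbl_getElem?] at h1
      rw [← h1]
      exact lbl_getElem? _ ⟨n, hn⟩
    · rw [List.getElem?_eq_none (by omega), List.getElem?_eq_none (by simp at hn ⊢; omega)]
  rw [e, e']
  exact .swap hu hv _ _ _ _

end SpliceParam

/-! ### Words with half letters only, or with one full letter in front. -/

section FullHalf
variable {C : Type u} [Category.{v} C] [MonoidalCategory C] [SymmetricCategory C] (B A : C)

theorem whiskerLeft_square {W W' Z Z' : C} {s : W ⟶ W'} {s' : Z ⟶ Z'} {f : W ⟶ Z} {f' : W' ⟶ Z'}
    (h : f ≫ s' = s ≫ f') : B ◁ s ≫ B ◁ f' = B ◁ f ≫ B ◁ s' := by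
  rw [← MonoidalCategory.whiskerLeft_comp, ← MonoidalCategory.whiskerLeft_comp, h]

/-- The identification of the tensor factors of colour `half`. -/
def halves (w : List Col) (hw : ∀ c ∈ w, c = Col.half) :
    wordTensor (pair B A) w ⟶ wordTensor (fun _ => A) w := mapWord (toHalf B A) w hw

def fullHalves (w : List Col) (hw : ∀ c ∈ w, c = Col.half) :
    wordTensor (pair B A) (.full :: w) ⟶ B ⊗ wordTensor (fun _ => A) w := B ◁ halves B A w hw

/-- Factor by factor this is an identity, but `pair B A c` reduces to `A` only once `c` is known to
be `half`; the inverse is therefore built from `eqToHom`. -/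
theorem isIso_halves (w : List Col) (hw : ∀ c ∈ w, c = Col.half) : IsIso (halves B A w hw) := by
  let g : ∀ c ∈ w, (fun _ : Col => A) c ⟶ pair B A c := fun c hc =>
    eqToHom (congrArg (pair B A) (hw c hc).symm)
  have h1 : ∀ c hc, toHalf B A c (hw c hc) ≫ g c hc = 𝟙 _ := by
    intro c hc
    have : ∀ (c : Col) (h : c = .half), toHalf B A c h ≫ eqToHom (congrArg (pair B A) h.symm) = 𝟙 _ := by
      rintro c rfl; exact Category.comp_id _
    exact this c (hw c hc)
  have h2 : ∀ c hc, g c hc ≫ toHalf B A c (hw c hc) = 𝟙 _ := by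
    intro c hc
    have : ∀ (c : Col) (h : c = .half), eqToHom (congrArg (pair B A) h.symm) ≫ toHalf B A c h = 𝟙 _ := by
      rintro c rfl; exact Category.comp_id _
    exact this c (hw c hc)
  refine ⟨wordTensorMap w g, ?_, ?_⟩
  · rw [halves, mapWord, ← wordTensorMap_comp]
    simp only [h1]
    exact wordTensorMap_id _ _
  · rw [halves, mapWord, ← wordTensorMap_comp]
    simp only [h2]
    exact wordTensorMap_id (fun _ => A) _

theorem isIso_fullHalves (w : List Col) (hw : ∀ c ∈ w, c = Col.half) :
    IsIso (fullHalves B A w hw) := by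
  have := isIso_halves B A w hw
  exact inferInstanceAs (IsIso (B ◁ halves B A w hw))

variable {B A}

theorem halves_op {t : List Col} (ht : ∀ c ∈ t, c = .half) (y : wordTensor (fun _ => A) t ⟶ A) :
    mapWord (toHalf B A) t ht ≫ y = (halves B A t ht ≫ y) ≫ toHalf B A .half rfl :=
  (Category.comp_id _).symm

theorem halves_ins {w t w' : List Col} {j : Fin w.length} (hw : ∀ c ∈ w, c = .half)
    (ht : ∀ c ∈ t, c = .half) (hw' : ∀ c ∈ w', c = .half) (hj : w.get j = .half)
    (e : Graft w j t w') (y : wordTensor (fun _ => A) t ⟶ A) :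
    halves B A w' hw' ≫ e.ins (c := .half) hj y =
      e.ins (X := pair B A) (c := .half) hj (halves B A t ht ≫ y) ≫ halves B A w hw :=
  e.ins_natural (toHalf B A) hj hw hw' ht rfl (halves_op ht y)

theorem fullHalves_swap (u v : List Col) (h : ∀ c ∈ u ++ .half :: .half :: v, c = .half) :
    swapHom (pair B A) .half .half v (.full :: u) ≫ fullHalves B A _ h =
      fullHalves B A _ h ≫ B ◁ swapHom (fun _ => A) .half .half v u := by
  exact whiskerLeft_square B (mapWord_swapHom (toHalf B A) .half .half v u h h)

theorem fullHalves_splice (u v t : List Col) (h : ∀ c ∈ u ++ .half :: v, c = .half)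
    (ht : ∀ c ∈ t, c = .half) (y : wordTensor (fun _ => A) t ⟶ A) :
    splice (pair B A) (c := .half) v (halves B A t ht ≫ y) (.full :: u) ≫ fullHalves B A _ h =
      fullHalves B A _ (half_append h ht) ≫ B ◁ splice (fun _ => A) (c := .half) v y u := by
  exact whiskerLeft_square B (splice_mapWord (toHalf B A) v rfl ht (halves_op ht y) u (half_append h ht) h)

theorem fullHalves_spliceParam (u v t : List Col) (h : ∀ c ∈ u ++ .half :: v, c = .half)
    (ht : ∀ c ∈ t, c = .half) (g : B ⊗ wordTensor (fun _ => A) t ⟶ A) :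
    spliceParam (pair B A) (pair B A .full) (c := .half) v (fullHalves B A t ht ≫ g) u ≫
        halves B A _ h =
      fullHalves B A _ (half_append h ht) ≫ spliceParam (fun _ => A) B (c := .half) v g u :=
  (spliceParam_mapWord (toHalf B A) B v (c := .half) rfl ht (fun c hc => h c (by simp [hc]))
    (Category.comp_id _).symm u (half_append h ht) h).symm

end FullHalf

/-! ### Algebras in degree at most one as parametrized module families. -/

section Modules
variable {C : Type u} [Category.{v} C] [MonoidalCategory C] [SymmetricCategory C]
  [MonoidalClosed C] {i : CGTop ⥤ C} [i.Braided] [i.IsLeftAdjoint] {P : Operad sigColl₁}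
  {A B D : C} (α : Alg i P.toOperadData.degZero (fun _ => A))

/-- The algebra `m` induces the structure `α` on `A`. -/
def HalfAlg.Restricts (m : HalfAlg i P.toOperadData (pair B A)) : Prop :=
  ∀ (w : List Col) (hw : ∀ c ∈ w, c = .half) (x : P.Obj w .half (.zero hw)),
    m.op (.zero hw) x = halves B A w hw ≫ α.op (k := .half) (h := .mk hw) x

variable (D) in
/-- Families of maps parametrized by `D` which are compatible with the bimodule structure of the
operations of degree one. -/
structure ModuleFamily where
  op : ∀ (w : List Col) (hw : ∀ c ∈ w, c = .half),
    P.Obj (.full :: w) .half (.one hw) → (D ⊗ wordTensor (fun _ => A) w ⟶ A)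
  continuous_op : ∀ w hw, Continuous[_, homTop i _ _] (op w hw)
  swap : ∀ (u v : List Col) (h : ∀ c ∈ u ++ .half :: .half :: v, c = .half)
    (x : P.Obj (.full :: (u ++ .half :: .half :: v)) .half (.one h)),
    op _ h (P.comp sigColl₁_unit (.one h) (.one h) 0 rfl
      (Graft.swap .half (.full :: u) .half .half v) (P.one .half sigColl₁_unit) x) =
        D ◁ swapHom (fun _ => A) .half .half v u ≫ op _ h x
  comp : ∀ (u v t : List Col) (h : ∀ c ∈ u ++ .half :: v, c = .half)
    (ht : ∀ c ∈ t, c = .half) (x : P.Obj (.full :: (u ++ .half :: v)) .half (.one h))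
    (y : P.Obj t .half (.zero ht)),
    op _ (half_append h ht) (P.comp (.one h) (.zero ht) (.one (half_append h ht))
      (mid (.full :: u) .half v) (get_mid (.full :: u) .half v)
      (Graft.planar (.full :: u) .half v t) x y) =
    D ◁ splice (fun _ => A) (c := .half) v (α.op (k := .half) (h := .mk ht) y) u ≫ op _ h x
  left : ∀ (u v t : List Col) (h : ∀ c ∈ u ++ .half :: v, c = .half)
    (ht : ∀ c ∈ t, c = .half) (y : P.Obj (u ++ .half :: v) .half (.zero h))
    (x : P.Obj (.full :: t) .half (.one ht)),
    op _ (half_append h ht) (P.comp (.zero h) (.one ht) (.one (half_append h ht)) (mid u .half v)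
      (get_mid u .half v) (Graft.planarFull u .half v t) y x) =
    spliceParam (fun _ => A) D (c := .half) v (op _ ht x) u ≫ α.op (k := .half) (h := .mk h) y

variable {α}

/-- The degree zero operations are those of `α` and the degree one operations are the family; its
axioms are the hypotheses of `HalfAlg.exists_of_generators`. With `HalfAlg.Restricts.exists_family`
in the other direction, structures on `(B, A)` over `α` and families parametrized by `B` carry the
same information. -/
theorem ModuleFamily.exists_halfAlg (g : ModuleFamily B α) :
    ∃ m : HalfAlg i P.toOperadData (pair B A), m.Restricts α ∧ ∀ w hw x,
      m.op (.one hw) x = fullHalves B A w hw ≫ g.op w hw x := by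
  obtain ⟨m, h₀, h₁⟩ := HalfAlg.exists_of_generators (i := i) (P := P) (X := pair B A)
    (fun {w} hw x => halves B A w hw ≫ α.op (k := .half) (h := .mk hw) x)
    (fun {w} hw x => fullHalves B A w hw ≫ g.op w hw x)
    (fun {w} hw => continuous_homTop_precomp _ (α.continuous_op (.mk hw)))
    (fun {w} hw => continuous_homTop_precomp _ (g.continuous_op w hw))
    (by
      have h1 := α.op_one (k := .half) (.mk (by simp))
      refine (whisker_eq _ h1).trans ?_
      have : ∀ {T : C}, (𝟙 T ⊗ₘ 𝟙 (𝟙_ C)) ≫ (ρ_ T).hom = (ρ_ T).hom := by simp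
      exact this)
    (fun {w t w'} hw ht hw' {j} hj e x y => by
      have h1 := α.op_comp P.relabels_degZero (.mk hw) (.mk ht) (.mk hw') j hj e x y
      exact (whisker_eq _ h1).trans ((Category.assoc _ _ _).symm.trans
        ((eq_whisker (halves_ins hw ht hw' hj e _) _).trans (Category.assoc _ _ _))))
    (fun u v h x => (whisker_eq _ (g.swap u v h x)).trans ((Category.assoc _ _ _).symm.trans
      ((eq_whisker (fullHalves_swap u v h).symm _).trans (Category.assoc _ _ _))))
    (fun u v t h ht x y => (whisker_eq _ (g.comp u v t h ht x y)).trans ((Category.assoc _ _ _).symm.trans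
      ((eq_whisker (fullHalves_splice u v t h ht _).symm _).trans (Category.assoc _ _ _))))
    (fun u v t h ht y x => (whisker_eq _ (g.left u v t h ht y x)).trans ((Category.assoc _ _ _).symm.trans
      ((eq_whisker (fullHalves_spliceParam u v t h ht _).symm _).trans (Category.assoc _ _ _))))
  exact ⟨m, fun w hw x => h₀ hw x, fun w hw x => h₁ hw x⟩

theorem HalfAlg.Restricts.exists_family {m : HalfAlg i P.toOperadData (pair B A)}
    (hm : m.Restricts α) : ∃ g : ModuleFamily B α, ∀ w hw x,
      m.op (.one hw) x = fullHalves B A w hw ≫ g.op w hw x := by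
  -- The family is the given operation transported along the isomorphism `fullHalves`; its axioms
  -- are checked after cancelling that isomorphism.
  have hi : ∀ (w : List Col) (hw : ∀ c ∈ w, c = Col.half), ∃ j, fullHalves B A w hw ≫ j = 𝟙 _ ∧
      j ≫ fullHalves B A w hw = 𝟙 _ := fun w hw => (isIso_fullHalves B A w hw).out
  choose j hj hj' using hi
  have hg : ∀ w hw x, m.op (.one hw) x = fullHalves B A w hw ≫ j w hw ≫ m.op (.one hw) x := by
    intro w hw x
    rw [← Category.assoc, hj, Category.id_comp]
  have cancel : ∀ {w : List Col} (hw : ∀ c ∈ w, c = Col.half) {a b : B ⊗ wordTensor _ w ⟶ A},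
      fullHalves B A w hw ≫ a = fullHalves B A w hw ≫ b → a = b := by
    intro w hw a b h
    have := isIso_fullHalves B A w hw
    exact (cancel_epi _).1 h
  refine ⟨⟨fun w hw x => j w hw ≫ m.op (.one hw) x,
    fun w hw => continuous_homTop_precomp _ (m.continuous_op _),
    fun u v h x => cancel h ?_,
    fun u v t h ht x y => cancel (half_append h ht) ?_,
    fun u v t h ht y x => cancel (half_append h ht) ?_⟩, hg⟩
  · refine (hg _ h _).symm.trans ?_
    refine (m.op_comp sigColl₁_unit (.one h) (.one h) rfl
      (Graft.swap .half (.full :: u) .half .half v) (P.one .half sigColl₁_unit) x).trans ?_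
    rw [m.op_one]
    refine (Graft.ins_perm' _ _).trans ?_
    rw [Graft.perm_swap]
    exact (whisker_eq _ (hg _ h x)).trans ((Category.assoc _ _ _).symm.trans
      ((eq_whisker (fullHalves_swap u v h) _).trans (Category.assoc _ _ _)))
  · refine (hg _ (half_append h ht) _).symm.trans ?_
    refine (m.op_comp (.one h) (.zero ht) (.one (half_append h ht)) _ _ x y).trans ?_
    rw [Graft.ins_planar, hm t ht y]
    exact (whisker_eq _ (hg _ h x)).trans ((Category.assoc _ _ _).symm.trans
      ((eq_whisker (fullHalves_splice u v t h ht _) _).trans (Category.assoc _ _ _)))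
  · refine (hg _ (half_append h ht) _).symm.trans ?_
    refine (m.op_comp (.zero h) (.one ht) (.one (half_append h ht)) _ _ y x).trans ?_
    rw [Graft.ins_planarFull, hm _ h y]
    refine (congrArg (fun z => spliceParam (pair B A) (pair B A .full) v z u ≫ _)
      (hg t ht x)).trans ?_
    exact (Category.assoc _ _ _).symm.trans
      ((eq_whisker (fullHalves_spliceParam u v t h ht _) _).trans (Category.assoc _ _ _))

/-- Algebras agree if they agree on the operations of degree zero, and on the operations of degree one
whose first input is the one of colour `full`. -/
theorem HalfAlg.ext_generators {X : Col → C} {m m' : HalfAlg i P.toOperadData X}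
    (h₀ : ∀ {w : List Col} (hw : ∀ c ∈ w, c = .half) x,
      m.op (w := w) (.zero hw) x = m'.op (.zero hw) x)
    (h₁ : ∀ {w : List Col} (hw : ∀ c ∈ w, c = .half) x,
      m.op (w := .full :: w) (.one hw) x = m'.op (.one hw) x) : m = m' := by
  refine HalfAlg.ext_op fun {w} hw x => ?_
  rcases hw.half_or_one with h | ⟨w₀, hw₀, hp⟩
  · exact h₀ h x
  · obtain ⟨σ⟩ := Graft.exists_of_perm .half hp.symm
    have key : ∀ m : HalfAlg i P.toOperadData X, m.op hw x =
        σ.perm X ≫ m.op (.one hw₀) (P.permute hw (.one hw₀) σ.symm x) := by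
      intro m
      have h1 := m.op_comp sigColl₁_unit (.one hw₀) hw rfl σ (P.one .half sigColl₁_unit)
        (P.permute hw (.one hw₀) σ.symm x)
      rw [m.op_one] at h1
      have h2 : P.permute (.one hw₀) hw σ (P.permute hw (.one hw₀) σ.symm x) = x := by
        rw [P.permute_permute]
        have e : σ.symm.trans σ = Graft.idL _ _ :=
          Graft.relabel_ext fun b => by rw [Graft.trans_n, Graft.n_symm_n]; rfl
        rw [e, P.permute_idL]
      exact (congrArg (m.op hw) h2).symm.trans (h1.trans (Graft.ins_perm' _ _))
    rw [key m, key m', h₁ hw₀]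

theorem halves_pairMap (f : D ⟶ B) (w : List Col) (hw : ∀ c ∈ w, c = .half) :
    wordTensorMap w (fun c _ => pairMap A f c) ≫ halves B A w hw = halves D A w hw := by
  rw [halves, mapWord, ← wordTensorMap_comp]
  have : ∀ c (h : c = Col.half), pairMap A f c ≫ toHalf B A c h = toHalf D A c h := by
    rintro c rfl; exact Category.comp_id _
  have h2 : (fun c hc => pairMap A f c ≫ toHalf B A c (hw c hc)) =
      fun c hc => toHalf D A c (hw c hc) := by
    funext c hc; exact this c _
  rw [h2]
  rfl

theorem fullHalves_pairMap (f : D ⟶ B) (w : List Col) (hw : ∀ c ∈ w, c = .half) :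
    wordTensorMap (.full :: w) (fun c _ => pairMap A f c) ≫ fullHalves B A w hw =
      fullHalves D A w hw ≫ f ▷ _ := by
  have : ∀ {W W' Z : C} {a : W ⟶ W'} {b : W' ⟶ Z} {c : W ⟶ Z}, a ≫ b = c →
      (f ⊗ₘ a) ≫ B ◁ b = D ◁ c ≫ f ▷ Z := by
    rintro W W' Z a b _ rfl
    rw [MonoidalCategory.tensorHom_def, Category.assoc, ← MonoidalCategory.whiskerLeft_comp, whisker_exchange]
  exact this (halves_pairMap f w hw)

/-- Restriction of an algebra along a map of the objects of colour `full`. -/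
theorem HalfAlg.exists_pullback (m : HalfAlg i P.toOperadData (pair B A)) (f : D ⟶ B) :
    ∃ m' : HalfAlg i P.toOperadData (pair D A), ∀ {w : List Col} (hw : sigColl₁ w .half) x,
      m'.op hw x = wordTensorMap w (fun c _ => pairMap A f c) ≫ m.op hw x := by
  refine ⟨⟨fun {w} hw x => wordTensorMap w (fun c _ => pairMap A f c) ≫ m.op hw x,
    fun hw => continuous_homTop_precomp _ (m.continuous_op hw), ?_, ?_⟩, fun _ _ => rfl⟩
  · rw [m.op_one]
    have : ∀ {T : C}, (𝟙 T ⊗ₘ 𝟙 (𝟙_ C)) ≫ (ρ_ T).hom = (ρ_ T).hom := by simp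
    exact this
  · intro w t w' hw ht hw' j hj e x y
    rw [m.op_comp hw ht hw' hj e x y]
    refine (Category.assoc _ _ _).symm.trans (Eq.trans (eq_whisker ?_ _) (Category.assoc _ _ _))
    exact e.ins_natural (K := fun _ => True) (fun c _ => pairMap A f c) hj (fun _ _ => trivial)
      (fun _ _ => trivial) (fun _ _ => trivial) trivial (Category.comp_id _).symm

end Modules

/-! ### The tautological structure on `(Hoch A, A)` and classifying maps. -/

section HochModule
variable {C : Type u} [Category.{v} C] [MonoidalCategory C] [SymmetricCategory C]
  [MonoidalClosed C] [HasLimitsOfSize.{0, 0} C] [HasColimitsOfSize.{0, 0} C]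
  {i : CGTop ⥤ C} [i.Braided] [i.IsLeftAdjoint] {P : Operad sigColl₁}
  {A B D : C} (α : Alg i P.toOperadData.degZero (fun _ => A))

theorem continuous_homTop_whiskerLeft {T : Type} [TopologicalSpace T] [IsGeneratedBy CH T] (D : C)
    {X Y : C} {f : T → (X ⟶ Y)} (hf : Continuous[_, homTop i X Y] f) :
    Continuous[_, homTop i (D ⊗ X) (D ⊗ Y)] (fun t => D ◁ f t) := by
  have h : (fun t => D ◁ f t) = fun t => (β_ D X).hom ≫ f t ▷ D ≫ (β_ Y D).hom := by
    funext t
    rw [BraidedCategory.braiding_naturality_left, SymmetricCategory.symmetry_assoc]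
  rw [h]
  exact continuous_homTop_precomp _ (continuous_homTop_postcomp _
    (continuous_homTop_whiskerRight _ hf))

theorem Asc.continuous_ι (w : List Col) (hw : ∀ c ∈ w, c = Col.half) :
    Continuous[_, homTop i _ _] (fun x : P.Obj (.full :: w) .half (.one hw) => Asc.ι α hw x) :=
  continuous_homTop_postcomp _ (continuous_homTop.2 ⟨_, fun _ => rfl⟩)

/-- The evaluation maps. -/
noncomputable def hochFamily : ModuleFamily (Hoch α) α where
  op w hw x := Hoch.eval α hw x
  continuous_op w hw := by
    obtain ⟨e, he⟩ := Hoch.eval_eq α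
    simp only [he]
    exact continuous_homTop_postcomp _ (continuous_homTop_whiskerLeft _ (Asc.continuous_ι α w hw))
  swap u v h x := by
    obtain ⟨e, he⟩ := Hoch.eval_eq α
    refine (he h _).trans (Eq.trans ?_ (whisker_eq _ (he h x).symm))
    rw [Asc.ι_swap α u v h x, MonoidalCategory.whiskerLeft_comp, Category.assoc]
  comp u v t h ht x y := by
    obtain ⟨e, he⟩ := Hoch.eval_eq α
    refine (he _ _).trans (Eq.trans ?_ (whisker_eq _ (he h x).symm))
    rw [Asc.ι_comp α u v t h ht x y, MonoidalCategory.whiskerLeft_comp, Category.assoc]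
  left u v t h ht y x := Hoch.eval_left α u v t h ht y x

variable {α}

theorem ModuleFamily.exists_lift (g : ModuleFamily D α) :
    ∃ f : D ⟶ Hoch α, ∀ w hw x, f ▷ _ ≫ Hoch.eval α hw x = g.op w hw x :=
  Hoch.exists_lift α g.op g.continuous_op g.swap g.comp g.left

variable (α)

theorem exists_hochAlg : ∃ m : HalfAlg i P.toOperadData (pair (Hoch α) A), m.Restricts α ∧
    ∀ w hw x, m.op (.one hw) x = fullHalves (Hoch α) A w hw ≫ Hoch.eval α hw x :=
  (hochFamily α).exists_halfAlg

/-- The operations of degree at most one on `(Hoch A, A)`. -/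
noncomputable def hochAlg : HalfAlg i P.toOperadData (pair (Hoch α) A) := (exists_hochAlg α).choose

theorem hochAlg_restricts : (hochAlg α).Restricts α := (exists_hochAlg α).choose_spec.1

theorem hochAlg_op_one {w : List Col} (hw : ∀ c ∈ w, c = .half)
    (x : P.Obj (.full :: w) .half (.one hw)) :
    (hochAlg α).op (.one hw) x = fullHalves (Hoch α) A w hw ≫ Hoch.eval α hw x :=
  (exists_hochAlg α).choose_spec.2 w hw x

variable {α}

/-- A structure on `(B, A)` extending the one on `A` is pulled back from `(Hoch A, A)`. -/
theorem HalfAlg.Restricts.exists_map {m : HalfAlg i P.toOperadData (pair B A)}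
    (hm : m.Restricts α) : ∃ f : B ⟶ Hoch α, ∀ {w : List Col} (hw : sigColl₁ w .half) x,
      m.op hw x = wordTensorMap w (fun c _ => pairMap A f c) ≫ (hochAlg α).op hw x := by
  obtain ⟨g, hg⟩ := hm.exists_family
  obtain ⟨f, hf⟩ := g.exists_lift
  obtain ⟨m', hm'⟩ := (hochAlg α).exists_pullback f
  -- The structure pulled back along the classifying map has the same degree zero part, by
  -- restriction to `α`, and the same degree one part, by the choice of `f`.
  have : m = m' := by
    refine HalfAlg.ext_generators (fun {w} hw x => ?_) (fun {w} hw x => ?_)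
    · rw [hm', hm w hw x, hochAlg_restricts α w hw x]
      exact (eq_whisker (halves_pairMap f w hw).symm _).trans (Category.assoc _ _ _)
    · rw [hm', hg w hw x, hochAlg_op_one α hw x, ← hf w hw x]
      exact (Category.assoc _ _ _).symm.trans ((eq_whisker (fullHalves_pairMap f w hw).symm _).trans
        (Category.assoc _ _ _))
  exact ⟨f, fun hw x => by rw [this, hm']⟩

/-- This is `Hoch.hom_ext` in operadic terms, after cancelling `fullHalves`; it makes classifying
maps unique. -/
theorem hoch_map_ext {f g : B ⟶ Hoch α} (h : ∀ {w : List Col} (hw : ∀ c ∈ w, c = .half)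
    (x : P.Obj (.full :: w) .half (.one hw)),
      wordTensorMap (.full :: w) (fun c _ => pairMap A f c) ≫ (hochAlg α).op (.one hw) x =
        wordTensorMap (.full :: w) (fun c _ => pairMap A g c) ≫ (hochAlg α).op (.one hw) x) :
    f = g := by
  refine Hoch.hom_ext α fun w hw x => ?_
  have := isIso_fullHalves B A w hw
  refine (cancel_epi (fullHalves B A w hw)).1 ?_
  have key : ∀ f : B ⟶ Hoch α,
      wordTensorMap (.full :: w) (fun c _ => pairMap A f c) ≫ (hochAlg α).op (.one hw) x =
        fullHalves B A w hw ≫ f ▷ _ ≫ Hoch.eval α hw x := by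
    intro f
    rw [hochAlg_op_one α hw x]
    exact (Category.assoc _ _ _).symm.trans ((eq_whisker (fullHalves_pairMap f w hw) _).trans
      (Category.assoc _ _ _))
  exact (key f).symm.trans ((h hw x).trans (key g))

end HochModule

open Graft

/-! ### Graftings at the first input. -/

section FrontGrafts
variable {I : Type} {k c d : Col} {w t : List Col}

theorem Graft.planar_o_val (u : List Col) (c : Col) (v t : List Col)
    (j : Fin (u ++ c :: v).length) (hj : j ≠ mid u c v) : ((planar u c v t).o j hj).1 =
      if j.1 < u.length then j.1 else j.1 - 1 + t.length := by
  by_cases h : j.1 < u.length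
  · rw [planar_o_lt j hj h, if_pos h]
  · rw [if_neg h]
    simp [Graft.o, Graft.planar, h]


/-- Substitution of the word `w` for the first letter. -/
def Graft.front (w : List Col) (c : Col) (t : List Col) : Graft (c :: t) 0 w (w ++ t) :=
  planar [] c t w

def inL (w u : List Col) (b : Fin w.length) : Fin (w ++ u).length :=
  ⟨b.1, by have := b.2; rw [List.length_append]; omega⟩

def inR (w u : List Col) (b : Fin u.length) : Fin (w ++ u).length :=
  ⟨w.length + b.1, by have := b.2; rw [List.length_append]; omega⟩

theorem inR_injective (w u : List Col) : Function.Injective (inR w u) := fun _ _ h =>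
  Fin.ext (Nat.add_left_cancel (congrArg Fin.val h))

theorem inL_ne_inR {w u : List Col} (a : Fin w.length) (b : Fin u.length) : inL w u a ≠ inR w u b := by
  intro h
  have h1 : a.1 = w.length + b.1 := congrArg Fin.val h
  have := a.2
  omega

theorem lbl_inL_inR {w u : List Col} (l : Fin (w ++ u).length → I) :
    lbl l = lbl (l ∘ inL w u) ++ lbl (l ∘ inR w u) := lbl_append l

theorem Graft.front_n (w : List Col) (c : Col) (t : List Col) (b : Fin w.length) :
    (front w c t).n b = inL w t b := Fin.ext (Nat.zero_add _)

theorem Graft.front_o (w : List Col) (c : Col) (t : List Col) (j : Fin t.length)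
    (hj : (j.succ : Fin (c :: t).length) ≠ 0) : (front w c t).o j.succ hj = inR w t j := by
  refine Fin.ext ((planar_o_val [] c t w j.succ hj).trans ?_)
  simp [Nat.add_comm, inR]

variable {C : Type u} [Category.{v} C] [MonoidalCategory C] [SymmetricCategory C] {X : Col → C}

theorem Graft.ins_front (g : wordTensor X w ⟶ X c) :
    (front w c t).ins rfl g = splitHom X t w ≫ g ▷ wordTensor X t :=
  ins_planar [] t g

/-- Relabelling the later inputs commutes with replacing the first one by `w`. This and the next
results turn the laws of a bimodule map into the laws of a module family with parameter `wordTensor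
X w`. -/
theorem Graft.perm_front {u u' : List Col} {σ : Graft [k] 0 u u'}
    {e : Graft [k] 0 (w ++ u) (w ++ u')}
    (h : SeqCompat (σ.cons c) (front w c u') (front w c u) e) :
    e.perm X = appMap X w (σ.perm X) := by
  have h1 : ∀ b, e.n (inL w u b) = inL w u' b := fun b => by
    rw [← front_n w c u b, ← h.nn b, front_n]
  have h2 : ∀ b, e.n (inR w u b) = inR w u' (σ.n b) := by
    intro b
    have hb : ((b.succ : Fin (c :: u).length)) ≠ 0 := Fin.succ_ne_zero _
    have := h.no b.succ hb (by rw [cons_succ]; exact Fin.succ_ne_zero _)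
    simp only [cons_succ] at this
    rw [front_o, front_o] at this
    exact this.symm
  refine perm_eq e (lc := id) (lb := e.n) (fun _ => rfl) Function.injective_id ?_
  rw [lbl_inL_inR (id : Fin (w ++ u').length → _), lbl_inL_inR e.n,
    show e.n ∘ inL w u = id ∘ inL w u' from funext h1]
  exact Coh.append_left (perm_coh σ fun b => (h2 b).symm) (lbl_length _).symm

theorem IsIns.append_left {w' : List Col} {a a' b : List I} {x : I} {g : wordTensor X t ⟶ X c}
    {f : wordTensor X w' ⟶ wordTensor X w}
    (h : IsIns g w' a' b x w a f) (ht : t.length = b.length) :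
    ∀ {s : List Col} {l : List I}, s.length = l.length →
      IsIns g (s ++ w') (l ++ a') b x (s ++ w) (l ++ a) (appMap X s f)
  | [], [], _ => h
  | e :: s, y :: l, hs => (h.append_left ht (s := s) (l := l) (by simpa using hs)).cons e y ht
  | [], _ :: _, hs => by simp at hs
  | _ :: _, [], hs => by simp at hs

/-- Insertion at an input behind the block `w` does not touch that block. This serves composition at
a half input of an operation whose full input has been replaced by `w`. -/
theorem Graft.ins_front_par {u v : List Col} {q : Fin (w ++ (u ++ d :: v)).length}
    {e : Graft (w ++ (u ++ d :: v)) q t (w ++ (u ++ (t ++ v)))} (hq : _ = d)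
    (h : ParCompat (front w c (u ++ d :: v)) e (planar (c :: u) d v t)
      (front w c (u ++ (t ++ v)))) (g : wordTensor X t ⟶ X d) :
    e.ins hq g = appMap X w (splice X v g u) := by
  have hm : ∀ j : Fin (u ++ d :: v).length, j ≠ mid u d v →
      (j.succ : Fin (c :: (u ++ d :: v)).length) ≠ mid (c :: u) d v := by
    intro j hj h'
    have := congrArg Fin.val h'
    exact hj (Fin.ext (by simpa [mid] using this))
  have hq1 : q = inR w _ (mid u d v) := by
    rw [← h.pos₁]
    exact front_o w c _ (mid u d v) _
  have hb : ∀ b : Fin t.length, e.n b = inR w _ ((planar u d v t).n b) := by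
    intro b
    have h0 : (planar (c :: u) d v t).n b = ((planar u d v t).n b).succ := Fin.ext (by
      change (c :: u).length + b.1 = u.length + b.1 + 1
      simp; omega)
    have := h.on b (by rw [h0]; exact Fin.succ_ne_zero _)
    simp only [h0] at this
    rw [front_o] at this
    exact this
  have ho : ∀ (j : Fin (u ++ d :: v).length) (hj : j ≠ mid u d v) (h'),
      e.o (inR w _ j) h' = inR w _ ((planar u d v t).o j hj) := by
    intro j hj h'
    have h0 : (planar (c :: u) d v t).o j.succ (hm j hj) = ((planar u d v t).o j hj).succ := by
      refine Fin.ext ((planar_o_val (c :: u) d v t j.succ (hm j hj)).trans ?_)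
      have h1 := planar_o_val u d v t j hj
      have : j.1 ≠ u.length := fun h' => hj (Fin.ext h')
      simp only [Fin.val_succ, List.length_cons, Nat.add_lt_add_iff_right, h1]
      split <;> omega
    have h1 : (front w c (u ++ d :: v)).o j.succ (Fin.succ_ne_zero _) = inR w _ j :=
      front_o w c _ j _
    have := h.oo j.succ (Fin.succ_ne_zero _) (hm j hj) (by rw [h1]; exact h')
      (by rw [h0]; exact Fin.succ_ne_zero _)
    simp only [h0, h1] at this
    exact this.trans (front_o w c _ _ _)
  have hw : ∀ (j : Fin w.length) (h'), e.o (inL w _ j) h' = inL w _ j := by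
    intro j h'
    have h1 : (front w c (u ++ d :: v)).n j = inL w _ j := front_n w c _ j
    have := h.no j (by rw [h1]; exact h')
    simp only [h1] at this
    exact this.trans (front_n w c _ _)
  refine ins_eq e hq g (lab_injective _ (x := none) (Option.some_injective _) (by simp))
    (Option.some_injective _) (fun j hj => (lab_o _ _ _ j hj).symm)
    (lb := some ∘ e.n) (fun _ => rfl) ?_
  obtain ⟨au, av, hu, hv, h1, h2⟩ := Graft.lbl_planar (u := u) (c := d) (t := t) (v := v) none
    (some ∘ inR w (u ++ (t ++ v)))
  have e1 : e.lab none some ∘ inL w (u ++ d :: v) = some ∘ inL w (u ++ (t ++ v)) := by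
    funext j
    have hne : inL w (u ++ d :: v) j ≠ q := by rw [hq1]; exact inL_ne_inR _ _
    exact (lab_o _ _ _ _ hne).trans (congrArg some (hw j hne))
  have e2 : e.lab none some ∘ inR w (u ++ d :: v) =
      (planar u d v t).lab none (some ∘ inR w (u ++ (t ++ v))) := by
    funext j
    by_cases hj : j = mid u d v
    · subst hj
      rw [lab_self, Function.comp_apply, ← hq1]
      exact lab_self _ _ _
    · have hne : inR w (u ++ d :: v) j ≠ q := by
        rw [hq1]; exact fun h' => hj (inR_injective _ _ h')
      rw [lab_o _ _ _ _ hj]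
      exact (lab_o _ _ _ _ hne).trans (congrArg some (ho j hj hne))
  have e3 : some ∘ e.n = (some ∘ inR w (u ++ (t ++ v))) ∘ (planar u d v t).n := by
    funext b
    exact congrArg some (hb b)
  rw [lab_self, lbl_inL_inR (some : Fin (w ++ (u ++ (t ++ v))).length → _),
    lbl_inL_inR (e.lab none some), e1, e2, e3, h1, h2]
  exact (splice_isIns _ hu (lbl_length _).symm hv g).append_left (lbl_length _).symm
    (lbl_length _).symm

/-- The map `s` undoes the splitting of `w ++ t`, so that a map out of `w ++ t` can be read as a map
with parameter object `wordTensor X w`. Moving that parameter inwards over `u` letter by letter is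
undone, up to labels, by `Coh.exists_move`. -/
theorem splitHom_spliceParam_isIns {u v : List Col} {l au b av : List I} (x : I)
    (hw : w.length = l.length) (hu : u.length = au.length) (ht : t.length = b.length)
    (hv : v.length = av.length) (g : wordTensor X (w ++ t) ⟶ X c)
    {s : wordTensor X w ⊗ wordTensor X t ⟶ wordTensor X (w ++ t)}
    (hs : splitHom X t w ≫ s = 𝟙 _) :
    IsIns g (w ++ (u ++ (t ++ v))) (l ++ (au ++ (b ++ av))) (l ++ b) x (u ++ c :: v)
      (au ++ x :: av)
      (splitHom X (u ++ (t ++ v)) w ≫ spliceParam X (wordTensor X w) v (s ≫ g) u) := by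
  induction u generalizing au with
  | nil =>
    obtain rfl : au = [] := by simpa using hu.symm
    obtain ⟨m, hm, em⟩ := Coh.exists_assoc (X := X) hw ht hv
    refine ⟨v, av, m, 𝟙 _, hm, .refl _ _ (by simp [hv]), ?_⟩
    have : ∀ {W T V Y Z Z' M K : C} {a : Z ⟶ W ⊗ Y} {b : Y ⟶ T ⊗ V} {m : Z ⟶ Z'} {p : Z' ⟶ M ⊗ V}
        {p' : M ⟶ W ⊗ T} {s : W ⊗ T ⟶ M} {g : M ⟶ K},
        m ≫ p ≫ p' ▷ V = a ≫ W ◁ b ≫ (α_ _ _ _).inv → p' ≫ s = 𝟙 _ →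
        a ≫ W ◁ b ≫ (α_ W T V).inv ≫ (s ≫ g) ▷ V = m ≫ p ≫ g ▷ V ≫ 𝟙 _ := by
      intro W T V Y Z Z' M K a b m p p' s g h h'
      have h2 := congrArg (fun z => z ≫ (s ≫ g) ▷ V) h
      simp only [Category.assoc] at h2
      rw [← h2, ← comp_whiskerRight, reassoc_of% h', Category.comp_id]
    exact this em hs
  | cons e u ih =>
    cases au with
    | nil => simp at hu
    | cons y au =>
      have h1 := (ih (au := au) (by simpa using hu)).cons e y (by simp [hw, ht])
      obtain ⟨m, hm, em⟩ := Coh.exists_move (X := X) e y (t := w) (v := u ++ (t ++ v))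
        (b := l) (r := au ++ (b ++ av)) hw (by simpa [ht, hv] using hu)
      obtain ⟨m', hm', -, e2⟩ := hm.symm
      have h2 := IsIns.precomp hm' h1
      have : ∀ {Z Z' R W E K : C} {m : E ⊗ Z ⟶ Z'} {m' : Z' ⟶ E ⊗ Z} {p : Z' ⟶ W ⊗ E ⊗ R}
          {s : Z ⟶ W ⊗ R} {f : W ⊗ R ⟶ K}, m ≫ p = E ◁ s ≫ exch E W R → m' ≫ m = 𝟙 _ →
          m' ≫ E ◁ (s ≫ f) = p ≫ (α_ W E R).inv ≫ (β_ W E).hom ▷ R ≫ (α_ E W R).hom ≫ E ◁ f := by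
        intro Z Z' R W E K m m' p s f h h'
        have h3 : p = m' ≫ E ◁ s ≫ exch E W R := by
          rw [← h, reassoc_of% h']
        have h4 := exch_exch E W R
        have h5 : (α_ W E R).inv ≫ (β_ W E).hom ▷ R ≫ (α_ E W R).hom ≫ E ◁ f =
            exch W E R ≫ E ◁ f := by simp [exch]
        rw [h5, h3]
        simp only [Category.assoc]
        rw [reassoc_of% h4, MonoidalCategory.whiskerLeft_comp]
      have h3 := this (f := spliceParam X (wordTensor X w) v (s ≫ g) u) em e2
      exact Eq.mp (congrArg _ h3) h2

/-- The operation inserted in the middle has its inputs `w` placed in front of the whole word, as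
for `planarFull` with one full input. It serves the left module law. -/
theorem Graft.ins_front_seq {u v : List Col}
    {e : Graft (u ++ c :: v) (mid u c v) (w ++ t) (w ++ (u ++ (t ++ v)))}
    (h : SeqCompat (planarFull u c v t) (front w .full (u ++ (t ++ v))) (front w .full t) e)
    (g : wordTensor X (w ++ t) ⟶ X c)
    {s : wordTensor X w ⊗ wordTensor X t ⟶ wordTensor X (w ++ t)}
    (hs : splitHom X t w ≫ s = 𝟙 _) :
    e.ins (get_mid u c v) g =
      splitHom X (u ++ (t ++ v)) w ≫ spliceParam X (wordTensor X w) v (s ≫ g) u := by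
  have ho : ∀ (j : Fin (u ++ c :: v).length) (hj : j ≠ mid u c v),
      e.o j hj = inR w _ ((planar u c v t).o j hj) := by
    intro j hj
    have := h.oo j hj (Fin.succ_ne_zero _)
    simp only [planarFull_o] at this
    rw [front_o] at this
    exact this.symm
  have hn : ∀ b, e.n (inL w t b) = inL w _ b := fun b => by
    rw [← front_n w .full t b, ← h.nn b, front_n]
  have hn' : ∀ b, e.n (inR w t b) = inR w _ ((planar u c v t).n b) := by
    intro b
    have hb : (b.succ : Fin (Col.full :: t).length) ≠ 0 := Fin.succ_ne_zero _
    have := h.no b.succ hb (Fin.succ_ne_zero _)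
    simp only [planarFull_n_succ] at this
    rw [front_o, front_o] at this
    exact this.symm
  obtain ⟨au, av, hu, hv, h1, h2⟩ := Graft.lbl_planar (u := u) (c := c) (t := t) (v := v) none
    (some ∘ inR w (u ++ (t ++ v)))
  refine ins_eq e _ g (lab_injective _ (x := none) (Option.some_injective _) (by simp))
    (Option.some_injective _) (fun j hj => (lab_o _ _ _ j hj).symm)
    (lb := some ∘ e.n) (fun _ => rfl) ?_
  have e1 : e.lab none some = (planar u c v t).lab none (some ∘ inR w (u ++ (t ++ v))) := by
    funext j
    by_cases hj : j = mid u c v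
    · subst hj
      rw [lab_self, lab_self]
    · rw [lab_o _ _ _ _ hj, lab_o _ _ _ _ hj]
      exact congrArg some (ho j hj)
  have e2 : (some ∘ e.n) ∘ inL w t = some ∘ inL w (u ++ (t ++ v)) := by
    funext j
    exact congrArg some (hn j)
  have e3 : (some ∘ e.n) ∘ inR w t = (some ∘ inR w (u ++ (t ++ v))) ∘ (planar u c v t).n := by
    funext b
    exact congrArg some (hn' b)
  rw [lab_self, lbl_inL_inR (some : Fin (w ++ (u ++ (t ++ v))).length → _), h1,
    lbl_inL_inR (some ∘ e.n), e1, e2, e3, h2]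
  exact splitHom_spliceParam_isIns _ (lbl_length _).symm hu (lbl_length _).symm hv g hs

end FrontGrafts

theorem locallyCompactSpace_of_compact_t2 (Y : Type) [TopologicalSpace Y] [CompactSpace Y]
    [T2Space Y] : LocallyCompactSpace Y := inferInstance

/-- The mapping space topology is tested by restricting along maps from compact Hausdorff spaces; on
such a space, being locally compact, a continuous family of maps is jointly continuous. Restriction
to the diagonal gives the claim. -/
theorem BimodMap.continuous_app_two {P : OperadData sigColl₁} {w u u' : List Col} (j : Fin u.length)
    (hu : FullAt u j) (e : Graft u j w u') (K : CompHaus.{0}) {a : K → BimodMap P w}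
    {b : K → EObj P u} (ha : Continuous a) (hb : Continuous b) :
    Continuous fun z => (a z).app j hu e (b z) := by
  have h0 := continuous_le_rng TopologicalSpace.generatedBy_le ha
  simp only [continuous_iInf_rng, continuous_induced_rng] at h0
  have h1 := h0 u u' j hu e
  let b' : C(CH K, EObj P u) := ⟨b, hb⟩
  have h2 := h1 K b'
  have : LocallyCompactSpace (CH K) := locallyCompactSpace_of_compact_t2 K
  exact (ContinuousMap.continuous_uncurry_of_continuous ⟨_, h2⟩).comp
    (continuous_id.prodMk continuous_id)

theorem EObj.gen_comp {P : OperadData sigColl₁} {w t w' : List Col} (hw : sigColl₁ w .half)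
    (ht : sigColl₁ t .half) (hw' : sigColl₁ w' .half) (i : Fin w.length) (hi : w.get i = .half)
    (e : Graft w i t w') (x : P.Obj w .half hw) (y : P.Obj t .half ht) :
    EObj.gen hw' (P.comp hw ht hw' i hi e x y) = EObj.comp i hi e (EObj.gen hw x) (EObj.gen ht y) :=
  (Quot.sound (.gen_comp hw ht hw' i hi e x y)).symm

theorem allHalf_of_forall {w : List Col} (hw : ∀ c ∈ w, c = .half) : AllHalf w :=
  fun _ => hw _ (List.get_mem _ _)

/-! ### Continuous families of classifying maps; laws of evaluated bimodule maps. -/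

section Lift
variable {C : Type u} [Category.{v} C] [MonoidalCategory C] [SymmetricCategory C]
  [MonoidalClosed C] [HasLimitsOfSize.{0, 0} C] [HasColimitsOfSize.{0, 0} C]
  {i : CGTop ⥤ C} [i.Braided] [i.IsLeftAdjoint] {P : Operad sigColl₁}
  {A D : C} {α : Alg i P.toOperadData.degZero (fun _ => A)}

/-- A continuous family of maps compatible with the bimodule structure is represented by a continuous
family of maps to the Hochschild object. -/
theorem ModuleFamily.exists_continuous_lift {T : Type} [TopologicalSpace T] [IsGeneratedBy CH T]
    (g : T → ModuleFamily D α)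
    (hg : ∀ (w : List Col) (hw : ∀ c ∈ w, c = .half) (K : CompHaus.{0})
      (a : K → P.Obj (.full :: w) .half (.one hw)) (b : K → T), Continuous a → Continuous b →
      Continuous[_, homTop i _ _] (fun z => (g (b z)).op w hw (a z))) :
    ∃ f : T → (D ⟶ Hoch α), Continuous[_, homTop i _ _] f ∧
      ∀ t w hw x, f t ▷ _ ≫ Hoch.eval α hw x = (g t).op w hw x := by
  let T' := CGTop.of T
  -- The parameter space is absorbed into the parameter object: a family indexed by `T` over `D`
  -- becomes a single family over `i.obj T' ⊗ D`.
  have hF : ∀ (w : List Col) (hw : ∀ c ∈ w, c = .half),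
      ∃ F : P.Obj (.full :: w) .half (.one hw) →
        ((i.obj T' ⊗ D) ⊗ wordTensor (fun _ => A) w ⟶ A), Continuous[_, homTop i _ _] F ∧
        ∀ t x, ptO i T' t D ▷ _ ≫ F x = (g t).op w hw x := by
    intro w hw
    obtain ⟨F, hF⟩ := exists_two_parameter (i := i)
      (T := CGTop.of (P.Obj (.full :: w) .half (.one hw))) (S := T')
      (fun x t => (g t).op w hw x) (fun K a b ha hb => hg w hw K a b ha hb)
    refine ⟨fun x => (α_ _ _ _).hom ≫ pt i x _ ≫ F,
      continuous_homTop_precomp _ (continuous_homTop.2 ⟨F, fun _ => rfl⟩), fun t x => ?_⟩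
    refine Eq.trans ?_ (hF x t)
    rw [ptO_whisker, Category.assoc]
    beta_reduce
    rw [pt_eq_ptO]
  choose F hFc hF using hF
  -- Points of `T'` remain jointly epimorphic after tensoring with `W`, so the laws of the combined
  -- family may be checked for one `t` at a time.
  have ext : ∀ {W Z : C} {a b : (i.obj T' ⊗ D) ⊗ W ⟶ Z},
      (∀ t, ptO i T' t D ▷ W ≫ a = ptO i T' t D ▷ W ≫ b) → a = b := by
    intro W Z a b h
    refine (cancel_epi (α_ _ _ _).inv).1 (hom_ext_pt fun t => ?_)
    rw [ptO_whisker]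
    simpa using h t
  have ext' : ∀ {W W' Z : C} {a : (i.obj T' ⊗ D) ⊗ W ⟶ Z} {s : W ⟶ W'}
      {b : (i.obj T' ⊗ D) ⊗ W' ⟶ Z},
      (∀ t, ptO i T' t D ▷ W ≫ a = D ◁ s ≫ ptO i T' t D ▷ W' ≫ b) →
        a = (i.obj T' ⊗ D) ◁ s ≫ b := by
    intro W W' Z a s b h
    refine ext fun t => (h t).trans ?_
    rw [whisker_exchange_assoc]
  let G : ModuleFamily (i.obj T' ⊗ D) α := ⟨F, hFc,
    fun u v h x => ext' fun t => (hF _ _ _ _).trans (((g t).swap u v h x).trans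
      (whisker_eq _ (hF _ _ _ _).symm)),
    fun u v t h ht x y => ext' fun s => (hF _ _ _ _).trans (((g s).comp u v t h ht x y).trans
      (whisker_eq _ (hF _ _ _ _).symm)),
    fun u v t h ht y x => ext fun s => by
      refine (hF _ (half_append h ht) _ _).trans (((g s).left u v t h ht y x).trans ?_)
      rw [← hF t ht s x]
      exact (eq_whisker (spliceParam_natural _ _ v _ u).symm _).trans (Category.assoc _ _ _)⟩
  obtain ⟨f, hf⟩ := G.exists_lift
  refine ⟨fun t => pt i t D ≫ f, continuous_homTop.2 ⟨f, fun _ => rfl⟩, fun t w hw x => ?_⟩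
  refine (eq_whisker (comp_whiskerRight _ _ _) _).trans ((Category.assoc _ _ _).trans ?_)
  rw [hf, pt_eq_ptO]
  exact hF w hw t x

variable (α)

/-- Evaluation of the image under `φ` of an operation of degree one. -/
noncomputable def BimodMap.frontEval {w : List Col} (φ : BimodMap P.toOperadData w) {t : List Col}
    (ht : ∀ c ∈ t, c = .half) (x : P.Obj (.full :: t) .half (.one ht)) :
    wordTensor (pair (Hoch α) A) (w ++ t) ⟶ A :=
  (hochAlg α).eval (φ.app 0 (fullAt_of_sig (.one ht) rfl) (Graft.front w .full t)
    (EObj.gen (.one ht) x))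

variable {w : List Col} (φ : BimodMap P.toOperadData w)

/-- A relabelling is composition with the identity operation from the left, so this is `φ.left` for
the identity. -/
theorem BimodMap.frontEval_swap (u v : List Col) (h : ∀ c ∈ u ++ .half :: .half :: v, c = .half)
    (x : P.Obj (.full :: (u ++ .half :: .half :: v)) .half (.one h)) :
    φ.frontEval α h (P.comp sigColl₁_unit (.one h) (.one h) 0 rfl
      (Graft.swap .half (.full :: u) .half .half v) (P.one .half sigColl₁_unit) x) =
        appMap (pair (Hoch α) A) w (swapHom (pair (Hoch α) A) .half .half v u) ≫
          φ.frontEval α h x := by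
  let σ : Graft [.half] 0 (.full :: (u ++ .half :: .half :: v))
    (.full :: (u ++ .half :: .half :: v)) := Graft.swap .half (.full :: u) .half .half v
  have hσ : (Graft.swap .half u .half .half v).cons .full = σ := Graft.cons_swap _ _ _ _ _ _
  obtain ⟨e, he⟩ := Graft.exists_seq₄ σ (j := 0) (q := 0) (by rw [← hσ, Graft.cons_zero])
    (Graft.front w .full _) (Graft.front w .full _)
  have he' := he
  rw [← hσ] at he'
  have h1 := Graft.perm_front (X := pair (Hoch α) A) he'
  rw [Graft.perm_swap] at h1
  rw [← h1]
  refine Eq.trans ?_ ((hochAlg α).eval_act e _)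
  unfold frontEval
  rw [EObj.gen_comp]
  refine congrArg _ (φ.left rfl _ _ _ _ _ e _ _ (fun j => ?_) he)
  have : j = 0 := Subsingleton.elim (α := Fin 1) _ _
  subst this; rfl

/-- This is `φ.right`: the operation `y` is inserted at a half input of `x`, away from the full
input where `φ` acts. -/
theorem BimodMap.frontEval_comp (u v t : List Col) (h : ∀ c ∈ u ++ .half :: v, c = .half)
    (ht : ∀ c ∈ t, c = .half) (x : P.Obj (.full :: (u ++ .half :: v)) .half (.one h))
    (y : P.Obj t .half (.zero ht)) :
    φ.frontEval α (half_append h ht) (P.comp (.one h) (.zero ht) (.one (half_append h ht))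
      (mid (.full :: u) .half v) (get_mid (.full :: u) .half v)
      (Graft.planar (.full :: u) .half v t) x y) =
    appMap (pair (Hoch α) A) w (splice (pair (Hoch α) A) (c := .half) v
      (halves (Hoch α) A t ht ≫ α.op (k := .half) (h := .mk ht) y) u) ≫ φ.frontEval α h x := by
  let m : Fin (Col.full :: (u ++ .half :: v)).length := mid (.full :: u) .half v
  let p : Graft (.full :: (u ++ .half :: v)) m t (.full :: (u ++ (t ++ v))) :=
    Graft.planar (.full :: u) .half v t
  have hm : m ≠ 0 := fun h' => by
    have : u.length + 1 = 0 := congrArg Fin.val h'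
    omega
  obtain ⟨e, he⟩ := Graft.exists_par₄ p hm (q := 0) (Fin.ext (by
      refine (Graft.planar_o_val (.full :: u) .half v t
        (0 : Fin (Col.full :: (u ++ .half :: v)).length) hm.symm).trans ?_
      simp))
    (Graft.front w .full (u ++ (t ++ v))) (Graft.front w .full (u ++ .half :: v)) rfl
  have hq := (Graft.front w .full (u ++ .half :: v)).get_o _ hm
  have h1 := Graft.ins_front_par (X := pair (Hoch α) A) (hq.trans (get_mid (.full :: u) .half v))
    he.symm (halves (Hoch α) A t ht ≫ α.op (k := .half) (h := .mk ht) y)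
  have h0 := ((hochAlg α).eval_gen _ y).trans (hochAlg_restricts α t ht y)
  refine Eq.trans ?_ (eq_whisker h1 _)
  refine Eq.trans ?_ (congrArg (fun z => e.ins (X := pair (Hoch α) A) _ z ≫ _) h0)
  refine Eq.trans ?_ ((hochAlg α).eval_comp (hq.trans (get_mid (.full :: u) .half v)) e _ _)
  unfold frontEval
  rw [EObj.gen_comp]
  exact congrArg _ (φ.right _ _ _ _ _ e _ _ _ _ (allHalf_of_forall ht) he.symm)

/-- This is `φ.left` for an arbitrary operation `y` of degree zero. -/
theorem BimodMap.frontEval_left (u v t : List Col) (h : ∀ c ∈ u ++ .half :: v, c = .half)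
    (ht : ∀ c ∈ t, c = .half) (y : P.Obj (u ++ .half :: v) .half (.zero h))
    (x : P.Obj (.full :: t) .half (.one ht))
    {s : wordTensor (pair (Hoch α) A) w ⊗ wordTensor (pair (Hoch α) A) t ⟶
      wordTensor (pair (Hoch α) A) (w ++ t)} (hs : splitHom (pair (Hoch α) A) t w ≫ s = 𝟙 _) :
    φ.frontEval α (half_append h ht) (P.comp (.zero h) (.one ht) (.one (half_append h ht))
      (mid u .half v) (get_mid u .half v) (Graft.planarFull u .half v t) y x) =
    splitHom (pair (Hoch α) A) (u ++ (t ++ v)) w ≫ spliceParam (pair (Hoch α) A)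
      (wordTensor (pair (Hoch α) A) w) (c := .half) v (s ≫ φ.frontEval α ht x) u ≫
        halves (Hoch α) A _ h ≫ α.op (k := .half) (h := .mk h) y := by
  obtain ⟨e, he⟩ := Graft.exists_seq₄ (Graft.planarFull u .half v t)
    (Graft.planarFull_n_zero (u := u) (c := .half) (t := t) (v := v))
    (Graft.front w .full (u ++ (t ++ v))) (Graft.front w .full t)
  have h1 := Graft.ins_front_seq (X := pair (Hoch α) A) he (φ.frontEval α ht x) hs
  have h0 := ((hochAlg α).eval_gen _ y).trans (hochAlg_restricts α _ h y)
  refine Eq.trans ?_ ((eq_whisker h1 _).trans (Category.assoc _ _ _))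
  refine Eq.trans ?_ (whisker_eq _ h0)
  refine Eq.trans ?_ ((hochAlg α).eval_comp (get_mid u .half v) e _ _)
  unfold frontEval
  rw [EObj.gen_comp]
  exact congrArg _ (φ.left _ _ _ _ _ _ e _ _ (allHalf_of_forall h) he)

end Lift

/-! ### Splitting off the half letters behind a word. -/

section FrontHalves
variable {C : Type u} [Category.{v} C] [MonoidalCategory C] [SymmetricCategory C] {B A : C}

theorem isIso_splitHom (X : Col → C) (v t : List Col) : IsIso (splitHom X v t) := by
  obtain ⟨g, h1, h2⟩ := exists_split_inv X v t
  exact ⟨g, h1, h2⟩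

variable (B A) in
/-- The identification of the tensor factors of colour `half` after those of the word `w`. -/
def frontHalves (w t : List Col) (ht : ∀ c ∈ t, c = Col.half) :
    wordTensor (pair B A) (w ++ t) ⟶ wordTensor (pair B A) w ⊗ wordTensor (fun _ => A) t :=
  splitHom (pair B A) t w ≫ _ ◁ halves B A t ht

instance isIso_frontHalves (w t : List Col) (ht : ∀ c ∈ t, c = Col.half) :
    IsIso (frontHalves B A w t ht) := by
  have := isIso_halves B A t ht
  have := isIso_splitHom (pair B A) t w
  unfold frontHalves
  infer_instance

theorem frontHalves_natural (w : List Col) {t t' : List Col} (ht : ∀ c ∈ t, c = Col.half)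
    (ht' : ∀ c ∈ t', c = Col.half) {f : wordTensor (pair B A) t ⟶ wordTensor (pair B A) t'}
    {g : wordTensor (fun _ => A) t ⟶ wordTensor (fun _ => A) t'}
    (h : halves B A t ht ≫ g = f ≫ halves B A t' ht') :
    appMap (pair B A) w f ≫ frontHalves B A w t' ht' = frontHalves B A w t ht ≫ _ ◁ g := by
  have : ∀ {W W' D T T' S S' : C} {a : W ⟶ W'} {s : W ⟶ D ⊗ T} {s' : W' ⟶ D ⊗ T'} {f : T ⟶ T'}
      {k : T ⟶ S} {k' : T' ⟶ S'} {g : S ⟶ S'}, a ≫ s' = s ≫ D ◁ f → k ≫ g = f ≫ k' →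
      a ≫ s' ≫ D ◁ k' = (s ≫ D ◁ k) ≫ D ◁ g := by
    intro W W' D T T' S S' a s s' f k k' g h1 h2
    rw [reassoc_of% h1, Category.assoc, ← MonoidalCategory.whiskerLeft_comp, ← h2,
      MonoidalCategory.whiskerLeft_comp]
  exact this (appMap_split _ w f) h

end FrontHalves

/-! ### The map on Hochschild objects induced by a bimodule map. -/

section Substitution
variable {C : Type u} [Category.{v} C] [MonoidalCategory C] [SymmetricCategory C]
  [MonoidalClosed C] [HasLimitsOfSize.{0, 0} C] [HasColimitsOfSize.{0, 0} C]
  {i : CGTop ⥤ C} [i.Braided] [i.IsLeftAdjoint] {P : Operad sigColl₁}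
  {A : C} (α : Alg i P.toOperadData.degZero (fun _ => A)) {w : List Col}

theorem BimodMap.continuous_frontEval {t : List Col} (ht : ∀ c ∈ t, c = .half) (K : CompHaus.{0})
    {a : K → P.Obj (.full :: t) .half (.one ht)} {b : K → BimodMap P.toOperadData w}
    (ha : Continuous a) (hb : Continuous b) :
    Continuous[_, homTop i _ _] (fun z => (b z).frontEval α ht (a z)) := by
  have h1 := BimodMap.continuous_app_two (P := P.toOperadData) 0 (fullAt_of_sig (.one ht) rfl)
    (Graft.front w .full t) K hb (((isETop_finest P.toOperadData).gen _ (.one ht)).comp ha)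
  let _ := homTop i (wordTensor (pair (Hoch α) A) (w ++ t)) A
  exact Continuous.comp ((hochAlg α).continuous_eval (w ++ t)) h1

/-- The maps compatible with the bimodule structure defined by evaluation of a bimodule map. -/
noncomputable def BimodMap.family (φ : BimodMap P.toOperadData w) :
    ModuleFamily (wordTensor (pair (Hoch α) A) w) α where
  op t ht x := inv (frontHalves (Hoch α) A w t ht) ≫ φ.frontEval α ht x
  continuous_op t ht := by
    refine continuous_homTop_precomp _ ?_
    let _ := homTop i (wordTensor (pair (Hoch α) A) (w ++ t)) A
    refine (IsGeneratedBy.continuous_iff (X := CH) _).2 fun K g => ?_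
    exact BimodMap.continuous_frontEval α ht K g.continuous continuous_const
  swap u v h x := by
    rw [IsIso.inv_comp_eq, φ.frontEval_swap, ← reassoc_of% (frontHalves_natural w h h
      (mapWord_swapHom (toHalf (Hoch α) A) .half .half v u h h)), IsIso.hom_inv_id_assoc]
  comp u v t h ht x y := by
    have h1 := frontHalves_natural w (half_append h ht) h
      (splice_mapWord (toHalf (Hoch α) A) v rfl ht
        (halves_op ht (α.op (k := .half) (h := .mk ht) y)) u (half_append h ht) h)
    rw [IsIso.inv_comp_eq]
    refine (φ.frontEval_comp α u v t h ht x y).trans ?_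
    refine Eq.trans ?_ ((eq_whisker h1 _).trans (Category.assoc _ _ _))
    refine Eq.trans ?_ (Category.assoc _ _ _).symm
    refine whisker_eq _ ?_
    exact (IsIso.hom_inv_id_assoc _ _).symm
  left u v t h ht y x := by
    rw [IsIso.inv_comp_eq]
    obtain ⟨s, hs, hs'⟩ := exists_split_inv (pair (Hoch α) A) t w
    refine (φ.frontEval_left α u v t h ht y x hs).trans ?_
    have h1 := spliceParam_mapWord (toHalf (Hoch α) A) (wordTensor (pair (Hoch α) A) w) v
      (c := .half) rfl ht (fun c hc => h c (by simp [hc]))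
      (g := s ≫ φ.frontEval α ht x)
      (g' := inv (frontHalves (Hoch α) A w t ht) ≫ φ.frontEval α ht x) (by
        refine Eq.trans ?_ (Category.comp_id _).symm
        have : _ ◁ mapWord (toHalf (Hoch α) A) t ht = s ≫ frontHalves (Hoch α) A w t ht := by
          unfold frontHalves
          rw [reassoc_of% hs']
          rfl
        rw [this, Category.assoc, IsIso.hom_inv_id_assoc]
        rfl) u (half_append h ht) h
    have key : ∀ {Z Z' Y W V : C} {a : Z ⟶ Z'} {b : Z' ⟶ Y} {c : Y ⟶ W} {d : W ⟶ V} {e : Z' ⟶ V}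
        {e' : V ⟶ A} {d' : W ⟶ A} {q : Z' ⟶ W}, b ≫ c = q → q ≫ d' = e ≫ e' →
        a ≫ b ≫ c ≫ d' = a ≫ e ≫ e' := by
      rintro Z Z' Y W V a b c d e e' d' q rfl h; rw [← h, Category.assoc]
    refine Eq.trans (whisker_eq _ ((Category.assoc _ _ _).symm.trans (eq_whisker h1.symm _))) ?_
    unfold frontHalves
    have : ∀ {Z Z' Y W : C} (a : Z ⟶ Z') (b : Z' ⟶ Y) (c : Y ⟶ W) (d : W ⟶ A),
      a ≫ (b ≫ c) ≫ d = (a ≫ b) ≫ c ≫ d := by intros; simp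
    exact this _ _ _ _

/-- The classifying maps are chosen for all `φ` at once, so that they depend continuously on `φ`;
this later yields continuity of the action of `O`. -/
theorem exists_substitution (w : List Col) :
    ∃ f : BimodMap P.toOperadData w → (wordTensor (pair (Hoch α) A) w ⟶ Hoch α),
      Continuous[_, homTop i _ _] f ∧
      ∀ φ t ht x, f φ ▷ _ ≫ Hoch.eval α ht x = (φ.family α).op t ht x :=
  ModuleFamily.exists_continuous_lift (fun φ => BimodMap.family α φ) fun _ ht K _ _ ha hb =>
    continuous_homTop_precomp (T := K) _ (BimodMap.continuous_frontEval α ht K ha hb)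

/-- The map on Hochschild objects defined by a bimodule map. -/
noncomputable def BimodMap.hoch (φ : BimodMap P.toOperadData w) :
    wordTensor (pair (Hoch α) A) w ⟶ Hoch α := (exists_substitution α w).choose φ

theorem BimodMap.continuous_hoch :
    Continuous[_, homTop i _ _] (BimodMap.hoch α : BimodMap P.toOperadData w → _) :=
  (exists_substitution α w).choose_spec.1

/-- This is the defining property of `φ.hoch`: evaluating its value on `x` is the same as evaluating
`φ x`. -/
theorem BimodMap.hoch_eval (φ : BimodMap P.toOperadData w) {t : List Col}
    (ht : ∀ c ∈ t, c = .half) (x : P.Obj (.full :: t) .half (.one ht)) :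
    splitHom (pair (Hoch α) A) t w ≫ φ.hoch α ▷ _ ≫ (hochAlg α).op (.one ht) x =
      φ.frontEval α ht x := by
  have h1 := (exists_substitution α w).choose_spec.2 φ t ht x
  have h2 : frontHalves (Hoch α) A w t ht ≫ φ.hoch α ▷ _ ≫ Hoch.eval α ht x = φ.frontEval α ht x :=
    (whisker_eq _ h1).trans (IsIso.hom_inv_id_assoc _ _)
  rw [← h2, hochAlg_op_one]
  have : ∀ {Z D H T S : C} {s : Z ⟶ D ⊗ T} {k : T ⟶ S} {f : D ⟶ H} {e : H ⊗ S ⟶ A},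
      s ≫ f ▷ T ≫ H ◁ k ≫ e = (s ≫ D ◁ k) ≫ f ▷ S ≫ e := by
    intro Z D H T S s k f e
    rw [Category.assoc, whisker_exchange_assoc]
  exact this

variable {α}

/-- Evaluation turns the action of a bimodule map into composition. -/
theorem BimodMap.eval_app (φ : BimodMap P.toOperadData w) {u u' : List Col}
    (hu : sigColl₁ u .half) {j : Fin u.length} (hj : u.get j = .full) (e : Graft u j w u')
    (x : P.Obj u .half hu) :
    (hochAlg α).eval (φ.app j (fullAt_of_sig hu hj) e (EObj.gen hu x)) =
      e.ins (X := pair (Hoch α) A) (c := .full) hj (φ.hoch α) ≫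
        (hochAlg α).eval (EObj.gen hu x) := by
  rcases hu.half_or_one with h | ⟨t, ht, hp⟩
  · exact absurd (hj.symm.trans (h _ (List.get_mem _ _))) (by simp)
  · obtain ⟨σ⟩ := Graft.exists_of_perm .half hp.symm
    -- The operation is a relabelling of one with its full input in front, to which
    -- `BimodMap.hoch_eval` applies; `φ.left` carries the relabelling through `φ`.
    obtain ⟨y, rfl⟩ : ∃ y, x = P.permute (.one ht) hu σ y := by
      refine ⟨P.permute hu (.one ht) σ.symm x, ?_⟩
      rw [P.permute_permute]
      have e : σ.symm.trans σ = Graft.idL _ _ :=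
        Graft.relabel_ext fun b => by rw [Graft.trans_n, Graft.n_symm_n]; rfl
      rw [e, P.permute_idL]
    have hs : σ.n 0 = j := by
      refine (fullAt_of_sig hu hj _).1 ?_
      rw [σ.get_n]; rfl
    obtain ⟨e₄, he⟩ := Graft.exists_seq₄ σ hs e (Graft.front w .full t)
    have h1 : EObj.gen hu (P.permute (.one ht) hu σ y) =
        EObj.comp 0 rfl σ (EObj.one P.toOperadData) (EObj.gen (.one ht) y) :=
      EObj.gen_comp _ _ _ _ _ _ _ _
    rw [h1, φ.left rfl (fullAt_of_sig (.one ht) rfl) _ _ _ _ e₄ _ _ (fun j => by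
      have : j = 0 := Subsingleton.elim (α := Fin 1) _ _
      subst this; rfl) he, (hochAlg α).eval_comp, (hochAlg α).eval_comp]
    have h2 : (hochAlg α).eval (φ.app 0 (fullAt_of_sig (.one ht) rfl) (Graft.front w .full t)
        (EObj.gen (.one ht) y)) = (Graft.front w .full t).ins (X := pair (Hoch α) A) (c := .full)
          rfl (φ.hoch α) ≫ (hochAlg α).eval (EObj.gen (.one ht) y) := by
      refine (φ.hoch_eval α ht y).symm.trans ?_
      refine Eq.trans ?_ (whisker_eq _ ((hochAlg α).eval_gen _ y).symm)
      refine Eq.trans ?_ (eq_whisker (Graft.ins_front (X := pair (Hoch α) A) (c := .full) _).symm _)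
      exact (Category.assoc _ _ _).symm
    rw [h2]
    refine (eq_whisker (Graft.ins_seq he rfl rfl hj _ _).symm _).trans (Category.assoc _ _ _)

/-- Induction on formal composites. The action descends to the factor that contains the full input,
and insertion does the same: `Graft.ins_par` if this is the outer factor, `Graft.ins_seq` if it is
the inner one. Generators are `BimodMap.eval_app`. -/
theorem BimodMap.eval_act (φ : BimodMap P.toOperadData w) {u u' : List Col} {j : Fin u.length}
    (hj : u.get j = .full) (e : Graft u j w u') (x : EObj P.toOperadData u) :
    (hochAlg α).eval (φ.act j hj e x) =
      e.ins (X := pair (Hoch α) A) (c := .full) hj (φ.hoch α) ≫ (hochAlg α).eval x := by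
  induction x using Quot.ind with
  | mk x =>
    induction x generalizing u' with
    | gen hu x => exact φ.eval_app hu hj e x
    | @graft v t u k hk e₁ x y ihx ihy =>
      rcases e₁.cases j with ⟨a, ha, rfl⟩ | ⟨b, rfl⟩
      · have ha' : v.get a = .full := by rw [← e₁.get_o a ha]; exact hj
        have hp : (Graft.stdW v a w).get ((Graft.std v a w).o k ha.symm) = .half := by
          rw [Graft.get_o]; exact hk
        obtain ⟨e₄, h4⟩ := Graft.exists_par₄ e₁ ha.symm rfl e (Graft.std v a w) rfl
        refine (congrArg _ (φ.act_o hk (EObj.mk x) (EObj.mk y) ha' hj hp h4)).trans ?_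
        refine ((hochAlg α).eval_comp hp e₄ _ _).trans ?_
        refine Eq.trans ?_ (whisker_eq _ ((hochAlg α).eval_comp hk e₁ (EObj.mk x) (EObj.mk y)).symm)
        refine (whisker_eq _ (ihx ha' (Graft.std v a w))).trans ?_
        refine (Category.assoc _ _ _).symm.trans (Eq.trans (eq_whisker ?_ _) (Category.assoc _ _ _))
        exact (Graft.ins_par h4 hk ha' hj hp _ _).symm
      · have hb : t.get b = .full := by rw [← e₁.get_n b]; exact hj
        obtain ⟨e₄, h4⟩ := Graft.exists_seq₄ e₁ rfl e (Graft.std t b w)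
        refine (congrArg _ (φ.act_n hk (EObj.mk x) (EObj.mk y) hb hj h4)).trans ?_
        refine ((hochAlg α).eval_comp hk e₄ _ _).trans ?_
        refine Eq.trans ?_ (whisker_eq _ ((hochAlg α).eval_comp hk e₁ (EObj.mk x) (EObj.mk y)).symm)
        refine (congrArg (fun z => e₄.ins (X := pair (Hoch α) A) hk z ≫ _)
          (ihy hb (Graft.std t b w))).trans ?_
        refine Eq.trans (eq_whisker ?_ _) (Category.assoc _ _ _)
        exact (Graft.ins_seq h4 hk hb hj _ _).symm

end Substitution

theorem full_append {u v t : List Col} {c : Col} (h : ∀ c' ∈ u ++ c :: v, c' = .full)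
    (ht : ∀ c ∈ t, c = .full) : ∀ c ∈ u ++ (t ++ v), c = Col.full := by
  intro c' hc'
  simp only [List.mem_append] at hc'
  rcases hc' with h1 | h1 | h1
  · exact h c' (by simp [h1])
  · exact ht c' h1
  · exact h c' (by simp [h1])

/-! ### Algebras over an operad with the single colour `full`. -/

section Fulls
variable {C : Type u} [Category.{v} C] [MonoidalCategory C] [SymmetricCategory C] (B A : C)

/-- The identification of the tensor factors of colour `full`. -/
def fulls (w : List Col) (hw : ∀ c ∈ w, c = Col.full) :
    wordTensor (pair B A) w ⟶ wordTensor (fun _ => B) w := mapWord (toFull B A) w hw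

instance isIso_fulls (w : List Col) (hw : ∀ c ∈ w, c = Col.full) : IsIso (fulls B A w hw) := by
  let g : ∀ c ∈ w, (fun _ : Col => B) c ⟶ pair B A c := fun c hc =>
    eqToHom (congrArg (pair B A) (hw c hc).symm)
  have h1 : ∀ c hc, toFull B A c (hw c hc) ≫ g c hc = 𝟙 _ := by
    intro c hc
    have : ∀ (c : Col) (h : c = .full), toFull B A c h ≫ eqToHom (congrArg (pair B A) h.symm) = 𝟙 _ := by
      rintro c rfl; exact Category.comp_id _
    exact this c (hw c hc)
  have h2 : ∀ c hc, g c hc ≫ toFull B A c (hw c hc) = 𝟙 _ := by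
    intro c hc
    have : ∀ (c : Col) (h : c = .full), eqToHom (congrArg (pair B A) h.symm) ≫ toFull B A c h = 𝟙 _ := by
      rintro c rfl; exact Category.comp_id _
    exact this c (hw c hc)
  refine ⟨wordTensorMap w g, ?_, ?_⟩
  · rw [fulls, mapWord, ← wordTensorMap_comp]
    simp only [h1]
    exact wordTensorMap_id _ _
  · rw [fulls, mapWord, ← wordTensorMap_comp]
    simp only [h2]
    exact wordTensorMap_id (fun _ => B) _

variable {B A}

theorem fulls_ins {w t w' : List Col} {j : Fin w.length} (hw : ∀ c ∈ w, c = .full)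
    (ht : ∀ c ∈ t, c = .full) (hw' : ∀ c ∈ w', c = .full) (hj : w.get j = .full)
    (e : Graft w j t w') (y : wordTensor (fun _ => B) t ⟶ B) :
    fulls B A w' hw' ≫ e.ins (X := fun _ => B) (c := .full) hj y =
      e.ins (X := pair B A) (c := .full) hj (fulls B A t ht ≫ y) ≫ fulls B A w hw :=
  e.ins_natural (toFull B A) hj hw hw' ht rfl (Category.comp_id _).symm

theorem wordTensorMap_pairMap_fulls {D : C} (f : D ⟶ B) (w : List Col) (hw : ∀ c ∈ w, c = .full) :
    wordTensorMap w (fun c _ => pairMap A f c) ≫ fulls B A w hw =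
      fulls D A w hw ≫ wordTensorMap w (fun _ _ => f) := by
  rw [fulls, mapWord, fulls, mapWord, ← wordTensorMap_comp, ← wordTensorMap_comp]
  have : ∀ c (h : c = Col.full), pairMap A f c ≫ toFull B A c h = toFull D A c h ≫ f := by
    rintro c rfl; exact (Category.comp_id _).trans (Category.id_comp _).symm
  have h2 : (fun c hc => pairMap A f c ≫ toFull B A c (hw c hc)) =
      fun c hc => toFull D A c (hw c hc) ≫ f := by
    funext c hc; exact this c _
  rw [h2]

variable [MonoidalClosed C] {i : CGTop ⥤ C} [i.Braided] [i.IsLeftAdjoint] {O : Operad sigFull}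

/-- Algebras over an operad with the single colour `full`, described by operations on the word
tensors of a pair. -/
theorem exists_fullAlg (op : ∀ {w : List Col} (hw : ∀ c ∈ w, c = .full),
      O.Obj w .full (.mk hw) → (wordTensor (pair B A) w ⟶ B))
    (continuous_op : ∀ {w : List Col} (hw : ∀ c ∈ w, c = .full), @Continuous _ _ (O.top w .full (.mk hw)) (homTop i _ _) (op hw))
    (op_one : ∀ h : ∀ c ∈ [Col.full], c = .full, op h (O.one .full (.mk h)) = (ρ_ B).hom)
    (op_comp : ∀ {w t w' : List Col} (hw : ∀ c ∈ w, c = .full) (ht : ∀ c ∈ t, c = .full)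
      (hw' : ∀ c ∈ w', c = .full) {j : Fin w.length} (hj : w.get j = .full) (e : Graft w j t w')
      (x : O.Obj w .full (.mk hw)) (y : O.Obj t .full (.mk ht)),
      op hw' (O.comp (.mk hw) (.mk ht) (.mk hw') j hj e x y) =
        e.ins (X := pair B A) (c := .full) hj (op ht y) ≫ op hw x) :
    ∃ β : Alg i O.toOperadData (fun _ => B), ∀ {w : List Col} (hw : ∀ c ∈ w, c = .full)
      (x : O.Obj w .full (.mk hw)), op hw x = fulls B A w hw ≫ β.op x := by
  have key : ∀ {w : List Col} (hw : ∀ c ∈ w, c = .full) (f : wordTensor (pair B A) w ⟶ B),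
      fulls B A w hw ≫ inv (fulls B A w hw) ≫ f = f := fun _ _ => IsIso.hom_inv_id_assoc _ _
  obtain ⟨β, hβ⟩ := Alg.exists_of_op (i := i) (P := O.toOperadData) (X := fun _ => B)
    (fun w k h => match k, h with
      | .full, h => fun x => inv (fulls B A w h.2) ≫ op h.2 x
      | .half, h => absurd h.1 (by simp))
    (by
      rintro w k ⟨rfl, h⟩
      let _ := O.top w .full (.mk h)
      have _ := O.gen w .full (.mk h)
      exact continuous_homTop_precomp _ (continuous_op h))
    (by
      rintro k ⟨rfl, h⟩
      refine (IsIso.inv_comp_eq _).2 ((op_one h).trans ?_)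
      have : ∀ {T : C}, (ρ_ T).hom = (𝟙 T ⊗ₘ 𝟙 (𝟙_ C)) ≫ (ρ_ T).hom := by simp
      exact this)
    (by
      rintro u v t k c ⟨rfl, h⟩ ⟨rfl, ht⟩ hw' x y
      refine (IsIso.inv_comp_eq _).2 ((op_comp h ht hw'.2 (get_mid u .full v)
        (Graft.planar u .full v t) x y).trans ?_)
      have h1 := fulls_ins (A := A) h ht (full_append h ht) (get_mid u .full v)
        (Graft.planar u .full v t) (inv (fulls B A t ht) ≫ op ht y)
      have h2 := congrArg (fun z => (Graft.planar u .full v t).ins (X := pair B A) (c := .full)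
        (get_mid u .full v) z ≫ op h x) (key ht (op ht y)).symm
      have h3 := congrArg (fun z => fulls B A _ (full_append h ht) ≫ z) (Graft.ins_planar
        (X := fun _ => B) (c := .full) (t := t) u v (inv (fulls B A t ht) ≫ op ht y))
      refine h2.trans ((whisker_eq _ (key h _).symm).trans ?_)
      exact (Category.assoc _ _ _).symm.trans ((eq_whisker (h1.symm.trans h3) _).trans
        (Category.assoc _ _ _)))
    (by
      rintro u v a b k hk ⟨rfl, h⟩ hw' x
      obtain rfl := h a (by simp)
      obtain rfl := h b (by simp)
      refine (IsIso.inv_comp_eq _).2 ((op_comp hk.2 h hw'.2 rfl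
        (Graft.swap .full u .full .full v) (O.one .full hk) x).trans ?_)
      rw [op_one]
      refine (Graft.ins_perm' (X := pair B A) (k := .full) _ _).trans ?_
      rw [Graft.perm_swap]
      have h1 := mapWord_swapHom (toFull B A) .full .full v u h h
      refine (whisker_eq _ (key h _).symm).trans ?_
      exact (Category.assoc _ _ _).symm.trans ((eq_whisker h1.symm _).trans
        (Category.assoc _ _ _)))
  refine ⟨β, fun {w} hw x => ?_⟩
  rw [hβ]
  exact (key hw _).symm

theorem Alg.fulls_op_comp (β : Alg i O.toOperadData (fun _ => B)) {w t w' : List Col}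
    (hw : ∀ c ∈ w, c = .full) (ht : ∀ c ∈ t, c = .full) (hw' : ∀ c ∈ w', c = .full)
    {j : Fin w.length} (hj : w.get j = .full) (e : Graft w j t w')
    (x : O.Obj w .full (.mk hw)) (y : O.Obj t .full (.mk ht)) :
    fulls B A w' hw' ≫ β.op (O.comp (.mk hw) (.mk ht) (.mk hw') j hj e x y) =
      e.ins (X := pair B A) (c := .full) hj (fulls B A t ht ≫ β.op y) ≫
        fulls B A w hw ≫ β.op x := by
  refine (whisker_eq _ (β.op_comp O.relabels_full (.mk hw) (.mk ht) (.mk hw') j hj e x y)).trans ?_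
  exact (Category.assoc _ _ _).symm.trans
    ((eq_whisker (fulls_ins hw ht hw' hj e _) _).trans (Category.assoc _ _ _))

theorem Alg.fulls_op_one (β : Alg i O.toOperadData (fun _ => B)) (h : ∀ c ∈ [Col.full], c = .full) :
    fulls B A [.full] h ≫ β.op (O.one .full (.mk h)) = (ρ_ B).hom := by
  refine (whisker_eq _ (β.op_one (.mk h))).trans ?_
  have : ∀ {T : C}, (𝟙 T ⊗ₘ 𝟙 (𝟙_ C)) ≫ (ρ_ T).hom = (ρ_ T).hom := by simp
  exact this

end Fulls

/-! ### The action of `O` on the Hochschild object. -/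

section HochOperad
variable {C : Type u} [Category.{v} C] [MonoidalCategory C] [SymmetricCategory C]
  [MonoidalClosed C] [HasLimitsOfSize.{0, 0} C] [HasColimitsOfSize.{0, 0} C]
  {i : CGTop ⥤ C} [i.Braided] [i.IsLeftAdjoint] {P : Operad sigColl₁}
  {A B : C} {α : Alg i P.toOperadData.degZero (fun _ => A)} {w : List Col}

theorem hoch_word_ext {f g : wordTensor (pair B A) w ⟶ Hoch α}
    (h : ∀ {t : List Col} (ht : ∀ c ∈ t, c = .half) (x : P.Obj (.full :: t) .half (.one ht)),
      splitHom (pair B A) t w ≫ f ▷ _ ≫ Hoch α ◁ halves B A t ht ≫ Hoch.eval α ht x =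
        splitHom (pair B A) t w ≫ g ▷ _ ≫ Hoch α ◁ halves B A t ht ≫ Hoch.eval α ht x) :
    f = g := by
  refine Hoch.hom_ext α fun t ht x => ?_
  have := isIso_halves B A t ht
  have := isIso_splitHom (pair B A) t w
  have h1 := (cancel_epi _).1 (h ht x)
  rw [← whisker_exchange_assoc, ← whisker_exchange_assoc] at h1
  exact (cancel_epi _).1 h1

/-- The map on Hochschild objects is determined by its effect on the operations of degree one. -/
theorem BimodMap.hoch_unique (φ : BimodMap P.toOperadData w)
    {f : wordTensor (pair (Hoch α) A) w ⟶ Hoch α}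
    (h : ∀ {t : List Col} (ht : ∀ c ∈ t, c = .half) (x : P.Obj (.full :: t) .half (.one ht)),
      φ.frontEval α ht x = (Graft.front w .full t).ins (X := pair (Hoch α) A) (c := .full) rfl f ≫
        (hochAlg α).op (.one ht) x) : f = φ.hoch α := by
  refine hoch_word_ext fun {t} ht x => ?_
  have h1 := (φ.hoch_eval α ht x).trans (h ht x)
  rw [hochAlg_op_one] at h1
  refine Eq.trans ?_ h1.symm
  refine Eq.trans ?_ (eq_whisker (Graft.ins_front (X := pair (Hoch α) A) (c := .full) f).symm _)
  exact (Category.assoc _ _ _).symm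

/-- The identity bimodule map merely renames the full input. By `Graft.ins_chg` and
`Graft.ins_unit`, the resulting permutation is insertion of the unitor, and uniqueness of
classifying maps concludes. -/
theorem BimodMap.hoch_one : (BimodMap.one P.toOperadData).hoch α =
    (show wordTensor (pair (Hoch α) A) [.full] ⟶ Hoch α from (ρ_ (Hoch α)).hom) := by
  refine ((BimodMap.one P.toOperadData).hoch_unique fun {t} ht x => ?_).symm
  have h := (hochAlg α).eval_act (Graft.chg .half (Graft.idR (.full :: t) 0 .full rfl)
    (Graft.front [.full] .full t)) (EObj.gen (.one ht) x)
  refine h.trans ?_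
  rw [HalfAlg.eval_gen]
  refine eq_whisker ?_ _
  have h1 := Graft.ins_chg (X := pair (Hoch α) A) (c := .full) (k := .half)
    (Graft.idR (.full :: t) 0 .full rfl) (Graft.front [.full] .full t) rfl
    (show wordTensor (pair (Hoch α) A) [.full] ⟶ Hoch α from (ρ_ (Hoch α)).hom)
  have h2 := Graft.ins_unit (X := pair (Hoch α) A) (c := .full)
    (Graft.idR (.full :: t) 0 .full rfl) rfl (fun _ _ => rfl) rfl
  exact (Category.comp_id _).symm.trans ((whisker_eq _ h2.symm).trans h1.symm)

/-- Composition of bimodule maps applies `φ` and then acts by `ψ` on one of the new inputs.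
Evaluation turns each into an insertion, by `BimodMap.eval_app` and `BimodMap.eval_act`, and
`Graft.ins_seq` combines them. -/
theorem BimodMap.hoch_comp {t w' : List Col} {b : Fin w.length} (e : Graft w b t w')
    (hb : w.get b = .full) (φ : BimodMap P.toOperadData w) (ψ : BimodMap P.toOperadData t) :
    (φ.comp e hb ψ).hoch α =
      e.ins (X := pair (Hoch α) A) (c := .full) hb (ψ.hoch α) ≫ φ.hoch α := by
  refine ((φ.comp e hb ψ).hoch_unique fun {s} ht x => ?_).symm
  have h := (Graft.exists_seq₂ (Graft.std (.full :: s) 0 w) rfl e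
    (Graft.front w' .full s)).choose_spec
  refine (BimodMap.eval_act ψ _ _ _).trans ?_
  refine (whisker_eq _ (BimodMap.eval_app φ (.one ht) rfl _ x)).trans ?_
  rw [HalfAlg.eval_gen]
  refine (Category.assoc _ _ _).symm.trans (eq_whisker ?_ _)
  exact Graft.ins_seq h _ _ _ _ _

variable {O : Operad sigFull} (ρ : OperadHom O.toOperadData (endOperad P.toOperadData)) (α)

/-- By the preceding lemmas, sending `φ` to `φ.hoch` respects units, composition and the topology,
so precomposition with `ρ` gives an `O`-algebra. -/
theorem exists_hochAlgO : ∃ η : Alg i O.toOperadData (fun _ => Hoch α),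
    ∀ {w : List Col} (hw : ∀ c ∈ w, c = .full) (x : O.Obj w .full (.mk hw)),
      BimodMap.hoch α (ρ.map w .full (.mk hw) x) = fulls (Hoch α) A w hw ≫ η.op x := by
  refine exists_fullAlg (fun {w} hw x => BimodMap.hoch α (ρ.map w .full (.mk hw) x))
    (fun {w} hw => ?_) (fun h => ?_) (fun {w t w'} hw ht hw' j hj e x y => ?_)
  · let _ := homTop i (wordTensor (pair (Hoch α) A) w) (Hoch α)
    exact Continuous.comp (BimodMap.continuous_hoch α) (ρ.continuous_map w .full (.mk hw))
  · rw [ρ.map_one]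
    exact BimodMap.hoch_one
  · rw [ρ.map_comp]
    exact BimodMap.hoch_comp _ _ _ _

/-- The action of the operad `O` on the Hochschild object. -/
noncomputable def hochAlgO : Alg i O.toOperadData (fun _ => Hoch α) := (exists_hochAlgO α ρ).choose

theorem hoch_map {w : List Col} (hw : ∀ c ∈ w, c = .full) (x : O.Obj w .full (.mk hw)) :
    BimodMap.hoch α (ρ.map w .full (.mk hw) x) = fulls (Hoch α) A w hw ≫ (hochAlgO α ρ).op x :=
  (exists_hochAlgO α ρ).choose_spec hw x

end HochOperad

/-! ### Relabelling in the semidirect product. -/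

section RtimesRelabels
variable {P : OperadData sigColl₁} {O : Operad sigFull}
  {ρ : OperadHom O.toOperadData (endOperad P)}

/-- These laws are all that `Alg.op_comp` needs, so the full operad axioms of the semidirect product
never have to be verified. The mixed case, an operation of `O` inserted into one with output `half`,
is `BimodMap.act_n` with the identity as outer operation. -/
theorem rtimes_relabels : (rtimes P O.toOperadData ρ).Relabels where
  perm _ _ := trivial
  unit _ := trivial
  act_id {w k} h hw x := by
    cases k with
    | half => exact EObj.one_comp _ x fun _ => rfl
    | full =>
      obtain ⟨⟨hx⟩, x⟩ := x
      exact congrArg (Sigma.mk _) (O.relabels_full.act_id (.mk (by simp)) (.mk hx) x)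
  act_act {w w' w'' k} h hw hw' hw'' σ τ x := by
    cases k with
    | half =>
      have h1 := EObj.comp_seq (P := P) (hi := rfl) (hj := rfl) (hq := rfl) (x := EObj.one P)
        (y := EObj.one P) (z := x) (e₁ := Graft.idL _ _) (e₂ := σ.trans τ) (e₃ := σ) (e₄ := τ)
        ⟨rfl, fun a ha => (Graft.unique_o a ha).elim, fun a ha => (Graft.unique_o a ha).elim,
          fun c => rfl⟩
      refine Eq.trans ?_ h1
      exact congrArg (fun z => EObj.comp 0 rfl (σ.trans τ) z x)
        (EObj.one_comp _ (EObj.one P) fun _ => rfl).symm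
    | full =>
      obtain ⟨⟨hx⟩, x⟩ := x
      have h1 : ∀ c ∈ w', c = Col.full := fun c hc => hx c (σ.perm_word.mem_iff.2 hc)
      have h2 : ∀ c ∈ w'', c = Col.full := fun c hc => h1 c (τ.perm_word.mem_iff.2 hc)
      exact congrArg (Sigma.mk (PLift.up h2))
        (O.relabels_full.act_act (.mk (by simp)) (.mk hx) (.mk h1) (.mk h2) σ τ x)
  chg {w t w' w'' k c i} h hw ht hw' hw'' hi e e' x y := by
    cases k with
    | half =>
      cases c with
      | half =>
        have h1 := EObj.comp_seq (P := P) (hi := rfl) (hj := hi) (hq := hi) (x := EObj.one P)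
          (y := x) (z := y) (e₁ := Graft.idL _ _) (e₂ := e') (e₃ := e) (e₄ := e.chg _ e')
          ⟨rfl, fun a ha => (Graft.unique_o a ha).elim,
            fun a ha h => (Graft.chg_o _ e e' a ha).symm, fun c => (Graft.chg_n _ e e' c).symm⟩
        refine Eq.trans ?_ h1
        exact congrArg (fun z => EObj.comp i hi e' z y) (EObj.one_comp _ x fun _ => rfl).symm
      | full =>
        have h1 := (ρ.map t .full (.mk y.1.down) y.2 : BimodMap P t).act_n (j := 0) rfl
          (EObj.one P) x hi hi (e₁ := Graft.idL _ _) (e := e') (e₃ := e) (e₄ := e.chg _ e')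
          ⟨rfl, fun a ha => (Graft.unique_o a ha).elim,
            fun a ha h => (Graft.chg_o _ e e' a ha).symm, fun c => (Graft.chg_n _ e e' c).symm⟩
        refine Eq.trans ?_ h1
        exact congrArg (fun z => BimodMap.act (ρ.map t .full (.mk y.1.down) y.2) i hi e' z)
          (EObj.one_comp _ x fun _ => rfl).symm
    | full =>
      obtain ⟨⟨hx⟩, x⟩ := x
      cases c with
      | half => exact absurd (hi.symm.trans (hx _ (List.get_mem _ _))) (by simp)
      | full =>
        obtain ⟨⟨hy⟩, y⟩ := y
        exact congrArg (Sigma.mk (PLift.up (e'.all_full hx hy)))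
          (O.relabels_full.chg (.mk (by simp)) (.mk hx) (.mk hy) (.mk (e.all_full hx hy))
            (.mk (e'.all_full hx hy)) hi e e' x y)

end RtimesRelabels

/-! ### Decomposition of algebras over the semidirect product. -/

section Decomposition
variable {C : Type u} [Category.{v} C] [MonoidalCategory C] [SymmetricCategory C]
  [MonoidalClosed C] {i : CGTop ⥤ C} [i.Braided] [i.IsLeftAdjoint] {P : Operad sigColl₁}
  {O : Operad sigFull} {ρ : OperadHom O.toOperadData (endOperad P.toOperadData)} {A B : C}

variable (ρ) in
/-- The operations with output `half` turn the action of `O` through `ρ` into insertion of the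
operations with output `full`. -/
def HalfAlg.Compat (m : HalfAlg i P.toOperadData (pair B A))
    (β : Alg i O.toOperadData (fun _ => B)) : Prop :=
  ∀ (t : List Col) (ht : ∀ c ∈ t, c = .full) (y : O.Obj t .full (.mk ht)) {w w' : List Col}
    {j : Fin w.length} (hj : w.get j = .full) (e : Graft w j t w') (x : EObj P.toOperadData w),
    m.eval (BimodMap.act (ρ.map t .full (.mk ht) y) j hj e x) =
      e.ins (X := pair B A) (c := .full) hj (fulls B A t ht ≫ β.op y) ≫ m.eval x

/-- The structure `θ` consists of the structures `m` and `β`. -/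
structure Alg.Decomposes (θ : Alg i (rtimes P.toOperadData O.toOperadData ρ) (pair B A))
    (m : HalfAlg i P.toOperadData (pair B A)) (β : Alg i O.toOperadData (fun _ => B)) : Prop where
  half : ∀ {w : List Col} (x : EObj P.toOperadData w),
    θ.op (w := w) (k := .half) (h := trivial) x = m.eval x
  full : ∀ {w : List Col} (hw : ∀ c ∈ w, c = .full) (y : O.Obj w .full (.mk hw)),
    θ.op (w := w) (k := .full) (h := trivial)
      (⟨⟨hw⟩, y⟩ : RtimesObj P.toOperadData O.toOperadData w .full) = fulls B A w hw ≫ β.op y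

/-- The composition axiom is checked by colours: half into half holds for `m`, full into full for
`β`, and full into half is the hypothesis `Compat`. An operation with output `full` has no half
input. -/
theorem HalfAlg.Compat.exists_alg {m : HalfAlg i P.toOperadData (pair B A)}
    {β : Alg i O.toOperadData (fun _ => B)} (h : m.Compat ρ β) :
    ∃ θ : Alg i (rtimes P.toOperadData O.toOperadData ρ) (pair B A), θ.Decomposes m β := by
  obtain ⟨θ, hθ⟩ := Alg.exists_of_op (i := i) (P := rtimes P.toOperadData O.toOperadData ρ)
    (X := pair B A)
    (fun w k _ => match k with
      | .half => fun x : EObj P.toOperadData w => m.eval x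
      | .full => fun x : (Σ h : PLift (∀ c ∈ w, c = .full), O.Obj w .full (.mk h.down)) =>
          fulls B A w x.1.down ≫ β.op x.2)
    (by
      intro w k _
      cases k with
      | half => exact m.continuous_eval w
      | full =>
        refine @continuous_sigma _ _ _ _ (homTop i _ _) (fun x : (Σ h : PLift (∀ c ∈ w, c = .full),
          O.Obj w .full (.mk h.down)) => fulls B A w x.1.down ≫ β.op x.2) fun hw => ?_
        let _ := O.top w .full (.mk hw.down)
        have _ := O.gen w .full (.mk hw.down)
        exact continuous_homTop_precomp (fulls B A w hw.down) (β.continuous_op (.mk hw.down)))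
    (by
      intro k _
      cases k with
      | half => exact m.eval_one
      | full => exact β.fulls_op_one _)
    (by
      intro u v t k c _ _ _ x y
      cases k with
      | half =>
        cases c with
        | half =>
          refine (m.eval_comp _ _ _ _).trans ?_
          exact eq_whisker (Graft.ins_planar (X := pair B A) (c := .half) u v (m.eval y)) _
        | full =>
          refine (h t y.1.down y.2 _ _ _).trans ?_
          exact eq_whisker (Graft.ins_planar (X := pair B A) (c := .full) u v
            (fulls B A t y.1.down ≫ β.op y.2)) _
      | full =>
        obtain ⟨⟨hx⟩, x⟩ := x
        cases c with
        | half => exact absurd (hx .half (by simp)) (by simp)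
        | full =>
          obtain ⟨⟨hy⟩, y⟩ := y
          refine (β.fulls_op_comp hx hy _ _ _ x y).trans ?_
          exact eq_whisker (Graft.ins_planar (X := pair B A) (c := .full) u v
            (fulls B A t hy ≫ β.op y)) _)
    (by
      intro u v a b k _ _ _ x
      cases k with
      | half =>
        refine (m.eval_act _ _).trans ?_
        exact eq_whisker (Graft.perm_swap ..) _
      | full =>
        obtain ⟨⟨hx⟩, x⟩ := x
        have h1 : ∀ c ∈ u ++ b :: a :: v, c = Col.full := fun c hc => hx c (by
          simp only [List.mem_append, List.mem_cons] at hc ⊢; tauto)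
        have h2 : ∀ c ∈ [Col.full], c = Col.full := by simp
        refine (β.fulls_op_comp h2 hx h1 rfl (Graft.swap .full u a b v) (O.one .full (.mk h2))
          x).trans ?_
        refine (whisker_eq _ (β.fulls_op_one h2)).trans ?_
        refine (Graft.ins_perm' (X := pair B A) (k := .full) _ _).trans ?_
        exact eq_whisker (Graft.perm_swap ..) _)
  exact ⟨θ, fun x => hθ _ _ _ _, fun hw y => hθ _ _ _ _⟩

variable {θ θ' : Alg i (rtimes P.toOperadData O.toOperadData ρ) (pair B A)}

/-- Operations with output `half` of any degree respect composition, hence are determined by their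
restriction to degree at most one through `HalfAlg.eval_unique`. -/
theorem Alg.exists_decomposition (θ : Alg i (rtimes P.toOperadData O.toOperadData ρ) (pair B A)) :
    ∃ m β, θ.Decomposes m β := by
  let m : HalfAlg i P.toOperadData (pair B A) :=
    { op := fun {w} hw x => θ.op (w := w) (k := .half) (h := trivial) (EObj.gen hw x)
      continuous_op := fun {w} hw => by
        exact @Continuous.comp _ _ _ (P.top w .half hw)
          ((rtimes P.toOperadData O.toOperadData ρ).top w .half trivial) (homTop i _ _) _ _ (θ.continuous_op (w := w) (k := .half) trivial)
          ((isETop_finest P.toOperadData).gen w hw)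
      op_one := θ.op_one (k := .half) trivial
      op_comp := fun {w t w'} hw ht hw' j hj e x y => by
        rw [EObj.gen_comp]
        exact θ.op_comp rtimes_relabels (k := .half) (c := .half) trivial trivial trivial j hj e
          (EObj.gen hw x) (EObj.gen ht y) }
  obtain ⟨β, hβ⟩ := exists_fullAlg (O := O) (i := i) (B := B) (A := A)
    (fun {w} hw y => θ.op (w := w) (k := .full) (h := trivial)
      (⟨⟨hw⟩, y⟩ : RtimesObj P.toOperadData O.toOperadData w .full))
    (fun {w} hw => by
      exact @Continuous.comp _ _ _ (O.top w .full (.mk hw))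
        ((rtimes P.toOperadData O.toOperadData ρ).top w .full trivial) (homTop i _ _) _ _ (θ.continuous_op (w := w) (k := .full) trivial)
        (continuous_sigmaMk (σ := fun h : PLift (∀ c ∈ w, c = Col.full) =>
          O.Obj w .full (.mk h.down)) (i := ⟨hw⟩)))
    (fun _ => θ.op_one (k := .full) trivial)
    (fun {w t w'} hw ht hw' j hj e x y =>
      θ.op_comp rtimes_relabels (k := .full) (c := .full) trivial trivial trivial j hj e
        (⟨⟨hw⟩, x⟩ : RtimesObj P.toOperadData O.toOperadData w .full)
        (⟨⟨ht⟩, y⟩ : RtimesObj P.toOperadData O.toOperadData t .full))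
  refine ⟨m, β, fun {w} x => ?_, hβ⟩
  exact m.eval_unique (fun {w} x => θ.op (w := w) (k := .half) (h := trivial) x)
    (fun hw x => rfl) (fun {w t w' j} hj e x y =>
      θ.op_comp rtimes_relabels (k := .half) (c := .half) trivial trivial trivial j hj e x y) x

namespace Alg.Decomposes
variable {m m' : HalfAlg i P.toOperadData (pair B A)} {β : Alg i O.toOperadData (fun _ => B)}

theorem compat (h : θ.Decomposes m β) : m.Compat ρ β := by
  intro t ht y w w' j hj e x
  refine (h.half _).symm.trans ?_
  have h1 := θ.op_comp rtimes_relabels (k := .half) (c := .full) trivial trivial trivial j hj e x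
    (⟨⟨ht⟩, y⟩ : RtimesObj P.toOperadData O.toOperadData t .full)
  refine h1.trans ?_
  refine (whisker_eq _ (h.half x)).trans ?_
  exact congrArg (fun z => e.ins (X := pair B A) (c := .full) hj z ≫ m.eval x) (h.full ht y)

theorem ext (h : θ.Decomposes m β) (h' : θ'.Decomposes m β) : θ = θ' := by
  refine Alg.ext_op fun w k hw x => ?_
  cases k with
  | half => exact (h.half x).trans (h'.half x).symm
  | full =>
    obtain ⟨⟨hx⟩, x⟩ := x
    exact (h.full hx x).trans (h'.full hx x).symm

theorem op_gen (h : θ.Decomposes m β) {w : List Col} (hw : sigColl₁ w .half)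
    (x : P.Obj w .half hw) :
    θ.op (w := w) (k := .half) (h := trivial) (EObj.gen hw x) = m.op hw x :=
  (h.half _).trans (m.eval_gen _ _)

theorem extends_iff {α : Alg i P.toOperadData.degZero (fun _ => A)} (h : θ.Decomposes m β) :
    Extends α θ ↔ m.Restricts α :=
  forall_congr' fun _ => forall_congr' fun hw => forall_congr' fun x => by
    refine Eq.congr_left (h.op_gen (.zero hw) x)

end Alg.Decomposes

end Decomposition

/-! ### Morphisms of the separate parts. -/

section Morphisms
variable {C : Type u} [Category.{v} C] [MonoidalCategory C] [SymmetricCategory C]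
  [MonoidalClosed C] {i : CGTop ⥤ C} [i.Braided] [i.IsLeftAdjoint] {P : Operad sigColl₁}
  {O : Operad sigFull} {ρ : OperadHom O.toOperadData (endOperad P.toOperadData)} {A B D E : C}

theorem Graft.pairMap_ins (f : D ⟶ B) {w t w' : List Col} {j : Fin w.length} {c : Col}
    (e : Graft w j t w') (hj : w.get j = c) {g : wordTensor (pair D A) t ⟶ pair D A c}
    {g' : wordTensor (pair B A) t ⟶ pair B A c}
    (h : wordTensorMap t (fun c _ => pairMap A f c) ≫ g' = g ≫ pairMap A f c) :
    wordTensorMap w' (fun c _ => pairMap A f c) ≫ e.ins hj g' =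
      e.ins hj g ≫ wordTensorMap w (fun c _ => pairMap A f c) :=
  e.ins_natural (K := fun _ => True) (fun c _ => pairMap A f c) hj (fun _ _ => trivial)
    (fun _ _ => trivial) (fun _ _ => trivial) trivial h

/-- The map `f` is compatible with the operations with output `half`. -/
def HalfAlg.IsHom (m : HalfAlg i P.toOperadData (pair D A)) (m' : HalfAlg i P.toOperadData (pair B A))
    (f : D ⟶ B) : Prop :=
  ∀ (w : List Col) (hw : sigColl₁ w .half) (x : P.Obj w .half hw),
    m.op hw x = wordTensorMap w (fun c _ => pairMap A f c) ≫ m'.op hw x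

variable {m : HalfAlg i P.toOperadData (pair D A)} {m' : HalfAlg i P.toOperadData (pair B A)}
  {m'' : HalfAlg i P.toOperadData (pair E A)}
  {β : Alg i O.toOperadData (fun _ => D)} {β' : Alg i O.toOperadData (fun _ => B)}
  {f : D ⟶ B} {g : E ⟶ D}

theorem wordTensorMap_pairMap_comp (g : E ⟶ D) (f : D ⟶ B) (w : List Col) :
    wordTensorMap w (fun c _ => pairMap A (g ≫ f) c) =
      wordTensorMap w (fun c _ => pairMap A g c) ≫ wordTensorMap w (fun c _ => pairMap A f c) := by
  rw [← wordTensorMap_comp, pairMap_comp]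

/-- The operations of `m'` precomposed with `f` also respect composition and agree with `m` on
generators; uniqueness of the extension applies. -/
theorem HalfAlg.IsHom.eval (h : m.IsHom m' f) {w : List Col} (x : EObj P.toOperadData w) :
    m.eval x = wordTensorMap w (fun c _ => pairMap A f c) ≫ m'.eval x := by
  refine (m.eval_unique (fun {w} x => wordTensorMap w (fun c _ => pairMap A f c) ≫ m'.eval x)
    (fun hw x => (h _ hw x).symm) (fun {w t w' j} hj e x y => ?_) x).symm
  refine (whisker_eq _ (m'.eval_comp hj e x y)).trans ?_
  refine (Category.assoc _ _ _).symm.trans ((eq_whisker ?_ _).trans (Category.assoc _ _ _))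
  exact e.pairMap_ins f hj (Category.comp_id _).symm

theorem HalfAlg.IsHom.comp (h' : m''.IsHom m g) (h : m.IsHom m' f) : m''.IsHom m' (g ≫ f) := by
  intro w hw x
  rw [wordTensorMap_pairMap_comp]
  exact (h' w hw x).trans ((whisker_eq _ (h w hw x)).trans (Category.assoc _ _ _).symm)

theorem Alg.isHom_iff_fulls : β.IsHom β' (fun _ => f) ↔
    ∀ {w : List Col} (hw : ∀ c ∈ w, c = .full) (y : O.Obj w .full (.mk hw)),
      (fulls D A w hw ≫ β.op y) ≫ f =
        wordTensorMap w (fun c _ => pairMap A f c) ≫ fulls B A w hw ≫ β'.op y := by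
  have key : ∀ {w : List Col} (hw : ∀ c ∈ w, c = .full) (y : O.Obj w .full (.mk hw)),
      (fulls D A w hw ≫ β.op y) ≫ f =
        wordTensorMap w (fun c _ => pairMap A f c) ≫ fulls B A w hw ≫ β'.op y ↔
      β.op y ≫ f = wordTensorMap w (fun _ _ => f) ≫ β'.op y := by
    intro w hw y
    have h1 := wordTensorMap_pairMap_fulls (A := A) f w hw
    have h2 : wordTensorMap w (fun c _ => pairMap A f c) ≫ fulls B A w hw ≫ β'.op y =
        fulls D A w hw ≫ wordTensorMap w (fun _ _ => f) ≫ β'.op y :=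
      (Category.assoc _ _ _).symm.trans ((eq_whisker h1 _).trans (Category.assoc _ _ _))
    rw [h2, Category.assoc]
    exact cancel_epi _
  constructor
  · intro h w hw y
    exact (key hw y).2 (h w .full (.mk hw) y)
  · rintro h w k ⟨rfl, hw⟩ y
    exact (key hw y).1 (h hw y)

/-- Every operation with output `half` has output object `A`, on which the map is the identity. So
both sides of `Compat` for the source are obtained from those for the target by precomposition. No
condition on `f` such as being monic is needed. -/
theorem HalfAlg.IsHom.compat (h : m.IsHom m' f) (hf : β.IsHom β' (fun _ => f))
    (hc : m'.Compat ρ β') : m.Compat ρ β := by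
  intro t ht y w w' j hj e x
  refine (h.eval _).trans ((whisker_eq _ (hc t ht y hj e x)).trans ?_)
  refine (Category.assoc _ _ _).symm.trans ?_
  refine Eq.trans ?_ (whisker_eq _ (h.eval x).symm)
  refine Eq.trans ?_ (Category.assoc _ _ _)
  refine eq_whisker ?_ _
  exact e.pairMap_ins f (c := .full) hj (Alg.isHom_iff_fulls.1 hf ht y).symm

theorem HalfAlg.IsHom.restricts {α : Alg i P.toOperadData.degZero (fun _ => A)}
    (h : m.IsHom m' f) (hm : m'.Restricts α) : m.Restricts α := by
  intro w hw x
  refine (h w _ x).trans ((whisker_eq _ (hm w hw x)).trans ?_)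
  exact (Category.assoc _ _ _).symm.trans (eq_whisker (halves_pairMap f w hw) _)

variable {θ : Alg i (rtimes P.toOperadData O.toOperadData ρ) (pair D A)}
  {θ' : Alg i (rtimes P.toOperadData O.toOperadData ρ) (pair B A)}

theorem Alg.Decomposes.isHom_iff (h : θ.Decomposes m β) (h' : θ'.Decomposes m' β') :
    θ.IsHom θ' (pairMap A f) ↔ m.IsHom m' f ∧ β.IsHom β' (fun _ => f) := by
  rw [Alg.isHom_iff_fulls (A := A)]
  constructor
  · refine fun hθ => ⟨fun w hw x => ?_, fun {w} hw y => ?_⟩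
    · have h1 := hθ w .half trivial (EObj.gen hw x)
      refine (h.op_gen hw x).symm.trans ?_
      refine (Category.comp_id _).symm.trans (h1.trans ?_)
      exact whisker_eq _ (h'.op_gen hw x)
    · have h1 := hθ w .full trivial (⟨⟨hw⟩, y⟩ : RtimesObj P.toOperadData O.toOperadData w .full)
      refine (eq_whisker (h.full hw y).symm _).trans (h1.trans ?_)
      exact whisker_eq _ (h'.full hw y)
  · rintro ⟨h1, h2⟩ w k _ x
    cases k with
    | half =>
      refine (Category.comp_id _).trans ((h.half x).trans ((h1.eval x).trans ?_))
      exact whisker_eq _ (h'.half x).symm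
    | full =>
      obtain ⟨⟨hw⟩, y⟩ := x
      refine (eq_whisker (h.full hw y) _).trans ((h2 hw y).trans ?_)
      exact whisker_eq _ (h'.full hw y).symm

theorem Alg.Decomposes.isFullHom_iff (h : θ.Decomposes m β) :
    IsFullHom θ β' f ↔ β.IsHom β' (fun _ => f) := by
  rw [Alg.isHom_iff_fulls (A := A)]
  refine forall_congr' fun w => forall_congr' fun hw => forall_congr' fun y => ?_
  have h1 : wordTensorMap w (fun c hc => toFull D A c (hw c hc) ≫ f) =
      wordTensorMap w (fun c _ => pairMap A f c) ≫ fulls B A w hw := by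
    rw [wordTensorMap_pairMap_fulls]
    exact wordTensorMap_comp w (fun c hc => toFull D A c (hw c hc)) (fun _ _ => f)
  have h2 : wordTensorMap w (fun c hc => toFull D A c (hw c hc) ≫ f) ≫ β'.op y =
      wordTensorMap w (fun c _ => pairMap A f c) ≫ fulls B A w hw ≫ β'.op y :=
    (eq_whisker h1 _).trans (Category.assoc _ _ _)
  rw [← h2]
  exact Eq.congr_left (eq_whisker (h.full hw y) _)

end Morphisms

/-! ### Compatibility with `O` detected by evaluation. -/

section Universal
variable {C : Type u} [Category.{v} C] [MonoidalCategory C] [SymmetricCategory C]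
  [MonoidalClosed C] [HasLimitsOfSize.{0, 0} C] [HasColimitsOfSize.{0, 0} C]
  {i : CGTop ⥤ C} [i.Braided] [i.IsLeftAdjoint] {P : Operad sigColl₁}
  {A B : C} {α : Alg i P.toOperadData.degZero (fun _ => A)}
  {O : Operad sigFull} {ρ : OperadHom O.toOperadData (endOperad P.toOperadData)}
  {m : HalfAlg i P.toOperadData (pair B A)} {β : Alg i O.toOperadData (fun _ => B)} {f : B ⟶ Hoch α}

variable (α ρ) in
theorem hochAlg_compat : (hochAlg α).Compat ρ (hochAlgO α ρ) := by
  intro t ht y w w' j hj e x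
  refine (BimodMap.eval_act _ hj e x).trans ?_
  exact congrArg (fun z => e.ins (X := pair (Hoch α) A) (c := .full) hj z ≫ (hochAlg α).eval x)
    (hoch_map α ρ ht y)

/-- The interchange law separates the factors `W`, on which operations of `O` act, from the factors
`U` identified with powers of `A`. It brings an equality of evaluations into the shape required by
`hoch_word_ext`. -/
theorem whisker_split {T T' W W' U U' V B H A : C} {s : T ⟶ W ⊗ U} {s' : T' ⟶ W' ⊗ U'}
    {M : T ⟶ T'} {M₁ : W ⟶ W'} {M₂ : U ⟶ U'} {r : U ⟶ V} {r' : U' ⟶ V} {a : W ⟶ B} {f : B ⟶ H}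
    {b : W' ⟶ H} {ev : H ⊗ V ⟶ A} (hs : M ≫ s' = s ≫ (M₁ ⊗ₘ M₂)) (hr : M₂ ≫ r' = r)
    (h : (s ≫ a ▷ U) ≫ B ◁ r ≫ f ▷ V ≫ ev = M ≫ (s' ≫ b ▷ U') ≫ H ◁ r' ≫ ev) :
    s ≫ (a ≫ f) ▷ U ≫ H ◁ r ≫ ev = s ≫ (M₁ ≫ b) ▷ U ≫ H ◁ r ≫ ev := by
  subst hr
  simp only [Category.assoc, reassoc_of% hs] at h
  simp only [whisker_exchange_assoc, MonoidalCategory.whiskerLeft_comp, Category.assoc,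
    comp_whiskerRight, MonoidalCategory.tensorHom_def] at h ⊢
  exact h

/-- A map to the Hochschild object compatible with the operations with output `half` is a map of
algebras over `O`. -/
theorem HalfAlg.IsHom.isHom_hochAlgO (h : m.IsHom (hochAlg α) f) (hc : m.Compat ρ β) :
    β.IsHom (hochAlgO α ρ) (fun _ => f) := by
  refine (Alg.isHom_iff_fulls (A := A)).2 fun {w} hw y => hoch_word_ext fun {t} ht x => ?_
  have hx : m.op (.one ht) x = fullHalves B A t ht ≫ f ▷ _ ≫ Hoch.eval α ht x := by
    refine (h _ (.one ht) x).trans ((whisker_eq _ (hochAlg_op_one α ht x)).trans ?_)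
    exact (Category.assoc _ _ _).symm.trans ((eq_whisker (fullHalves_pairMap f t ht) _).trans
      (Category.assoc _ _ _))
  -- The image of `x` under the action of `y` is evaluated in two ways: on `B` by `Compat`, which
  -- gives the operation of `O` followed by `f`, and after mapping to `Hoch α`, which gives `f` on
  -- each factor followed by the operation of `O`.
  have h1 := hc _ hw y (j := 0) rfl (Graft.front w .full t) (EObj.gen (.one ht) x)
  have h2 := (h.eval _).trans (whisker_eq _
    (hochAlg_compat α ρ _ hw y (j := 0) rfl (Graft.front w .full t) (EObj.gen (.one ht) x)))
  refine whisker_split (mapWord_splitHom (K := fun _ => True) (fun c _ => pairMap A f c) t w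
    (fun _ _ => trivial) (fun _ _ => trivial) (fun _ _ => trivial)) (halves_pairMap f t ht) ?_
  have h3 := h1.symm.trans h2
  refine Eq.trans ?_ (h3.trans ?_)
  · refine Eq.trans ?_ (whisker_eq _ hx.symm)
    exact eq_whisker (Graft.ins_front (X := pair B A) (c := .full) _).symm _
  · refine whisker_eq _ ?_
    refine (whisker_eq _ (hochAlg_op_one α ht x)).trans ?_
    exact eq_whisker (Graft.ins_front (X := pair (Hoch α) A) (c := .full) _) _

end Universal

/-! ### The two functors and their composites. -/

section Functors
variable {C : Type u} [Category.{v} C] [MonoidalCategory C] [SymmetricCategory C]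
  [MonoidalClosed C] [HasLimitsOfSize.{0, 0} C] [HasColimitsOfSize.{0, 0} C]
  {i : CGTop ⥤ C} [i.Braided] [i.IsLeftAdjoint] {P : Operad sigColl₁}
  {A B D : C} {α : Alg i P.toOperadData.degZero (fun _ => A)}
  {O : Operad sigFull} {ρ : OperadHom O.toOperadData (endOperad P.toOperadData)}
  {m : HalfAlg i P.toOperadData (pair B A)} {β : Alg i O.toOperadData (fun _ => B)}

theorem HalfAlg.IsHom.eq_of_hoch {f g : B ⟶ Hoch α} (hf : m.IsHom (hochAlg α) f)
    (hg : m.IsHom (hochAlg α) g) : f = g :=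
  hoch_map_ext fun hw x => (hf _ (.one hw) x).symm.trans (hg _ (.one hw) x)

theorem HalfAlg.isHom_id (m : HalfAlg i P.toOperadData (pair B A)) : m.IsHom m (𝟙 B) := by
  intro w hw x
  rw [pairMap_id, wordTensorMap_id, Category.id_comp]

theorem Alg.eq_of_isHom_id {β' : Alg i O.toOperadData (fun _ => B)}
    (h : β.IsHom β' (fun _ => 𝟙 B)) : β = β' := by
  refine Alg.ext_op fun w k hw x => ?_
  refine (Category.comp_id _).symm.trans ((h w k hw x).trans ?_)
  exact (eq_whisker (wordTensorMap_id (fun _ => B) w) _).trans (Category.id_comp _)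

namespace Alg.Decomposes
variable {θ : Alg i (rtimes P.toOperadData O.toOperadData ρ) (pair B A)}
  {m' : HalfAlg i P.toOperadData (pair B A)} {β' : Alg i O.toOperadData (fun _ => B)}

theorem unique_half (h : θ.Decomposes m β) (h' : θ.Decomposes m' β') : m = m' :=
  HalfAlg.ext_op fun hw x => (h.op_gen hw x).symm.trans (h'.op_gen hw x)

theorem unique_full (h : θ.Decomposes m β) (h' : θ.Decomposes m' β') : β = β' := by
  refine Alg.ext_op fun w k hw x => ?_
  obtain ⟨rfl, hw⟩ := hw
  exact (cancel_epi (fulls B A w hw)).1 ((h.full hw x).symm.trans (h'.full hw x))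

end Alg.Decomposes

/-- The part with output `half` is forced on generators. The identity of `Hoch α` then respects
these operations, hence is a map of `O`-algebras from the given structure to `hochAlgO`; so the two
`O`-structures coincide. -/
theorem IsInduced.decomposes {θ : Alg i (rtimes P.toOperadData O.toOperadData ρ) (pair (Hoch α) A)}
    (h : IsInduced α θ) : θ.Decomposes (hochAlg α) (hochAlgO α ρ) := by
  obtain ⟨m, β, hd⟩ := θ.exists_decomposition
  obtain rfl : m = hochAlg α := by
    refine HalfAlg.ext_generators (fun {w} hw x => ?_) (fun {w} hw x => ?_)
    · exact (hd.extends_iff.1 h.extends_alg w hw x).trans (hochAlg_restricts α w hw x).symm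
    · exact (hd.op_gen _ x).symm.trans ((h.eval w hw x).trans (hochAlg_op_one α hw x).symm)
  obtain rfl : β = hochAlgO α ρ :=
    Alg.eq_of_isHom_id ((hochAlg α).isHom_id.isHom_hochAlgO hd.compat)
  exact hd

variable (α ρ) in
theorem exists_hochRtimes :
    ∃ θ : Alg i (rtimes P.toOperadData O.toOperadData ρ) (pair (Hoch α) A),
      θ.Decomposes (hochAlg α) (hochAlgO α ρ) ∧ IsInduced α θ := by
  obtain ⟨θ, hθ⟩ := (hochAlg_compat α ρ).exists_alg
  exact ⟨θ, hθ, hθ.extends_iff.2 (hochAlg_restricts α),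
    fun w hw x => (hθ.op_gen _ x).trans (hochAlg_op_one α hw x)⟩

namespace AlgUnder
variable (Y Y' : AlgUnder ρ α)

theorem exists_parts : ∃ (m : HalfAlg i P.toOperadData (pair Y.carrier A))
    (β : Alg i O.toOperadData (fun _ => Y.carrier)) (f : Y.carrier ⟶ Hoch α),
    Y.alg.Decomposes m β ∧ m.IsHom (hochAlg α) f := by
  obtain ⟨m, β, h⟩ := Y.alg.exists_decomposition
  obtain ⟨f, hf⟩ := (h.extends_iff.1 Y.extends_alg).exists_map
  exact ⟨m, β, f, h, fun _ hw x => hf hw x⟩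

/-- The operations with output `half`. -/
noncomputable def half : HalfAlg i P.toOperadData (pair Y.carrier A) := Y.exists_parts.choose

/-- The operations with output `full`. -/
noncomputable def full : Alg i O.toOperadData (fun _ => Y.carrier) :=
  Y.exists_parts.choose_spec.choose

/-- The classifying map. -/
noncomputable def toHoch : Y.carrier ⟶ Hoch α := Y.exists_parts.choose_spec.choose_spec.choose

theorem decomposes : Y.alg.Decomposes Y.half Y.full :=
  Y.exists_parts.choose_spec.choose_spec.choose_spec.1

theorem isHom_toHoch : Y.half.IsHom (hochAlg α) Y.toHoch :=
  Y.exists_parts.choose_spec.choose_spec.choose_spec.2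

theorem isHom_toHoch_full : Y.full.IsHom (hochAlgO α ρ) (fun _ => Y.toHoch) :=
  Y.isHom_toHoch.isHom_hochAlgO Y.decomposes.compat

variable {Y Y'} in
-- Both sides are compatible with the operations with output `half`, and such a map to `Hoch α` is
-- unique.
theorem hom_toHoch (g : Y ⟶ Y') : g.hom ≫ Y'.toHoch = Y.toHoch :=
  (((Y.decomposes.isHom_iff Y'.decomposes).1 g.isHom).1.comp Y'.isHom_toHoch).eq_of_hoch
    Y.isHom_toHoch

theorem eqToHom_hom {Y Y' : AlgUnder ρ α} (h : Y = Y') :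
    AlgUnder.Hom.hom (eqToHom h) = eqToHom (congrArg carrier h) := by
  subst h; rfl

theorem eq_of_alg {θ : Alg i (rtimes P.toOperadData O.toOperadData ρ) (pair Y.carrier A)}
    (hθ : Extends α θ) (h : θ = Y.alg) : AlgUnder.mk Y.carrier θ hθ = Y := by
  subst h; rfl

end AlgUnder

theorem AlgO.over_eq {X : AlgO i O.toOperadData} {β β' : Alg i O.toOperadData (fun _ => B)}
    {f : AlgO.mk B β ⟶ X} {g : AlgO.mk B β' ⟶ X} (h : β = β')
    (hf : AlgO.Hom.hom f = AlgO.Hom.hom g) : Over.mk f = Over.mk g := by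
  subst h
  exact congrArg Over.mk (AlgO.Hom.ext hf)

theorem AlgO.eqToHom_left_hom {X : AlgO i O.toOperadData} {Z Z' : Over X} (h : Z = Z') :
    AlgO.Hom.hom (eqToHom h).left = eqToHom (congrArg (fun Z => Z.left.carrier) h) := by
  subst h; rfl

variable (α ρ) in
/-- The object `B` of an algebra `(B, A)`, with its map to the Hochschild object. -/
noncomputable def toOver : AlgUnder ρ α ⥤ Over (AlgO.mk (Hoch α) (hochAlgO α ρ)) where
  obj Y := Over.mk (Y := AlgO.mk Y.carrier Y.full) ⟨Y.toHoch, Y.isHom_toHoch_full⟩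
  map {Y Y'} g := Over.homMk (U := Over.mk _) (V := Over.mk _)
    ⟨g.hom, ((Y.decomposes.isHom_iff Y'.decomposes).1 g.isHom).2⟩
    (AlgO.Hom.ext (AlgUnder.hom_toHoch g))

section OfOver
variable (Z Z' : Over (AlgO.mk (Hoch α) (hochAlgO α ρ)))

/-- The operations with output `half` are pulled back from `(Hoch α, A)`. As the structure map is
one of `O`-algebras, `Compat` is pulled back too, and the parts assemble. -/
theorem exists_ofOver : ∃ (m : HalfAlg i P.toOperadData (pair Z.left.carrier A))
    (θ : Alg i (rtimes P.toOperadData O.toOperadData ρ) (pair Z.left.carrier A)),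
    m.IsHom (hochAlg α) (AlgO.Hom.hom Z.hom) ∧ θ.Decomposes m Z.left.alg ∧ Extends α θ := by
  obtain ⟨m, hm⟩ := (hochAlg α).exists_pullback (AlgO.Hom.hom Z.hom)
  have hm : m.IsHom (hochAlg α) (AlgO.Hom.hom Z.hom) := fun _ hw x => hm hw x
  obtain ⟨θ, hθ⟩ := (hm.compat (AlgO.Hom.isHom Z.hom) (hochAlg_compat α ρ)).exists_alg
  exact ⟨m, θ, hm, hθ, hθ.extends_iff.2 (hm.restricts (hochAlg_restricts α))⟩

/-- The operations with output `half` given by a map to the Hochschild object. -/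
noncomputable def overHalf : HalfAlg i P.toOperadData (pair Z.left.carrier A) :=
  (exists_ofOver Z).choose

/-- The algebra structure given by a map to the Hochschild object. -/
noncomputable def overAlg : Alg i (rtimes P.toOperadData O.toOperadData ρ) (pair Z.left.carrier A) :=
  (exists_ofOver Z).choose_spec.choose

theorem overHalf_isHom : (overHalf Z).IsHom (hochAlg α) (AlgO.Hom.hom Z.hom) :=
  (exists_ofOver Z).choose_spec.choose_spec.1

theorem overAlg_decomposes : (overAlg Z).Decomposes (overHalf Z) Z.left.alg :=
  (exists_ofOver Z).choose_spec.choose_spec.2.1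

theorem overAlg_extends : Extends α (overAlg Z) :=
  (exists_ofOver Z).choose_spec.choose_spec.2.2

variable {Z Z'} in
theorem overHalf_isHom_map (g : Z ⟶ Z') : (overHalf Z).IsHom (overHalf Z') (AlgO.Hom.hom g.left) := by
  intro w hw x
  have h : AlgO.Hom.hom g.left ≫ AlgO.Hom.hom Z'.hom = AlgO.Hom.hom Z.hom :=
    congrArg AlgO.Hom.hom (Over.w g)
  refine (overHalf_isHom Z w hw x).trans ?_
  rw [← h, wordTensorMap_pairMap_comp, Category.assoc]
  exact whisker_eq _ (overHalf_isHom Z' w hw x).symm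

end OfOver

variable (α ρ) in
/-- The algebra `(B, A)` given by a map from `B` to the Hochschild object. -/
noncomputable def ofOver : Over (AlgO.mk (Hoch α) (hochAlgO α ρ)) ⥤ AlgUnder ρ α where
  obj Z := ⟨Z.left.carrier, overAlg Z, overAlg_extends Z⟩
  map {Z Z'} g := ⟨AlgO.Hom.hom g.left,
    ((overAlg_decomposes Z).isHom_iff (overAlg_decomposes Z')).2
      ⟨overHalf_isHom_map g, AlgO.Hom.isHom g.left⟩⟩

/-- Pulling back along the classifying map recovers the operations with output `half`, and the
`O`-structure is kept. An algebra is determined by these parts, so objects agree on the nose and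
underlying morphisms are unchanged. -/
theorem toOver_ofOver : toOver α ρ ⋙ ofOver α ρ = 𝟭 _ := by
  have h : ∀ Y : AlgUnder ρ α, (ofOver α ρ).obj ((toOver α ρ).obj Y) = Y := by
    intro Y
    refine Y.eq_of_alg _ ?_
    have h1 := overAlg_decomposes ((toOver α ρ).obj Y)
    have h2 : overHalf ((toOver α ρ).obj Y) = Y.half := HalfAlg.ext_op fun hw x =>
      (overHalf_isHom ((toOver α ρ).obj Y) _ hw x).trans (Y.isHom_toHoch _ hw x).symm
    rw [h2] at h1
    exact h1.ext Y.decomposes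
  refine CategoryTheory.Functor.ext h fun Y Y' g => AlgUnder.Hom.ext ?_
  have h1 : AlgUnder.Hom.hom (eqToHom (h Y)) = 𝟙 Y.carrier := AlgUnder.eqToHom_hom (h Y)
  have h2 : AlgUnder.Hom.hom (eqToHom (h Y').symm) = 𝟙 Y'.carrier :=
    AlgUnder.eqToHom_hom (h Y').symm
  refine Eq.trans ?_ (congrArg₂ (fun a b => a ≫ g.hom ≫ b) h1 h2).symm
  exact ((Category.id_comp _).trans (Category.comp_id _)).symm

/-- The given map to `Hoch α` is compatible with the operations pulled back along it, so by
uniqueness it is the classifying map of the algebra constructed from it. -/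
theorem ofOver_toOver : ofOver α ρ ⋙ toOver α ρ = 𝟭 _ := by
  have h : ∀ Z : Over (AlgO.mk (Hoch α) (hochAlgO α ρ)), (toOver α ρ).obj ((ofOver α ρ).obj Z) = Z := by
    intro Z
    have h1 := overAlg_decomposes Z
    have h2 := ((ofOver α ρ).obj Z).decomposes
    refine AlgO.over_eq (g := Z.hom) (h2.unique_full h1) ?_
    have h3 := ((ofOver α ρ).obj Z).isHom_toHoch
    have h4 : ((ofOver α ρ).obj Z).half = overHalf Z := h2.unique_half h1
    rw [h4] at h3
    exact h3.eq_of_hoch (overHalf_isHom Z)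
  refine CategoryTheory.Functor.ext h fun Z Z' g => Over.OverMorphism.ext (AlgO.Hom.ext ?_)
  have h1 : AlgO.Hom.hom (eqToHom (h Z)).left = 𝟙 Z.left.carrier := AlgO.eqToHom_left_hom (h Z)
  have h2 : AlgO.Hom.hom (eqToHom (h Z').symm).left = 𝟙 Z'.left.carrier :=
    AlgO.eqToHom_left_hom (h Z').symm
  refine Eq.trans ?_ (congrArg₂ (fun a b => a ≫ AlgO.Hom.hom g.left ≫ b) h1 h2).symm
  exact ((Category.id_comp _).trans (Category.comp_id _)).symm

end Functors

/-! ### The universal property. -/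

section Universal
variable {C : Type u} [Category.{v} C] [MonoidalCategory C] [SymmetricCategory C]
  [MonoidalClosed C] [HasLimitsOfSize.{0, 0} C] [HasColimitsOfSize.{0, 0} C]
  (i : CGTop ⥤ C) [i.Braided] [i.IsLeftAdjoint] (P : Operad sigColl₁)
  (A : C) (α : Alg i P.toOperadData.degZero (fun _ => A))
  (O : Operad sigFull) (ρ : OperadHom O.toOperadData (endOperad P.toOperadData))

/-- The universal property of the Hochschild object, for any operad `P` in degrees zero and one. -/
theorem hoch_universal :
    ∃ (θ : Alg i (rtimes P.toOperadData O.toOperadData ρ) (pair (Hoch α) A))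
      (η : Alg i O.toOperadData (fun _ => Hoch α)),
      IsInduced α θ ∧ (∀ θ', IsInduced α θ' → θ' = θ) ∧ IsFullHom θ η (𝟙 (Hoch α)) ∧
      ∃ (F : AlgUnder ρ α ⥤ Over (AlgO.mk (Hoch α) η))
        (G : Over (AlgO.mk (Hoch α) η) ⥤ AlgUnder ρ α),
        F ⋙ G = 𝟭 _ ∧ G ⋙ F = 𝟭 _ ∧
        ∃ hF : ∀ Y : AlgUnder ρ α, Y.carrier = (F.obj Y).left.carrier,
          (∀ Y : AlgUnder ρ α, IsFullHom Y.alg (F.obj Y).left.alg (eqToHom (hF Y))) ∧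
          (∀ Y : AlgUnder ρ α, Y.alg.IsHom θ (pairMap A (eqToHom (hF Y) ≫ (F.obj Y).hom.hom))) ∧
          ∀ {Y Y' : AlgUnder ρ α} (m : Y ⟶ Y'),
            m.hom ≫ eqToHom (hF Y') = eqToHom (hF Y) ≫ (F.map m).left.hom := by
  obtain ⟨θ, hθ, hi⟩ := exists_hochRtimes α ρ
  -- Uniqueness holds because every induced structure has the same two parts. `toOver` does not
  -- change the carrier, so `hF` is reflexivity and the transports in the statement are identities.
  refine ⟨θ, hochAlgO α ρ, hi, fun θ' h => h.decomposes.ext hθ, hθ.isFullHom_iff.2 (Alg.IsHom.id _),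
    toOver α ρ, ofOver α ρ, toOver_ofOver, ofOver_toOver, fun _ => rfl, fun Y => ?_, fun Y => ?_,
    fun {Y Y'} m => ?_⟩
  · exact Y.decomposes.isFullHom_iff.2 (Alg.IsHom.id _)
  · have h := (Y.decomposes.isHom_iff hθ).2 ⟨Y.isHom_toHoch, Y.isHom_toHoch_full⟩
    have h1 : 𝟙 Y.carrier ≫ Y.toHoch = Y.toHoch := Category.id_comp _
    rw [← h1] at h
    exact h
  · exact (Category.comp_id _).trans (Category.id_comp _).symm

end Universal
end Cheese

theorem mainTheorem2 (d : ℕ) [NeZero d] {C : Type u} [Category.{v} C] [MonoidalCategory C]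
    [SymmetricCategory C] [MonoidalClosed C] [HasLimitsOfSize.{0, 0} C]
    [HasColimitsOfSize.{0, 0} C] (i : Cheese.CGTop ⥤ C) [i.Braided] [i.IsLeftAdjoint]
    (A : C) (α : Cheese.Alg i (Cheese.SC₁ d).degZero (fun _ => A))
    (O : Cheese.Operad Cheese.sigFull)
    (ρ : Cheese.OperadHom O.toOperadData (Cheese.endOperad (Cheese.SC₁ d))) :
    ∃ (θ : Cheese.Alg i (Cheese.rtimes (Cheese.SC₁ d) O.toOperadData ρ)
        (Cheese.pair (Cheese.Hoch α) A))
      (η : Cheese.Alg i O.toOperadData (fun _ => Cheese.Hoch α)),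
      Cheese.IsInduced α θ ∧ (∀ θ', Cheese.IsInduced α θ' → θ' = θ) ∧
      Cheese.IsFullHom θ η (𝟙 (Cheese.Hoch α)) ∧
      ∃ (F : Cheese.AlgUnder ρ α ⥤ Over (Cheese.AlgO.mk (Cheese.Hoch α) η))
        (G : Over (Cheese.AlgO.mk (Cheese.Hoch α) η) ⥤ Cheese.AlgUnder ρ α),
        F ⋙ G = 𝟭 _ ∧ G ⋙ F = 𝟭 _ ∧
        ∃ hF : ∀ Y : Cheese.AlgUnder ρ α, Y.carrier = (F.obj Y).left.carrier,
          (∀ Y : Cheese.AlgUnder ρ α, Cheese.IsFullHom Y.alg (F.obj Y).left.alg (eqToHom (hF Y))) ∧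
          (∀ Y : Cheese.AlgUnder ρ α, Y.alg.IsHom θ (Cheese.pairMap A (eqToHom (hF Y) ≫ (F.obj Y).hom.hom))) ∧
          ∀ {Y Y' : Cheese.AlgUnder ρ α} (m : Y ⟶ Y'), m.hom ≫ eqToHom (hF Y') = eqToHom (hF Y) ≫ (F.map m).left.hom :=
  Cheese.hoch_universal i ((Cheese.swissCheese d).restrict Cheese.sigColl₁ fun _ _ _ => trivial).W A α O ρ
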